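/- **Setting.** Let $p$ be an odd prime, $F$ a totally real number field of degree $d=[F:\mathbb Q]$ with ring of integers $O_F$, $B$ a totally definite quaternion algebra over $F$ with canonical involution $*$, and $O_B\subset B$ an $O_F$-order which is stable under $*$ and such that $O_B\otimes\mathbb Z_p$ is a maximal order in $B\otimes\mathbb Q_p$. For $b\in O_B$ let $\mathrm{char}(b)\in\mathbb Z[T]$ be its reduced characteristic polynomial over $\mathbb Q$, of degree $2d$. Let $k$ be an algebraically closed field of characteristic $p$, $W=W(k)$, and $\sigma$ the Frobenius of $W$. Let $\Lambda$ be a free $O_B\otimes\mathbb Z_p$-module of rank one with a perfect alternating pairing $\psi:\Lambda\times\Lambda\to\mathbb Z_p$ such that $\psi(bx,y)=\psi(x,b^*y)$ for $b\in O_B$. * $\mathbf M_\Lambda(k)$ is the set of $O_B$-stable $k$-subspaces $\mathcal F\subset\Lambda\otimes k$ of dimension $2d$ that are isotropic for $\psi$ and satisfy the determinant condition: for every $b\in O_B$ the characteristic polynomial of $b$ on $(\Lambda\otimes k)/\mathcal F$ is the image of $\mathrm{char}(b)$ in $k[T]$. $\mathcal G(k)$ is the group of $O_B\otimes k$-linear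 automorphisms of $\Lambda\otimes k$ preserving $\psi$; it acts on $\mathbf M_\Lambda(k)$. * $\mathrm{Dieu}^{O_B\otimes\mathbb Z_p}(k)$ is the set of isomorphism classes of separably quasi-polarized Dieudonné $O_B\otimes\mathbb Z_p$-modules of rank $4d$ satisfying the determinant condition. Such an object is a free $W$-module $M$ of rank $4d$ with a $\sigma$-linear map $F$ and a $\sigma^{-1}$-linear map $V$ with $FV=VF=p$, a $\mathbb Z_p$-algebra monomorphism from $O_B\otimes\mathbb Z_p$ to the endomorphisms of $(M,F,V)$, and a perfect alternating $W$-bilinear form $\langle\,,\rangle$ on $M$ with $\langle Fx,y\rangle=\langle x,Vy\rangle^\sigma$ and $\langle bx,y\rangle=\langle x,b^*y\rangle$ for $b\in O_B$, such that for every $b\in O_B$ the characteristic polynomial of $b$ on $M/VM$ is the image of $\mathrm{char}(b)$. Isomorphisms preserve all the structure. * Put $I=\mathrm{Hom}(O_F,k)$ (ring homomorphisms). For $i\in I$ let $v=\ker i$ be the corresponding place over $p$, $e_v$ its ramification index over $p$, and $\pi$ a uniformizer at $v$. The $i$-component of a finite-dimensional $O_F\otimes k$-module is the subspace on which every $c\in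 O_F$ has $i(c)$ as its only eigenvalue. An $O_B\otimes k$-module $D$ has reduced Lie type $(e_{i,1},e_{i,2})_{i\in I}$ if $e_{i,1}\le e_{i,2}$ and the $i$-component of $D$ is isomorphic to $(k[\pi]/(\pi^{e_{i,1}}))^{2}\oplus(k[\pi]/(\pi^{e_{i,2}}))^{2}$ for all $i\in I$. The reduced Lie type of $M$ is that of $M/VM$; the reduced Lie type of $\mathcal F\in\mathbf M_\Lambda(k)$ is that of $(\Lambda\otimes k)/\mathcal F$. **Proposition 12.1.** For every $M$ as above there is an $O_B\otimes k$-linear isomorphism $\gamma:M/pM\to\Lambda\otimes k$ compatible with the pairings; for each such $\gamma$ the subspace $\gamma(VM/pM)$ lies in $\mathbf M_\Lambda(k)$, and its $\mathcal G(k)$-orbit depends only on the isomorphism class of $M$. The resulting map $$\alpha:\mathrm{Dieu}^{O_B\otimes\mathbb Z_p}(k)\to\mathcal G(k)\backslash\mathbf M_\Lambda(k),\qquad [M]\mapsto[\gamma(VM/pM)],$$ is surjective. Moreover, every point of $\mathbf M_\Lambda(k)$ has a unique reduced Lie type, and $\mathcal F\mapsto$ (reduced Lie type of $\mathcal F$)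 induces a bijection from $\mathcal G(k)\backslash\mathbf M_\Lambda(k)$ to the set of systems $(e_{i,1},e_{i,2})_{i\in I}$ of integers with $0\le e_{i,1}\le e_{i,2}$ and $e_{i,1}+e_{i,2}=e_v$ for all $i$, and with $e_{i,1}=\lfloor e_v/2\rfloor$ whenever $v$ is ramified in $B$. Every $M$ has a unique reduced Lie type, equal to that of $\alpha([M])$, and every such system is the reduced Lie type of some $M$. -/

import Mathlib

open scoped TensorProduct Quaternion NumberField Polynomial

set_option linter.unusedSectionVars false

noncomputable section

namespace MinimalTypeD

universe u

/-! ### Orders -/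

/-- `O` is an `R`-order in the `K`-algebra `A`: a finitely generated `R`-module spanning `A`. -/
def IsOrderIn (R K : Type*) {A : Type*} [CommRing R] [Field K] [Semiring A] [Algebra R A]
    [Algebra K A] (O : Subalgebra R A) : Prop :=
  (Subalgebra.toSubmodule O).FG ∧ Submodule.span K (O : Set A) = ⊤

/-- `O` is a maximal `R`-order in the `K`-algebra `A`. -/
def IsMaximalOrderIn (R K : Type*) {A : Type*} [CommRing R] [Field K] [Semiring A] [Algebra R A]
    [Algebra K A] (O : Subalgebra R A) : Prop :=
  IsOrderIn R K O ∧ ∀ O' : Subalgebra R A, IsOrderIn R K O' → O ≤ O' → O' = O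

section Quaternion

variable {F : Type*} [Field F] [NumberField F] {a b : F}

/-- The quaternion algebra `B = (a, b / F)` is totally definite: at every real embedding of `F`
it becomes Hamilton's quaternion algebra. -/
def IsTotallyDefinite (a b : F) : Prop := ∀ φ : F →+* ℝ, φ a < 0 ∧ φ b < 0

/-- The image of `O_B ⊗ ℤ_p` in `B ⊗ ℚ_p`. -/
def completionAt (p : ℕ) [Fact p.Prime] (O : Subalgebra (𝓞 F) ℍ[F, a, b]) :
    Subalgebra ℤ_[p] (ℚ_[p] ⊗[ℚ] ℍ[F, a, b]) :=
  Algebra.adjoin ℤ_[p] ((fun x : ℍ[F, a, b] => (1 : ℚ_[p]) ⊗ₜ[ℚ] x) '' (O : Set ℍ[F, a, b]))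

/-- `O_B` is an `O_F`-order in `B` which is stable under the canonical involution and such that
`O_B ⊗ ℤ_p` is a maximal order in `B ⊗ ℚ_p`. -/
structure IsStarOrderMaximalAt (p : ℕ) [Fact p.Prime] (O : Subalgebra (𝓞 F) ℍ[F, a, b]) :
    Prop where
  isOrder : IsOrderIn (𝓞 F) F O
  star_mem : ∀ x ∈ O, star x ∈ O
  maximal : IsMaximalOrderIn ℤ_[p] ℚ_[p] (completionAt p O)

/-- `B` is ramified at the finite place `v`: the algebra `B ⊗_F F_v` is a division algebra. -/
def IsRamifiedAt (a b : F) (v : IsDedekindDomain.HeightOneSpectrum (𝓞 F)) : Prop :=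
  ∀ x : v.adicCompletion F ⊗[F] ℍ[F, a, b], x ≠ 0 → IsUnit x

/-- `P ∈ ℤ[T]` is the reduced characteristic polynomial (over `ℚ`) of the integral element
`x ∈ B`, that is, `P = ∏_φ (T² - φ(Trd x) T + φ(Nrd x))`, over all real embeddings `φ` of the
totally real field `F`. Here `Trd x = 2 re x`, and `Nrd x = x x^*` lies in `F`. -/
def IsReducedCharpoly (x : ℍ[F, a, b]) (P : ℤ[X]) : Prop :=
  P.map (Int.castRingHom ℝ) =
    ∏ φ : F →+* ℝ, (Polynomial.X ^ 2 - Polynomial.C (φ (x + star x).re) * Polynomial.X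
      + Polynomial.C (φ (x * star x).re))

/-- `O_B ⊗ ℤ_p`. -/
abbrev AtP (p : ℕ) [Fact p.Prime] (O : Subalgebra (𝓞 F) ℍ[F, a, b]) : Type _ := ℤ_[p] ⊗[ℤ] O

end Quaternion

/-! ### The base field `k`, its Witt vectors, and the structure maps -/

section Witt

variable (p : ℕ) [Fact p.Prime] (k : Type*) [Field k] [CharP k p]

/-- The structure map `ℤ_p = W(𝔽_p) → W(k)`. -/
def padicToWitt : ℤ_[p] →+* WittVector p k :=
  (WittVector.map (ZMod.castHom (dvd_refl p) k)).comp
    (WittVector.equiv p).symm.toRingHom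

/-- `k` is an algebra over `W(k)` through `W(k) → W(k)/p = k`. -/
instance algebraWitt : Algebra (WittVector p k) k :=
  (WittVector.constantCoeff : WittVector p k →+* k).toAlgebra

/-- `k` is an algebra over `ℤ_p` through `ℤ_p → 𝔽_p → k`. -/
instance algebraPadic : Algebra ℤ_[p] k :=
  ((ZMod.castHom (dvd_refl p) k).comp PadicInt.toZMod).toAlgebra

end Witt

/-! ### Quotients of `k[O_B]`-modules: determinant condition and reduced Lie type -/

section LinearAlgebraOverK

variable {F : Type*} [Field F] [NumberField F] {a b : F} {O : Subalgebra (𝓞 F) ℍ[F, a, b]}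
  {k : Type*} [Field k] {D : Type*} [AddCommGroup D] [Module k D]

/-- The action of `x ∈ O_B` on `D / N`, for a stable subspace `N` of `D`. -/
def quotAct (ρ : O → Module.End k D) (N : Submodule k D) (hN : ∀ x, N ≤ N.comap (ρ x)) (x : O) :
    Module.End k (D ⧸ N) :=
  N.mapQ N (ρ x) (hN x)

/-- The determinant condition (K) for the quotient `D / N`: the characteristic polynomial of
each `x ∈ O_B` on `D / N` is the image of the reduced characteristic polynomial of `x`. -/
def DetCondition [Module.Finite k D] (ρ : O → Module.End k D) (N : Submodule k D)
    (hN : ∀ x, N ≤ N.comap (ρ x)) : Prop :=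
  ∀ x : O, ∃ P : ℤ[X], IsReducedCharpoly (x : ℍ[F, a, b]) P ∧
    (quotAct ρ N hN x).charpoly = P.map (Int.castRingHom k)

/-- For `i : O_F → k` the `i`-component of a `k`-vector space `Q` with an action of `O_F`. The
homomorphisms `O_F → k` are the same as pairs of a place `v ∣ p` of `F` and an embedding of the
residue field of `v` in `k`, that is, an embedding of the maximal unramified subring of `O_v` in
`W(k)`. The `i`-component is the subspace where `c ∈ O_F` acts with the only eigenvalue
`i c`. -/
def component {Q : Type*} [AddCommGroup Q] [Module k Q] (act : 𝓞 F → Module.End k Q)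
    (i : 𝓞 F →+* k) : Submodule k Q :=
  ⨅ c : 𝓞 F, (act c).maxGenEigenspace (i c)

/-- The `k[π]`-module `k[π]/(π^{e₁}) ⊕ k[π]/(π^{e₁}) ⊕ k[π]/(π^{e₂}) ⊕ k[π]/(π^{e₂})`. -/
abbrev LieModel (k : Type*) [Field k] (e : ℕ × ℕ) : Type _ :=
  (Fin 2 → k[X] ⧸ Ideal.span {(Polynomial.X : k[X]) ^ e.1}) ×
    (Fin 2 → k[X] ⧸ Ideal.span {(Polynomial.X : k[X]) ^ e.2})

/-- The reduced Lie type of the `O_B ⊗ k`-module `D / N` is `ε`: for every `i : O_F → k`, with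
`ε i = (e₁, e₂)`, one has `e₁ ≤ e₂`, and the `i`-component of `D / N` is isomorphic to
`(k[π]/(π^{e₁}))² ⊕ (k[π]/(π^{e₂}))²`, where `π` is a uniformizer at the place `ker i`. -/
def HasReducedLieType (ρ : O → Module.End k D) (N : Submodule k D)
    (hN : ∀ x, N ≤ N.comap (ρ x)) (ε : (𝓞 F →+* k) → ℕ × ℕ) : Prop :=
  ∀ i : 𝓞 F →+* k, (ε i).1 ≤ (ε i).2 ∧
    ∀ π : 𝓞 F, π ∈ RingHom.ker i → π ∉ RingHom.ker i ^ 2 →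
      ∃ φ : component (fun c : 𝓞 F => quotAct ρ N hN (algebraMap (𝓞 F) O c)) i ≃ₗ[k]
          LieModel k (ε i),
        ∀ y, ((φ.symm ((Polynomial.X : k[X]) • φ y) : component _ i) : D ⧸ N) =
          quotAct ρ N hN (algebraMap (𝓞 F) O π) y

end LinearAlgebraOverK

section Types

variable (p : ℕ) [Fact p.Prime] {F : Type*} [Field F] [NumberField F]
  {k : Type*} [Field k] [CharP k p]

/-- The place of `F` over `p` defined by a homomorphism `i : O_F → k`. -/
def placeOf (i : 𝓞 F →+* k) : IsDedekindDomain.HeightOneSpectrum (𝓞 F) where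
  asIdeal := RingHom.ker i
  isPrime := RingHom.ker_isPrime i
  ne_bot := by
    intro h
    have hp : (p : 𝓞 F) ∈ RingHom.ker i := by
      rw [RingHom.mem_ker, map_natCast, CharP.cast_eq_zero]
    rw [h, Ideal.mem_bot] at hp
    exact (Fact.out : p.Prime).ne_zero (by exact_mod_cast hp)

/-- The systems of pairs `(e_{i,1}, e_{i,2})` with `0 ≤ e_{i,1} ≤ e_{i,2}` and
`e_{i,1} + e_{i,2} = e_v`, where `e_v` is the ramification index of the place `v` below `i`, and
with the minimal pair `(⌊e_v/2⌋, e_v - ⌊e_v/2⌋)` if `v` is ramified in `B`. -/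
def IsAdmissible (a b : F) (ε : (𝓞 F →+* k) → ℕ × ℕ) : Prop :=
  ∀ i : 𝓞 F →+* k,
    (ε i).1 ≤ (ε i).2 ∧
    (ε i).1 + (ε i).2 =
      Ideal.ramificationIdx' (Ideal.span {(p : ℤ)}) (placeOf p i).asIdeal ∧
    (IsRamifiedAt a b (placeOf p i) →
      (ε i).1 = Ideal.ramificationIdx' (Ideal.span {(p : ℤ)}) (placeOf p i).asIdeal / 2)

end Types

/-! ### The lattice `Λ` and the special fibre of its local model -/

section LocalModel

variable (p : ℕ) [Fact p.Prime] {F : Type*} [Field F] [NumberField F] {a b : F}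
  (O : Subalgebra (𝓞 F) ℍ[F, a, b])

/-- The structure on the `ℤ_p`-module `Λ` of a free `O_B ⊗ ℤ_p`-module of rank one with a perfect
`ℤ_p`-valued skew-Hermitian (that is, alternating with `ψ(bx, y) = ψ(x, b^* y)`) pairing. -/
structure SkewHermitianLattice (Λ : Type*) [AddCommGroup Λ] [Module ℤ_[p] Λ] where
  ι : AtP p O →ₐ[ℤ_[p]] Module.End ℤ_[p] Λ
  free_rank_one : ∃ x₀ : Λ, Function.Bijective fun r : AtP p O => ι r x₀
  ψ : LinearMap.BilinForm ℤ_[p] Λ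
  alternating : ψ.IsAlt
  perfect : ψ.IsPerfPair
  adjoint : ∀ c c' : O, (c' : ℍ[F, a, b]) = star (c : ℍ[F, a, b]) →
    ∀ x y, ψ (ι (1 ⊗ₜ c) x) y = ψ x (ι (1 ⊗ₜ c') y)

variable {p O} {Λ : Type*} [AddCommGroup Λ] [Module ℤ_[p] Λ] [Module.Finite ℤ_[p] Λ]
  (L : SkewHermitianLattice p O Λ) (k : Type*) [Field k] [CharP k p]

namespace SkewHermitianLattice

/-- The action of `O_B` on `Λ ⊗ k`. -/
def act (c : O) : Module.End k (k ⊗[ℤ_[p]] Λ) := (L.ι (1 ⊗ₜ c)).baseChange k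

/-- The pairing on `Λ ⊗ k`. -/
def form : LinearMap.BilinForm k (k ⊗[ℤ_[p]] Λ) := L.ψ.baseChange k

/-- The set `M_Λ(k)` of `k`-points of the local model. -/
structure LocalModelPoint where
  toSubmodule : Submodule k (k ⊗[ℤ_[p]] Λ)
  finrank_eq : Module.finrank k toSubmodule = 2 * Module.finrank ℚ F
  isotropic : ∀ x ∈ toSubmodule, ∀ y ∈ toSubmodule, L.form k x y = 0
  stable : ∀ c : O, toSubmodule ≤ toSubmodule.comap (L.act k c)
  det : DetCondition (L.act k) toSubmodule stable

/-- The group `G(k)` of `O_B`-linear automorphisms of `(Λ ⊗ k, ψ)`. -/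
def autGroup : Subgroup ((k ⊗[ℤ_[p]] Λ) ≃ₗ[k] (k ⊗[ℤ_[p]] Λ)) where
  carrier := {g | (∀ (c : O) x, g (L.act k c x) = L.act k c (g x)) ∧
    ∀ x y, L.form k (g x) (g y) = L.form k x y}
  one_mem' := ⟨fun _ _ => rfl, fun _ _ => rfl⟩
  mul_mem' := by
    rintro g h ⟨hg, hg'⟩ ⟨hh, hh'⟩
    refine ⟨fun c x => ?_, fun x y => ?_⟩
    · simp only [LinearEquiv.mul_apply, hh, hg]
    · simp only [LinearEquiv.mul_apply, hh', hg']
  inv_mem' := by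
    rintro g ⟨hg, hg'⟩
    have h1 : ∀ x, g (g⁻¹ x) = x := fun x => g.apply_symm_apply x
    refine ⟨fun c x => ?_, fun x y => ?_⟩
    · apply g.injective
      rw [h1, hg, h1]
    · rw [← hg' (g⁻¹ x) (g⁻¹ y), h1, h1]

/-- Two points of `M_Λ(k)` are equivalent if they lie in the same `G(k)`-orbit. -/
instance orbitSetoid : Setoid (L.LocalModelPoint k) where
  r N N' := ∃ g ∈ L.autGroup k, N.toSubmodule.map (g : _ →ₗ[k] _) = N'.toSubmodule
  iseqv :=
    { refl := fun N => ⟨1, one_mem _, Submodule.map_id _⟩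
      symm := by
        rintro N N' ⟨g, hg, h⟩
        refine ⟨g⁻¹, inv_mem hg, ?_⟩
        rw [← h, ← Submodule.map_comp]
        refine Eq.trans ?_ (Submodule.map_id _)
        congr 1
        refine LinearMap.ext fun x => ?_
        exact LinearEquiv.symm_apply_apply g _
      trans := by
        rintro N N' N'' ⟨g, hg, h⟩ ⟨g', hg', h'⟩
        refine ⟨g' * g, mul_mem hg' hg, ?_⟩
        rw [← h', ← h, ← Submodule.map_comp]
        rfl }

/-- The set `G(k) \ M_Λ(k)` of orbits. -/
def Orbits : Type _ := Quotient (L.orbitSetoid k)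

/-- The orbit of a point. -/
def orbit (N : L.LocalModelPoint k) : L.Orbits k := Quotient.mk _ N

end SkewHermitianLattice

end LocalModel

/-! ### Dieudonné modules -/

section Dieudonne

variable (p : ℕ) [Fact p.Prime] (k : Type u) [Field k] [CharP k p] [PerfectRing k p]

/-- A Dieudonné module over the perfect field `k`, finite and free over `W(k)`. -/
structure DieudonneModule where
  carrier : Type u
  [addCommGroup : AddCommGroup carrier]
  [module : Module (WittVector p k) carrier]
  [free : Module.Free (WittVector p k) carrier]
  [finite : Module.Finite (WittVector p k) carrier]
  Fr : carrier →ₛₗ[(WittVector.frobeniusEquiv p k : WittVector p k →+* WittVector p k)] carrier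
  Ve : carrier →ₛₗ[((WittVector.frobeniusEquiv p k).symm : WittVector p k →+* WittVector p k)]
    carrier
  Fr_Ve : ∀ x, Fr (Ve x) = (p : WittVector p k) • x
  Ve_Fr : ∀ x, Ve (Fr x) = (p : WittVector p k) • x

attribute [instance] DieudonneModule.addCommGroup DieudonneModule.module DieudonneModule.free
  DieudonneModule.finite

variable {F : Type*} [Field F] [NumberField F] {a b : F} (O : Subalgebra (𝓞 F) ℍ[F, a, b])

/-- A Dieudonné `O_B ⊗ ℤ_p`-module: a Dieudonné module `M` with a monomorphism of `ℤ_p`-algebras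
from `O_B ⊗ ℤ_p` to the endomorphisms of `M`. -/
structure DieudonneOModule extends DieudonneModule p k where
  ι : AtP p O →+* Module.End (WittVector p k) carrier
  ι_padic : ∀ c : ℤ_[p], ι (c ⊗ₜ 1) = padicToWitt p k c • (1 : Module.End _ carrier)
  ι_injective : Function.Injective ι
  ι_Fr : ∀ r x, ι r (Fr x) = Fr (ι r x)
  ι_Ve : ∀ r x, ι r (Ve x) = Ve (ι r x)

namespace DieudonneOModule

variable {p k O} (M : DieudonneOModule p k O)

/-- The `k`-vector space `M/pM`. -/
abbrev ModP : Type _ := k ⊗[WittVector p k] M.carrier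

/-- The action of `O_B` on `M/pM`. -/
def act (c : O) : Module.End k M.ModP := (M.ι (1 ⊗ₜ c)).baseChange k

/-- The subspace `VM/pM` of `M/pM`. -/
def hodge : Submodule k M.ModP :=
  Submodule.span k (Set.range fun x : M.carrier => (1 : k) ⊗ₜ[WittVector p k] M.Ve x)

theorem hodge_stable (c : O) : M.hodge ≤ M.hodge.comap (M.act c) := by
  rw [hodge, Submodule.span_le]
  rintro _ ⟨x, rfl⟩
  refine Submodule.subset_span ⟨M.ι (1 ⊗ₜ c) x, ?_⟩
  simp [act, M.ι_Ve]

end DieudonneOModule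

/-- A Dieudonné `O_B ⊗ ℤ_p`-module with a separable (that is, perfect) `O_B`-linear
quasi-polarization. -/
structure SepQPDieudonneOModule extends DieudonneOModule p k O where
  form : LinearMap.BilinForm (WittVector p k) carrier
  alternating : form.IsAlt
  perfect : form.IsPerfPair
  form_Fr : ∀ x y, form (Fr x) y = WittVector.frobenius (form x (Ve y))
  adjoint : ∀ c c' : O, (c' : ℍ[F, a, b]) = star (c : ℍ[F, a, b]) →
    ∀ x y, form (ι (1 ⊗ₜ c) x) y = form x (ι (1 ⊗ₜ c') y)

/-- A separably quasi-polarized Dieudonné `O_B ⊗ ℤ_p`-module of rank `4d`, `d = [F : ℚ]`, which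
satisfies the determinant condition on `M/VM = (M/pM)/(VM/pM)`. -/
structure DieuObject extends SepQPDieudonneOModule p k O where
  finrank_eq : Module.finrank (WittVector p k) carrier = 4 * Module.finrank ℚ F
  det : DetCondition toDieudonneOModule.act toDieudonneOModule.hodge
    toDieudonneOModule.hodge_stable

namespace DieuObject

variable {p k O}

/-- Isomorphisms: `W(k)`-linear bijections compatible with `F`, `V`, the action of `O_B ⊗ ℤ_p` and
the quasi-polarizations. -/
def IsIso {M M' : DieuObject p k O} (g : M.carrier ≃ₗ[WittVector p k] M'.carrier) : Prop :=
  (∀ x, g (M.Fr x) = M'.Fr (g x)) ∧ (∀ x, g (M.Ve x) = M'.Ve (g x)) ∧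
  (∀ r x, g (M.ι r x) = M'.ι r (g x)) ∧ ∀ x y, M'.form (g x) (g y) = M.form x y

instance isoSetoid : Setoid (DieuObject p k O) where
  r M M' := ∃ g : M.carrier ≃ₗ[WittVector p k] M'.carrier, IsIso g
  iseqv :=
    { refl := fun M => ⟨LinearEquiv.refl _ _, fun _ => rfl, fun _ => rfl, fun _ _ => rfl,
        fun _ _ => rfl⟩
      symm := by
        rintro M M' ⟨g, h1, h2, h3, h4⟩
        refine ⟨g.symm, fun x => ?_, fun x => ?_, fun r x => ?_, fun x y => ?_⟩
        · rw [LinearEquiv.symm_apply_eq, h1, LinearEquiv.apply_symm_apply]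
        · rw [LinearEquiv.symm_apply_eq, h2, LinearEquiv.apply_symm_apply]
        · rw [LinearEquiv.symm_apply_eq, h3, LinearEquiv.apply_symm_apply]
        · rw [← h4, LinearEquiv.apply_symm_apply, LinearEquiv.apply_symm_apply]
      trans := by
        rintro M M' M'' ⟨g, h1, h2, h3, h4⟩ ⟨g', h1', h2', h3', h4'⟩
        refine ⟨g.trans g', fun x => ?_, fun x => ?_, fun r x => ?_, fun x y => ?_⟩
        · simp only [LinearEquiv.trans_apply, h1, h1']
        · simp only [LinearEquiv.trans_apply, h2, h2']
        · simp only [LinearEquiv.trans_apply, h3, h3']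
        · simp only [LinearEquiv.trans_apply, h4, h4'] }

/-- The reduced Lie type of `M`, read off from `M/VM`. -/
def HasLieType (M : DieuObject p k O) (ε : (𝓞 F →+* k) → ℕ × ℕ) : Prop :=
  HasReducedLieType M.toDieudonneOModule.act M.toDieudonneOModule.hodge
    M.toDieudonneOModule.hodge_stable ε

variable {Λ : Type*} [AddCommGroup Λ] [Module ℤ_[p] Λ] [Module.Finite ℤ_[p] Λ]

/-- Trivializations of `M/pM`: `k`-linear and `O_B`-linear isomorphisms from `M/pM` to `Λ ⊗ k`
which carry the pairing on `M/pM` to that on `Λ ⊗ k`. -/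
def IsTrivialization (M : DieuObject p k O) (L : SkewHermitianLattice p O Λ)
    (γ : M.toDieudonneOModule.ModP ≃ₗ[k] (k ⊗[ℤ_[p]] Λ)) : Prop :=
  (∀ (c : O) x, γ (M.toDieudonneOModule.act c x) = L.act k c (γ x)) ∧
  ∀ x y, L.form k (γ x) (γ y) = M.form.baseChange k x y

end DieuObject

/-- The set of isomorphism classes of separably quasi-polarized Dieudonné `O_B ⊗ ℤ_p`-modules of
rank `4d` with the determinant condition. -/
def DieuClasses : Type _ := Quotient (DieuObject.isoSetoid (p := p) (k := k) (O := O))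

variable {p k O} in
/-- The isomorphism class of `M`. -/
def DieuObject.cls (M : DieuObject p k O) : DieuClasses p k O := Quotient.mk _ M

end Dieudonne

variable {p : ℕ} [Fact p.Prime] {F : Type*} [Field F] [NumberField F] {a b : F}
  {O : Subalgebra (𝓞 F) ℍ[F, a, b]} {k : Type*} [Field k] [CharP k p]

/-- The reduced Lie type of a point `N` of `M_Λ(k)`, read off from `(Λ ⊗ k)/N`. -/
def SkewHermitianLattice.LocalModelPoint.HasLieType
    {Λ : Type*} [AddCommGroup Λ] [Module ℤ_[p] Λ] [Module.Finite ℤ_[p] Λ]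
    {L : SkewHermitianLattice p O Λ} (N : L.LocalModelPoint k)
    (ε : (𝓞 F →+* k) → ℕ × ℕ) : Prop :=
  HasReducedLieType (L.act k) N.toSubmodule N.stable ε

end MinimalTypeD

end

set_option linter.unusedSectionVars false
set_option linter.style.haveILetI false

noncomputable section

namespace MinimalTypeD

open Module hiding Finite
open RingHom (ker mem_ker)
open Function (Bijective Surjective Injective)
open LinearMap (BilinForm range mulLeft toSpanSingleton eval_charpoly injective_iff_surjective_of_finrank_eq_finrank)
open LinearMap.GeneralLinearGroup (generalLinearEquiv)
open Ideal.Quotient (mk mk_surjective eq_zero_iff_mem)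
open Algebra (smul_def commutes lsmul algebraMap_eq_smul_one)
open LinearMap.BilinForm (baseChange_tmul)
open Algebra.TensorProduct (includeRight includeRight_apply includeLeft tmul_mul_tmul)
open Polynomial (aeval)
open Ideal.IsPrime (mul_mem_pow)
open NumberField (IsTotallyReal)
open QuaternionAlgebra (basisOneIJK finrank_eq_four)
open TensorProduct (smul_tmul' tmul_add tmul_smul tmul_zero smul_tmul add_tmul tmul)
open LinearEquiv (ofBijective apply_symm_apply symm_apply_apply trans_apply)
open Subalgebra (toSubmodule)
open Submodule (mem_sup mem_top)
open Nat (cast_smul_eq_nsmul)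
open CharP (cast_eq_zero)
open Finset (sum_congr sum_eq_single)
open IsUltrametricDist (norm_add_le_max)
open Valued.toNormedField (norm_le_iff)

set_option hygiene false in
local notation "𝕎" => WittVector p k
set_option hygiene false in
local notation "Oₖ" => k ⊗[ℤ] O
set_option hygiene false in
local notation "O𝕎" => WittVector p k ⊗[ℤ] O

section SquareRoots

/-- Units of a finite-dimensional commutative algebra over an algebraically closed field of
characteristic different from two are squares. -/
theorem exists_sq_eq_of_isUnit {k C : Type*} [Field k] [IsAlgClosed k] (h2 : (2 : k) ≠ 0)
    [CommRing C] [Algebra k C] [Module.Finite k C] {u : C} (hu : IsUnit u) : ∃ g : C, g * g = u := by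
  classical
  let f := minpoly k u
  have hint : IsIntegral k u := Algebra.IsIntegral.isIntegral u
  have hf0 : f ≠ 0 := minpoly.ne_zero hint
  let s : Finset k := f.roots.toFinset
  choose r hr using fun x : k => IsAlgClosed.exists_pow_nat_eq x (n := 2) (by norm_num)
  let q : k[X] := Lagrange.interpolate s id r
  have hq : ∀ x ∈ s, q.eval x = r x := fun x hx => by
    exact Lagrange.eval_interpolate_at_node (s := s) (v := id) r (Set.injOn_id _) hx
  have hdvd : f ∣ (q ^ 2 - Polynomial.X) ^ f.natDegree := by
    by_cases hq0 : q ^ 2 - Polynomial.X = 0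
    · by_cases hd : f.natDegree = 0
      · rw [hd, pow_zero]; rw [show f = 1 from (minpoly.monic hint).natDegree_eq_zero.mp hd]
      · rw [hq0, zero_pow hd]; exact dvd_zero _
    have hsplit := IsAlgClosed.splits f
    have hprod : f = (f.roots.map fun x => Polynomial.X - Polynomial.C x).prod := by
      have := hsplit.eq_prod_roots
      rwa [(minpoly.monic hint).leadingCoeff, Polynomial.C_1, one_mul] at this
    rw [← Polynomial.splits_iff_card_roots.mp hsplit]
    have : ∀ m : Multiset k, (∀ x ∈ m, x ∈ f.roots) →
        (m.map fun x => Polynomial.X - Polynomial.C x).prod ∣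
          (q ^ 2 - Polynomial.X) ^ (Multiset.card m) := by
      intro m
      induction m using Multiset.induction_on with
      | empty => intro _; simp
      | cons x m ih =>
        intro h
        rw [Multiset.map_cons, Multiset.prod_cons, Multiset.card_cons, pow_succ']
        refine mul_dvd_mul ?_ (ih fun y hy => h y (Multiset.mem_cons_of_mem hy))
        rw [Polynomial.dvd_iff_isRoot]
        have hx : x ∈ s := by simpa [s] using h x (Multiset.mem_cons_self x m)
        simp [hq x hx, hr]
    have h3 := this f.roots (fun x hx => hx)
    rwa [← hprod] at h3
  have hnil : IsNilpotent ((aeval u q) ^ 2 - u) := by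
    refine ⟨f.natDegree, ?_⟩
    obtain ⟨g, hg⟩ := hdvd
    have := congrArg (aeval u) hg
    simpa [f, minpoly.aeval] using this
  let P : C[X] := Polynomial.X ^ 2 - Polynomial.C u
  have hP1 : IsNilpotent (aeval (aeval u q) P) := by simpa [P] using hnil
  have hsq : IsUnit ((aeval u q) ^ 2) := by
    have := hnil.isUnit_add_left_of_commute hu (Commute.all _ _)
    simpa using this
  have h2C : IsUnit (2 : C) := by
    have : IsUnit (algebraMap k C 2) := (isUnit_iff_ne_zero.mpr h2).map _
    rwa [map_ofNat] at this
  have hP2 : IsUnit (aeval (aeval u q) (Polynomial.derivative P)) := by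
    have h1 : IsUnit (aeval u q) := isUnit_pow_iff (two_ne_zero) |>.mp hsq
    have : IsUnit (2 * (aeval u q)) := h2C.mul h1
    simpa [P, one_add_one_eq_two] using this
  obtain ⟨g, ⟨-, hg⟩, -⟩ := Polynomial.existsUnique_nilpotent_sub_and_aeval_eq_zero hP1 hP2
  refine ⟨g, ?_⟩
  have : g ^ 2 - u = 0 := by simpa [P] using hg
  rw [← sq]; exact sub_eq_zero.mp this

end SquareRoots

section AdicComplete

theorem isAdicComplete_pi {R : Type*} [CommRing R] (I : Ideal R) [IsAdicComplete I R]
    (ι : Type*) [Finite ι] : IsAdicComplete I (ι → R) := by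
  classical
  have := Fintype.ofFinite ι
  have key : ∀ (n : ℕ) (x : ι → R), x ∈ (I ^ n • ⊤ : Submodule R (ι → R)) ↔ ∀ i, x i ∈ I ^ n := by
    intro n x
    constructor
    · intro hx i
      induction hx using Submodule.smul_induction_on' with
      | smul r hr y _ => exact Ideal.mul_mem_right _ _ hr
      | add y _ z _ hy hz => exact Ideal.add_mem _ hy hz
    · intro h
      have : x = ∑ i, x i • Pi.single (M := fun _ => R) i (1 : R) := by
        ext j; simp [Finset.sum_apply, Pi.single_apply]
      rw [this]; exact Submodule.sum_mem _ fun i _ => Submodule.smul_mem_smul (h i) trivial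
  refine { haus' := ?_, prec' := ?_ }
  · intro x hx
    ext i
    refine IsHausdorff.haus (I := I) inferInstance (x i) fun n => ?_
    have h1 := hx n
    rw [SModEq.zero, key] at h1; rw [SModEq.zero]; simpa using h1 i
  · intro f hf
    have : ∀ i, ∃ L : R, ∀ n, f n i ≡ L [SMOD (I ^ n • ⊤ : Submodule R R)] := fun i => by
      refine IsPrecomplete.prec (I := I) inferInstance ?_
      intro m n hmn
      have h1 := hf hmn
      rw [SModEq.sub_mem, key] at h1; rw [SModEq.sub_mem]; simpa using h1 i
    choose L hL using this
    refine ⟨L, fun n => ?_⟩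
    rw [SModEq.sub_mem, key]
    intro i
    have := hL i n
    rw [SModEq.sub_mem] at this; simpa using this

theorem isAdicComplete_of_linearEquiv {R : Type*} [CommRing R] (I : Ideal R) {M N : Type*}
    [AddCommGroup M] [AddCommGroup N] [Module R M] [Module R N] (e : M ≃ₗ[R] N)
    [IsAdicComplete I M] : IsAdicComplete I N := by
  have key : ∀ (n : ℕ) (x : N), x ∈ (I ^ n • ⊤ : Submodule R N) ↔
      e.symm x ∈ (I ^ n • ⊤ : Submodule R M) := by
    intro n x
    have : (I ^ n • ⊤ : Submodule R N) = (I ^ n • ⊤ : Submodule R M).map (e : M →ₗ[R] N) := by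
      rw [Submodule.map_smul'', Submodule.map_top, LinearEquiv.range]
    rw [this, Submodule.mem_map_equiv]
  refine { haus' := ?_, prec' := ?_ }
  · intro x hx
    rw [← e.symm.map_eq_zero_iff]
    refine IsHausdorff.haus (I := I) inferInstance _ fun n => ?_
    have h1 := hx n
    rw [SModEq.zero, key] at h1; rwa [SModEq.zero]
  · intro f hf
    obtain ⟨L, hL⟩ := IsPrecomplete.prec (I := I) (M := M) inferInstance
      (f := fun n => e.symm (f n)) (fun {m n} hmn => by
        have h1 := hf hmn
        rw [SModEq.sub_mem, key, map_sub] at h1; rwa [SModEq.sub_mem])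
    refine ⟨e L, fun n => ?_⟩
    have := hL n
    rw [SModEq.sub_mem] at this ⊢; rw [key]; simpa using this

variable (p : ℕ) [Fact p.Prime] {k : Type*} [Field k] [CharP k p] [IsAlgClosed k]

theorem algebraMap_witt_surjective :
    Surjective (algebraMap 𝕎 k) :=
  WittVector.constantCoeff_surjective p

theorem algebraMap_witt_eq_zero_iff (x : 𝕎) :
    algebraMap 𝕎 k x = 0 ↔ ∃ y, x = p * y := by
  have := WittVector.ker_constantCoeff (p := p) (k := k)
  change x ∈ ker (WittVector.constantCoeff : 𝕎 →+* k) ↔ _; rw [this, Ideal.mem_span_singleton]; rfl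

variable {C : Type*} [CommRing C] [Algebra 𝕎 C] [Module.Finite 𝕎 C]
  [Free 𝕎 C]

variable (k C) in
theorem henselianRing_of_finite_free (_ : Module.Finite 𝕎 C) : HenselianRing C (Ideal.span {(p : C)}) := by
  have h1 := isAdicComplete_pi (Ideal.span {(p : 𝕎)})
    (Module.Free.ChooseBasisIndex 𝕎 C)
  have h2 := isAdicComplete_of_linearEquiv (Ideal.span {(p : 𝕎)})
    ((Module.Free.chooseBasis 𝕎 C).equivFun).symm
  have h3 := (IsAdicComplete.map_algebraMap_iff (S := C) (M := C)
    (Ideal.span {(p : 𝕎)})).mpr h2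
  rw [Ideal.map_span, Set.image_singleton, map_natCast] at h3
  infer_instance

theorem one_tmul_eq_zero_iff {Y : Type*} [AddCommGroup Y] [Module 𝕎 Y]
    [Free 𝕎 Y] [Module.Finite 𝕎 Y] (y : Y) :
    (1 : k) ⊗ₜ[𝕎] y = 0 ↔ ∃ z, y = (p : 𝕎) • z := by
  constructor
  · intro h
    let b := Module.Free.chooseBasis 𝕎 Y
    have h1 : ∀ i, ∃ c, b.repr y i = p * c := fun i => by
      rw [← algebraMap_witt_eq_zero_iff]
      have := congrArg (fun t => (b.baseChange k).repr t i) h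
      simpa [smul_def] using this
    choose c hc using h1
    refine ⟨∑ i, c i • b i, ?_⟩
    conv_lhs => rw [← b.sum_repr y]
    rw [Finset.smul_sum]
    refine sum_congr rfl fun i _ => ?_
    rw [hc, mul_smul]
  · rintro ⟨z, rfl⟩
    rw [tmul_smul, smul_tmul', smul_def]; simp

theorem one_tmul_surjective (Y : Type*) [AddCommGroup Y] [Module 𝕎 Y] :
    Surjective fun y : Y => (1 : k) ⊗ₜ[𝕎] y := by
  intro t
  induction t with
  | zero => exact ⟨0, tmul_zero _ _⟩
  | tmul a y =>
    obtain ⟨w, rfl⟩ := algebraMap_witt_surjective p a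
    refine ⟨w • y, ?_⟩
    simp only [tmul_smul, smul_tmul', smul_def, mul_one]
  | add x y hx hy =>
    obtain ⟨a, rfl⟩ := hx
    obtain ⟨b, rfl⟩ := hy
    exact ⟨a + b, tmul_add _ _ _⟩

variable (hp : p ≠ 2)

include hp in
theorem two_ne_zero_of_charP (k : Type*) [Field k] [CharP k p] : (2 : k) ≠ 0 := by
  have : ((2 : ℕ) : k) ≠ 0 := fun h => by
    rw [CharP.cast_eq_zero_iff k p, Nat.prime_dvd_prime_iff_eq (Fact.out) Nat.prime_two] at h
    exact hp h
  simpa using this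

variable (k) in
include hp in
theorem exists_sq_eq_of_isUnit_witt (_ : Module.Finite 𝕎 C) {u : C}
    (hu : IsUnit u) : ∃ g : C, g * g = u := by
  let i : C →+* k ⊗[𝕎] C := (includeRight : C →ₐ[𝕎] k ⊗[𝕎] C).toRingHom
  have h2 := two_ne_zero_of_charP p hp k
  obtain ⟨g0, hg0⟩ := exists_sq_eq_of_isUnit (k := k) h2 (hu.map i)
  obtain ⟨g1, hg1⟩ := one_tmul_surjective (k := k) p C g0
  have hi : ∀ x, i x = 0 ↔ ∃ z, x = (p : 𝕎) • z := one_tmul_eq_zero_iff p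
  have hg1' : i g1 = g0 := hg1
  have hp1 : ∀ z : C, (p : 𝕎) • z = p * z := fun z => by rw [smul_def, map_natCast]
  have h3 : g1 ^ 2 - u ∈ Ideal.span {(p : C)} := by
    obtain ⟨z, hz⟩ := (hi (g1 ^ 2 - u)).mp (by rw [map_sub, map_pow, hg1', ← hg0, sq, sub_self])
    rw [hz, hp1]; exact Ideal.mul_mem_right _ _ (Ideal.subset_span rfl)
  have hH := henselianRing_of_finite_free p k C inferInstance
  have h2C : IsUnit (2 : C) := by
    have h2W : IsUnit (2 : 𝕎) := by
      refine WittVector.isUnit_of_coeff_zero_ne_zero _ ?_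
      change algebraMap 𝕎 k 2 ≠ 0; rwa [map_ofNat]
    have := h2W.map (algebraMap 𝕎 C)
    rwa [map_ofNat] at this
  obtain ⟨g, hg, -⟩ := HenselianRing.is_henselian (I := Ideal.span {(p : C)})
    (Polynomial.X ^ 2 - Polynomial.C u) (Polynomial.monic_X_pow_sub_C u two_ne_zero) g1
    (by simpa using h3)
    (by
      have : IsUnit (mk (Ideal.span {(p : C)}) (g1 ^ 2)) := by
        rw [← sub_add_cancel (g1 ^ 2) u, map_add, eq_zero_iff_mem.mpr h3, zero_add]; exact hu.map _
      rw [map_pow, isUnit_pow_iff two_ne_zero] at this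
      have h4 := (h2C.map (mk (Ideal.span {(p : C)}))).mul this
      simpa [one_add_one_eq_two] using h4)
  refine ⟨g, ?_⟩
  have h5 : g ^ 2 - u = 0 := by simpa [Polynomial.IsRoot] using hg
  rw [← sq]; exact sub_eq_zero.mp h5

variable (C) in
theorem exists_idempotent_lift (e0 : k ⊗[𝕎] C) (h0 : e0 * e0 = e0) :
    ∃ e : C, e * e = e ∧ (1 : k) ⊗ₜ[𝕎] e = e0 := by
  let i : C →+* k ⊗[𝕎] C := (includeRight : C →ₐ[𝕎] k ⊗[𝕎] C).toRingHom
  obtain ⟨g1, hg1⟩ := one_tmul_surjective (k := k) p C e0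
  have hi : ∀ x, i x = 0 ↔ ∃ z, x = (p : 𝕎) • z := one_tmul_eq_zero_iff p
  have hg1' : i g1 = e0 := hg1
  have hp1 : ∀ z : C, (p : 𝕎) • z = p * z := fun z => by rw [smul_def, map_natCast]
  have hmem : ∀ x, i x = 0 ↔ x ∈ Ideal.span {(p : C)} := fun x => by
    rw [hi, Ideal.mem_span_singleton]
    constructor
    · rintro ⟨z, hz⟩
      exact ⟨z, hz.trans (hp1 z)⟩
    · rintro ⟨z, hz⟩
      exact ⟨z, hz.trans (hp1 z).symm⟩
  have h3 : g1 ^ 2 - g1 ∈ Ideal.span {(p : C)} := by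
    rw [← hmem, map_sub, map_pow, hg1', sq, h0, sub_self]
  have hH := henselianRing_of_finite_free p k C inferInstance
  have hmon : (Polynomial.X ^ 2 - Polynomial.X : C[X]).Monic := by
    rcases subsingleton_or_nontrivial C with h | h
    · exact Subsingleton.elim _ _
    · refine Polynomial.monic_X_pow_sub ?_
      rw [Polynomial.degree_X]; norm_num
  obtain ⟨g, hg, hg2⟩ := HenselianRing.is_henselian (I := Ideal.span {(p : C)})
    (Polynomial.X ^ 2 - Polynomial.X) hmon g1
    (by simpa using h3)
    (by
      refine IsUnit.of_mul_eq_one (mk _ (2 * g1 - 1)) ?_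
      rw [← map_mul, ← map_one (Ideal.Quotient.mk _), Ideal.Quotient.eq]
      have : Polynomial.eval g1 (Polynomial.derivative (Polynomial.X ^ 2 - Polynomial.X)) *
          (2 * g1 - 1) - 1 = 4 * (g1 ^ 2 - g1) := by
        simp; ring
      rw [this]; exact Ideal.mul_mem_left _ _ h3)
  refine ⟨g, ?_, ?_⟩
  · have h5 : g ^ 2 - g = 0 := by simpa [Polynomial.IsRoot] using hg
    rw [← sq]; exact sub_eq_zero.mp h5
  · change i g = e0; rw [← hg1', ← sub_eq_zero, ← map_sub, hmem]; exact hg2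

end AdicComplete

section IsometryTrick

/-- Every automorphism has a square root in the algebra generated by it and its inverse. -/
def HasSquareRoots (R D : Type*) [CommRing R] [AddCommGroup D] [Module R D] : Prop :=
  ∀ u : (End R D)ˣ, ∃ g ∈ Algebra.adjoin R {(u : End R D), ↑u⁻¹}, g * g = u

theorem commute_of_mem_adjoin_units {R A : Type*} [CommRing R] [Ring A] [Algebra R A] (u : Aˣ) :
    ∀ a ∈ ({(u : A), ↑u⁻¹} : Set A), ∀ b ∈ ({(u : A), ↑u⁻¹} : Set A), a * b = b * a := by
  rintro a (rfl | rfl) b (rfl | rfl) <;> simp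

theorem hasSquareRoots_of_forall (R D : Type*) [CommRing R] [AddCommGroup D] [Module R D]
    (H : ∀ S : Subalgebra R (End R D), (∀ a b : S, a * b = b * a) → ∀ u : S,
      IsUnit u → ∃ g, g * g = u) : HasSquareRoots R D := by
  intro u
  let S := Algebra.adjoin R {(u : End R D), ↑u⁻¹}
  have hu : (u : End R D) ∈ S := Algebra.subset_adjoin (by simp)
  have hu' : (↑u⁻¹ : End R D) ∈ S := Algebra.subset_adjoin (by simp)
  obtain ⟨g, hg⟩ := H S (fun a b => by
    exact (Algebra.isMulCommutative_adjoin R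
      (commute_of_mem_adjoin_units (R := R) u)).is_comm.comm a b) ⟨u, hu⟩ ⟨⟨⟨u, hu⟩, ⟨_, hu'⟩, by ext1; simp, by ext1; simp⟩, rfl⟩
  exact ⟨g, g.2, congrArg Subtype.val hg⟩

theorem hasSquareRoots_field {k D : Type*} [Field k] [IsAlgClosed k] (h2 : (2 : k) ≠ 0)
    [AddCommGroup D] [Module k D] [Module.Finite k D] : HasSquareRoots k D :=
  hasSquareRoots_of_forall k D fun S c _ hu => by
    let _ : CommRing S := { (inferInstance : Ring S) with mul_comm := c }
    exact exists_sq_eq_of_isUnit h2 hu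

theorem hasSquareRoots_witt (p : ℕ) [Fact p.Prime] (hp : p ≠ 2) {k D : Type*} [Field k]
    [CharP k p] [IsAlgClosed k] [AddCommGroup D] [Module 𝕎 D]
    [Module.Finite 𝕎 D] [Free 𝕎 D] :
    HasSquareRoots 𝕎 D :=
  hasSquareRoots_of_forall _ D fun S c u hu => by
    let _ : CommRing S := { (inferInstance : Ring S) with mul_comm := c }
    have : Module.Finite 𝕎 S := inferInstanceAs (Module.Finite 𝕎 (toSubmodule S))
    have : Free 𝕎 S := inferInstanceAs (Free 𝕎 (toSubmodule S))
    exact exists_sq_eq_of_isUnit_witt p k hp inferInstance hu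

theorem HasSquareRoots.exists_selfAdjoint {R D : Type*} [CommRing R] [AddCommGroup D] [Module R D]
    (H : HasSquareRoots R D) (ψ : BilinForm R D) (u : D ≃ₗ[R] D)
    (hu : ∀ x y, ψ (u x) y = ψ x (u y)) :
    ∃ g : D ≃ₗ[R] D, (∀ x, g (g x) = u x) ∧ (∀ x y, ψ (g x) y = ψ x (g y)) ∧
      (∀ f : D →+ D, (∀ (c : R) x, f (c • x) = c • f x) → (∀ x, f (u x) = u (f x)) →
        ∀ x, f (g x) = g (f x)) ∧
      ∀ N : Submodule R D, (∀ x ∈ N, u x ∈ N) → (∀ x ∈ N, u.symm x ∈ N) → ∀ x ∈ N, g x ∈ N := by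
  let U : (End R D)ˣ := (generalLinearEquiv R D).symm u
  have hU : ∀ x, (U : End R D) x = u x := fun x => rfl
  have hU' : ∀ x, (↑U⁻¹ : End R D) x = u.symm x := fun x => rfl
  obtain ⟨g, hgm, hg⟩ := H U
  have hind : ∀ P : End R D → Prop, P U → P ↑U⁻¹ → (∀ r, P (algebraMap R _ r)) →
      (∀ a b, P a → P b → P (a + b)) → (∀ a b, (a * b = b * a) → P a → P b → P (a * b)) → P g := by
    intro P h1 h2 h3 h4 h5
    refine Algebra.adjoin_induction (hx := hgm) (p := fun a _ => P a) ?_ h3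
      (fun a b _ _ => h4 a b) (fun a b ha hb => h5 a b ?_)
    · rintro a (rfl | rfl)
      exacts [h1, h2]
    · exact congrArg Subtype.val ((Algebra.isMulCommutative_adjoin R
        (commute_of_mem_adjoin_units (R := R) U)).is_comm.comm ⟨a, ha⟩ ⟨b, hb⟩)
  have hunit : IsUnit g := by
    have hc : Commute g (g * g) := (Commute.refl g).mul_right (Commute.refl g)
    have h1 : IsUnit (g * g) := hg ▸ U.isUnit
    exact ((Commute.refl g).isUnit_mul_iff.mp h1).1
  let G : D ≃ₗ[R] D := generalLinearEquiv R D hunit.unit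
  have hG : ∀ x, G x = g x := fun x => rfl
  refine ⟨G, fun x => ?_, fun x y => ?_, fun f hf hfu x => ?_, fun N h1 h2 x hx => ?_⟩
  · rw [hG, hG, ← hU, ← hg]; rfl
  · rw [hG, hG]
    refine hind (fun a => ∀ x y, ψ (a x) y = ψ x (a y)) hu ?_ ?_ ?_ ?_ x y
    · intro x y
      rw [hU', hU', ← u.apply_symm_apply y, ← hu, u.apply_symm_apply, u.symm_apply_apply]
    · intro r x y; simp
    · intro a b ha hb x y; simp [ha, hb]
    · intro a b hab ha hb x y
      rw [End.mul_apply, ha, hb, ← End.mul_apply, hab]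
  · rw [hG, hG]
    refine hind (fun a => ∀ x, f (a x) = a (f x)) hfu ?_ ?_ ?_ ?_ x
    · intro x
      rw [hU', hU', LinearEquiv.eq_symm_apply, ← hfu, u.apply_symm_apply]
    · intro r x; simp [hf]
    · intro a b ha hb x; simp [ha, hb]
    · intro a b _ ha hb x; simp [ha, hb]
  · rw [hG]
    refine hind (fun a => ∀ x ∈ N, a x ∈ N) h1 h2 ?_ ?_ ?_ x hx
    · intro r x hx; simpa using N.smul_mem r hx
    · intro a b ha hb x hx; simpa using N.add_mem (ha x hx) (hb x hx)
    · intro a b _ ha hb x hx; simpa using ha _ (hb x hx)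

theorem HasSquareRoots.exists_isometry {R D : Type*} [CommRing R] [AddCommGroup D] [Module R D]
    (H : HasSquareRoots R D) (ψ ψ' : BilinForm R D) (u : D ≃ₗ[R] D)
    (h : ∀ x y, ψ' x y = ψ (u x) y) (hψ : ψ.IsAlt) (hψ' : ψ'.IsAlt) :
    ∃ g : D ≃ₗ[R] D, (∀ x y, ψ' x y = ψ (g x) (g y)) ∧
      (∀ f : D →+ D, (∀ (c : R) x, f (c • x) = c • f x) → (∀ x, f (u x) = u (f x)) →
        ∀ x, f (g x) = g (f x)) ∧
      ∀ N : Submodule R D, (∀ x ∈ N, u x ∈ N) → (∀ x ∈ N, u.symm x ∈ N) → ∀ x ∈ N, g x ∈ N := by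
  have hu : ∀ x y, ψ (u x) y = ψ x (u y) := fun x y => by rw [← h, ← hψ'.neg_eq, h, hψ.neg_eq]
  obtain ⟨g, h1, h2, h3, h4⟩ := H.exists_selfAdjoint ψ u hu
  exact ⟨g, fun x y => by rw [h, ← h1, h2], h3, h4⟩

end IsometryTrick

section Orders

variable {F : Type*} [Field F] [NumberField F] {a b : F}

theorem finite_rat_quaternion : Module.Finite ℚ ℍ[F, a, b] := Module.Finite.trans F _

variable {O : Subalgebra (𝓞 F) ℍ[F, a, b]}

theorem exists_int_smul_mem (h : Submodule.span F (O : Set ℍ[F, a, b]) = ⊤) (x : ℍ[F, a, b]) :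
    ∃ n : ℤ, n ≠ 0 ∧ n • x ∈ O := by
  have hx : x ∈ Submodule.span F (O : Set ℍ[F, a, b]) := h ▸ mem_top
  induction hx using Submodule.span_induction with
  | mem x hx => exact ⟨1, one_ne_zero, by simpa using hx⟩
  | zero => exact ⟨1, one_ne_zero, by simp [O.zero_mem]⟩
  | add x y _ _ hx hy =>
    obtain ⟨m, hm, hx⟩ := hx
    obtain ⟨n, hn, hy⟩ := hy
    refine ⟨m * n, mul_ne_zero hm hn, ?_⟩
    rw [smul_add]
    refine O.add_mem ?_ ?_
    · rw [mul_comm, mul_smul]; exact O.toSubring.zsmul_mem hx n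
    · rw [mul_smul]; exact O.toSubring.zsmul_mem hy m
  | smul c x _ hx =>
    obtain ⟨m, hm, hx⟩ := hx
    obtain ⟨n, hn, hc⟩ := exists_integral_multiples ℤ ℚ ({c} : Finset F)
    have hc := hc c (by simp)
    refine ⟨n * m, mul_ne_zero hn hm, ?_⟩
    have : (n * m) • c • x = (⟨n • c, hc⟩ : 𝓞 F) • m • x := by
      change _ = (n • c) • m • x; rw [smul_assoc n c, smul_comm c m x, mul_smul]
    rw [this]; exact O.smul_mem hx _

theorem finite_int (h : (toSubmodule O).FG) : Module.Finite ℤ O :=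
  have : Module.Finite (𝓞 F) O := Module.Finite.iff_fg.mpr h
  Module.Finite.trans (𝓞 F) O

instance isTorsionFree_int (O : Subalgebra (𝓞 F) ℍ[F, a, b]) : Module.IsTorsionFree ℤ O := by
  refine Module.IsTorsionFree.of_smul_eq_zero fun n x h => ?_
  have h1 : ((n : ℤ) : ℚ) • (x : ℍ[F, a, b]) = 0 := by
    rw [Int.cast_smul_eq_zsmul]; exact congrArg Subtype.val h
  rcases smul_eq_zero.mp h1 with h1 | h1
  · exact Or.inl (by exact_mod_cast h1)
  · exact Or.inr (Subtype.ext h1)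

theorem exists_rat_basis (h : IsOrderIn (𝓞 F) F O) :
    ∃ (n : ℕ) (β : Basis (Fin n) ℤ O) (γ : Basis (Fin n) ℚ ℍ[F, a, b]),
      ∀ i, γ i = β i := by
  have hfin : Module.Finite ℤ O := finite_int h.1
  obtain ⟨n, β⟩ := Module.basisOfFiniteTypeTorsionFree' (R := ℤ) (M := O)
  have hli : LinearIndependent ℚ fun i => (β i : ℍ[F, a, b]) := by
    rw [← LinearIndependent.iff_fractionRing ℤ ℚ]
    exact β.linearIndependent.map' ((toSubmodule O).subtype.restrictScalars ℤ)
      (LinearMap.ker_eq_bot.mpr Subtype.val_injective)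
  refine ⟨n, β, Module.Basis.mk hli ?_, fun i => Module.Basis.mk_apply _ _ i⟩
  rintro x -
  obtain ⟨m, hm, hx⟩ := exists_int_smul_mem h.2 x
  have hx' : m • x ∈ Submodule.span ℚ (Set.range fun i => (β i : ℍ[F, a, b])) := by
    have := congrArg (Subtype.val : O → ℍ[F, a, b]) (β.sum_repr ⟨m • x, hx⟩)
    rw [← show _ = m • x from this]; rw [AddSubmonoidClass.coe_finsetSum]
    refine Submodule.sum_mem _ fun i _ => ?_
    have : ((β.repr ⟨m • x, hx⟩ i • β i : O) : ℍ[F, a, b]) =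
        ((β.repr ⟨m • x, hx⟩ i : ℤ) : ℚ) • (β i : ℍ[F, a, b]) := by
      rw [Int.cast_smul_eq_zsmul]; rfl
    rw [this]; exact Submodule.smul_mem _ _ (Submodule.subset_span ⟨i, rfl⟩)
  have hm' : (m : ℚ) ≠ 0 := by exact_mod_cast hm
  have := Submodule.smul_mem _ ((m : ℚ)⁻¹) hx'
  rwa [← Int.cast_smul_eq_zsmul ℚ m x, smul_smul, inv_mul_cancel₀ hm', one_smul] at this

theorem finrank_order (h : IsOrderIn (𝓞 F) F O) :
    finrank ℤ O = 4 * finrank ℚ F := by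
  obtain ⟨n, β, γ, -⟩ := exists_rat_basis h
  rw [Module.finrank_eq_card_basis β, ← Module.finrank_eq_card_basis γ,
    ← Module.finrank_mul_finrank ℚ F ℍ[F, a, b], finrank_eq_four, mul_comm]

variable (p : ℕ) [Fact p.Prime]

theorem toSubmodule_completionAt (O : Subalgebra (𝓞 F) ℍ[F, a, b]) :
    toSubmodule (completionAt p O) = Submodule.span ℤ_[p]
      ((fun x : ℍ[F, a, b] => (1 : ℚ_[p]) ⊗ₜ[ℚ] x) '' (O : Set ℍ[F, a, b])) := by
  let f : ℍ[F, a, b] →* ℚ_[p] ⊗[ℚ] ℍ[F, a, b] :=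
    (includeRight : ℍ[F, a, b] →ₐ[ℚ] ℚ_[p] ⊗[ℚ] ℍ[F, a, b])
  have : ((fun x : ℍ[F, a, b] => (1 : ℚ_[p]) ⊗ₜ[ℚ] x) '' (O : Set ℍ[F, a, b])) =
      ((O.toSubring.toSubmonoid).map f : Set _) := rfl
  rw [completionAt, Algebra.adjoin_eq_span, this, Submonoid.closure_eq]

theorem completionAt_mono {O O' : Subalgebra (𝓞 F) ℍ[F, a, b]} (h : O ≤ O') :
    completionAt p O ≤ completionAt p O' :=
  Algebra.adjoin_mono (Set.image_mono h)

theorem completionAt_fg {O : Subalgebra (𝓞 F) ℍ[F, a, b]} (h : (toSubmodule O).FG) :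
    (toSubmodule (completionAt p O)).FG := by
  rw [toSubmodule_completionAt]
  obtain ⟨S, hS⟩ := (finite_int h).fg_top
  let f : O →ₗ[ℤ] ℚ_[p] ⊗[ℚ] ℍ[F, a, b] :=
    AddMonoidHom.toIntLinearMap (((includeRight :
      ℍ[F, a, b] →ₐ[ℚ] ℚ_[p] ⊗[ℚ] ℍ[F, a, b]) : ℍ[F, a, b] →+ _).comp
        (O.val : O →+ ℍ[F, a, b]))
  classical
  refine ⟨S.image f, le_antisymm ?_ ?_⟩
  · refine Submodule.span_mono ?_
    rw [Finset.coe_image]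
    rintro _ ⟨x, -, rfl⟩
    exact ⟨x, x.2, rfl⟩
  · rw [Submodule.span_le]
    rintro _ ⟨x, hx, rfl⟩
    have h1 : f ⟨x, hx⟩ ∈ (Submodule.span ℤ (S : Set O)).map f :=
      Submodule.mem_map_of_mem (hS ▸ mem_top)
    rw [Submodule.map_span, ← Finset.coe_image] at h1; exact Submodule.span_subset_span ℤ ℤ_[p] _ h1

theorem IsStarOrderMaximalAt.exists_smul_mem (hO : IsStarOrderMaximalAt p O)
    {O' : Subalgebra (𝓞 F) ℍ[F, a, b]} (hO' : (toSubmodule O').FG) (h : O ≤ O')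
    {x : ℍ[F, a, b]} (hx : x ∈ O') : ∃ n : ℕ, ¬ p ∣ n ∧ n • x ∈ O := by
  have h1 : completionAt p O' = completionAt p O := by
    refine hO.maximal.2 _ ⟨completionAt_fg p hO', ?_⟩ (completionAt_mono p h)
    rw [eq_top_iff, ← hO.maximal.1.2]; exact Submodule.span_mono (completionAt_mono p h)
  have h2 : (1 : ℚ_[p]) ⊗ₜ[ℚ] x ∈ toSubmodule (completionAt p O) := by
    rw [← h1]; exact Algebra.subset_adjoin ⟨x, hx, rfl⟩
  obtain ⟨n, β, γ, hγ⟩ := exists_rat_basis hO.isOrder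
  let Γ := γ.baseChange ℚ_[p]
  have h3 : ∀ y ∈ toSubmodule (completionAt p O), ∀ i, ‖Γ.repr y i‖ ≤ 1 := by
    intro y hy i
    rw [toSubmodule_completionAt] at hy
    induction hy using Submodule.span_induction with
    | mem y hy =>
      obtain ⟨z, hz, rfl⟩ := hy
      have hz' : z = ∑ j, ((β.repr ⟨z, hz⟩ j : ℤ) : ℚ) • γ j := by
        have := congrArg (Subtype.val : O → ℍ[F, a, b]) (β.sum_repr ⟨z, hz⟩)
        rw [AddSubmonoidClass.coe_finsetSum] at this
        refine this.symm.trans (sum_congr rfl fun j _ => ?_)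
        rw [Int.cast_smul_eq_zsmul, hγ]; rfl
      have : Γ.repr ((1 : ℚ_[p]) ⊗ₜ[ℚ] z) i = ((β.repr ⟨z, hz⟩ i : ℤ) : ℚ_[p]) := by
        have h5 : γ.repr z i = ((β.repr ⟨z, hz⟩ i : ℤ) : ℚ) := by
          conv_lhs => rw [hz', γ.repr_sum_self]
        simp [Γ, h5, smul_def]
      rw [this]; exact Padic.norm_int_le_one _
    | zero => simp
    | add y z _ _ hy hz =>
      rw [map_add, Finsupp.add_apply]; exact (Padic.nonarchimedean _ _).trans (max_le hy hz)
    | smul c y _ hy =>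
      rw [← algebraMap_smul ℚ_[p] c y, map_smul, Finsupp.smul_apply, smul_eq_mul, norm_mul]
      exact mul_le_one₀ c.2 (norm_nonneg _) hy
  have h4 : ∀ i, ¬ p ∣ (γ.repr x i).den := by
    intro i
    have := h3 _ h2 i
    have h5 : Γ.repr ((1 : ℚ_[p]) ⊗ₜ[ℚ] x) i = ((γ.repr x i : ℚ) : ℚ_[p]) := by simp [Γ, smul_def]
    rw [h5] at this
    intro hd
    have key : ∀ m : ℤ, ‖(m : ℚ_[p])‖ < 1 ↔ (p : ℤ) ∣ m := fun m => by
      rw [← PadicInt.norm_int_lt_one_iff_dvd, PadicInt.norm_def, PadicInt.coe_intCast]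
    refine absurd ?_ (not_lt.mpr this)
    have hn : ¬ (p : ℤ) ∣ (γ.repr x i).num := fun hn =>
      (Nat.Prime.not_coprime_iff_dvd.mpr ⟨p, Fact.out, Int.natCast_dvd.mp hn, hd⟩)
        (γ.repr x i).reduced
    have hd' : ‖(((γ.repr x i).den : ℤ) : ℚ_[p])‖ < 1 := (key _).mpr (by exact_mod_cast hd)
    have hn' : ‖(((γ.repr x i).num : ℤ) : ℚ_[p])‖ = 1 :=
      le_antisymm (Padic.norm_int_le_one _)
        (not_lt.mp fun h => hn ((key _).mp h))
    have h0 : (((γ.repr x i).den : ℤ) : ℚ_[p]) ≠ 0 := by exact_mod_cast (γ.repr x i).den_ne_zero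
    rw [Rat.cast_def, norm_div, hn', one_lt_div (norm_pos_iff.mpr (by exact_mod_cast h0))]
    exact_mod_cast hd'
  refine ⟨∏ i, (γ.repr x i).den, ?_, ?_⟩
  · rw [Prime.dvd_finsetProd_iff (Fact.out : p.Prime).prime]
    rintro ⟨i, -, hi⟩
    exact h4 i hi
  · rw [← γ.sum_repr x, Finset.smul_sum]; simp only [γ.sum_repr x]
    refine O.toSubring.sum_mem fun i _ => ?_
    have : (∏ j, (γ.repr x j).den) • γ.repr x i • γ i =
        ((∏ j ∈ Finset.univ.erase i, (γ.repr x j).den : ℕ) * (γ.repr x i).num) • γ i := by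
      rw [← Finset.mul_prod_erase _ _ (Finset.mem_univ i), ← cast_smul_eq_nsmul ℚ, smul_smul,
        ← Int.cast_smul_eq_zsmul ℚ]
      congr 1
      have := Rat.mul_den_eq_num (γ.repr x i)
      push_cast; rw [← this]; ring
    rw [this, hγ]; exact O.toSubring.zsmul_mem (β i).2 _

end Orders

/-! ### Rings with a standard involution over a Dedekind domain -/

section Uniformizer

variable {R : Type*} [CommRing R] [IsDedekindDomain R]

theorem exists_mul_eq_uniformizer_mul (v : Ideal R) [v.IsPrime] {π : R} (hπ : π ∈ v)
    (hπ2 : π ∉ v ^ 2) : ∃ t ∉ v, ∀ c ∈ v, ∃ d, t * c = π * d := by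
  obtain ⟨J, hJ⟩ : v ∣ Ideal.span {π} := Ideal.dvd_span_singleton.mpr hπ
  have hJv : ¬ J ≤ v := by
    intro h
    apply hπ2
    have : Ideal.span {π} ≤ v ^ 2 := by
      rw [hJ, pow_two]; exact Ideal.mul_mono le_rfl h
    exact this (Ideal.mem_span_singleton_self π)
  obtain ⟨t, htJ, htv⟩ := SetLike.not_le_iff_exists.mp hJv
  refine ⟨t, htv, fun c hc => ?_⟩
  have : c * t ∈ Ideal.span {π} := hJ ▸ Ideal.mul_mem_mul hc htJ
  obtain ⟨d, hd⟩ := Ideal.mem_span_singleton.mp this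
  exact ⟨d, by rw [mul_comm, hd]⟩

theorem exists_mul_eq_uniformizer_pow_mul (v : Ideal R) [v.IsPrime] {π : R} (hπ : π ∈ v)
    (hπ2 : π ∉ v ^ 2) (n : ℕ) : ∃ t ∉ v, ∀ c ∈ v ^ n, ∃ d, t * c = π ^ n * d := by
  obtain ⟨t, ht, h⟩ := exists_mul_eq_uniformizer_mul v hπ hπ2
  refine ⟨t ^ n, fun h => ht (Ideal.IsPrime.mem_of_pow_mem ‹_› _ h), fun c hc => ?_⟩
  induction n generalizing c with
  | zero => exact ⟨c, by simp⟩
  | succ n ih =>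
    rw [pow_succ] at hc
    induction hc using Submodule.mul_induction_on' with
    | mem_mul_mem x hx y hy =>
      obtain ⟨d, hd⟩ := ih x hx
      obtain ⟨d', hd'⟩ := h y hy
      exact ⟨d * d', by linear_combination (t * y) * hd + π ^ n * d * hd'⟩
    | add x _ y _ hx hy =>
      obtain ⟨d, hd⟩ := hx
      obtain ⟨d', hd'⟩ := hy
      exact ⟨d + d', by linear_combination hd + hd'⟩

end Uniformizer

/-- A reduced trace and a reduced norm for the involution of the `R`-algebra `O`. -/
structure StdInvolution (R O : Type*) [CommRing R] [Ring O] [StarRing O] [Algebra R O] where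
  tr : O →ₗ[R] R
  nr : O → R
  tr_spec : ∀ x, algebraMap R O (tr x) = x + star x
  nr_spec : ∀ x, algebraMap R O (nr x) = x * star x
  inj : Injective (algebraMap R O)
  eq_zero_of_nr : ∀ x, nr x = 0 → x = 0
  exists_orthogonal : ∀ x : O, ∃ y, y ≠ 0 ∧ tr y = 0 ∧ tr (x * y) = 0

namespace StdInvolution

variable {R O : Type*} [CommRing R] [Ring O] [StarRing O] [Algebra R O] (I : StdInvolution R O)

theorem star_eq (x : O) : star x = algebraMap R O (I.tr x) - x := by rw [I.tr_spec]; abel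

theorem mul_self (x : O) : x * x = I.tr x • x - algebraMap R O (I.nr x) := by
  rw [I.nr_spec, smul_def, I.tr_spec]
  have : x * star x = star x * x := by rw [I.star_eq, mul_sub, sub_mul, commutes]
  rw [add_mul, this]; abel

theorem star_mul_self (x : O) : star x * x = algebraMap R O (I.nr x) := by
  rw [I.nr_spec, I.star_eq, mul_sub, sub_mul, commutes]

theorem tr_mul_comm (x y : O) : I.tr (x * y) = I.tr (y * x) := by
  apply I.inj; rw [I.tr_spec, I.tr_spec, star_mul, star_mul, I.star_eq x, I.star_eq y]
  simp only [mul_sub, sub_mul]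
  rw [commutes (I.tr x) y, commutes (I.tr y) x,
    commutes (I.tr x) (algebraMap R O (I.tr y))]
  abel

theorem nr_add (x y : O) : I.nr (x + y) = I.nr x + I.nr y + I.tr (x * star y) := by
  apply I.inj
  simp only [map_add, I.tr_spec, I.nr_spec, star_add, star_mul, star_star, add_mul, mul_add]; abel

theorem nr_mul (x y : O) : I.nr (x * y) = I.nr x * I.nr y := by
  apply I.inj
  rw [map_mul, I.nr_spec, star_mul, mul_assoc, ← mul_assoc y, ← I.nr_spec y, ← mul_assoc,
    ← commutes, mul_assoc, ← I.nr_spec x, ← commutes]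

include I in
theorem star_algebraMap (c : R) : star (algebraMap R O c) = algebraMap R O c := by
  have h : algebraMap R O (I.tr 1) = 1 + 1 := by rw [I.tr_spec, star_one]
  have ht : I.tr (algebraMap R O c) = c * I.tr 1 := by
    rw [algebraMap_eq_smul_one, map_smul, smul_eq_mul]
  rw [I.star_eq, ht, map_mul, h, mul_add, mul_one]; abel

include I in
theorem star_smul (c : R) (x : O) : star (c • x) = c • star x := by
  rw [smul_def, star_mul, I.star_algebraMap, ← commutes, smul_def]

theorem nr_smul (c : R) (x : O) : I.nr (c • x) = c ^ 2 * I.nr x := by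
  apply I.inj
  rw [I.nr_spec, I.star_smul, smul_mul_smul_comm, ← I.nr_spec, smul_def, ← map_mul, pow_two]

theorem tr_star (x : O) : I.tr (star x) = I.tr x := by
  apply I.inj; rw [I.tr_spec, I.tr_spec, star_star, add_comm]

theorem star_of_tr {x : O} (h : I.tr x = 0) : star x = -x := by
  rw [I.star_eq, h, map_zero, zero_sub]

theorem mul_self_of_tr {x : O} (h : I.tr x = 0) : x * x = algebraMap R O (- I.nr x) := by
  rw [I.mul_self, h, zero_smul, zero_sub, map_neg]

theorem tr_algebraMap (c : R) : I.tr (algebraMap R O c) = 2 * c := by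
  apply I.inj; rw [I.tr_spec, I.star_algebraMap, two_mul, map_add]

theorem nr_algebraMap (c : R) : I.nr (algebraMap R O c) = c ^ 2 := by
  apply I.inj; rw [I.nr_spec, I.star_algebraMap, pow_two, map_mul]

include I in
theorem smul_eq_zero [IsDomain R] {c : R} {x : O} (h : c • x = 0) : c = 0 ∨ x = 0 := by
  have h1 : c ^ 2 * I.nr x = 0 := by
    rw [← I.nr_smul, h]
    apply I.inj; rw [I.nr_spec, zero_mul, map_zero]
  rcases mul_eq_zero.mp h1 with h1 | h1
  · exact Or.inl (pow_eq_zero_iff two_ne_zero |>.mp h1)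
  · exact Or.inr (I.eq_zero_of_nr _ h1)

theorem mul_eq_neg {x y : O} (hx : I.tr x = 0) (hy : I.tr y = 0) (h : I.tr (x * y) = 0) :
    x * y = -(y * x) := by
  have := I.star_of_tr h
  rw [star_mul, I.star_of_tr hx, I.star_of_tr hy, neg_mul_neg] at this; rw [this, neg_neg]

theorem tr_mul_traceless {x y : O} (hy : I.tr y = 0) :
    I.tr (x * y) = I.nr x + I.nr y - I.nr (x + y) := by
  rw [I.nr_add, I.star_of_tr hy, mul_neg, map_neg]; ring

/-- The order `O` is maximal at `v`, in the form of a saturation property. -/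
def IsMaximalAt (v : Ideal R) : Prop :=
  ∀ x, (∀ y, I.tr (x * y) ∈ v) → I.nr x ∈ v ^ 2 → ∀ π ∈ v, π ∉ v ^ 2 → ∃ u ∉ v, ∃ y, u • x = π • y

section Local

variable [IsDedekindDomain R] (v : Ideal R) [hv : v.IsPrime] (hv0 : v ≠ ⊥)
  (hmax : I.IsMaximalAt v) (h2 : (2 : R) ∉ v)

include hv0 in
theorem exists_uniformizer : ∃ π ∈ v, π ∉ v ^ 2 := by
  have := SetLike.exists_of_lt (Ideal.pow_right_strictAnti v hv0 hv.ne_top (show 1 < 2 by norm_num))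
  simpa using this

include hv0 hmax in
/-- Descent: a non-zero saturated submodule contains an element of small norm at `v`. -/
theorem exists_nr_notMem (S : Submodule R O) (hS : ∀ (c : R) x, c ≠ 0 → c • x ∈ S → x ∈ S)
    (hS0 : ∃ x ∈ S, x ≠ 0) (htr : ∀ x ∈ S, ∀ y, I.tr (x * y) ∈ v) : ∃ x ∈ S, I.nr x ∉ v ^ 2 := by
  by_contra! hcon
  obtain ⟨π, hπ, hπ2⟩ := exists_uniformizer v hv0
  have hπ0 : π ≠ 0 := fun h => hπ2 (h ▸ zero_mem _)
  have key : ∀ n : ℕ, ∀ x ∈ S, I.nr x ∈ v ^ n := by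
    intro n
    induction n with
    | zero => intro x _; simp
    | succ n ih =>
      intro x hx
      obtain ⟨u, hu, y, hy⟩ := hmax x (htr x hx) (hcon x hx) π hπ hπ2
      have hyS : y ∈ S := hS π y hπ0 (hy ▸ S.smul_mem u hx)
      have h1 : u ^ 2 * I.nr x = π ^ 2 * I.nr y := by rw [← I.nr_smul, hy, I.nr_smul]
      have h2 : u ^ 2 * I.nr x ∈ v ^ (2 + n) := by
        rw [h1, pow_add]; exact Ideal.mul_mem_mul (Ideal.pow_mem_pow hπ 2) (ih y hyS)
      rcases mul_mem_pow v h2 with h | h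
      · exact absurd (hv.mem_of_pow_mem _ h) hu
      · exact Ideal.pow_le_pow_right (by omega) h
  obtain ⟨x, hx, hx0⟩ := hS0
  apply hx0
  apply I.eq_zero_of_nr
  have : I.nr x ∈ ⨅ n : ℕ, v ^ n := Ideal.mem_iInf.mpr fun n => key n x hx
  rwa [Ideal.iInf_pow_eq_bot_of_isDomain v hv.ne_top, Ideal.mem_bot] at this

/-- Traceless elements with traceless product with `x`. -/
def orthogonal (x : O) : Submodule R O :=
  LinearMap.ker I.tr ⊓ LinearMap.ker (I.tr.comp (mulLeft R x))

theorem mem_orthogonal {x y : O} : y ∈ I.orthogonal x ↔ I.tr y = 0 ∧ I.tr (x * y) = 0 := by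
  simp [orthogonal]

theorem orthogonal_saturated (x : O) (c : R) (y : O) (hc : c ≠ 0) (h : c • y ∈ I.orthogonal x) :
    y ∈ I.orthogonal x := by
  rw [mem_orthogonal] at h ⊢; simpa [hc] using h

theorem exists_mem_orthogonal (x : O) : ∃ y ∈ I.orthogonal x, y ≠ 0 := by
  obtain ⟨y, h, h'⟩ := I.exists_orthogonal x
  exact ⟨y, I.mem_orthogonal.mpr h', h⟩

include hv0 hmax h2 in
theorem exists_traceless : ∃ s, I.tr s = 0 ∧ I.nr s ∉ v := by
  by_contra! hcon
  obtain ⟨π, hπ, hπ2⟩ := exists_uniformizer v hv0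
  have hπ0 : π ≠ 0 := fun h => hπ2 (h ▸ zero_mem _)
  have htr : ∀ x, I.tr x = 0 → ∀ y, I.tr (x * y) ∈ v := by
    intro x hx y
    have h3 : I.tr (algebraMap R O 2 * y - algebraMap R O (I.tr y)) = 0 := by
      rw [map_sub, I.tr_algebraMap, ← smul_def, map_smul, smul_eq_mul, sub_self]
    have h4 : 2 * I.tr (x * y) ∈ v := by
      have h5 : 2 * I.tr (x * y) = I.tr (x * (algebraMap R O 2 * y - algebraMap R O (I.tr y))) := by
        rw [mul_sub, map_sub, ← smul_def, mul_smul_comm, map_smul, ← commutes,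
          ← smul_def, map_smul, hx]
        simp
      rw [h5, I.tr_mul_traceless h3]
      refine v.sub_mem (v.add_mem (hcon _ hx) (hcon _ h3)) (hcon _ ?_)
      rw [map_add, hx, h3, add_zero]
    exact (hv.mem_or_mem h4).resolve_left h2
  have hmem : ∀ z x, x ∈ I.orthogonal z → I.tr x = 0 := fun z x h => (I.mem_orthogonal.mp h).1
  obtain ⟨x, hx, hxn⟩ := I.exists_nr_notMem v hv0 hmax _ (I.orthogonal_saturated 1)
    (I.exists_mem_orthogonal 1) fun x hx => htr x (hmem _ _ hx)
  replace hx := hmem _ _ hx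
  obtain ⟨y, hy, hyn⟩ := I.exists_nr_notMem v hv0 hmax _ (I.orthogonal_saturated x)
    (I.exists_mem_orthogonal x) fun x hx => htr x (hmem _ _ hx)
  rw [mem_orthogonal] at hy
  have hxy : I.nr (x * y) ∈ v ^ 2 := by
    rw [I.nr_mul, pow_two]; exact Ideal.mul_mem_mul (hcon x hx) (hcon y hy.1)
  obtain ⟨u, hu, z, hz⟩ := hmax (x * y) (htr _ hy.2) hxy π hπ hπ2
  have hz0 : I.tr z = 0 := by
    have := congrArg I.tr hz
    rw [map_smul, hy.2, smul_zero, map_smul, smul_eq_mul, eq_comm, mul_eq_zero] at this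
    exact this.resolve_left hπ0
  obtain ⟨t, ht, h⟩ := exists_mul_eq_uniformizer_mul v hπ hπ2
  obtain ⟨c, hc⟩ := h _ (hcon x hx)
  obtain ⟨d, hd⟩ := h _ (hcon y hy.1)
  have hnot : ∀ n c, n ∉ v ^ 2 → t * n = π * c → c ∉ v := by
    intro n c hn hc hcv
    have : t * n ∈ v ^ 2 := by rw [hc, pow_two]; exact Ideal.mul_mem_mul hπ hcv
    rcases mul_mem_pow v this with h | h
    exacts [ht h, hn h]
  have e1 : u ^ 2 * (I.nr x * I.nr y) = π ^ 2 * I.nr z := by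
    rw [← I.nr_mul, ← I.nr_smul, hz, I.nr_smul]
  have e2 : t ^ 2 * I.nr z = u ^ 2 * (c * d) := by
    apply mul_left_cancel₀ (pow_ne_zero 2 hπ0)
    linear_combination (-t ^ 2) * e1 + u ^ 2 * t * I.nr y * hc + u ^ 2 * π * c * hd
  have e3 : u ^ 2 * (c * d) ∈ v := e2 ▸ v.mul_mem_left _ (hcon z hz0)
  rcases hv.mem_or_mem e3 with h | h
  · exact hu (hv.mem_of_pow_mem _ h)
  · rcases hv.mem_or_mem h with h | h
    exacts [hnot _ _ hxn hc h, hnot _ _ hyn hd h]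

variable {s : O} (hs : I.tr s = 0) (hsn : I.nr s ∉ v)

include hs in
theorem proj_mem_orthogonal (y : O) :
    (2 * I.nr s) • y - I.nr s • algebraMap R O (I.tr y) + I.tr (s * y) • s ∈ I.orthogonal s := by
  rw [mem_orthogonal]
  refine ⟨?_, ?_⟩
  · simp only [map_add, map_sub, map_smul, I.tr_algebraMap, hs, smul_eq_mul]; ring
  · rw [mul_add, mul_sub, mul_smul_comm, mul_smul_comm, mul_smul_comm, I.mul_self_of_tr hs,
      ← commutes, ← smul_def]
    simp only [map_add, map_sub, map_smul, I.tr_algebraMap, hs, smul_eq_mul]; ring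

include hs hsn h2 in
theorem tr_mul_mem_of_orthogonal (hcon : ∀ w ∈ I.orthogonal s, I.nr w ∈ v) :
    ∀ w ∈ I.orthogonal s, ∀ y, I.tr (w * y) ∈ v := by
  intro w hw y
  have hw' := I.mem_orthogonal.mp hw
  have h3 := I.proj_mem_orthogonal hs y
  have h4 : 2 * I.nr s * I.tr (w * y) = I.tr (w * ((2 * I.nr s) • y -
      I.nr s • algebraMap R O (I.tr y) + I.tr (s * y) • s)) := by
    rw [mul_add, mul_sub, mul_smul_comm, mul_smul_comm, mul_smul_comm, ← commutes,
      ← smul_def]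
    simp only [map_add, map_sub, map_smul, hw'.1, I.tr_mul_comm w s, hw'.2, smul_eq_mul]; ring
  have h5 : 2 * I.nr s * I.tr (w * y) ∈ v := by
    rw [h4, I.tr_mul_traceless (I.mem_orthogonal.mp h3).1]
    exact v.sub_mem (v.add_mem (hcon _ hw) (hcon _ h3)) (hcon _ ((I.orthogonal s).add_mem hw h3))
  rcases hv.mem_or_mem h5 with h | h
  · exact ((hv.mem_or_mem h).elim h2 hsn).elim
  · exact h

include hv0 hmax h2 hs hsn in
theorem exists_orthogonal_nr_notMem : ∃ w ∈ I.orthogonal s, I.nr w ∉ v ^ 2 ∧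
    (I.nr w ∈ v → ∀ w ∈ I.orthogonal s, I.nr w ∈ v) := by
  by_cases h : ∀ w ∈ I.orthogonal s, I.nr w ∈ v
  · obtain ⟨w, hw, hwn⟩ := I.exists_nr_notMem v hv0 hmax _ (I.orthogonal_saturated s)
      (I.exists_mem_orthogonal s) (I.tr_mul_mem_of_orthogonal v h2 hs hsn h)
    exact ⟨w, hw, hwn, fun _ => h⟩
  · push Not at h
    obtain ⟨w, hw, hwn⟩ := h
    exact ⟨w, hw, fun h => hwn (Ideal.pow_le_self two_ne_zero h), fun h => absurd h hwn⟩

include hv0 hmax h2 hs hsn in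
theorem nonsquare_of_orthogonal (hcon : ∀ w ∈ I.orthogonal s, I.nr w ∈ v) {w : O}
    (hw : w ∈ I.orthogonal s) (hwn : I.nr w ∉ v ^ 2) (c : R) : c ^ 2 + I.nr s ∉ v := by
  intro hc
  obtain ⟨π, hπ, hπ2⟩ := exists_uniformizer v hv0
  have hπ0 : π ≠ 0 := fun h => hπ2 (h ▸ zero_mem _)
  have hcv : c ∉ v := fun h => hsn <| by
    have := v.sub_mem hc (v.mul_mem_left c h)
    rwa [show c ^ 2 + I.nr s - c * c = I.nr s by ring] at this
  obtain ⟨c, hc, hc2⟩ : ∃ c, c ^ 2 + I.nr s ∈ v ∧ c ^ 2 + I.nr s ∉ v ^ 2 := by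
    by_cases h : c ^ 2 + I.nr s ∈ v ^ 2
    · refine ⟨c + π, ?_, fun h' => ?_⟩
      · rw [show (c + π) ^ 2 + I.nr s = (c ^ 2 + I.nr s) + π * (2 * c + π) by ring]
        exact v.add_mem hc (v.mul_mem_right _ hπ)
      · have := (v ^ 2).sub_mem ((v ^ 2).sub_mem h' h) (Ideal.pow_mem_pow hπ 2)
        rw [show (c + π) ^ 2 + I.nr s - (c ^ 2 + I.nr s) - π ^ 2 = (2 * c) * π by ring] at this
        rcases mul_mem_pow v this with h | h
        · exact (hv.mem_or_mem h).elim h2 hcv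
        · exact hπ2 h
    · exact ⟨c, hc, h⟩
  have hw' := I.mem_orthogonal.mp hw
  have hsw := I.mul_eq_neg hs hw'.1 hw'.2
  let z := (algebraMap R O c + s) * w
  have hz : z ∈ I.orthogonal s := by
    rw [mem_orthogonal]
    refine ⟨?_, ?_⟩
    · rw [show z = (algebraMap R O c + s) * w from rfl, add_mul, ← smul_def, map_add,
        map_smul, hw'.1, hw'.2]; simp
    · rw [show z = (algebraMap R O c + s) * w from rfl, add_mul, mul_add, ← smul_def, mul_smul_comm, ← mul_assoc, I.mul_self_of_tr hs,
        ← smul_def, map_add, map_smul, map_smul, hw'.1, hw'.2]; simp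
  have hnz : I.nr z = (c ^ 2 + I.nr s) * I.nr w := by
    rw [I.nr_mul, I.nr_add, I.nr_algebraMap, ← smul_def, map_smul, I.tr_star, hs]; simp
  obtain ⟨u, hu, y, hy⟩ := hmax z (I.tr_mul_mem_of_orthogonal v h2 hs hsn hcon z hz)
    (by rw [hnz, pow_two]; exact Ideal.mul_mem_mul hc (hcon w hw)) π hπ hπ2
  have hyo : y ∈ I.orthogonal s :=
    I.orthogonal_saturated s π y hπ0 (hy ▸ (I.orthogonal s).smul_mem u hz)
  obtain ⟨t, ht, h⟩ := exists_mul_eq_uniformizer_mul v hπ hπ2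
  obtain ⟨d, hd⟩ := h _ hc
  obtain ⟨d', hd'⟩ := h _ (hcon w hw)
  have hnot : ∀ n c, n ∉ v ^ 2 → t * n = π * c → c ∉ v := by
    intro n c hn hc hcv
    have : t * n ∈ v ^ 2 := by rw [hc, pow_two]; exact Ideal.mul_mem_mul hπ hcv
    rcases mul_mem_pow v this with h | h
    exacts [ht h, hn h]
  have e1 : u ^ 2 * ((c ^ 2 + I.nr s) * I.nr w) = π ^ 2 * I.nr y := by
    rw [← hnz, ← I.nr_smul, hy, I.nr_smul]
  have e2 : t ^ 2 * I.nr y = u ^ 2 * (d * d') := by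
    apply mul_left_cancel₀ (pow_ne_zero 2 hπ0)
    linear_combination (-t ^ 2) * e1 + u ^ 2 * t * I.nr w * hd + u ^ 2 * π * d * hd'
  have e3 : u ^ 2 * (d * d') ∈ v := e2 ▸ v.mul_mem_left _ (hcon y hyo)
  rcases hv.mem_or_mem e3 with h | h
  · exact hu (hv.mem_of_pow_mem _ h)
  · rcases hv.mem_or_mem h with h | h
    exacts [hnot _ _ hc2 hd h, hnot _ _ hwn hd' h]

theorem eq_zero_of_orthogonal [CharZero R] {w y : O} (hs : I.tr s = 0) (hw : w ∈ I.orthogonal s) (hs0 : s ≠ 0)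
    (hw0 : w ≠ 0) (h0 : I.tr y = 0) (h1 : I.tr (s * y) = 0) (h2 : I.tr (w * y) = 0)
    (h3 : I.tr (s * w * y) = 0) : y = 0 := by
  have hw' := I.mem_orthogonal.mp hw
  have e1 := I.mul_eq_neg hs h0 h1
  have e2 := I.mul_eq_neg hw'.1 h0 h2
  have e3 := I.mul_eq_neg hw'.2 h0 h3
  have e4 : s * w * y = y * (s * w) := by
    rw [mul_assoc, e2, mul_neg, ← mul_assoc, e1, neg_mul, neg_neg, mul_assoc]
  have e5 : (2 : R) • (y * (s * w)) = 0 := by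
    rw [two_smul]
    nth_rewrite 1 [← e4]
    rw [e3, neg_add_cancel]
  have e6 : I.nr y * (I.nr s * I.nr w) = 0 := by
    rw [← I.nr_mul, ← I.nr_mul, (I.smul_eq_zero e5).resolve_left two_ne_zero]
    apply I.inj; rw [I.nr_spec, zero_mul, map_zero]
  rcases mul_eq_zero.mp e6 with h | h
  · exact I.eq_zero_of_nr _ h
  · rcases mul_eq_zero.mp h with h | h
    exacts [absurd (I.eq_zero_of_nr _ h) hs0, absurd (I.eq_zero_of_nr _ h) hw0]

theorem expansion [CharZero R] {w : O} (hs : I.tr s = 0) (hw : w ∈ I.orthogonal s) (hs0 : s ≠ 0)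
    (hw0 : w ≠ 0) (y : O) :
    (2 * I.nr s * I.nr w) • y = (I.nr s * I.nr w * I.tr y) • (1 : O) - (I.nr w * I.tr (s * y)) • s
      - (I.nr s * I.tr (w * y)) • w - I.tr (s * w * y) • (s * w) := by
  have hw' := I.mem_orthogonal.mp hw
  have hsw := I.mul_eq_neg hs hw'.1 hw'.2
  have hss := I.mul_self_of_tr hs
  have hww := I.mul_self_of_tr hw'.1
  have t1 : I.tr (1 : O) = 2 := by
    have := I.tr_algebraMap 1
    rwa [map_one, mul_one] at this
  have m1 : w * s = -(s * w) := by rw [hsw, neg_neg]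
  have m2 : s * (s * w) = (-I.nr s) • w := by rw [← mul_assoc, hss, smul_def]
  have m3 : w * (s * w) = (I.nr w) • s := by
    rw [← mul_assoc, m1, neg_mul, mul_assoc, hww, ← commutes, ← smul_def, neg_smul,
      neg_neg]
  have m4 : s * w * s = (I.nr s) • w := by rw [mul_assoc, m1, mul_neg, m2, neg_smul, neg_neg]
  have m5 : s * w * w = (-I.nr w) • s := by rw [mul_assoc, hww, ← commutes, smul_def]
  have m6 : s * w * (s * w) = algebraMap R O (-(I.nr s * I.nr w)) := by
    rw [mul_assoc, m3, mul_smul_comm, hss, smul_def, ← map_mul]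
    congr 1; ring
  rw [← sub_eq_zero]
  refine I.eq_zero_of_orthogonal hs hw hs0 hw0 ?_ ?_ ?_ ?_
  · simp only [map_sub, map_smul, t1, hs, hw'.1, hw'.2, smul_eq_mul]; ring
  · simp only [mul_sub, mul_smul_comm, mul_one, hss, m2, map_sub, map_smul, hs, hw'.1, hw'.2,
      I.tr_algebraMap, smul_eq_mul]; ring
  · simp only [mul_sub, mul_smul_comm, mul_one, hww, m3, m1, map_sub, map_smul, map_neg, hs, hw'.1,
      hw'.2, I.tr_algebraMap, smul_eq_mul]; ring
  · simp only [mul_sub, mul_smul_comm, mul_one, m4, m5, m6, map_sub, map_smul, hs, hw'.1, hw'.2,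
      I.tr_algebraMap, smul_eq_mul]; ring

include h2 hs hsn in
theorem exists_smul_mem_span [CharZero R] (hv0 : v ≠ ⊥) {w : O} (hw : w ∈ I.orthogonal s) (hwn : I.nr w ∉ v ^ 2)
    (hcon : I.nr w ∈ v → ∀ w ∈ I.orthogonal s, I.nr w ∈ v) (y : O) :
    ∃ u ∉ v, u • y ∈ Submodule.span R {1, s, w, s * w} := by
  have mem : ∀ c0 c1 c2 c3 : R, c0 • (1 : O) - c1 • s - c2 • w - c3 • (s * w) ∈
      Submodule.span R {1, s, w, s * w} := fun c0 c1 c2 c3 => by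
    refine Submodule.sub_mem _ (Submodule.sub_mem _ (Submodule.sub_mem _ ?_ ?_) ?_) ?_ <;>
    · refine Submodule.smul_mem _ _ (Submodule.subset_span ?_)
      simp
  have zero_nr : I.nr 0 = 0 := by
    apply I.inj; rw [I.nr_spec, zero_mul, map_zero]
  have hs0 : s ≠ 0 := by rintro rfl; exact hsn (zero_nr ▸ v.zero_mem)
  have hw0 : w ≠ 0 := by rintro rfl; exact hwn (zero_nr ▸ (v ^ 2).zero_mem)
  by_cases hwv : I.nr w ∈ v
  · have hw' := I.mem_orthogonal.mp hw
    have hJ := I.tr_mul_mem_of_orthogonal v h2 hs hsn (hcon hwv)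
    let y' := (2 * I.nr s) • y - I.nr s • algebraMap R O (I.tr y) + I.tr (s * y) • s
    have hy' : y' ∈ I.orthogonal s := I.proj_mem_orthogonal hs y
    have hy := I.mem_orthogonal.mp hy'
    have e := I.expansion hs hw hs0 hw0 y'
    rw [hy.1, hy.2] at e
    obtain ⟨π, hπ, hπ2⟩ := exists_uniformizer v hv0
    have hπ0 : π ≠ 0 := fun h => hπ2 (h ▸ zero_mem _)
    obtain ⟨t, ht, h⟩ := exists_mul_eq_uniformizer_mul v hπ hπ2
    obtain ⟨A, hA⟩ := h _ (hJ w hw y')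
    have hsw : I.tr (s * w * y') ∈ v := by
      rw [show s * w * y' = w * y' * s * 1 + (s * (w * y') - w * y' * s) by noncomm_ring, map_add,
        mul_one, map_sub, I.tr_mul_comm s, sub_self, add_zero, mul_assoc]
      exact hJ w hw _
    obtain ⟨C, hC⟩ := h _ hsw
    obtain ⟨d, hd⟩ := h _ hwv
    have hdv : d ∉ v := fun hdv => by
      have : t * I.nr w ∈ v ^ 2 := by rw [hd, pow_two]; exact Ideal.mul_mem_mul hπ hdv
      rcases mul_mem_pow v this with h | h
      exacts [ht h, hwn h]
    refine ⟨2 * I.nr s * d * (2 * I.nr s), ?_, ?_⟩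
    · intro h
      rcases hv.mem_or_mem h with h | h
      · rcases hv.mem_or_mem h with h | h
        · exact (hv.mem_or_mem h).elim h2 hsn
        · exact hdv h
      · exact (hv.mem_or_mem h).elim h2 hsn
    · have e' : (2 * I.nr s * d) • y' = (0 : R) • (1 : O) - (0 : R) • s - (I.nr s * A) • w - C • (s * w) := by
        have e2 := congrArg (fun z => t • z) e
        have : π • ((2 * I.nr s * d) • y' - ((0 : R) • (1 : O) - (0 : R) • s - (I.nr s * A) • w - C • (s * w))) = 0 := by
          simp only [smul_sub, smul_smul] at e2 ⊢
          rw [show π * (2 * I.nr s * d) = t * (2 * I.nr s * I.nr w) by linear_combination (-2) * I.nr s * hd,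
            e2, show π * (I.nr s * A) = t * (I.nr s * I.tr (w * y')) by linear_combination (-1) * I.nr s * hA,
            show π * C = t * I.tr (s * w * y') from hC.symm]
          simp
        exact sub_eq_zero.mp ((I.smul_eq_zero this).resolve_left hπ0)
      have e3 : (2 * I.nr s * d * (2 * I.nr s)) • y = ((2 * I.nr s * d) • y') +
          ((2 * I.nr s * d * I.nr s * I.tr y) • (1 : O) - (2 * I.nr s * d * I.tr (s * y)) • s - (0 : R) • w - (0 : R) • (s * w)) := by
        simp only [y', smul_sub, smul_add, smul_smul, algebraMap_eq_smul_one, zero_smul,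
          ← mul_assoc]
        abel
      rw [e3, e']; exact Submodule.add_mem _ (mem _ _ _ _) (mem _ _ _ _)
  · refine ⟨2 * I.nr s * I.nr w, ?_, ?_⟩
    · intro h
      rcases hv.mem_or_mem h with h | h
      · exact (hv.mem_or_mem h).elim h2 hsn
      · exact hwv h
    · rw [I.expansion hs hw hs0 hw0 y]; exact mem _ _ _ _

end Local

end StdInvolution

section VectorCRT

variable {R : Type*} [CommRing R] [IsDedekindDomain R] {O : Type*}

theorem exists_sub_mem_smul [AddCommGroup O] [Module R O] (s : Finset (Ideal R))
    (hs : ∀ v ∈ s, Prime v) (n : ℕ) (S : Submodule R O) (x : Ideal R → O) (hx : ∀ v ∈ s, x v ∈ S) :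
    ∃ y ∈ S, ∀ v ∈ s, y - x v ∈ v ^ n • (⊤ : Submodule R O) := by
  classical
  have h : ∀ v : Ideal R, ∃ c : R, ∀ v' ∈ s, c - (if v' = v then 1 else 0) ∈ v' ^ n := by
    intro v
    obtain ⟨c, hc⟩ := IsDedekindDomain.exists_forall_sub_mem_ideal (s := s) (fun v => v)
      (fun _ => n) hs (fun _ _ _ _ h => h) (fun v' => if (v' : Ideal R) = v then 1 else 0)
    exact ⟨c, fun v' hv' => hc v' hv'⟩
  choose c hc using h
  refine ⟨∑ v ∈ s, c v • x v, S.sum_mem fun v hv => S.smul_mem _ (hx v hv), fun v hv => ?_⟩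
  have : ∑ v' ∈ s, c v' • x v' - x v = ∑ v' ∈ s, (c v' - if v = v' then 1 else 0) • x v' := by
    simp [sub_smul, Finset.sum_sub_distrib, ite_smul, hv]
  rw [this]; exact Submodule.sum_mem _ fun v' _ => Submodule.smul_mem_smul (hc v' v hv) mem_top

theorem apply_mem_of_mem_smul [AddCommGroup O] [Module R O] (J : Ideal R) (f : O →ₗ[R] R) {z : O}
    (hz : z ∈ J • (⊤ : Submodule R O)) : f z ∈ J := by
  induction hz using Submodule.smul_induction_on' with
  | smul r hr x hx => rw [map_smul]; exact J.mul_mem_right _ hr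
  | add x _ y _ hx hy => rw [map_add]; exact J.add_mem hx hy

theorem StdInvolution.nr_sub_mem [Ring O] [StarRing O] [Algebra R O] (I : StdInvolution R O)
    (J : Ideal R) {x y : O} (h : y - x ∈ J • (⊤ : Submodule R O)) : I.nr y - I.nr x ∈ J := by
  have tr_mem : ∀ a z : O, z ∈ J • (⊤ : Submodule R O) → I.tr (a * star z) ∈ J := by
    intro a z hz
    rw [← I.tr_star, star_mul, star_star]
    exact apply_mem_of_mem_smul J (I.tr.comp (LinearMap.mulRight R (star a))) hz
  have key : ∀ z ∈ J • (⊤ : Submodule R O), I.nr z ∈ J := by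
    intro z hz
    induction hz using Submodule.smul_induction_on' with
    | smul r hr x hx =>
      rw [I.nr_smul, pow_two, mul_assoc]; exact J.mul_mem_right _ hr
    | add x _ y hy' hx hy =>
      rw [I.nr_add]; exact J.add_mem (J.add_mem hx hy) (tr_mem _ _ hy')
  have : y = x + (y - x) := by abel
  rw [this, I.nr_add]
  rw [show I.nr x + I.nr (y - x) + I.tr (x * star (y - x)) - I.nr x =
    I.nr (y - x) + I.tr (x * star (y - x)) by ring]
  exact J.add_mem (key _ h) (tr_mem _ _ h)

end VectorCRT

/-- A quadruple `1, s, w, sw` of elements of an order `O` which is an orthogonal basis of `O` at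
`p`, with `s² = α` prime to `p` and `w² = β` square-free at `p`. -/
structure QuatFrame {R : Type*} [CommRing R] (p : ℕ) (O : Type*) [Ring O] [Algebra R O]
    (conj : O → O) where
  s : O
  w : O
  α : R
  β : R
  conj_s : conj s = -s
  conj_w : conj w = -w
  anti : s * w = -(w * s)
  s_sq : s * s = algebraMap R O α
  w_sq : w * w = algebraMap R O β
  α_notMem : ∀ v : Ideal R, v.IsPrime → (p : R) ∈ v → α ∉ v
  β_notMem : ∀ v : Ideal R, v.IsPrime → (p : R) ∈ v → β ∉ v ^ 2
  nonsquare : ∀ v : Ideal R, v.IsPrime → (p : R) ∈ v → β ∈ v → ∀ c, c ^ 2 - α ∉ v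
  exists_mem_span : ∀ x : O, ∃ c : R, ∃ y0 y1 y2 y3 : R,
    (1 + p * c) • x = algebraMap R O y0 + y1 • s + y2 • w + y3 • (s * w)

theorem StdInvolution.exists_frame {R O : Type*} [CommRing R] [IsDedekindDomain R] [CharZero R]
    [Ring O] [StarRing O] [Algebra R O] (I : StdInvolution R O) (p : ℕ) (hp : p.Prime) (hp2 : p ≠ 2)
    (hmax : ∀ v : Ideal R, v.IsPrime → (p : R) ∈ v → I.IsMaximalAt v) :
    Nonempty (QuatFrame (R := R) p O star) := by
  classical
  have hp0 : (p : R) ≠ 0 := by exact_mod_cast hp.ne_zero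
  have hbot : ∀ v : Ideal R, (p : R) ∈ v → v ≠ ⊥ := by
    rintro v hv rfl
    exact hp0 (Ideal.mem_bot.mp hv)
  have h2 : ∀ v : Ideal R, v.IsPrime → (p : R) ∈ v → (2 : R) ∉ v := by
    intro v hv hpv h
    obtain ⟨m, hm⟩ := hp.odd_of_ne_two hp2
    apply hv.ne_top; rw [Ideal.eq_top_iff_one]
    have : (1 : R) = p - 2 * m := by rw [hm]; push_cast; ring
    rw [this]; exact v.sub_mem hpv (v.mul_mem_right _ h)
  have hspan : Ideal.span {(p : R)} ≠ ⊥ := by simpa using hp0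
  let T := (UniqueFactorizationMonoid.normalizedFactors (Ideal.span {(p : R)})).toFinset
  have hT : ∀ v : Ideal R, v ∈ T ↔ v.IsPrime ∧ (p : R) ∈ v := by
    intro v
    rw [Multiset.mem_toFinset, Ideal.mem_normalizedFactors_iff hspan,
      Ideal.span_singleton_le_iff_mem]
  have hTp : ∀ v ∈ T, Prime v := by
    intro v hv
    exact Ideal.prime_of_isPrime (hbot v ((hT v).mp hv).2) ((hT v).mp hv).1
  have hs : ∀ v : Ideal R, ∃ s, v ∈ T → I.tr s = 0 ∧ I.nr s ∉ v := by
    intro v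
    by_cases hv : v ∈ T
    · obtain ⟨hv1, hv2⟩ := (hT v).mp hv
      obtain ⟨s, hs⟩ := I.exists_traceless v (hbot v hv2) (hmax v hv1 hv2) (h2 v hv1 hv2)
      exact ⟨s, fun _ => hs⟩
    · exact ⟨0, fun h => absurd h hv⟩
  choose s₀ hs₀ using hs
  obtain ⟨s, hs, hs'⟩ := exists_sub_mem_smul T hTp 1 (LinearMap.ker I.tr) s₀
    fun v hv => (hs₀ v hv).1
  rw [LinearMap.mem_ker] at hs
  have hsn : ∀ v ∈ T, I.nr s ∉ v := by
    intro v hv h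
    have := I.nr_sub_mem _ (hs' v hv)
    rw [pow_one] at this
    apply (hs₀ v hv).2
    have := v.sub_mem h this
    rwa [sub_sub_cancel] at this
  have hw : ∀ v : Ideal R, ∃ w, v ∈ T → w ∈ I.orthogonal s ∧ I.nr w ∉ v ^ 2 ∧
      (I.nr w ∈ v → ∀ w ∈ I.orthogonal s, I.nr w ∈ v) := by
    intro v
    by_cases hv : v ∈ T
    · obtain ⟨hv1, hv2⟩ := (hT v).mp hv
      obtain ⟨w, hw⟩ := I.exists_orthogonal_nr_notMem v (hbot v hv2) (hmax v hv1 hv2)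
        (h2 v hv1 hv2) hs (hsn v hv)
      exact ⟨w, fun _ => hw⟩
    · exact ⟨0, fun h => absurd h hv⟩
  choose w₀ hw₀ using hw
  obtain ⟨w, hw, hw'⟩ := exists_sub_mem_smul T hTp 2 (I.orthogonal s) w₀
    fun v hv => (hw₀ v hv).1
  have hwn : ∀ v ∈ T, I.nr w ∉ v ^ 2 := by
    intro v hv h
    have := I.nr_sub_mem _ (hw' v hv)
    apply (hw₀ v hv).2.1
    have := (v ^ 2).sub_mem h this
    rwa [sub_sub_cancel] at this
  have hwc : ∀ v ∈ T, I.nr w ∈ v → ∀ w ∈ I.orthogonal s, I.nr w ∈ v := by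
    intro v hv h
    apply (hw₀ v hv).2.2
    have := v.sub_mem h (Ideal.pow_le_self two_ne_zero (I.nr_sub_mem _ (hw' v hv)))
    rwa [sub_sub_cancel] at this
  have hw1 := I.mem_orthogonal.mp hw
  refine ⟨⟨s, w, -I.nr s, -I.nr w, I.star_of_tr hs, I.star_of_tr hw1.1, I.mul_eq_neg hs hw1.1 hw1.2,
    I.mul_self_of_tr hs, I.mul_self_of_tr hw1.1, ?_, ?_, ?_, ?_⟩⟩
  · intro v hv hpv
    rw [neg_mem_iff]; exact hsn v ((hT v).mpr ⟨hv, hpv⟩)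
  · intro v hv hpv
    rw [neg_mem_iff]; exact hwn v ((hT v).mpr ⟨hv, hpv⟩)
  · intro v hv hpv hβ c
    rw [neg_mem_iff] at hβ
    have hvT := (hT v).mpr ⟨hv, hpv⟩
    rw [sub_neg_eq_add]
    exact I.nonsquare_of_orthogonal v (hbot v hpv) (hmax v hv hpv) (h2 v hv hpv) hs (hsn v hvT)
      (hwc v hvT hβ) hw (hwn v hvT) c
  · intro x
    let Z := Submodule.span R {1, s, w, s * w}
    let J : Ideal R := Z.comap (toSpanSingleton R O x)
    have hJ : J ⊔ Ideal.span {(p : R)} = ⊤ := by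
      by_contra hne
      obtain ⟨v, hv, hle⟩ := Ideal.exists_le_maximal _ hne
      have hpv : (p : R) ∈ v := hle (Ideal.mem_sup_right (Ideal.mem_span_singleton_self _))
      have hvT := (hT v).mpr ⟨hv.isPrime, hpv⟩
      have := hv.isPrime
      obtain ⟨u, hu, hux⟩ := I.exists_smul_mem_span v (h2 v hv.isPrime hpv) hs (hsn v hvT)
        (hbot v hpv) hw (hwn v hvT) (hwc v hvT) x
      exact hu (hle (Ideal.mem_sup_left (show u ∈ J by simpa [J] using hux)))
    obtain ⟨u, hu, c, hc, huc⟩ := mem_sup.mp (hJ ▸ mem_top : (1 : R) ∈ _)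
    obtain ⟨c, rfl⟩ := Ideal.mem_span_singleton.mp hc
    refine ⟨-c, ?_⟩
    rw [show (1 : R) + p * -c = u by rw [← huc]; ring]
    have hux : u • x ∈ Z := by simpa [J] using hu
    simp only [Z, Submodule.mem_span_insert, Submodule.mem_span_singleton] at hux
    obtain ⟨y0, _, ⟨y1, _, ⟨y2, _, ⟨y3, rfl⟩, rfl⟩, rfl⟩, h⟩ := hux
    refine ⟨y0, y1, y2, y3, ?_⟩
    rw [h, algebraMap_eq_smul_one]; abel

theorem exists_subalgebra_of_mul_mul {R A : Type*} [CommRing R] [Ring A] [Algebra R A]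
    {T : Subalgebra R A} (hT : (toSubmodule T).FG) (x : A)
    (h : ∀ y ∈ T, ∃ d : R, ∃ z ∈ T, x * y * x = algebraMap R A d * x + z) :
    ∃ T' : Subalgebra R A, (toSubmodule T').FG ∧ T ≤ T' ∧ x ∈ T' := by
  let S := toSubmodule T
  let P := Submodule.span R {x}
  have hSS : S * S = S := Subalgebra.isIdempotentElem_toSubmodule T
  have h1S : (1 : A) ∈ S := T.one_mem
  have hPSP : P * S * P ≤ P ⊔ S := by
    rw [Submodule.mul_le]
    intro m hm n hn
    obtain ⟨c, rfl⟩ := Submodule.mem_span_singleton.mp hn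
    induction hm using Submodule.mul_induction_on' with
    | mem_mul_mem m hm y hy =>
      obtain ⟨c', rfl⟩ := Submodule.mem_span_singleton.mp hm
      obtain ⟨d, z, hz, hd⟩ := h y hy
      rw [smul_mul_assoc, smul_mul_assoc, mul_smul_comm, hd, ← smul_def]
      refine Submodule.smul_mem _ _ (Submodule.smul_mem _ _ (Submodule.add_mem _ ?_ ?_))
      · exact Submodule.mem_sup_left (Submodule.smul_mem _ _ (Submodule.mem_span_singleton_self _))
      · exact Submodule.mem_sup_right hz
    | add m _ m' _ h h' => rw [add_mul]; exact Submodule.add_mem _ h h'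
  let X := S * P * S
  have hSX : S * X = X := by
    change S * (S * P * S) = S * P * S; rw [← mul_assoc, ← mul_assoc, hSS]
  have hXS : X * S = X := by
    change S * P * S * S = S * P * S; rw [mul_assoc, hSS]
  have hXX : X * X ≤ S ⊔ X := by
    have : X * X = S * (P * S * P) * S := by
      calc X * X = S * P * (S * S) * P * S := by simp only [X, mul_assoc]
        _ = _ := by rw [hSS]; simp only [mul_assoc]
    rw [this]
    calc S * (P * S * P) * S ≤ S * (P ⊔ S) * S := by gcongr
      _ = X ⊔ S := by rw [Submodule.mul_sup, Submodule.sup_mul, hSS, hSS]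
      _ = S ⊔ X := sup_comm _ _
  have hmul : (S ⊔ X) * (S ⊔ X) ≤ S ⊔ X := by
    rw [Submodule.mul_sup, Submodule.sup_mul, Submodule.sup_mul, hSS, hSX, hXS]
    exact sup_le le_rfl (sup_le le_sup_right hXX)
  refine ⟨(S ⊔ X).toSubalgebra (Submodule.mem_sup_left h1S)
    fun y z hy hz => hmul (Submodule.mul_mem_mul hy hz), ?_,
    fun y hy => Submodule.mem_sup_left (show y ∈ S from hy), Submodule.mem_sup_right ?_⟩
  · change (S ⊔ X).FG; exact hT.sup ((hT.mul (Submodule.fg_span_singleton _)).mul hT)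
  · have := Submodule.mul_mem_mul (Submodule.mul_mem_mul h1S
      (Submodule.mem_span_singleton_self (R := R) x)) h1S
    simpa using this

section Concrete

variable {F : Type*} [Field F] [NumberField F] {a b : F} {O : Subalgebra (𝓞 F) ℍ[F, a, b]}

/-- The conjugation of a star-stable order. -/
def conj (hs : ∀ x ∈ O, star x ∈ O) (x : O) : O := ⟨star (x : ℍ[F, a, b]), hs x x.2⟩

/-- A star-stable order as a star ring. -/
abbrev starRingOrder (hs : ∀ x ∈ O, star x ∈ O) : StarRing O where
  star := conj hs
  star_involutive _ := Subtype.ext (star_star _)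
  star_mul _ _ := Subtype.ext (star_mul _ _)
  star_add _ _ := Subtype.ext (star_add _ _)

theorem algebraMap_quaternion_injective : Injective (algebraMap F ℍ[F, a, b]) :=
  FaithfulSMul.algebraMap_injective _ _

theorem algebraMap_quaternion_injective' : Injective (algebraMap (𝓞 F) ℍ[F, a, b]) := by
  rw [IsScalarTower.algebraMap_eq (𝓞 F) F]
  exact algebraMap_quaternion_injective.comp NumberField.RingOfIntegers.coe_injective

theorem exists_algebraMap_eq (h : (toSubmodule O).FG) {f : F}
    (hf : algebraMap F ℍ[F, a, b] f ∈ O) : ∃ c : 𝓞 F, algebraMap (𝓞 F) F c = f := by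
  have h1 : IsIntegral (𝓞 F) (algebraMap F ℍ[F, a, b] f) := IsIntegral.of_mem_of_fg O h _ hf
  have h2 : IsIntegral (𝓞 F) f :=
    (isIntegral_algHom_iff (Algebra.ofId F ℍ[F, a, b] |>.restrictScalars (𝓞 F))
      algebraMap_quaternion_injective).mp h1
  exact IsIntegrallyClosed.isIntegral_iff.mp h2

theorem add_star_eq (x : ℍ[F, a, b]) : x + star x = algebraMap F _ (x + star x).re := by
  ext <;> simp

theorem mul_star_eq (x : ℍ[F, a, b]) : x * star x = algebraMap F _ (x * star x).re := by
  ext <;> simp <;> ring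

theorem nrd_eq (x : ℍ[F, a, b]) : (x * star x).re =
    x.re ^ 2 - a * x.imI ^ 2 - b * x.imJ ^ 2 + a * b * x.imK ^ 2 := by
  simp; ring

theorem eq_zero_of_nrd [IsTotallyReal F] (hB : IsTotallyDefinite a b)
    (x : ℍ[F, a, b]) (h : x * star x = 0) : x = 0 := by
  obtain ⟨w⟩ := (inferInstance : Nonempty (NumberField.InfinitePlace F))
  let φ : F →+* ℝ := NumberField.InfinitePlace.embedding_of_isReal
    (NumberField.IsTotallyReal.isReal w)
  have h1 : (x * star x).re = 0 := by rw [h]; rfl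
  rw [nrd_eq] at h1
  have h2 := congrArg φ h1
  obtain ⟨ha, hb⟩ := hB φ
  simp only [map_add, map_sub, map_mul, map_pow, map_zero] at h2
  have hab := mul_pos_of_neg_of_neg ha hb
  have e1 := sq_nonneg (φ x.re)
  have e2 := mul_nonneg (neg_nonneg.mpr ha.le) (sq_nonneg (φ x.imI))
  have e3 := mul_nonneg (neg_nonneg.mpr hb.le) (sq_nonneg (φ x.imJ))
  have e4 := mul_nonneg hab.le (sq_nonneg (φ x.imK))
  have f1 : φ x.re ^ 2 = 0 := by linarith
  have f2 : φ a * φ x.imI ^ 2 = 0 := by linarith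
  have f3 : φ b * φ x.imJ ^ 2 = 0 := by linarith
  have f4 : φ a * φ b * φ x.imK ^ 2 = 0 := by linarith
  have := φ.injective
  ext
  · simpa using f1
  · simpa [ha.ne] using f2
  · simpa [hb.ne] using f3
  · simpa [ha.ne, hb.ne] using f4

theorem exists_stdInvolution [IsTotallyReal F] (hB : IsTotallyDefinite a b)
    (h : IsOrderIn (𝓞 F) F O) (hs : ∀ x ∈ O, star x ∈ O) :
    letI := starRingOrder hs
    Nonempty (StdInvolution (𝓞 F) O) := by
  letI := starRingOrder hs
  have inj : Injective (algebraMap (𝓞 F) O) := fun x y hxy =>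
    algebraMap_quaternion_injective' (congrArg Subtype.val hxy)
  have htr : ∀ x : O, ∃ c, algebraMap (𝓞 F) O c = x + star x := by
    intro x
    obtain ⟨c, hc⟩ := exists_algebraMap_eq h.1 (f := ((x : ℍ[F, a, b]) + star (x : ℍ[F, a, b])).re)
      (by rw [← add_star_eq]; exact O.add_mem x.2 (hs x x.2))
    refine ⟨c, Subtype.ext ?_⟩
    change algebraMap (𝓞 F) ℍ[F, a, b] c = x + star (x : ℍ[F, a, b])
    rw [add_star_eq, ← hc, ← IsScalarTower.algebraMap_apply]
  have hnr : ∀ x : O, ∃ c, algebraMap (𝓞 F) O c = x * star x := by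
    intro x
    obtain ⟨c, hc⟩ := exists_algebraMap_eq h.1 (f := ((x : ℍ[F, a, b]) * star (x : ℍ[F, a, b])).re)
      (by rw [← mul_star_eq]; exact O.mul_mem x.2 (hs x x.2))
    refine ⟨c, Subtype.ext ?_⟩
    change algebraMap (𝓞 F) ℍ[F, a, b] c = x * star (x : ℍ[F, a, b])
    rw [mul_star_eq, ← hc, ← IsScalarTower.algebraMap_apply]
  choose tr htr using htr
  choose nr hnr using hnr
  let tr' : O →ₗ[𝓞 F] 𝓞 F :=
    { toFun := tr
      map_add' := fun x y => inj (by rw [map_add, htr, htr, htr, star_add]; abel)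
      map_smul' := fun c x => inj (by
        have : star (c • x) = c • star x := Subtype.ext (by
          change star (c • (x : ℍ[F, a, b])) = c • star (x : ℍ[F, a, b])
          rw [← algebraMap_smul F c, ← algebraMap_smul F c]
          ext <;> simp)
        rw [RingHom.id_apply, smul_eq_mul, map_mul, htr, htr, this, ← smul_add, smul_def]) }
  refine ⟨⟨tr', nr, htr, hnr, inj, fun x hx => ?_, fun x => ?_⟩⟩
  · have := hnr x
    rw [hx, map_zero] at this
    exact Subtype.ext (eq_zero_of_nrd hB x (congrArg Subtype.val this).symm)
  · let f : ℍ[F, a, b] →ₗ[F] F × F := LinearMap.prod (QuaternionAlgebra.reₗ a 0 b)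
      ((QuaternionAlgebra.reₗ a 0 b).comp (mulLeft F (x : ℍ[F, a, b])))
    have hker : LinearMap.ker f ≠ ⊥ := by
      apply LinearMap.ker_ne_bot_of_finrank_lt
      rw [finrank_eq_four, Module.finrank_prod, Module.finrank_self]; norm_num
    obtain ⟨y, hy, hy0⟩ := Submodule.exists_mem_ne_zero_of_ne_bot hker
    obtain ⟨n, hn, hny⟩ := exists_int_smul_mem h.2 y
    have hn' : (n : F) ≠ 0 := by exact_mod_cast hn
    have hf : f (n • y) = 0 := by rw [map_zsmul, hy, smul_zero]
    have tr_eq : ∀ z : O, (z : ℍ[F, a, b]).re = 0 → tr z = 0 := by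
      intro z hz
      apply inj; rw [htr, map_zero]
      apply Subtype.ext
      change (z : ℍ[F, a, b]) + star (z : ℍ[F, a, b]) = 0; rw [add_star_eq]; simp [hz]
    refine ⟨⟨n • y, hny⟩, fun h0 => hy0 ?_, tr_eq _ (congrArg Prod.fst hf),
      tr_eq _ (congrArg Prod.snd hf)⟩
    have := congrArg Subtype.val h0
    change n • y = 0 at this; rw [← Int.cast_smul_eq_zsmul F n y] at this
    exact (smul_eq_zero.mp this).resolve_left hn'

theorem isMaximalAt (p : ℕ) [Fact p.Prime] (hO : IsStarOrderMaximalAt p O) :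
    letI := starRingOrder hO.star_mem
    ∀ (I : StdInvolution (𝓞 F) O) (v : Ideal (𝓞 F)), v.IsPrime → (p : 𝓞 F) ∈ v →
      I.IsMaximalAt v := by
  letI := starRingOrder hO.star_mem
  intro I v hv hpv x hx hxn π hπ hπ2
  have hπ0 : π ≠ 0 := fun h => hπ2 (h ▸ zero_mem _)
  obtain ⟨t1, ht1, h1⟩ := exists_mul_eq_uniformizer_mul v hπ hπ2
  obtain ⟨t2, ht2, h2⟩ := exists_mul_eq_uniformizer_pow_mul v hπ hπ2 2
  obtain ⟨t, ht, hd1, hd2⟩ : ∃ t ∉ v, (∀ c ∈ v, ∃ d, t * c = π * d) ∧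
      ∀ c ∈ v ^ 2, ∃ d, t * c = π ^ 2 * d := by
    refine ⟨t1 * t2, fun h => (hv.mem_or_mem h).elim ht1 ht2, fun c hc => ?_, fun c hc => ?_⟩
    · obtain ⟨d, hd⟩ := h1 c hc
      exact ⟨t2 * d, by linear_combination t2 * hd⟩
    · obtain ⟨d, hd⟩ := h2 c hc
      exact ⟨t1 * d, by linear_combination t1 * hd⟩
  have hπF : (π : F) ≠ 0 := by simpa using hπ0
  let r : F := (t : F) / (π : F)
  let x' : ℍ[F, a, b] := r • (x : ℍ[F, a, b])
  have coe_smul : ∀ (c : 𝓞 F) (y : ℍ[F, a, b]), c • y = (c : F) • y := fun c y => rfl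
  have coe_alg : ∀ c : 𝓞 F, algebraMap (𝓞 F) ℍ[F, a, b] c = algebraMap F _ (c : F) :=
    fun c => IsScalarTower.algebraMap_apply (𝓞 F) F _ c
  have star_x' : star x' = r • star (x : ℍ[F, a, b]) := by ext <;> simp [x']
  have htr : ∀ y : O, ∃ d : 𝓞 F, x' * y + star (x' * y) = algebraMap (𝓞 F) _ d := by
    intro y
    obtain ⟨d, hd⟩ := hd1 _ (hx y)
    refine ⟨d, ?_⟩
    have e1 : algebraMap (𝓞 F) ℍ[F, a, b] (I.tr (x * y)) = x * y + star (x * y : ℍ[F, a, b]) :=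
      congrArg Subtype.val (I.tr_spec (x * y))
    have e2 : x' * y + star (x' * y) = r • (x * y + star (x * y : ℍ[F, a, b])) := by
      rw [star_mul, star_x', star_mul, smul_add, mul_smul_comm]; simp [x']
    rw [e2, ← e1, coe_alg, coe_alg, smul_def, ← map_mul]
    congr 1
    have : (t : F) * (I.tr (x * y) : F) = π * d := by exact_mod_cast congrArg (algebraMap (𝓞 F) F) hd
    rw [div_mul_eq_mul_div, this, mul_div_cancel_left₀ _ hπF]
  obtain ⟨e, he⟩ : ∃ e : 𝓞 F, star x' * x' = algebraMap (𝓞 F) _ e := by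
    obtain ⟨d, hd⟩ := hd2 _ hxn
    refine ⟨t * d, ?_⟩
    have e1 : algebraMap (𝓞 F) ℍ[F, a, b] (I.nr x) = star (x : ℍ[F, a, b]) * x :=
      congrArg Subtype.val (I.star_mul_self x).symm
    rw [star_x', smul_mul_smul_comm, ← e1, coe_alg, coe_alg, smul_def, ← map_mul]
    congr 1
    have : (t : F) * (I.nr x : F) = (π : F) ^ 2 * d := by
      exact_mod_cast congrArg (algebraMap (𝓞 F) F) hd
    change (t : F) / π * ((t : F) / π) * (I.nr x : F) = (t : F) * (d : F)
    field_simp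
    linear_combination (t : F) * this
  have hxyx : ∀ y : O, ∃ (d : 𝓞 F), x' * y * x' =
      algebraMap (𝓞 F) _ d * x' - algebraMap (𝓞 F) _ e * star (y : ℍ[F, a, b]) := by
    intro y
    obtain ⟨d, hd⟩ := htr y
    refine ⟨d, ?_⟩
    rw [commutes e, ← hd, ← he, star_mul]
    noncomm_ring
  obtain ⟨O', hO', hle, hx'O'⟩ := exists_subalgebra_of_mul_mul hO.isOrder.1 x' fun y hy => by
    obtain ⟨d, hd⟩ := hxyx ⟨y, hy⟩
    exact ⟨d, _, O.mul_mem (O.algebraMap_mem (-e)) (hO.star_mem y hy), by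
      rw [hd, map_neg, neg_mul, sub_eq_add_neg]⟩
  obtain ⟨n, hn, hnx⟩ := hO.exists_smul_mem p hO' hle hx'O'
  refine ⟨n * t, fun h => ?_, ⟨n • x', hnx⟩, Subtype.ext ?_⟩
  · rcases hv.mem_or_mem h with h | h
    · apply hv.ne_top; rw [Ideal.eq_top_iff_one]
      have hcop : Nat.Coprime p n := (Nat.Prime.coprime_iff_not_dvd Fact.out).mpr hn
      have := Int.gcd_eq_gcd_ab p n
      rw [Int.gcd_natCast_natCast, hcop.gcd_eq_one] at this
      have h1 := congrArg (Int.cast : ℤ → 𝓞 F) this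
      push_cast at h1; rw [h1]; exact v.add_mem (v.mul_mem_right _ hpv) (v.mul_mem_right _ h)
    · exact ht h
  · change ((n : 𝓞 F) * t) • (x : ℍ[F, a, b]) = π • (n • x')
    rw [coe_smul, coe_smul, ← cast_smul_eq_nsmul F, smul_smul, smul_smul]
    congr 1; simp only [r, map_mul, map_natCast]
    field_simp

theorem exists_quatFrame [IsTotallyReal F] (hB : IsTotallyDefinite a b) (p : ℕ)
    [Fact p.Prime] (hp : p ≠ 2) (hO : IsStarOrderMaximalAt p O) :
    Nonempty (QuatFrame (R := 𝓞 F) p O (conj hO.star_mem)) := by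
  letI := starRingOrder hO.star_mem
  obtain ⟨I⟩ := exists_stdInvolution hB hO.isOrder hO.star_mem
  exact I.exists_frame p Fact.out hp fun v hv hpv => isMaximalAt p hO I v hv hpv

end Concrete

section Charpoly

theorem charpoly_restrictScalars_eval {R S V : Type*} [CommRing R] [Nontrivial R] [CommRing S]
    [Nontrivial S] [Algebra R S]
    [Free R S] [Module.Finite R S] [AddCommGroup V] [Module R V] [Module S V]
    [IsScalarTower R S V] [Free S V] [Module.Finite S V] [Free R V]
    [Module.Finite R V] (T : End S V) (n : R) :
    (T.restrictScalars R : End R V).charpoly.eval n =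
      Algebra.norm R (T.charpoly.eval (algebraMap R S n)) := by
  rw [eval_charpoly, eval_charpoly, ← LinearMap.det_restrictScalars]
  congr 1
  ext v; simp [Module.algebraMap_end_apply]

theorem det_mulLeft_quaternion {F : Type*} [Field F] {a b : F} (y : ℍ[F, a, b]) :
    LinearMap.det (mulLeft F y) = (y * star y).re ^ 2 := by
  rw [← LinearMap.det_toMatrix (basisOneIJK a 0 b)]
  have : LinearMap.toMatrix (basisOneIJK a 0 b)
      (basisOneIJK a 0 b) (mulLeft F y) =
      !![y.re, a * y.imI, b * y.imJ, - (a * b) * y.imK;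
         y.imI, y.re, b * y.imK, - b * y.imJ;
         y.imJ, - a * y.imK, y.re, a * y.imI;
         y.imK, - y.imJ, y.imI, y.re] := by
    have h0 : basisOneIJK a 0 b 0 = ⟨1, 0, 0, 0⟩ := by
      apply (basisOneIJK a 0 b).repr.injective; rw [Module.Basis.repr_self]
      ext i
      fin_cases i <;> simp
    have h1 : basisOneIJK a 0 b 1 = ⟨0, 1, 0, 0⟩ := by
      apply (basisOneIJK a 0 b).repr.injective; rw [Module.Basis.repr_self]
      ext i
      fin_cases i <;> simp
    have h2 : basisOneIJK a 0 b 2 = ⟨0, 0, 1, 0⟩ := by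
      apply (basisOneIJK a 0 b).repr.injective; rw [Module.Basis.repr_self]
      ext i
      fin_cases i <;> simp
    have h3 : basisOneIJK a 0 b 3 = ⟨0, 0, 0, 1⟩ := by
      apply (basisOneIJK a 0 b).repr.injective; rw [Module.Basis.repr_self]
      ext i
      fin_cases i <;> simp
    ext i j
    fin_cases j <;> fin_cases i <;>
      simp [LinearMap.toMatrix_apply, h0, h1, h2, h3]
  have h : (y * star y).re =
      y.re ^ 2 - a * y.imI ^ 2 - b * y.imJ ^ 2 + a * b * y.imK ^ 2 := by
    simp; ring
  rw [this, h]; simp [Matrix.det_succ_row_zero, Fin.sum_univ_succ, Fin.succAbove]; ring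

variable {F : Type*} [Field F] [NumberField F]

theorem ofReal_prod_embeddings [IsTotallyReal F] (y : F) :
    ((∏ φ : F →+* ℝ, φ y : ℝ) : ℂ) = ((Algebra.norm ℚ y : ℚ) : ℂ) := by
  have h := Algebra.norm_eq_prod_embeddings ℚ ℂ y
  rw [show ((Algebra.norm ℚ y : ℚ) : ℂ) = algebraMap ℚ ℂ (Algebra.norm ℚ y) from rfl, h]
  push_cast
  refine Fintype.prod_bijective (fun φ : F →+* ℝ => (Complex.ofRealHom.comp φ).toRatAlgHom)
    ⟨fun φ φ' h => ?_, fun σ => ?_⟩ _ _ fun φ => rfl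
  · ext x
    have := congrArg (fun τ : F →ₐ[ℚ] ℂ => τ x) h
    exact Complex.ofReal_injective this
  · have hr := NumberField.IsTotallyReal.complexEmbedding_isReal (σ : F →+* ℂ)
    refine ⟨hr.embedding, AlgHom.ext fun x => ?_⟩
    exact hr.coe_embedding_apply x

theorem prod_embeddings [IsTotallyReal F] (y : F) :
    (∏ φ : F →+* ℝ, φ y : ℝ) = ((Algebra.norm ℚ y : ℚ) : ℝ) := by
  apply Complex.ofReal_injective; rw [ofReal_prod_embeddings]; simp

theorem eq_of_eval_int {P Q : ℝ[X]} (h : ∀ n : ℤ, P.eval (n : ℝ) = Q.eval (n : ℝ)) : P = Q := by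
  refine Polynomial.eq_of_infinite_eval_eq P Q ?_
  exact (Set.infinite_range_of_injective (Int.cast_injective (α := ℝ))).mono
    (by rintro _ ⟨n, rfl⟩; exact h n)

variable {a b : F} {O : Subalgebra (𝓞 F) ℍ[F, a, b]}

theorem eval_reducedCharpoly [IsTotallyReal F] (x : ℍ[F, a, b]) (n : ℤ) :
    (∏ φ : F →+* ℝ, (Polynomial.X ^ 2 - Polynomial.C (φ (x + star x).re) * Polynomial.X
      + Polynomial.C (φ (x * star x).re))).eval (n : ℝ) =
    ((Algebra.norm ℚ ((n : F) ^ 2 - (x + star x).re * n + (x * star x).re) : ℚ) : ℝ) := by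
  rw [Polynomial.eval_prod, ← prod_embeddings]
  refine Finset.prod_congr rfl fun φ _ => ?_
  simp

theorem exists_isReducedCharpoly [IsTotallyReal F] (h : IsOrderIn (𝓞 F) F O)
    (hs : ∀ x ∈ O, star x ∈ O) (x : O) : ∃ P : ℤ[X], IsReducedCharpoly (x : ℍ[F, a, b]) P := by
  obtain ⟨t, ht⟩ := exists_algebraMap_eq h.1
    (f := ((x : ℍ[F, a, b]) + star (x : ℍ[F, a, b])).re)
    (by rw [← add_star_eq]; exact O.add_mem x.2 (hs x x.2))
  obtain ⟨m, hm⟩ := exists_algebraMap_eq h.1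
    (f := ((x : ℍ[F, a, b]) * star (x : ℍ[F, a, b])).re)
    (by rw [← mul_star_eq]; exact O.mul_mem x.2 (hs x x.2))
  let T : End (𝓞 F) (Fin 2 → 𝓞 F) := Matrix.toLin' !![0, -m; 1, t]
  refine ⟨(T.restrictScalars ℤ : End ℤ _).charpoly, eq_of_eval_int fun n => ?_⟩
  rw [eval_reducedCharpoly, Polynomial.eval_intCast_map, charpoly_restrictScalars_eval]
  have : T.charpoly = Polynomial.X ^ 2 - Polynomial.C t * Polynomial.X + Polynomial.C m := by
    rw [← LinearMap.charpoly_toMatrix T (Pi.basisFun _ _), LinearMap.toMatrix_eq_toMatrix',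
      LinearMap.toMatrix'_toLin', Matrix.charpoly_fin_two]
    simp [Matrix.trace_fin_two, Matrix.det_fin_two]
  rw [this, eq_intCast, ← ht, ← hm]
  have h2 := Algebra.coe_norm_int ((n : 𝓞 F) ^ 2 - t * (n : 𝓞 F) + m)
  have h3 : (((n : 𝓞 F) ^ 2 - t * (n : 𝓞 F) + m : 𝓞 F) : F) = (n : F) ^ 2 - (t : F) * n + (m : F) := by
    simp
  rw [h3] at h2; rw [← h2]; simp

/-- The characteristic polynomial of `x` on the order is the square of the reduced one. -/
theorem IsReducedCharpoly.sq_eq [IsTotallyReal F] (h : IsOrderIn (𝓞 F) F O) {x : O}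
    {P : ℤ[X]} (hP : IsReducedCharpoly (x : ℍ[F, a, b]) P) :
    have := finite_int h.1
    (mulLeft ℤ x).charpoly = P ^ 2 := by
  have := finite_int h.1
  have : Module.Finite ℚ ℍ[F, a, b] := finite_rat_quaternion
  dsimp only
  obtain ⟨N, β, γ, hγ⟩ := exists_rat_basis h
  have h1 : (mulLeft ℤ x).charpoly.map (Int.castRingHom ℚ) =
      (mulLeft ℚ (x : ℍ[F, a, b])).charpoly := by
    rw [← LinearMap.charpoly_toMatrix _ β, ← LinearMap.charpoly_toMatrix _ γ, ← Matrix.charpoly_map]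
    congr 1
    ext i j; rw [Matrix.map_apply, LinearMap.toMatrix_apply, LinearMap.toMatrix_apply, hγ]
    have hz : ∀ z : O, γ.repr (z : ℍ[F, a, b]) i = ((β.repr z i : ℤ) : ℚ) := by
      intro z
      have hz' : (z : ℍ[F, a, b]) = ∑ j, ((β.repr z j : ℤ) : ℚ) • γ j := by
        have := congrArg (Subtype.val : O → ℍ[F, a, b]) (β.sum_repr z)
        rw [AddSubmonoidClass.coe_finsetSum] at this
        refine this.symm.trans (sum_congr rfl fun j _ => ?_)
        rw [Int.cast_smul_eq_zsmul, hγ]; rfl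
      conv_lhs => rw [hz', γ.repr_sum_self]
    exact (hz (x * β j)).symm
  apply Polynomial.map_injective (Int.castRingHom ℝ) Int.cast_injective
  refine eq_of_eval_int fun n => ?_
  rw [Polynomial.map_pow, Polynomial.eval_pow, show P.map (Int.castRingHom ℝ) = _ from hP,
    eval_reducedCharpoly]
  have h2 : (mulLeft ℤ x).charpoly.map (Int.castRingHom ℝ) =
      ((mulLeft ℚ (x : ℍ[F, a, b])).charpoly).map (algebraMap ℚ ℝ) := by
    rw [← h1, Polynomial.map_map]; congr 1
  have h3 : (mulLeft ℚ (x : ℍ[F, a, b])) =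
    (mulLeft F (x : ℍ[F, a, b])).restrictScalars ℚ := rfl
  rw [h2, show (n : ℝ) = algebraMap ℚ ℝ (n : ℚ) by simp, Polynomial.eval_map_algebraMap,
    Polynomial.aeval_algebraMap_apply, Polynomial.coe_aeval_eq_eval, h3,
    charpoly_restrictScalars_eval, eval_charpoly]
  have h4 : algebraMap F (End F ℍ[F, a, b]) (algebraMap ℚ F n) -
      mulLeft F (x : ℍ[F, a, b]) =
      mulLeft F (algebraMap F ℍ[F, a, b] (n : F) - x) := by
    ext1 v; simp [sub_mul]
  have h5 : ((algebraMap F ℍ[F, a, b] (n : F) - x) * star (algebraMap F ℍ[F, a, b] (n : F) - x)).re =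
      (n : F) ^ 2 - ((x : ℍ[F, a, b]) + star (x : ℍ[F, a, b])).re * n +
        ((x : ℍ[F, a, b]) * star (x : ℍ[F, a, b])).re := by
    simp; ring
  rw [h4, det_mulLeft_quaternion, h5, map_pow, map_pow]; rfl

end Charpoly

section Characters

variable {k E : Type*} [Field k] [CommRing E] [Algebra k E]

theorem algHom_eq_of_ker_le {χ χ' : E →ₐ[k] k} (h : ∀ x, χ x = 0 → χ' x = 0) : χ = χ' := by
  ext x
  have h1 : χ' (x - algebraMap k E (χ x)) = 0 := h _ (by simp)
  rw [map_sub, AlgHom.commutes, sub_eq_zero] at h1; exact h1.symm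

variable [Module.Finite k E]

theorem finite_algHom : Finite (E →ₐ[k] k) := by
  have : IsArtinianRing E := IsArtinianRing.of_finite k E
  have hmax : ∀ χ : E →ₐ[k] k, (ker χ).IsMaximal := fun χ =>
    RingHom.ker_isMaximal_of_surjective _ fun c => ⟨algebraMap k E c, by simp⟩
  refine Finite.of_injective (β := MaximalSpectrum E) (fun χ => ⟨ker χ, hmax χ⟩) ?_
  intro χ χ' h
  refine algHom_eq_of_ker_le fun x hx => ?_
  have h' : ker χ = ker χ' := congrArg MaximalSpectrum.asIdeal h
  exact (mem_ker (f := χ')).mp (h' ▸ (mem_ker (f := χ)).mpr hx)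

theorem isNilpotent_of_forall_algHom [IsAlgClosed k] {x : E} (h : ∀ χ : E →ₐ[k] k, χ x = 0) :
    IsNilpotent x := by
  have : IsArtinianRing E := IsArtinianRing.of_finite k E
  rw [nilpotent_iff_mem_prime]
  intro P hP
  have hb : Bijective (algebraMap k (E ⧸ P)) := IsAlgClosed.algebraMap_bijective_of_isIntegral
  let χ : E →ₐ[k] k := (AlgEquiv.ofBijective (Algebra.ofId k (E ⧸ P)) hb).symm.toAlgHom.comp
    (Ideal.Quotient.mkₐ k P)
  have := h χ
  rw [← eq_zero_iff_mem]; simpa [χ] using this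

theorem exists_idempotents [IsAlgClosed k] [Fintype (E →ₐ[k] k)] :
    ∃ ε : (E →ₐ[k] k) → E, CompleteOrthogonalIdempotents ε ∧
      (∀ χ : E →ₐ[k] k, χ (ε χ) = 1) ∧ (∀ χ χ' : E →ₐ[k] k, χ ≠ χ' → χ' (ε χ) = 0) := by
  classical
  have : IsArtinianRing E := IsArtinianRing.of_finite k E
  have hex : ∀ χ : E →ₐ[k] k, ∃ x : E, ∀ χ' : E →ₐ[k] k, χ' x = if χ' = χ then 1 else 0 := by
    intro χ
    have hco : Pairwise (Function.onFun IsCoprime fun χ : E →ₐ[k] k => ker χ) := by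
      intro χ χ' hne
      have h1 : (ker χ).IsMaximal :=
        RingHom.ker_isMaximal_of_surjective _ fun c => ⟨algebraMap k E c, by simp⟩
      have h2 : (ker χ').IsMaximal :=
        RingHom.ker_isMaximal_of_surjective _ fun c => ⟨algebraMap k E c, by simp⟩
      refine Ideal.isCoprime_of_isMaximal fun h => hne (algHom_eq_of_ker_le fun x hx => ?_)
      have h : ker χ = ker χ' := h
      exact (mem_ker (f := χ')).mp (h ▸ (mem_ker (f := χ)).mpr hx)
    obtain ⟨x, hx⟩ := Ideal.exists_forall_sub_mem_ideal hco (fun χ' => if χ' = χ then 1 else 0)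
    refine ⟨x, fun χ' => ?_⟩
    have := hx χ'
    rw [mem_ker, map_sub, sub_eq_zero] at this; rw [this]
    split_ifs <;> simp
  choose x hx using hex
  let f := mk (nilradical E)
  have hf0 : ∀ y : E, (∀ χ : E →ₐ[k] k, χ y = 0) → f y = 0 := fun y hy =>
    eq_zero_iff_mem.mpr (isNilpotent_of_forall_algHom hy)
  have hc : CompleteOrthogonalIdempotents (f ∘ x) := by
    refine ⟨⟨fun χ => ?_, fun χ χ' hne => ?_⟩, ?_⟩
    · have := hf0 (x χ * x χ - x χ) fun χ' => by rw [map_sub, map_mul, hx]; split_ifs <;> simp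
      rw [map_sub, map_mul, sub_eq_zero] at this; exact this
    · have := hf0 (x χ * x χ') fun χ'' => by
        rw [map_mul, hx, hx]
        split_ifs with h1 h2 <;> simp
        exact hne (h1.symm.trans h2)
      rw [map_mul] at this; exact this
    · have := hf0 (∑ χ, x χ - 1) fun χ'' => by
        rw [map_sub, map_sum, map_one]; simp [hx]
      rw [map_sub, map_sum, map_one, sub_eq_zero] at this; exact this
  have hker : ∀ y ∈ ker f, IsNilpotent y := fun y hy => by
    rw [mem_ker, eq_zero_iff_mem] at hy; exact hy
  obtain ⟨ε, hε, hεx⟩ := CompleteOrthogonalIdempotents.lift_of_isNilpotent_ker f hker hc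
    fun χ => ⟨x χ, rfl⟩
  have hval : ∀ χ χ' : E →ₐ[k] k, χ' (ε χ) = χ' (x χ) := by
    intro χ χ'
    have h1 : f (ε χ - x χ) = 0 := by
      rw [map_sub, sub_eq_zero]; exact congrFun hεx χ
    have h2 : IsNilpotent (ε χ - x χ) := eq_zero_iff_mem.mp h1
    have h3 := (h2.map χ').eq_zero
    rw [map_sub, sub_eq_zero] at h3; exact h3
  refine ⟨ε, hε, fun χ => by rw [hval, hx, if_pos rfl], fun χ χ' hne => ?_⟩
  rw [hval, hx, if_neg (Ne.symm hne)]

end Characters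

section IntegralCharacters

variable {k R : Type*} [Field k] [CommRing R]

/-- The `k`-linear extension of a character. -/
def charExt (j : R →+* k) : k ⊗[ℤ] R →ₐ[k] k :=
  Algebra.TensorProduct.lift (AlgHom.id k k) j.toIntAlgHom fun _ _ => Commute.all _ _

@[simp]
theorem charExt_tmul (j : R →+* k) (c : k) (x : R) : charExt j (c ⊗ₜ x) = c * j x := by
  simp [charExt]

theorem charExt_surjective (χ : k ⊗[ℤ] R →ₐ[k] k) : ∃ j : R →+* k, charExt j = χ := by
  refine ⟨(χ : k ⊗[ℤ] R →+* k).comp (includeRight : R →ₐ[ℤ] k ⊗[ℤ] R), ?_⟩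
  ext x; simp

variable [Module.Finite ℤ R]

theorem finite_characters : Finite (R →+* k) := by
  have := finite_algHom (k := k) (E := k ⊗[ℤ] R)
  refine Finite.of_injective (charExt (k := k) (R := R)) fun j j' h => ?_
  ext x
  have := congrArg (fun χ => χ (1 ⊗ₜ x)) h
  simpa using this

theorem exists_character_idempotents [IsAlgClosed k] [Fintype (R →+* k)] :
    ∃ ε : (R →+* k) → k ⊗[ℤ] R, CompleteOrthogonalIdempotents ε ∧
      (∀ j, charExt j (ε j) = 1) ∧ (∀ j, ∀ x, charExt j x = 0 → IsNilpotent (x * ε j)) := by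
  classical
  have := finite_algHom (k := k) (E := k ⊗[ℤ] R)
  have := Fintype.ofFinite (k ⊗[ℤ] R →ₐ[k] k)
  obtain ⟨ε, hε, h1, h0⟩ := exists_idempotents (k := k) (E := k ⊗[ℤ] R)
  have hinj : Injective (charExt (k := k) (R := R)) := fun j j' h => by
    ext x
    have := congrArg (fun χ => χ (1 ⊗ₜ x)) h
    simpa using this
  let e : (R →+* k) ≃ (k ⊗[ℤ] R →ₐ[k] k) := Equiv.ofBijective charExt ⟨hinj, charExt_surjective⟩
  refine ⟨fun j => ε (charExt j), ?_, fun j => h1 _, fun j x hx => ?_⟩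
  · exact (CompleteOrthogonalIdempotents.equiv e).mpr hε
  · refine isNilpotent_of_forall_algHom (k := k) fun χ => ?_
    rw [map_mul]
    by_cases h : χ = charExt j
    · rw [h, hx, zero_mul]
    · rw [h0 _ _ (Ne.symm h), mul_zero]

theorem finite_quotient_ker (p : ℕ) [Fact p.Prime] [CharP k p] (j : R →+* k) :
    Finite (R ⧸ ker j) := by
  have : Module.Finite ℤ (R ⧸ ker j) :=
    Module.Finite.of_surjective
      ((mk (ker j)).toAddMonoidHom.toIntLinearMap)
      mk_surjective
  refine Module.finite_of_fg_torsion _ fun {x} => ?_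
  refine ⟨⟨(p : ℤ), ?_⟩, ?_⟩
  · exact mem_nonZeroDivisors_of_ne_zero (by exact_mod_cast (Fact.out : p.Prime).ne_zero)
  · obtain ⟨x, rfl⟩ := mk_surjective x
    change (p : ℤ) • mk _ x = 0; rw [← map_zsmul, eq_zero_iff_mem, mem_ker, map_zsmul]; simp

theorem isMaximal_ker (p : ℕ) [Fact p.Prime] [CharP k p] (j : R →+* k) :
    (ker j).IsMaximal := by
  have := finite_quotient_ker p j
  have := RingHom.ker_isPrime j
  exact Ideal.Quotient.maximal_of_isField _ (Finite.isField_of_domain _)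

theorem exists_separating (p : ℕ) [Fact p.Prime] [CharP k p] (j : R →+* k) :
    ∃ x : R, ∀ j' : R →+* k, j' x = j x → j' = j := by
  classical
  have := finite_characters (k := k) (R := R)
  have := Fintype.ofFinite (R →+* k)
  have := finite_quotient_ker p j
  have hmax := isMaximal_ker p j
  let _ : Field (R ⧸ ker j) := Ideal.Quotient.field _
  obtain ⟨g, hg⟩ := IsCyclic.exists_generator (α := (R ⧸ ker j)ˣ)
  have hb : ∀ j' : R →+* k, ∃ b, b ∉ ker j ∧
      (ker j' ≠ ker j → b ∈ ker j') := by
    intro j'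
    by_cases h : ker j' = ker j
    · exact ⟨1, fun h1 => hmax.ne_top ((Ideal.eq_top_iff_one _).mpr h1), fun h' => absurd h h'⟩
    · have : ¬ ker j' ≤ ker j := fun hle =>
        h ((isMaximal_ker p j').eq_of_le hmax.ne_top hle)
      obtain ⟨b, hb, hb'⟩ := SetLike.not_le_iff_exists.mp this
      exact ⟨b, hb', fun _ => hb⟩
  choose b hb hb' using hb
  let B := ∏ j', b j'
  have hB : mk (ker j) B ≠ 0 := by
    rw [Ne, eq_zero_iff_mem, hmax.isPrime.prod_mem_iff]
    rintro ⟨j', -, h⟩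
    exact hb j' h
  obtain ⟨c, hc⟩ := mk_surjective ((mk (ker j) B)⁻¹ *
    (g : R ⧸ ker j))
  have hy : mk (ker j) (B * c) = g := by rw [map_mul, hc, mul_inv_cancel_left₀ hB]
  have hy0 : j (B * c) ≠ 0 := fun h => by
    have h1 : mk (ker j) (B * c) = 0 := eq_zero_iff_mem.mpr h
    rw [hy] at h1; exact g.ne_zero h1
  refine ⟨B * c, fun j' hj' => ?_⟩
  have hker : ker j' = ker j := by
    by_contra hne
    have h1 : B * c ∈ ker j' := Ideal.mul_mem_right _ _
      (Ideal.mem_of_dvd _ (Finset.dvd_prod_of_mem b (Finset.mem_univ j')) (hb' j' hne))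
    rw [mem_ker, hj'] at h1; exact hy0 h1
  ext x
  by_cases hx : mk (ker j) x = 0
  · have h1 := eq_zero_iff_mem.mp hx
    have h2 := hker ▸ h1
    rw [mem_ker] at h1 h2; rw [h1, h2]
  · have hfin : Finite (R ⧸ ker j)ˣ := inferInstance
    obtain ⟨n, hn⟩ := mem_powers_iff_mem_zpowers.mpr (hg (Units.mk0 _ hx))
    have hn : g ^ n = _ := hn
    have h1 : mk (ker j) (x - (B * c) ^ n) = 0 := by
      rw [map_sub, map_pow, hy, ← Units.val_pow_eq_pow_val, hn, Units.val_mk0, sub_self]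
    have h1 := eq_zero_iff_mem.mp h1
    have h2 := hker ▸ h1
    rw [mem_ker, map_sub, map_pow, sub_eq_zero] at h1 h2; rw [h1, h2, hj']

end IntegralCharacters

section Reduction

variable (p : ℕ) [Fact p.Prime] (k : Type*) [Field k] [CharP k p]

/-- Reduction modulo `p`. -/
def red (O : Type*) [Ring O] : O𝕎 →ₐ[ℤ] Oₖ :=
  Algebra.TensorProduct.map (algebraMap 𝕎 k).toIntAlgHom (AlgHom.id ℤ O)

variable {k}

@[simp]
theorem red_tmul {O : Type*} [Ring O] (c : 𝕎) (x : O) :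
    red p k O (c ⊗ₜ x) = algebraMap 𝕎 k c ⊗ₜ x := rfl

theorem red_smul {O : Type*} [Ring O] (c : 𝕎) (x : O𝕎) :
    red p k O (c • x) = algebraMap 𝕎 k c • red p k O x := by
  induction x with
  | zero => simp
  | tmul d x => rw [smul_tmul', red_tmul, red_tmul, smul_tmul',
      smul_eq_mul, smul_eq_mul, map_mul]
  | add x y hx hy => rw [smul_add, map_add, hx, hy, map_add, smul_add]

variable [IsAlgClosed k]

theorem red_surjective (O : Type*) [Ring O] : Surjective (red p k O) :=
  LinearMap.rTensor_surjective O (g := (algebraMap 𝕎 k).toIntAlgHom.toLinearMap)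
    (algebraMap_witt_surjective p)

theorem red_eq_zero_iff {O : Type*} [Ring O] (x : O𝕎) :
    red p k O x = 0 ↔ ∃ y, x = (p : 𝕎) • y := by
  constructor
  · intro h
    let f : 𝕎 →ₗ[ℤ] 𝕎 := mulLeft ℤ (p : 𝕎)
    let g := (algebraMap 𝕎 k).toIntAlgHom.toLinearMap
    have hex : Function.Exact f g := fun y => by
      change algebraMap _ _ y = 0 ↔ _; rw [algebraMap_witt_eq_zero_iff]
      exact ⟨fun ⟨z, hz⟩ => ⟨z, hz.symm⟩, fun ⟨z, hz⟩ => ⟨z, hz.symm⟩⟩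
    obtain ⟨y, hy⟩ := (rTensor_exact O hex (algebraMap_witt_surjective p) x).mp h
    refine ⟨y, hy.symm.trans ?_⟩
    clear hy
    induction y with
    | zero => simp
    | tmul d x => simp [f, smul_tmul']
    | add x y hx hy => rw [map_add, hx, hy, smul_add]
  · rintro ⟨y, rfl⟩
    rw [red_smul, map_natCast, cast_eq_zero, zero_smul]

theorem isTorsionFree_witt_tensor (O : Type*) [Ring O] [Free ℤ O] {x : O𝕎}
    (h : (p : 𝕎) • x = 0) : x = 0 :=
  (smul_eq_zero.mp h).resolve_left 
    (WittVector.p_nonzero p k)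

end Reduction

section WittCharacters

variable (p : ℕ) [Fact p.Prime] {k : Type*} [Field k] [CharP k p] {R : Type*} [CommRing R]

/-- The residual character of `W ⊗ R` defined by a character of `R`. -/
def wchar (j : R →+* k) : 𝕎 ⊗[ℤ] R →+* k :=
  (charExt j : k ⊗[ℤ] R →+* k).comp (red p k R : 𝕎 ⊗[ℤ] R →+* k ⊗[ℤ] R)

@[simp]
theorem wchar_tmul (j : R →+* k) (c : 𝕎) (x : R) :
    wchar p j (c ⊗ₜ x) = algebraMap 𝕎 k c * j x := by
  simp [wchar]

variable [IsAlgClosed k] [Module.Finite ℤ R]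

theorem isUnit_of_forall_algHom {E : Type*} [CommRing E] [Algebra k E] [Module.Finite k E] {x : E}
    (h : ∀ χ : E →ₐ[k] k, χ x ≠ 0) : IsUnit x := by
  by_contra hx
  obtain ⟨P, hP, hxP⟩ := exists_max_ideal_of_mem_nonunits hx
  have hb : Bijective (algebraMap k (E ⧸ P)) := IsAlgClosed.algebraMap_bijective_of_isIntegral
  let χ : E →ₐ[k] k := (AlgEquiv.ofBijective (Algebra.ofId k (E ⧸ P)) hb).symm.toAlgHom.comp
    (Ideal.Quotient.mkₐ k P)
  apply h χ
  have : Ideal.Quotient.mkₐ k P x = 0 := eq_zero_iff_mem.mpr hxP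
  simp only [χ, AlgHom.comp_apply, this, map_zero]

theorem isUnit_of_forall_charExt {x : k ⊗[ℤ] R} (h : ∀ j : R →+* k, charExt j x ≠ 0) :
    IsUnit x := by
  refine isUnit_of_forall_algHom (k := k) fun χ => ?_
  obtain ⟨j, rfl⟩ := charExt_surjective χ
  exact h j

variable [Free ℤ R]

theorem isUnit_of_forall_wchar {x : 𝕎 ⊗[ℤ] R} (h : ∀ j : R →+* k, wchar p j x ≠ 0) :
    IsUnit x := by
  obtain ⟨y, hy⟩ := (isUnit_of_forall_charExt (x := red p k R x) h).exists_right_inv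
  obtain ⟨y, rfl⟩ := red_surjective p R y
  have h1 : red p k R (x * y - 1) = 0 := by rw [map_sub, map_mul, hy, map_one, sub_self]
  obtain ⟨z, hz⟩ := (red_eq_zero_iff p _).mp h1
  have hH := henselianRing_of_finite_free p k (𝕎 ⊗[ℤ] R) inferInstance
  have h2 : IsUnit (1 + (p : 𝕎 ⊗[ℤ] R) * z) := by
    have := hH.jac (Ideal.mem_span_singleton_self (p : 𝕎 ⊗[ℤ] R))
    have := Ideal.mem_jacobson_bot.mp this z
    rwa [add_comm] at this
  have h3 : x * y = 1 + (p : 𝕎 ⊗[ℤ] R) * z := by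
    rw [sub_eq_iff_eq_add'.mp hz, cast_smul_eq_nsmul, nsmul_eq_mul]
  rw [← h3] at h2; exact isUnit_of_mul_isUnit_left h2

theorem idempotent_ext {x y : 𝕎 ⊗[ℤ] R} (hx : x * x = x) (hy : y * y = y)
    (h : ∀ j : R →+* k, wchar p j x = wchar p j y) : x = y := by
  have h1 : IsUnit (1 - (x - y) ^ 2) := isUnit_of_forall_wchar p fun j => by
    rw [map_sub, map_pow, map_sub, h, sub_self]; simp
  have h2 : (1 - (x - y) ^ 2) * (x - y) = 0 := by
    linear_combination (-(x * 1) - 1 + 3 * y) * hx + (y + 1 - 3 * x) * hy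
  rw [h1.mul_right_eq_zero] at h2; exact sub_eq_zero.mp h2

variable (k R) in
theorem exists_witt_idempotents [Fintype (R →+* k)] [DecidableEq (R →+* k)] :
    ∃ ε : (R →+* k) → 𝕎 ⊗[ℤ] R, CompleteOrthogonalIdempotents ε ∧
      (∀ j j', wchar p j (ε j') = if j = j' then 1 else 0) ∧
      (∀ j, ∀ x, charExt j x = 0 → IsNilpotent (x * red p k R (ε j))) := by
  obtain ⟨ε, hε, h1, h0⟩ := exists_character_idempotents (k := k) (R := R)
  let c := Algebra.TensorProduct.cancelBaseChange ℤ 𝕎 k k R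
  have hc : ∀ x : 𝕎 ⊗[ℤ] R, c (1 ⊗ₜ x) = red p k R x := by
    intro x
    induction x with
    | zero => simp
    | tmul d x => simp [c, smul_def]
    | add x y hx hy => rw [tmul_add, map_add, hx, hy, map_add]
  have hl : ∀ j, ∃ e : 𝕎 ⊗[ℤ] R, e * e = e ∧ red p k R e = ε j := by
    intro j
    obtain ⟨e, he, he'⟩ := exists_idempotent_lift p (𝕎 ⊗[ℤ] R) (c.symm (ε j))
      (by rw [← map_mul, (hε.idem j).eq])
    exact ⟨e, he, by rw [← hc, he', AlgEquiv.apply_symm_apply]⟩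
  choose e he hred using hl
  have h2 : ∀ j j', wchar p j (e j') = if j = j' then 1 else 0 := by
    intro j j'
    change charExt j (red p k R (e j')) = _; rw [hred]
    split_ifs with h
    · rw [← h]; exact h1 j
    · have := congrArg (charExt j) (hε.ortho h)
      simp only [map_mul, map_zero] at this; rw [h1, one_mul] at this; exact this
  have ho : ∀ j j', j ≠ j' → e j * e j' = 0 := fun j j' hne =>
    idempotent_ext p (by rw [mul_mul_mul_comm, he, he]) (mul_zero 0) fun i => by
      rw [map_mul, h2, h2, map_zero]
      split_ifs with h3 h4 <;> simp
      exact hne (h3.symm.trans h4)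
  refine ⟨e, ⟨⟨he, fun j j' hne => ho j j' hne⟩, ?_⟩, h2, fun j x hx => by rw [hred]; exact h0 j x hx⟩
  refine idempotent_ext p ?_ (mul_one 1) fun j => by rw [map_sum, map_one]; simp [h2]
  rw [Finset.sum_mul]
  refine sum_congr rfl fun j _ => ?_
  rw [Finset.mul_sum, sum_eq_single j (fun j' _ h => ho j j' (Ne.symm h)) (by simp), he]

theorem exists_mul_eq_idempotent {ε : 𝕎 ⊗[ℤ] R} (hε : ε * ε = ε) {j : R →+* k}
    (hj : ∀ j' ≠ j, wchar p j' ε = 0) {x : 𝕎 ⊗[ℤ] R} (hx : wchar p j x ≠ 0) :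
    ∃ y, y * x * ε = ε := by
  have hu : IsUnit (x * ε + (1 - ε)) := isUnit_of_forall_wchar p fun j' => by
    rw [map_add, map_mul, map_sub, map_one]
    by_cases h : j' = j
    · subst h
      have h1 : wchar p j' ε * wchar p j' ε = wchar p j' ε := by rw [← map_mul, hε]
      rcases eq_or_ne (wchar p j' ε) 0 with h0 | h0
      · rw [h0]; simp
      · rw [mul_eq_left₀ h0] at h1; rw [h1]; simpa using hx
    · rw [hj j' h]; simp
  obtain ⟨y, hy⟩ := hu.exists_left_inv
  refine ⟨y, ?_⟩
  have := congrArg (· * ε) hy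
  simp only [one_mul] at this; linear_combination this + (y - y * x) * hε

end WittCharacters

/-! ### Modules over `k[T]/(T^e)` with a symmetric form -/

section Nilpotent

open Polynomial

variable {k P : Type*} [Field k] [AddCommGroup P] [Module k P] {T : End k P} {e : ℕ}

theorem eq_top_of_nilpotent (hT : T ^ e = 0) (U : Submodule k P) (hU : ∀ u ∈ U, T u ∈ U)
    (h : ∀ v, ∃ u ∈ U, ∃ w, v = u + T w) : U = ⊤ := by
  have key : ∀ n : ℕ, ∀ v, ∃ u ∈ U, ∃ w, v = u + (T ^ n) w := by
    intro n
    induction n with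
    | zero => exact fun v => ⟨0, U.zero_mem, v, by simp⟩
    | succ n ih =>
      intro v
      obtain ⟨u, hu, w, rfl⟩ := ih v
      obtain ⟨u', hu', w', rfl⟩ := h w
      have : ∀ m : ℕ, (T ^ m) u' ∈ U := fun m => by
        induction m with
        | zero => simpa using hu'
        | succ m ihm => rw [pow_succ', End.mul_apply]; exact hU _ ihm
      refine ⟨u + (T ^ n) u', U.add_mem hu (this n), w', ?_⟩
      rw [map_add, pow_succ, End.mul_apply, add_assoc]
  rw [eq_top_iff]
  rintro v -
  obtain ⟨u, hu, w, rfl⟩ := key e v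
  simpa [hT] using hu

theorem aeval_mem {U : Submodule k P} (hU : ∀ u ∈ U, T u ∈ U) (f : k[X]) {u : P} (hu : u ∈ U) :
    aeval T f u ∈ U := by
  induction f using Polynomial.induction_on' with
  | add p q hp hq => rw [map_add, LinearMap.add_apply]; exact U.add_mem hp hq
  | monomial n c =>
    rw [aeval_monomial, End.mul_apply, Module.algebraMap_end_apply]
    refine U.smul_mem _ ?_
    induction n with
    | zero => simpa using hu
    | succ m ihm => rw [pow_succ', End.mul_apply]; exact hU _ ihm

theorem aeval_eq_coeff_add (f : k[X]) (x : P) : ∃ w, aeval T f x = f.coeff 0 • x + T w := by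
  refine ⟨aeval T f.divX x, ?_⟩
  conv_lhs => rw [← divX_mul_X_add f]
  rw [map_add, mul_comm, map_mul, aeval_X, aeval_C, LinearMap.add_apply, End.mul_apply,
    Module.algebraMap_end_apply, add_comm]

/-- `x` and `y` generate `P` over `k[T]`. -/
def Generate (T : End k P) (x y : P) : Prop := ∀ v, ∃ f g : k[X], v = aeval T f x + aeval T g y

variable (T) in
/-- The `k[T]`-submodule generated by two elements. -/
def genSub (x y : P) : Submodule k P :=
  range (((toSpanSingleton (End k P) P x).restrictScalars k ∘ₗ
    (aeval T).toLinearMap).coprod ((toSpanSingleton (End k P) P y).restrictScalars k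
    ∘ₗ (aeval T).toLinearMap))

theorem mem_genSub {x y v : P} : v ∈ genSub T x y ↔ ∃ f g : k[X], aeval T f x + aeval T g y = v := by
  simp [genSub]

theorem genSub_stable (x y : P) : ∀ u ∈ genSub T x y, T u ∈ genSub T x y := by
  intro u hu
  obtain ⟨f, g, rfl⟩ := mem_genSub.mp hu
  exact mem_genSub.mpr ⟨X * f, X * g, by simp⟩

theorem left_mem_genSub (x y : P) : x ∈ genSub T x y := mem_genSub.mpr ⟨1, 0, by simp⟩

theorem right_mem_genSub (x y : P) : y ∈ genSub T x y := mem_genSub.mpr ⟨0, 1, by simp⟩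

theorem generate_of_mod (hT : T ^ e = 0) {x y : P}
    (h : ∀ v, ∃ u ∈ genSub T x y, ∃ w, v = u + T w) : Generate T x y := by
  have := eq_top_of_nilpotent hT (genSub T x y) (genSub_stable x y) h
  intro v
  obtain ⟨f, g, h⟩ := mem_genSub.mp (this ▸ mem_top : v ∈ genSub T x y)
  exact ⟨f, g, h.symm⟩

theorem Generate.symm {x y : P} (h : Generate T x y) : Generate T y x := fun v => by
  obtain ⟨f, g, h⟩ := h v
  exact ⟨g, f, by rw [h, add_comm]⟩

theorem Generate.exists_coeff {x y : P} (h : Generate T x y) (v : P) :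
    ∃ c d : k, ∃ w, v = c • x + d • y + T w := by
  obtain ⟨f, g, hv⟩ := h v
  obtain ⟨w, hw⟩ := aeval_eq_coeff_add (T := T) f x
  obtain ⟨w', hw'⟩ := aeval_eq_coeff_add (T := T) g y
  refine ⟨f.coeff 0, g.coeff 0, w + w', ?_⟩
  rw [hv, hw, hw', map_add]; abel

theorem Generate.replace (hT : T ^ e = 0) {x y z : P} (h : Generate T x y) {c d : k} {w : P}
    (hz : z = c • x + d • y + T w) (hd : d ≠ 0) : Generate T x z := by
  refine generate_of_mod hT fun v => ?_
  obtain ⟨a, b, w', hv⟩ := h.exists_coeff v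
  refine ⟨(a - b * d⁻¹ * c) • x + (b * d⁻¹) • z, Submodule.add_mem _
    (Submodule.smul_mem _ _ (left_mem_genSub _ _)) (Submodule.smul_mem _ _ (right_mem_genSub _ _)),
    w' - (b * d⁻¹) • w, ?_⟩
  rw [hv, hz, map_sub, map_smul]
  simp only [smul_add, smul_smul, sub_smul, inv_mul_cancel_right₀ hd, mul_assoc]; abel

theorem Generate.exists_of_notMem (hT : T ^ e = 0) {x₀ y₀ x : P} (h : Generate T x₀ y₀)
    (hx : ∀ w, x ≠ T w) : ∃ y, Generate T x y := by
  obtain ⟨c, d, w, hw⟩ := h.exists_coeff x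
  by_cases hd : d = 0
  · have hc : c ≠ 0 := by
      rintro rfl
      exact hx w (by simpa [hd] using hw)
    exact ⟨y₀, (h.symm.replace hT (z := x) (c := d) (d := c) (w := w)
      (by rw [hw]; abel) hc).symm⟩
  · exact ⟨x₀, (h.replace hT hw hd).symm⟩

theorem exists_mul_eq_one_of_coeff (hT : T ^ e = 0) {f : k[X]} (hf : f.coeff 0 ≠ 0) :
    ∃ g : k[X], ∀ x, aeval T g (aeval T f x) = x := by
  have hco : IsCoprime f (X ^ e) := by
    refine IsCoprime.pow_right ((Polynomial.irreducible_X.coprime_iff_not_dvd.mpr ?_).symm)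
    rwa [X_dvd_iff]
  obtain ⟨g, q, h⟩ := hco
  refine ⟨g, fun x => ?_⟩
  have := congrArg (fun q => aeval T q x) h
  simpa [hT, End.mul_apply] using this

theorem exists_eq_X_pow_mul {f : k[X]} (hf : f ≠ 0) : ∃ r g, f = X ^ r * g ∧ g.coeff 0 ≠ 0 := by
  obtain ⟨g, hg, h⟩ := Polynomial.exists_eq_pow_rootMultiplicity_mul_and_not_dvd f hf 0
  refine ⟨_, g, by simpa using hg, fun h0 => h ?_⟩
  simpa [X_dvd_iff] using h0

variable {φ : BilinForm k P}

theorem aeval_adjoint (hadj : ∀ x y, φ (T x) y = φ x (T y)) (f : k[X]) (x y : P) :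
    φ (aeval T f x) y = φ x (aeval T f y) := by
  induction f using Polynomial.induction_on' with
  | add p q hp hq => simp only [map_add, LinearMap.add_apply, hp, hq]
  | monomial n c =>
    have hn : ∀ n : ℕ, ∀ x y, φ ((T ^ n) x) y = φ x ((T ^ n) y) := by
      intro n
      induction n with
      | zero => simp
      | succ n ih => intro x y; rw [pow_succ, End.mul_apply, ih, hadj, ← End.mul_apply,
          ← pow_succ', ← pow_succ]
    simp only [aeval_monomial, End.mul_apply, Module.algebraMap_end_apply, map_smul,
      LinearMap.smul_apply, hn]

theorem pow_adjoint (hadj : ∀ x y, φ (T x) y = φ x (T y)) (n : ℕ) (x y : P) :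
    φ ((T ^ n) x) y = φ x ((T ^ n) y) := by
  simpa using aeval_adjoint hadj (X ^ n) x y

theorem pow_aeval (n : ℕ) (f : k[X]) (x : P) : (T ^ n) (aeval T f x) = aeval T f ((T ^ n) x) := by
  rw [← End.mul_apply, ← End.mul_apply, ← aeval_X_pow (R := k) T, ← map_mul,
    ← map_mul, mul_comm]

/-- Self-orthogonal submodules of a module of rank two over `k[T]/(T^e)`. -/
theorem exists_of_lagrangian [Nontrivial P] (hT : T ^ e = 0)
    (hex : ∀ n ≤ e, ∀ x, (T ^ n) x = 0 → ∃ y, x = (T ^ (e - n)) y)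
    {x₀ y₀ : P} (hgen : Generate T x₀ y₀) (hadj : ∀ x y, φ (T x) y = φ x (T y))
    (hnd : ∀ x, (∀ y, φ x y = 0) → x = 0)
    (S : Submodule k P) (hS : ∀ u ∈ S, T u ∈ S) (hSS : ∀ x, x ∈ S ↔ ∀ y ∈ S, φ x y = 0) :
    ∃ a x y, 2 * a ≤ e ∧ Generate T x y ∧ (T ^ a) x ∈ S ∧ (∀ w, (T ^ (e - a)) w ∈ S) ∧
      ∀ v ∈ S, ∃ (f : k[X]) (w : P), v = aeval T f ((T ^ a) x) + (T ^ (e - a)) w := by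
  classical
  let p : ℕ → Prop := fun a => ∀ v ∈ S, ∃ v', v = (T ^ a) v'
  have hp0 : p 0 := fun v _ => ⟨v, by simp⟩
  let a := Nat.findGreatest p e
  have hpa : p a := Nat.findGreatest_spec (Nat.zero_le e) hp0
  have hae : a ≤ e := Nat.findGreatest_le e
  have hlt : a < e := by
    refine lt_of_le_of_ne hae fun h => ?_
    have hS0 : ∀ v ∈ S, v = 0 := fun v hv => by
      obtain ⟨v', rfl⟩ := hpa v hv
      rw [h, hT, LinearMap.zero_apply]
    obtain ⟨x, hx⟩ := exists_ne (0 : P)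
    exact hx (hS0 x ((hSS x).mpr fun y hy => by rw [hS0 y hy, map_zero]))
  have hnp : ¬ p (a + 1) := Nat.findGreatest_is_greatest (Nat.lt_succ_self _) hlt
  simp only [p, not_forall, not_exists] at hnp
  obtain ⟨s, hs, hsn⟩ := hnp
  obtain ⟨x, rfl⟩ := hpa s hs
  have hx : ∀ w, x ≠ T w := by
    rintro w rfl
    apply hsn w; rw [pow_succ, End.mul_apply]
  obtain ⟨y, hy⟩ := hgen.exists_of_notMem hT hx
  have hlow : ∀ w, (T ^ (e - a)) w ∈ S := fun w => (hSS _).mpr fun v hv => by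
    obtain ⟨v', rfl⟩ := hpa v hv
    rw [pow_adjoint hadj, ← End.mul_apply, ← pow_add, Nat.sub_add_cancel hae, hT]; simp
  have h2a : 2 * a ≤ e := by
    by_contra hcon
    obtain ⟨x', hx'⟩ := hpa _ (hlow x)
    obtain ⟨z, hz⟩ := hex (e - a) (Nat.sub_le _ _) (x - (T ^ (2 * a - e)) x') (by
      rw [map_sub, ← End.mul_apply (T ^ (e - a)) (T ^ (2 * a - e)), ← pow_add,
        show e - a + (2 * a - e) = a by omega, hx', sub_self])
    apply hx ((T ^ (2 * a - e - 1)) x' + (T ^ (e - (e - a) - 1)) z)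
    rw [map_add, ← End.mul_apply, ← End.mul_apply, ← pow_succ', ← pow_succ',
      show 2 * a - e - 1 + 1 = 2 * a - e by omega, show e - (e - a) - 1 + 1 = e - (e - a) by omega,
      ← hz]
    abel
  refine ⟨a, x, y, h2a, hy, hs, hlow, fun v hv => ?_⟩
  obtain ⟨v', hv'⟩ := hpa v hv
  obtain ⟨f, g, hfg⟩ := hy v'
  by_cases hg : g = 0
  · exact ⟨f, 0, by rw [hv', hfg, hg, map_zero, LinearMap.zero_apply, add_zero, pow_aeval]; simp⟩
  obtain ⟨r, u, hgu, hu⟩ := exists_eq_X_pow_mul hg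
  obtain ⟨u', hu'⟩ := exists_mul_eq_one_of_coeff hT hu
  have e1 : v = aeval T f ((T ^ a) x) + aeval T u ((T ^ (a + r)) y) := by
    rw [hv', hfg, map_add, pow_aeval, pow_aeval, hgu, mul_comm, map_mul, End.mul_apply,
      aeval_X_pow, ← End.mul_apply (T ^ r), ← pow_add, add_comm r]
  have h1 : aeval T u ((T ^ (a + r)) y) ∈ S := by
    have := S.sub_mem hv (aeval_mem hS f hs)
    rwa [e1, add_sub_cancel_left] at this
  have h2 : (T ^ (a + r)) y ∈ S := by
    have := aeval_mem hS u' h1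
    rwa [hu'] at this
  have h3 : (T ^ (2 * a + r)) x = 0 := hnd _ fun q => by
    obtain ⟨c, d, rfl⟩ := hy q
    rw [map_add]
    have t1 : φ ((T ^ (2 * a + r)) x) (aeval T c x) = 0 := by
      rw [show 2 * a + r = (a + r) + a by ring, pow_add, End.mul_apply, pow_adjoint hadj,
        pow_aeval, add_comm a r, pow_add, End.mul_apply]
      refine (hSS _).mp hs _ (aeval_mem hS c ?_)
      simpa using aeval_mem hS (X ^ r) hs
    have t2 : φ ((T ^ (2 * a + r)) x) (aeval T d y) = 0 := by
      rw [show 2 * a + r = (a + r) + a by ring, pow_add, End.mul_apply, pow_adjoint hadj,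
        pow_aeval]
      exact (hSS _).mp hs _ (aeval_mem hS d h2)
    rw [t1, t2, add_zero]
  have h4 : e - a ≤ a + r := by
    by_contra hcon
    obtain ⟨z, hz⟩ := hex (2 * a + r) (by omega) x h3
    apply hx ((T ^ (e - (2 * a + r) - 1)) z)
    rw [← End.mul_apply, ← pow_succ', show e - (2 * a + r) - 1 + 1 = e - (2 * a + r) by omega]
    exact hz
  refine ⟨f, (T ^ (a + r - (e - a))) (aeval T u y), ?_⟩
  rw [← End.mul_apply (T ^ (e - a)), ← pow_add, Nat.add_sub_cancel' h4, pow_aeval]; exact e1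

/-- A symmetric perfect form on a module of rank two over `k[T]/(T^e)` has a primitive isotropic
vector. -/
theorem exists_isotropic [IsAlgClosed k] [FiniteDimensional k P] (h2 : (2 : k) ≠ 0) (he : 0 < e)
    (hT : T ^ e = 0) (hex : ∀ n ≤ e, ∀ x, (T ^ n) x = 0 → ∃ y, x = (T ^ (e - n)) y)
    {x₀ y₀ : P} (hgen : Generate T x₀ y₀) (hdim : finrank k P = 2 * e)
    (hadj : ∀ x y, φ (T x) y = φ x (T y)) (hsymm : ∀ x y, φ x y = φ y x)
    (hnd : ∀ x, (∀ y, φ x y = 0) → x = 0) :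
    ∃ x y, Generate T x y ∧ ∀ f : k[X], φ x (aeval T f x) = 0 := by
  let C := k[X] ⧸ Ideal.span {(X : k[X]) ^ e}
  have hfin : Module.Finite k C := (Polynomial.monic_X_pow e).finite_quotient
  have hdimC : finrank k C = e := by rw [finrank_quotient_span_eq_natDegree, natDegree_X_pow]
  let ev : C →ₐ[k] End k P := Ideal.Quotient.liftₐ _ (aeval T) fun f hf => by
    obtain ⟨g, rfl⟩ := Ideal.mem_span_singleton.mp hf
    rw [map_mul, aeval_X_pow, hT, zero_mul]
  have ev_mk : ∀ f : k[X], ev (mk _ f) = aeval T f := fun f => rfl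
  have evadj : ∀ (c : C) x y, φ (ev c x) y = φ x (ev c y) := by
    intro c x y
    obtain ⟨f, rfl⟩ := mk_surjective c
    exact aeval_adjoint hadj f x y
  let ξ : C := mk _ (X ^ (e - 1))
  have evξ : ev ξ = T ^ (e - 1) := by rw [ev_mk, aeval_X_pow]
  have hTe : ∀ w, (T ^ (e - 1)) (T w) = 0 := fun w => by
    rw [← End.mul_apply, ← pow_succ, Nat.sub_add_cancel he, hT, LinearMap.zero_apply]
  have hrange : ∀ x, (T ^ (e - 1)) x = 0 → ∃ w, x = T w := fun x hx => by
    obtain ⟨y, hy⟩ := hex (e - 1) (Nat.sub_le _ _) x hx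
    rw [show e - (e - 1) = 1 by omega, pow_one] at hy
    exact ⟨y, hy⟩
  have hpos : 0 < finrank k P := by omega
  obtain ⟨u, hu⟩ : ∃ u, φ u ((T ^ (e - 1)) u) ≠ 0 := by
    by_contra! hcon
    have hb : ∀ x y, φ x ((T ^ (e - 1)) y) = 0 := fun x y => by
      have h := hcon (x + y)
      simp only [map_add, LinearMap.add_apply, hcon, zero_add, add_zero] at h
      rw [hsymm y, pow_adjoint hadj, ← two_mul] at h; exact (mul_eq_zero.mp h).resolve_left h2
    have hall : ∀ y, ∃ w, y = T w := fun y => hrange y (hnd _ fun x => by rw [hsymm]; exact hb x y)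
    have htop := eq_top_of_nilpotent hT (⊥ : Submodule k P) (by simp)
      fun v => ⟨0, zero_mem _, by simpa using hall v⟩
    rw [← finrank_top k P, ← htop, finrank_bot] at hpos; exact lt_irrefl _ hpos
  have hur : ∀ w, u ≠ T w := by
    rintro w rfl
    exact hu (by rw [hTe, map_zero])
  obtain ⟨y, huy⟩ := hgen.exists_of_notMem hT hur
  -- the functionals `c ↦ φ (u, c r u)`
  let Ψ : C →ₗ[k] Module.Dual k C := LinearMap.mk₂ k (fun r c => φ u (ev (c * r) u))
    (fun r r' c => by simp [mul_add]) (fun a r c => by simp) (fun r c c' => by simp [add_mul])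
    (fun a r c => by simp)
  have hΨ : ∀ r c, Ψ r c = φ u (ev (c * r) u) := fun _ _ => rfl
  have hΨinj : Injective Ψ := by
    rw [injective_iff_map_eq_zero]
    intro r hr
    obtain ⟨f, rfl⟩ := mk_surjective r
    by_contra hne
    have hf0 : f ≠ 0 := by rintro rfl; exact hne (map_zero _)
    obtain ⟨n, g, rfl, hg⟩ := exists_eq_X_pow_mul hf0
    have hn : n < e := by
      by_contra hcon
      exact hne (eq_zero_iff_mem.mpr (Ideal.mem_span_singleton.mpr
        (dvd_mul_of_dvd_left (pow_dvd_pow _ (not_lt.mp hcon)) g)))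
    obtain ⟨q, hq⟩ := exists_mul_eq_one_of_coeff hT hg
    apply hu
    have := LinearMap.congr_fun hr (mk _ (X ^ (e - 1 - n) * q))
    rw [hΨ, ← map_mul, ev_mk, LinearMap.zero_apply] at this
    rw [← this, show X ^ (e - 1 - n) * q * (X ^ n * g) = X ^ (e - 1 - n + n) * (q * g) by ring,
      Nat.sub_add_cancel (by omega), map_mul, map_mul, End.mul_apply, End.mul_apply,
      hq, aeval_X_pow]
  have hΨsurj : Surjective Ψ :=
    (injective_iff_surjective_of_finrank_eq_finrank
      (Subspace.dual_finrank_eq (K := k) (V := C)).symm).mp hΨinj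
  have hproj : ∀ q q' : P, ∃ r : C, ∀ c, φ u (ev (c * r) u) = φ q (ev c q') := by
    intro q q'
    obtain ⟨r, hr⟩ := hΨsurj
      ((φ q).comp ((toSpanSingleton (End k P) P q').restrictScalars k ∘ₗ
        ev.toLinearMap))
    exact ⟨r, fun c => by rw [← hΨ, hr]; rfl⟩
  obtain ⟨r, hr⟩ := hproj y u
  let v := y - ev r u
  have hvu : ∀ c, φ v (ev c u) = 0 := fun c => by
    rw [map_sub, LinearMap.sub_apply, ← hr, evadj, ← End.mul_apply, ← map_mul, mul_comm r c,
      sub_self]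
  have hyv : y = v + ev r u := by simp [v]
  have huv : Generate T u v := by
    intro q
    obtain ⟨f, g, rfl⟩ := huy q
    obtain ⟨r', hr'⟩ := mk_surjective r
    refine ⟨f + g * r', g, ?_⟩
    rw [hyv, ← hr', ev_mk, map_add, map_add, map_mul, LinearMap.add_apply, End.mul_apply]; abel
  have hvr : ∀ c w, v ≠ ev c u + T w := by
    intro c w hcw
    have htop : genSub T u 0 = ⊤ := eq_top_of_nilpotent hT _ (genSub_stable _ _) fun q => by
      obtain ⟨a, b, w', hq⟩ := huv.exists_coeff q
      obtain ⟨f, rfl⟩ := mk_surjective c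
      refine ⟨aeval T (Polynomial.C a + Polynomial.C b * f) u, mem_genSub.mpr ⟨Polynomial.C a + Polynomial.C b * f, 0, by simp⟩, b • w + w', ?_⟩
      rw [hq, hcw, ev_mk]
      simp only [map_add, map_mul, aeval_C, LinearMap.add_apply, End.mul_apply,
        Module.algebraMap_end_apply, map_smul, smul_add]
      abel
    have hsurj : Surjective (((toSpanSingleton (End k P) P u).restrictScalars k) ∘ₗ ev.toLinearMap) := by
      intro q
      obtain ⟨f, g, h⟩ := mem_genSub.mp (htop ▸ mem_top : q ∈ genSub T u 0)
      exact ⟨mk _ f, by rw [← h, map_zero, add_zero]; rfl⟩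
    have := LinearMap.finrank_le_finrank_of_surjective hsurj
    omega
  have hvv : φ v ((T ^ (e - 1)) v) ≠ 0 := by
    intro h0
    have h1 : (T ^ (e - 1)) v = 0 := hnd _ fun q => by
      obtain ⟨f, g, rfl⟩ := huv q
      obtain ⟨w, hw⟩ := aeval_eq_coeff_add (T := T) g v
      have h3 : φ ((T ^ (e - 1)) v) (aeval T f u) = 0 := by
        rw [pow_adjoint hadj, ← evξ, ← ev_mk, ← End.mul_apply, ← map_mul]; exact hvu _
      rw [map_add, h3, hw, map_add, map_smul, hsymm _ v, h0, pow_adjoint hadj, hTe]; simp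
    obtain ⟨w, hw⟩ := hrange v h1
    exact hvr 0 w (by rw [map_zero, LinearMap.zero_apply, zero_add]; exact hw)
  obtain ⟨ρ, hρ⟩ := hproj v v
  have hρu : IsUnit (-ρ) := by
    obtain ⟨f, hf⟩ := mk_surjective ρ
    have hf0 : f.coeff 0 ≠ 0 := by
      intro h0
      apply hvv
      have := hρ ξ
      rw [evξ] at this; rw [← this, map_mul, evξ, ← hf, ev_mk, End.mul_apply]
      obtain ⟨w, hw⟩ := aeval_eq_coeff_add (T := T) f u
      rw [hw, h0, zero_smul, zero_add, hTe, map_zero]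
    have hco : IsCoprime f (X ^ e) := by
      refine IsCoprime.pow_right ((Polynomial.irreducible_X.coprime_iff_not_dvd.mpr ?_).symm)
      rwa [X_dvd_iff]
    obtain ⟨g, q, h⟩ := hco
    refine IsUnit.neg (IsUnit.of_mul_eq_one (mk _ g) ?_)
    rw [← hf, mul_comm, ← map_mul, ← map_one (Ideal.Quotient.mk _), Ideal.Quotient.eq, ← h]
    exact Ideal.mem_span_singleton.mpr ⟨-q, by ring⟩
  obtain ⟨τ, hτ⟩ := exists_sq_eq_of_isUnit h2 hρu
  have hxr : ∀ w, ev τ u + v ≠ T w := fun w hw => hvr (-τ) w (by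
    rw [map_neg, LinearMap.neg_apply, ← hw]; abel)
  obtain ⟨y', hy'⟩ := hgen.exists_of_notMem hT hxr
  refine ⟨_, y', hy', fun f => ?_⟩
  rw [← ev_mk]
  set c := mk (Ideal.span {(X : k[X]) ^ e}) f
  have t1 : φ (ev τ u) (ev c (ev τ u)) = φ u (ev (c * (τ * τ)) u) := by
    rw [evadj, ← End.mul_apply, ← End.mul_apply, ← map_mul, ← map_mul]
    congr 3; ring
  have t2 : φ v (ev c (ev τ u)) = 0 := by rw [← End.mul_apply, ← map_mul]; exact hvu _
  have t3 : φ (ev τ u) (ev c v) = 0 := by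
    rw [← evadj, hsymm, ← End.mul_apply, ← map_mul]; exact hvu _
  simp only [map_add, LinearMap.add_apply, t1, t2, t3, ← hρ c, add_zero, zero_add]
  have hz : c * (τ * τ) = -(c * ρ) := by rw [hτ]; ring
  rw [hz, map_neg, LinearMap.neg_apply, map_neg, neg_add_cancel]

/-! ### The modules `LieModel` -/

section LieModel

variable {Q : Type*} [AddCommGroup Q] [Module k Q]

/-- The module with operator `(Q, T)` is isomorphic to `LieModel k e`. -/
def IsLieModel (T : End k Q) (e : ℕ × ℕ) : Prop :=
  ∃ φ : Q ≃ₗ[k] LieModel k e, ∀ y, φ.symm ((X : k[X]) • φ y) = T y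

theorem aeval_eq_of_mk_eq {T : End k Q} {n : ℕ} {g : Q} (hg : (T ^ n) g = 0) {f f' : k[X]}
    (h : mk (Ideal.span {(X : k[X]) ^ n}) f = mk _ f') :
    aeval T f g = aeval T f' g := by
  obtain ⟨q, hq⟩ := Ideal.mem_span_singleton.mp (Ideal.Quotient.eq.mp h)
  have := congrArg (fun q => aeval T q g) hq
  simp only [map_sub, LinearMap.sub_apply, mul_comm _ q, map_mul, End.mul_apply, aeval_X_pow,
    hg, map_zero] at this
  exact sub_eq_zero.mp this

/-- The linear map `f ↦ f(T) g` on `k[X]/(X^n)`. -/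
def evalQuot (T : End k Q) {n : ℕ} {g : Q} (hg : (T ^ n) g = 0) :
    (k[X] ⧸ Ideal.span {(X : k[X]) ^ n}) →ₗ[k] Q where
  toFun c := aeval T (Function.surjInv mk_surjective c) g
  map_add' c d := by
    rw [← LinearMap.add_apply, ← map_add]
    apply aeval_eq_of_mk_eq hg
    exact (Function.surjInv_eq mk_surjective (c + d)).trans (congrArg₂ (· + ·)
      (Function.surjInv_eq mk_surjective c).symm
      (Function.surjInv_eq mk_surjective d).symm)
  map_smul' a c := by
    rw [RingHom.id_apply, ← LinearMap.smul_apply, ← map_smul]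
    apply aeval_eq_of_mk_eq hg
    exact (Function.surjInv_eq mk_surjective (a • c)).trans (congrArg (a • ·)
      (Function.surjInv_eq mk_surjective c).symm)

theorem evalQuot_mk (T : End k Q) {n : ℕ} {g : Q} (hg : (T ^ n) g = 0) (f : k[X]) :
    evalQuot T hg (mk _ f) = aeval T f g :=
  aeval_eq_of_mk_eq hg (Function.surjInv_eq _ _)

theorem evalQuot_X_smul (T : End k Q) {n : ℕ} {g : Q} (hg : (T ^ n) g = 0)
    (c : k[X] ⧸ Ideal.span {(X : k[X]) ^ n}) :
    evalQuot T hg ((X : k[X]) • c) = T (evalQuot T hg c) := by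
  obtain ⟨f, rfl⟩ := mk_surjective c
  have : (X : k[X]) • mk (Ideal.span {(X : k[X]) ^ n}) f =
    Ideal.Quotient.mk _ (X * f) := rfl
  rw [this, evalQuot_mk, evalQuot_mk, map_mul, aeval_X, End.mul_apply]

instance finite_quotient_X_pow (n : ℕ) : Module.Finite k (k[X] ⧸ Ideal.span {(X : k[X]) ^ n}) :=
  (Polynomial.monic_X_pow n).finite_quotient

theorem finrank_lieModel (e : ℕ × ℕ) : finrank k (LieModel k e) = 2 * (e.1 + e.2) := by
  rw [Module.finrank_prod, Module.finrank_pi_fintype, Module.finrank_pi_fintype]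
  simp only [finrank_quotient_span_eq_natDegree, natDegree_X_pow, Finset.sum_const,
    Finset.card_univ, Fintype.card_fin, smul_eq_mul]
  ring

theorem isLieModel_of_generators [FiniteDimensional k Q] {T : End k Q} {e : ℕ × ℕ}
    {g h : Fin 2 → Q} (hg : ∀ j, (T ^ e.1) (g j) = 0) (hh : ∀ j, (T ^ e.2) (h j) = 0)
    (hgen : ∀ v, ∃ f f' : Fin 2 → k[X], v = ∑ j, aeval T (f j) (g j) + ∑ j, aeval T (f' j) (h j))
    (hdim : finrank k Q = 2 * (e.1 + e.2)) : IsLieModel T e := by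
  let Ψ : LieModel k e →ₗ[k] Q :=
    (LinearMap.lsum k _ k fun j => evalQuot T (hg j)).coprod
      (LinearMap.lsum k _ k fun j => evalQuot T (hh j))
  have hΨ : ∀ z, Ψ z = ∑ j, evalQuot T (hg j) (z.1 j) + ∑ j, evalQuot T (hh j) (z.2 j) := by
    intro z
    simp [Ψ]
  have hsurj : Surjective Ψ := by
    intro v
    obtain ⟨f, f', hv⟩ := hgen v
    refine ⟨(fun j => mk _ (f j), fun j => mk _ (f' j)), ?_⟩
    rw [hΨ, hv]; simp only [evalQuot_mk]
  have hinj : Injective Ψ :=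
    (injective_iff_surjective_of_finrank_eq_finrank
      ((finrank_lieModel e).trans hdim.symm)).mpr hsurj
  have hbij : Bijective Ψ := ⟨hinj, hsurj⟩
  refine ⟨(ofBijective Ψ hbij).symm, fun y => ?_⟩
  obtain ⟨z, rfl⟩ := hsurj y
  have h1 : (ofBijective Ψ hbij).symm (Ψ z) = z := (ofBijective Ψ hbij).symm_apply_apply z
  rw [h1, LinearEquiv.symm_symm]
  change Ψ ((X : k[X]) • z) = T (Ψ z); rw [hΨ, hΨ, map_add, map_sum, map_sum]
  simp only [Prod.smul_fst, Prod.smul_snd, Pi.smul_apply, evalQuot_X_smul]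

theorem IsLieModel.finrank_eq {T : End k Q} {e : ℕ × ℕ} (h : IsLieModel T e) :
    finrank k Q = 2 * (e.1 + e.2) := by
  obtain ⟨φ, -⟩ := h
  rw [φ.finrank_eq, finrank_lieModel]

theorem IsLieModel.pow_eq_zero_iff {T : End k Q} {e : ℕ × ℕ} (h : IsLieModel T e)
    (he : e.1 ≤ e.2) (n : ℕ) : T ^ n = 0 ↔ e.2 ≤ n := by
  obtain ⟨φ, hφ⟩ := h
  have hX : ∀ n y, φ ((T ^ n) y) = (X : k[X]) ^ n • φ y := by
    intro n
    induction n with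
    | zero => simp
    | succ n ih =>
      intro y
      rw [pow_succ', End.mul_apply, ← hφ, apply_symm_apply, ih, smul_smul,
        ← pow_succ']
  have hmk : ∀ (m : ℕ) (f : k[X]), (X : k[X]) ^ n • mk (Ideal.span {(X : k[X]) ^ m}) f
      = Ideal.Quotient.mk _ (X ^ n * f) := fun _ _ => rfl
  constructor
  · intro h0
    have h1 : (X : k[X]) ^ n • (φ (φ.symm (0, fun _ => mk _ 1))) = 0 := by
      rw [← hX, h0, LinearMap.zero_apply, map_zero]
    rw [apply_symm_apply] at h1
    have h2 := congrFun (congrArg Prod.snd h1) 0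
    simp only [Prod.smul_snd, Pi.smul_apply, hmk, mul_one, Prod.snd_zero, Pi.zero_apply] at h2
    rw [eq_zero_iff_mem, Ideal.mem_span_singleton] at h2
    exact (pow_dvd_pow_iff X_ne_zero not_isUnit_X).mp h2
  · intro hn
    refine LinearMap.ext fun y => φ.injective ?_
    rw [hX, LinearMap.zero_apply, map_zero]
    have hz : ∀ (m : ℕ), m ≤ n → ∀ c : k[X] ⧸ Ideal.span {(X : k[X]) ^ m}, (X : k[X]) ^ n • c = 0 := by
      intro m hm c
      obtain ⟨f, rfl⟩ := mk_surjective c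
      rw [hmk, eq_zero_iff_mem, Ideal.mem_span_singleton]
      exact dvd_mul_of_dvd_left (pow_dvd_pow _ hm) f
    refine Prod.ext (funext fun j => ?_) (funext fun j => ?_)
    · exact hz _ (he.trans hn) _
    · exact hz _ hn _

theorem IsLieModel.unique {T : End k Q} {e e' : ℕ × ℕ} (h : IsLieModel T e)
    (h' : IsLieModel T e') (he : e.1 ≤ e.2) (he' : e'.1 ≤ e'.2) : e = e' := by
  have h1 := h.finrank_eq.symm.trans h'.finrank_eq
  have h2 : e.2 ≤ e'.2 := (h.pow_eq_zero_iff he _).mp ((h'.pow_eq_zero_iff he' _).mpr le_rfl)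
  have h3 : e'.2 ≤ e.2 := (h'.pow_eq_zero_iff he' _).mp ((h.pow_eq_zero_iff he _).mpr le_rfl)
  refine Prod.ext ?_ ?_ <;> omega

end LieModel

end Nilpotent

/-! ### Orders as crossed products -/

/-- At `p`, the order `O` is a crossed product `S ⊕ S w` of the quadratic algebra `S` with
involution `bar`, where `w² = β`. For every character `j : S → k`, the element `ϖ j` of `S` is a
uniformizer at the kernel of `j`, with ramification index `e j`. -/
structure CyclicFrame (p : ℕ) (k : Type*) [Field k] (S O : Type*) [CommRing S] [Ring O]
    (conj : O → O) where
  θ : S →+* O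
  bar : S →+* S
  w : O
  β : S
  e : (S →+* k) → ℕ
  ϖ : (S →+* k) → S
  bar_bar : ∀ x, bar (bar x) = x
  bar_β : bar β = β
  w_mul : ∀ x, w * θ x = θ (bar x) * w
  w_sq : w * w = θ β
  conj_add : ∀ x y, conj (x + y) = conj x + conj y
  conj_mul : ∀ x y, conj (x * y) = conj y * conj x
  conj_θ : ∀ x, conj (θ x) = θ (bar x)
  conj_w : conj w = -w
  span : ∀ x, ∃ c y0 y1, θ (1 + p * c) * x = θ y0 + θ y1 * w
  bar_ne : ∀ j : S →+* k, j.comp bar ≠ j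
  e_pos : ∀ j : S →+* k, 0 < e j
  e_bar : ∀ j : S →+* k, e (j.comp bar) = e j
  ϖ_bar : ∀ j : S →+* k, ϖ (j.comp bar) = ϖ j
  bar_ϖ : ∀ j : S →+* k, bar (ϖ j) = ϖ j
  apply_ϖ : ∀ j : S →+* k, j (ϖ j) = 0
  p_eq : ∀ j : S →+* k, ∃ c t, j c ≠ 0 ∧ j t ≠ 0 ∧ p * c = ϖ j ^ e j * t
  uniformizer : ∀ (j : S →+* k) x, j x = 0 → ∃ t t', j t ≠ 0 ∧ t * x = ϖ j * t'
  ϖ_eq : ∀ j : S →+* k, j β = 0 → ϖ j = β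
  frob : ∀ j : S →+* k, j β = 0 → ∃ n : ℕ, ∀ x, j x ^ p ^ n = j (bar x)

namespace QuatFrame

variable {R O : Type*} [CommRing R] [Ring O] [Algebra R O] {p : ℕ} {conj : O → O}
  (f : QuatFrame (R := R) p O conj)

/-- The quadratic algebra `R[s]`. -/
abbrev Quad : Type _ := QuadraticAlgebra R f.α 0

/-- The inclusion of `R[s]` in `O`. -/
def incl : f.Quad →+* O where
  toFun x := algebraMap R O x.re + x.im • f.s
  map_zero' := by simp
  map_one' := by
    have h1 : (1 : f.Quad).re = 1 := rfl
    have h2 : (1 : f.Quad).im = 0 := rfl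
    simp [h1, h2]
  map_add' x y := by simp only [QuadraticAlgebra.re_add, QuadraticAlgebra.im_add, map_add, add_smul]; abel
  map_mul' x y := by
    simp only [QuadraticAlgebra.re_mul, QuadraticAlgebra.im_mul, map_add, map_mul,
      smul_def, add_mul, mul_add, zero_mul, add_zero]
    have h1 : algebraMap R O x.im * f.s * (algebraMap R O y.im * f.s) =
        algebraMap R O f.α * algebraMap R O x.im * algebraMap R O y.im := by
      rw [mul_assoc, ← mul_assoc f.s, ← commutes y.im f.s, mul_assoc _ f.s f.s, f.s_sq,
        ← map_mul, ← map_mul, ← map_mul, ← map_mul]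
      congr 1; ring
    have h2 : algebraMap R O x.im * f.s * algebraMap R O y.re =
        algebraMap R O x.im * algebraMap R O y.re * f.s := by
      rw [mul_assoc, ← commutes y.re f.s, mul_assoc]
    rw [h1, h2]; simp only [mul_assoc]; abel

theorem incl_apply (x : f.Quad) : f.incl x = algebraMap R O x.re + x.im • f.s := rfl

theorem incl_algebraMap (c : R) : f.incl (algebraMap R f.Quad c) = algebraMap R O c := by
  simp [incl_apply]

/-- Complex conjugation on `R[s]`. -/
def bar : f.Quad →+* f.Quad where
  toFun x := ⟨x.re, -x.im⟩
  map_zero' := by ext <;> simp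
  map_one' := by
    ext
    · rfl
    · exact neg_zero
  map_add' x y := by ext <;> simp [add_comm]
  map_mul' x y := by ext <;> simp [add_comm]

theorem bar_re (x : f.Quad) : (f.bar x).re = x.re := rfl

theorem bar_im (x : f.Quad) : (f.bar x).im = -x.im := rfl

theorem bar_algebraMap (c : R) : f.bar (algebraMap R f.Quad c) = algebraMap R f.Quad c := by
  ext
  · rfl
  · exact neg_zero

theorem add_bar (x : f.Quad) : x + f.bar x = algebraMap R f.Quad (2 * x.re) := by
  ext
  · simp [bar_re, two_mul]
  · simp [bar_im]

theorem mul_bar (x : f.Quad) :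
    x * f.bar x = algebraMap R f.Quad (x.re ^ 2 - f.α * x.im ^ 2) := by
  ext
  · rw [QuadraticAlgebra.re_mul, bar_re, bar_im, QuadraticAlgebra.algebraMap_re]; ring
  · rw [QuadraticAlgebra.im_mul, bar_re, bar_im, QuadraticAlgebra.algebraMap_im]; ring

variable {k : Type*} [Field k] [CharP k p] [Fact p.Prime] (hp : p ≠ 2)

theorem omega_mul_self : (⟨0, 1⟩ : f.Quad) * ⟨0, 1⟩ = algebraMap R f.Quad f.α := by ext <;> simp

theorem eq_add (x : f.Quad) : x = algebraMap R f.Quad x.re + algebraMap R f.Quad x.im * ⟨0, 1⟩ := by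
  ext <;> simp

include hp in
theorem apply_omega_ne_zero (j : f.Quad →+* k) : j ⟨0, 1⟩ ≠ 0 := by
  intro h
  have h1 := congrArg j f.omega_mul_self
  rw [map_mul, h, zero_mul] at h1
  refine f.α_notMem (ker (j.comp (algebraMap R f.Quad))) (RingHom.ker_isPrime _) ?_ h1.symm
  rw [mem_ker, map_natCast, cast_eq_zero]

theorem comp_bar_algebraMap (j : f.Quad →+* k) :
    (j.comp f.bar).comp (algebraMap R f.Quad) = j.comp (algebraMap R f.Quad) := by
  ext c; simp [bar_algebraMap]

include hp in
theorem exists_frob [IsDedekindDomain R] [Module.Finite ℤ R] (j : f.Quad →+* k)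
    (hj : j (algebraMap R f.Quad f.β) = 0) :
    ∃ n : ℕ, ∀ x, j x ^ p ^ n = j (f.bar x) := by
  classical
  set i := j.comp (algebraMap R f.Quad) with hi
  have hij : ∀ c, j (algebraMap R f.Quad c) = i c := fun _ => rfl
  have hv : (ker i).IsPrime := RingHom.ker_isPrime i
  have hpv : (p : R) ∈ ker i := by rw [mem_ker, map_natCast, cast_eq_zero]
  have := isMaximal_ker p i
  have := finite_quotient_ker p i
  let κ := R ⧸ ker i
  let _ : Field κ := Ideal.Quotient.field _
  let _ : Fintype κ := Fintype.ofFinite κ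
  let g : κ →+* k := RingHom.kerLift i
  have hg : ∀ c, g (Ideal.Quotient.mk _ c) = i c := fun c => rfl
  have : CharP κ p := (g.charP_iff g.injective p).mpr inferInstance
  obtain ⟨n, -, hn⟩ := FiniteField.card κ p
  have hodd : ringChar κ ≠ 2 := by rwa [← CharP.eq κ (inferInstance : CharP κ p) (ringChar.charP κ)]
  have hα : (Ideal.Quotient.mk (ker i) f.α : κ) ≠ 0 := fun h =>
    f.α_notMem _ hv hpv (eq_zero_iff_mem.mp h)
  have hns : ¬ IsSquare (Ideal.Quotient.mk (ker i) f.α : κ) := by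
    rintro ⟨r, hr⟩
    obtain ⟨r, rfl⟩ := mk_surjective r
    apply f.nonsquare _ hv hpv hj r; rw [← eq_zero_iff_mem, map_sub, hr, map_pow, pow_two, sub_self]
  have hq : (Ideal.Quotient.mk (ker i) f.α : κ) ^ (Fintype.card κ / 2) = -1 :=
    (FiniteField.pow_dichotomy hodd hα).resolve_left fun h =>
      hns ((FiniteField.isSquare_iff hodd hα).mpr h)
  have hq' : i f.α ^ (p ^ (n : ℕ) / 2) = -1 := by rw [← hg, ← map_pow, ← hn, hq, map_neg, map_one]
  have hpow : ∀ c, i c ^ p ^ (n : ℕ) = i c := fun c => by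
    rw [← hg, ← map_pow, ← hn, FiniteField.pow_card]
  have htw : j ⟨0, 1⟩ * j ⟨0, 1⟩ = i f.α := by rw [← map_mul, f.omega_mul_self]; rfl
  have hmod : p ^ (n : ℕ) = 2 * (p ^ (n : ℕ) / 2) + 1 := by
    have : p ^ (n : ℕ) % 2 = 1 := by rw [← hn]; exact FiniteField.odd_card_of_char_ne_two hodd
    omega
  have htq : j ⟨0, 1⟩ ^ p ^ (n : ℕ) = -j ⟨0, 1⟩ := by
    rw [hmod, pow_succ, pow_mul, pow_two, htw, hq', neg_one_mul]
  refine ⟨n, fun x => ?_⟩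
  rw [f.eq_add x, map_add, map_add, map_mul, map_mul, f.bar_algebraMap, f.bar_algebraMap,
    show f.bar ⟨0, 1⟩ = -⟨0, 1⟩ by ext <;> simp [bar_re, bar_im], map_add, map_mul, map_neg,
    add_pow_char_pow, mul_pow, htq, hij, hij, hpow, hpow]

theorem exists_unif [IsDedekindDomain R] [CharZero R] (i : R →+* k) :
    ∃ π ∈ ker i, π ∉ ker i ^ 2 ∧ (i f.β = 0 → π = f.β) := by
  have hpv : (p : R) ∈ ker i := by rw [mem_ker, map_natCast, cast_eq_zero]
  have := RingHom.ker_isPrime i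
  by_cases h : i f.β = 0
  · exact ⟨f.β, h, f.β_notMem _ this hpv, fun _ => rfl⟩
  · obtain ⟨π, h1, h2⟩ := StdInvolution.exists_uniformizer (ker i) (fun h => by
      rw [h, Ideal.mem_bot] at hpv; exact (Fact.out : p.Prime).ne_zero (by exact_mod_cast hpv))
    exact ⟨π, h1, h2, fun h' => absurd h' h⟩

/-- A uniformizer at the kernel of a character. -/
def unif [IsDedekindDomain R] [CharZero R] (i : R →+* k) : R := (f.exists_unif i).choose

/-- The crossed product structure defined by a frame. -/
def toCyclicFrame [IsDedekindDomain R] [CharZero R] [Module.Finite ℤ R]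
    (conj_add : ∀ x y, conj (x + y) = conj x + conj y)
    (conj_mul : ∀ x y, conj (x * y) = conj y * conj x)
    (conj_algebraMap : ∀ c, conj (algebraMap R O c) = algebraMap R O c) :
    CyclicFrame p k f.Quad O conj := by
  classical
  have hv : ∀ i : R →+* k, (ker i).IsPrime := fun i => RingHom.ker_isPrime i
  have hpv : ∀ i : R →+* k, (p : R) ∈ ker i := fun i => by rw [mem_ker, map_natCast, cast_eq_zero]
  let ϖ : (R →+* k) → R := f.unif
  have hϖ1 : ∀ i : R →+* k, ϖ i ∈ ker i := fun i => (f.exists_unif i).choose_spec.1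
  have hϖ2 : ∀ i : R →+* k, ϖ i ∉ ker i ^ 2 := fun i => (f.exists_unif i).choose_spec.2.1
  have hϖ3 : ∀ i : R →+* k, i f.β = 0 → ϖ i = f.β := fun i => (f.exists_unif i).choose_spec.2.2
  have he : ∀ i : R →+* k, 0 < Ideal.ramificationIdx' (Ideal.span {(p : ℤ)}) (ker i) ∧
      (p : R) ∈ ker i ^ (Ideal.ramificationIdx' (Ideal.span {(p : ℤ)}) (ker i)) ∧
      (p : R) ∉ ker i ^ (Ideal.ramificationIdx' (Ideal.span {(p : ℤ)}) (ker i) + 1) := by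
    intro i
    have hN : ∃ N, (p : R) ∉ ker i ^ N := by
      by_contra! hcon
      have h := Ideal.iInf_pow_eq_bot_of_isDomain (ker i) (hv i).ne_top
      have h1 : (p : R) ∈ ⨅ N, ker i ^ N := Ideal.mem_iInf.mpr hcon
      rw [h, Ideal.mem_bot] at h1; exact (Fact.out : p.Prime).ne_zero (by exact_mod_cast h1)
    have hmap : ∀ N, Ideal.map (algebraMap ℤ R) (Ideal.span {(p : ℤ)}) ≤ ker i ^ N ↔
        (p : R) ∈ ker i ^ N := fun N => by
      rw [Ideal.map_span, Ideal.span_le, Set.image_singleton, Set.singleton_subset_iff]; simp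
    have hspec := Nat.find_spec hN
    have hmin : ∀ m < Nat.find hN, (p : R) ∈ ker i ^ m := fun m hm =>
      not_not.mp (Nat.find_min hN hm)
    have h2 : 2 ≤ Nat.find hN := by
      by_contra h
      have h3 : Nat.find hN = 0 ∨ Nat.find hN = 1 := by omega
      rcases h3 with h3 | h3 <;> rw [h3] at hspec
      · simp at hspec
      · rw [pow_one] at hspec; exact hspec (hpv i)
    obtain ⟨m, hm⟩ : ∃ m, Nat.find hN = m + 1 := ⟨Nat.find hN - 1, by omega⟩
    rw [hm] at hspec hmin
    rw [Ideal.ramificationIdx'_spec ((hmap m).mpr (hmin m (Nat.lt_succ_self m)))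
      (fun h => hspec ((hmap _).mp h))]
    exact ⟨by omega, hmin m (Nat.lt_succ_self m), hspec⟩
  have hre : ∀ j : f.Quad →+* k, ∀ c, j (algebraMap R f.Quad c) = j.comp (algebraMap R f.Quad) c :=
    fun _ _ => rfl
  refine
    { θ := f.incl
      bar := f.bar
      w := f.w
      β := algebraMap R f.Quad f.β
      e := fun j => Ideal.ramificationIdx' (Ideal.span {(p : ℤ)})
        (ker (j.comp (algebraMap R f.Quad)))
      ϖ := fun j => algebraMap R f.Quad (ϖ (j.comp (algebraMap R f.Quad)))
      bar_bar := fun x => by ext <;> simp [bar_re, bar_im]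
      bar_β := f.bar_algebraMap _
      w_mul := fun x => ?_
      w_sq := by rw [f.incl_algebraMap, f.w_sq]
      conj_add := conj_add
      conj_mul := conj_mul
      conj_θ := fun x => ?_
      conj_w := f.conj_w
      span := fun x => ?_
      bar_ne := fun j h => ?_
      e_pos := fun j => (he _).1
      e_bar := fun j => by rw [f.comp_bar_algebraMap]
      ϖ_bar := fun j => by rw [f.comp_bar_algebraMap]
      bar_ϖ := fun j => f.bar_algebraMap _
      apply_ϖ := fun j => hϖ1 (j.comp (algebraMap R f.Quad))
      p_eq := fun j => ?_
      uniformizer := fun j x hx => ?_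
      ϖ_eq := fun j hj => by rw [hϖ3 _ hj]
      frob := fun j hj => f.exists_frob hp j hj }
  · rw [incl_apply, incl_apply, bar_re, bar_im, mul_add, add_mul, commutes, mul_smul_comm,
      neg_smul, neg_mul, smul_mul_assoc, f.anti, smul_neg, neg_neg]
  · rw [incl_apply, incl_apply, bar_re, bar_im, conj_add, conj_algebraMap, smul_def,
      conj_mul, conj_algebraMap, f.conj_s, neg_mul, ← commutes, ← smul_def, neg_smul]
  · obtain ⟨c, y0, y1, y2, y3, h⟩ := f.exists_mem_span x
    refine ⟨algebraMap R f.Quad c, ⟨y0, y1⟩, ⟨y2, y3⟩, ?_⟩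
    have h1 : (1 + p * algebraMap R O c) * x = (1 + p * c) • x := by rw [smul_def]; simp
    rw [map_add, map_one, map_mul, map_natCast, f.incl_algebraMap, h1, h, incl_apply, incl_apply,
      add_mul, smul_mul_assoc, ← smul_def, ← add_assoc]
  · have h1 : j (f.bar ⟨0, 1⟩) = j ⟨0, 1⟩ := congrArg (fun g => g ⟨0, 1⟩) h
    have h2 : f.bar ⟨0, 1⟩ = -⟨0, 1⟩ := by ext <;> simp [bar_re, bar_im]
    rw [h2, map_neg] at h1
    have h3 : (2 : k) * j ⟨0, 1⟩ = 0 := by linear_combination -h1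
    exact (mul_ne_zero (two_ne_zero_of_charP p hp k) (f.apply_omega_ne_zero hp j)) h3
  · set i := j.comp (algebraMap R f.Quad) with hi
    have := hv i
    obtain ⟨t, ht, h⟩ := exists_mul_eq_uniformizer_pow_mul (ker i) (hϖ1 i) (hϖ2 i)
      (Ideal.ramificationIdx' (Ideal.span {(p : ℤ)}) (ker i))
    obtain ⟨d, hd⟩ := h p (he i).2.1
    refine ⟨algebraMap R f.Quad t, algebraMap R f.Quad d, ht, fun h0 => (he i).2.2 ?_, ?_⟩
    · refine (mul_mem_pow (ker i) (a := t) (b := p) ?_).resolve_left ht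
      rw [hd, pow_succ]; exact Ideal.mul_mem_mul (Ideal.pow_mem_pow (hϖ1 i) _) h0
    · rw [← map_natCast (algebraMap R f.Quad), ← map_mul, mul_comm, hd, map_mul, map_pow]
  · set i := j.comp (algebraMap R f.Quad) with hi
    have := hv i
    obtain ⟨t, ht, h⟩ := exists_mul_eq_uniformizer_mul (ker i) (hϖ1 i) (hϖ2 i)
    have h1 : j (x * f.bar x) = 0 := by rw [map_mul, hx, zero_mul]
    rw [f.mul_bar] at h1
    by_cases hb : j (f.bar x) = 0
    · have h2 : i (2 * x.re) = 0 := by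
        have := congrArg j (f.add_bar x)
        rw [map_add, hx, hb, add_zero] at this; exact this.symm
      have h3 : i x.re = 0 := by
        rw [map_mul, map_ofNat] at h2
        exact (mul_eq_zero.mp h2).resolve_left (two_ne_zero_of_charP p hp k)
      have h4 : i x.im = 0 := by
        have := hx
        rw [f.eq_add x, map_add, map_mul] at this
        have h5 : j (algebraMap R f.Quad x.re) = 0 := h3
        rw [h5, zero_add] at this
        exact (mul_eq_zero.mp this).resolve_right (f.apply_omega_ne_zero hp j)
      obtain ⟨d0, hd0⟩ := h _ h3
      obtain ⟨d1, hd1⟩ := h _ h4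
      refine ⟨algebraMap R f.Quad t, ⟨d0, d1⟩, ht, ?_⟩
      ext
      · simpa using hd0
      · simpa using hd1
    · obtain ⟨d, hd⟩ := h _ h1
      refine ⟨algebraMap R f.Quad t * f.bar x, algebraMap R f.Quad d, ?_, ?_⟩
      · rw [map_mul]; exact mul_ne_zero ht hb
      · rw [mul_assoc, mul_comm (f.bar x), f.mul_bar, ← map_mul, hd, map_mul]

section Projections

variable [IsDedekindDomain R] [CharZero R] [Module.Finite ℤ R]
  (conj_add : ∀ x y, conj (x + y) = conj x + conj y)
  (conj_mul : ∀ x y, conj (x * y) = conj y * conj x)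
  (conj_algebraMap : ∀ c, conj (algebraMap R O c) = algebraMap R O c)

theorem toCyclicFrame_ϖ (j : f.Quad →+* k) :
    (f.toCyclicFrame hp conj_add conj_mul conj_algebraMap).ϖ j =
      algebraMap R f.Quad (f.unif (j.comp (algebraMap R f.Quad))) := rfl

end Projections

end QuatFrame

/-! ### Extension of scalars of a crossed product -/

namespace CyclicFrame

section Extend

variable {p : ℕ} {k S O : Type*} [Field k] [CommRing S] [Ring O] {conj : O → O}
  (C : CyclicFrame p k S O conj) (K : Type*) [CommRing K]

/-- The inclusion `K ⊗ S → K ⊗ O`. -/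
def th : K ⊗[ℤ] S →ₐ[K] K ⊗[ℤ] O := Algebra.TensorProduct.map (AlgHom.id K K) C.θ.toIntAlgHom

/-- The involution of `K ⊗ S`. -/
def br : K ⊗[ℤ] S →ₐ[K] K ⊗[ℤ] S := Algebra.TensorProduct.map (AlgHom.id K K) C.bar.toIntAlgHom

/-- The element `w` of `K ⊗ O`. -/
def ww : K ⊗[ℤ] O := 1 ⊗ₜ C.w

/-- The anti-involution of `K ⊗ O`. -/
def cj : K ⊗[ℤ] O →ₗ[K] K ⊗[ℤ] O :=
  LinearMap.baseChange K (AddMonoidHom.mk' conj C.conj_add).toIntLinearMap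

@[simp] theorem th_tmul (c : K) (x : S) : C.th K (c ⊗ₜ x) = c ⊗ₜ C.θ x := rfl
@[simp] theorem br_tmul (c : K) (x : S) : C.br K (c ⊗ₜ x) = c ⊗ₜ C.bar x := rfl
@[simp] theorem cj_tmul (c : K) (x : O) : C.cj K (c ⊗ₜ x) = c ⊗ₜ conj x := rfl

variable {K}

@[simp] theorem br_br (x : K ⊗[ℤ] S) : C.br K (C.br K x) = x := by
  induction x with
  | zero => simp
  | tmul c x => simp [C.bar_bar]
  | add x y hx hy => rw [map_add, map_add, hx, hy]

theorem ww_mul (x : K ⊗[ℤ] S) : C.ww K * C.th K x = C.th K (C.br K x) * C.ww K := by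
  induction x with
  | zero => simp
  | tmul c x => simp [ww, C.w_mul]
  | add x y hx hy => simp only [map_add, mul_add, add_mul, hx, hy]

theorem ww_mul_ww : C.ww K * C.ww K = C.th K (1 ⊗ₜ C.β) := by simp [ww, C.w_sq]

theorem th_mul_ww (x : K ⊗[ℤ] S) : C.th K x * C.ww K = C.ww K * C.th K (C.br K x) := by
  rw [ww_mul, br_br]

theorem cj_th (x : K ⊗[ℤ] S) : C.cj K (C.th K x) = C.th K (C.br K x) := by
  induction x with
  | zero => simp
  | tmul c x => simp [C.conj_θ]
  | add x y hx hy => rw [map_add, map_add, map_add, map_add, hx, hy]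

theorem cj_ww : C.cj K (C.ww K) = -C.ww K := by simp [ww, C.conj_w, TensorProduct.tmul_neg]

theorem br_ϖ (j : S →+* k) : C.br K (1 ⊗ₜ C.ϖ j) = 1 ⊗ₜ C.ϖ j := by rw [br_tmul, C.bar_ϖ]

theorem comp_bar_bar (j : S →+* k) : (j.comp C.bar).comp C.bar = j := by
  ext x; simp [C.bar_bar]

end Extend

end CyclicFrame

section

variable {p : ℕ} [Fact p.Prime] {k S O : Type*} [Field k] [CharP k p] [CommRing S] [Ring O]
  {conj : O → O} (C : CyclicFrame p k S O conj)

namespace CyclicFrame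

theorem wchar_br (j : S →+* k) (x : 𝕎 ⊗[ℤ] S) :
    wchar p j (C.br _ x) = wchar p (j.comp C.bar) x := by
  induction x with
  | zero => simp
  | tmul c x => simp [wchar_tmul]
  | add x y hx hy => rw [map_add, map_add, map_add, hx, hy]

theorem red_th (x : 𝕎 ⊗[ℤ] S) :
    red p k O (C.th _ x) = C.th k (red p k S x) := by
  induction x with
  | zero => simp
  | tmul c x => simp [red_tmul]
  | add x y hx hy => rw [map_add, map_add, map_add, map_add, hx, hy]

theorem red_br (x : 𝕎 ⊗[ℤ] S) :
    red p k S (C.br _ x) = C.br k (red p k S x) := by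
  induction x with
  | zero => simp
  | tmul c x => simp [red_tmul]
  | add x y hx hy => rw [map_add, map_add, map_add, map_add, hx, hy]

theorem red_ww : red p k O (C.ww _) = C.ww k := by simp [ww]

end CyclicFrame

variable [IsAlgClosed k] [Module.Finite ℤ S] [Free ℤ S] [Fintype (S →+* k)]
  [DecidableEq (S →+* k)]

namespace CyclicFrame

/-- The idempotents of `W ⊗ S` defined by the characters of `S`. -/
def eps (_ : CyclicFrame p k S O conj) (j : S →+* k) : 𝕎 ⊗[ℤ] S :=
  (exists_witt_idempotents p k S).choose j

theorem eps_complete : CompleteOrthogonalIdempotents C.eps :=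
  (exists_witt_idempotents p k S).choose_spec.1

theorem wchar_eps (j j' : S →+* k) : wchar p j (C.eps j') = if j = j' then 1 else 0 :=
  (exists_witt_idempotents p k S).choose_spec.2.1 j j'

theorem eps_mul_self (j : S →+* k) : C.eps j * C.eps j = C.eps j := C.eps_complete.idem j

theorem br_eps (j : S →+* k) : C.br _ (C.eps j) = C.eps (j.comp C.bar) := by
  refine idempotent_ext p ?_ (C.eps_mul_self _) fun j' => ?_
  · rw [← map_mul, C.eps_mul_self]
  · rw [wchar_br, wchar_eps, wchar_eps]
    refine if_congr ⟨fun h => ?_, fun h => ?_⟩ rfl rfl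
    · rw [← h, comp_bar_bar]
    · rw [h, comp_bar_bar]

theorem exists_mul_eq_eps {j : S →+* k} {x : 𝕎 ⊗[ℤ] S} (hx : wchar p j x ≠ 0) :
    ∃ y, y * x * C.eps j = C.eps j :=
  exists_mul_eq_idempotent p (C.eps_mul_self j)
    (fun j' hj' => by rw [wchar_eps, if_neg hj']) hx

/-- The idempotents of `k ⊗ S` defined by the characters of `S`. -/
def ep (j : S →+* k) : k ⊗[ℤ] S := red p k S (C.eps j)

theorem ep_mul_self (j : S →+* k) : C.ep j * C.ep j = C.ep j := by rw [ep, ← map_mul, eps_mul_self]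

theorem ep_mul_of_ne {j j' : S →+* k} (h : j ≠ j') : C.ep j * C.ep j' = 0 := by
  rw [ep, ep, ← map_mul, C.eps_complete.ortho h, map_zero]

theorem sum_ep : ∑ j, C.ep j = 1 := by
  simp only [ep]; rw [← map_sum, C.eps_complete.complete, map_one]

theorem br_ep (j : S →+* k) : C.br k (C.ep j) = C.ep (j.comp C.bar) := by
  rw [ep, ← red_br, br_eps, ep]

theorem exists_mul_eq_ep {j : S →+* k} {x : k ⊗[ℤ] S} (hx : charExt j x ≠ 0) :
    ∃ y, y * x * C.ep j = C.ep j := by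
  obtain ⟨x, rfl⟩ := red_surjective p S x
  obtain ⟨y, hy⟩ := C.exists_mul_eq_eps (x := x) hx
  exact ⟨red p k S y, by rw [ep, ← map_mul, ← map_mul, hy]⟩

theorem exists_pow_mul_eq (j : S →+* k) :
    ∃ u, (1 ⊗ₜ C.ϖ j : 𝕎 ⊗[ℤ] S) ^ C.e j * u * C.eps j = p * C.eps j := by
  obtain ⟨c, t, hc, -, h⟩ := C.p_eq j
  obtain ⟨y, hy⟩ := C.exists_mul_eq_eps (j := j) (x := 1 ⊗ₜ c) (by simpa using hc)
  have h1 : (p : 𝕎 ⊗[ℤ] S) * (1 ⊗ₜ c) = (1 ⊗ₜ C.ϖ j) ^ C.e j * (1 ⊗ₜ t) := by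
    have h2 := congrArg (includeRight : S →ₐ[ℤ] 𝕎 ⊗[ℤ] S) h
    simpa only [map_mul, map_pow, map_natCast, includeRight_apply] using h2
  refine ⟨y * (1 ⊗ₜ t), ?_⟩
  linear_combination (-y * C.eps j) * h1 + p * hy

theorem ϖ_pow_mul_ep (j : S →+* k) : (1 ⊗ₜ C.ϖ j : k ⊗[ℤ] S) ^ C.e j * C.ep j = 0 := by
  obtain ⟨c, t, -, ht, h⟩ := C.p_eq j
  obtain ⟨y, hy⟩ := C.exists_mul_eq_ep (j := j) (x := 1 ⊗ₜ t) (by simpa using ht)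
  have h1 : (p : k ⊗[ℤ] S) * (1 ⊗ₜ c) = (1 ⊗ₜ C.ϖ j) ^ C.e j * (1 ⊗ₜ t) := by
    have h2 := congrArg (includeRight : S →ₐ[ℤ] k ⊗[ℤ] S) h
    simpa only [map_mul, map_pow, map_natCast, includeRight_apply] using h2
  have h0 : (p : k ⊗[ℤ] S) = 0 := by
    rw [← map_natCast (algebraMap k (k ⊗[ℤ] S)), cast_eq_zero, map_zero]
  rw [h0, zero_mul] at h1
  linear_combination (-(1 ⊗ₜ C.ϖ j : k ⊗[ℤ] S) ^ C.e j) * hy - y * C.ep j * h1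

theorem exists_tmul_sub_mul_ep (j : S →+* k) (s : S) : ∃ y,
    (1 ⊗ₜ s - algebraMap k (k ⊗[ℤ] S) (j s)) * C.ep j = (1 ⊗ₜ C.ϖ j) * y * C.ep j := by
  have := isMaximal_ker p j
  have := finite_quotient_ker p j
  let κ := S ⧸ ker j
  let _ : Field κ := Ideal.Quotient.field _
  let _ : Fintype κ := Fintype.ofFinite κ
  let g : κ →+* k := RingHom.kerLift j
  have hg : ∀ c, g (Ideal.Quotient.mk _ c) = j c := fun c => rfl
  have : CharP κ p := (g.charP_iff g.injective p).mpr inferInstance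
  set q := Fintype.card κ with hq
  have hqk : (q : k) = 0 := by
    have := FiniteField.cast_card_eq_zero κ
    rw [← map_natCast g, this, map_zero]
  have hpow : ∀ c, j c ^ q = j c := fun c => by rw [← hg, ← map_pow, FiniteField.pow_card]
  obtain ⟨t, t', ht, htt⟩ := C.uniformizer j (s ^ q - s) (by rw [map_sub, map_pow, hpow, sub_self])
  set x : k ⊗[ℤ] S := 1 ⊗ₜ s
  set a : k ⊗[ℤ] S := algebraMap k (k ⊗[ℤ] S) (j s)
  have h1 : (1 ⊗ₜ t : k ⊗[ℤ] S) * (x ^ q - x) = (1 ⊗ₜ C.ϖ j) * (1 ⊗ₜ t') := by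
    have h2 := congrArg (includeRight : S →ₐ[ℤ] k ⊗[ℤ] S) htt
    simpa only [map_mul, map_pow, map_sub, includeRight_apply] using h2
  have ha : a ^ q = a := by simp only [a]; rw [← map_pow, hpow]
  set G := ∑ i ∈ Finset.range q, x ^ i * a ^ (q - 1 - i)
  have hG : (x - a) * (G - 1) = x ^ q - x := by
    have := (Commute.all x a).mul_geom_sum₂ q
    linear_combination this - ha
  have hx : charExt j x = j s := by simp [x, charExt_tmul]
  have ha' : charExt j a = j s := by simp [a]
  have hGj : charExt j (G - 1) ≠ 0 := by
    have hsum : charExt j G = 0 := by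
      rw [map_sum]
      have : ∀ i ∈ Finset.range q, charExt j (x ^ i * a ^ (q - 1 - i)) = j s ^ (q - 1) := by
        intro i hi
        rw [map_mul, map_pow, map_pow, hx, ha', ← pow_add]
        congr 1
        have := Finset.mem_range.mp hi
        omega
      rw [sum_congr rfl this, Finset.sum_const, Finset.card_range, nsmul_eq_mul, hqk, zero_mul]
    rw [map_sub, hsum, map_one, zero_sub]; exact neg_ne_zero.mpr one_ne_zero
  obtain ⟨y, hy⟩ := C.exists_mul_eq_ep hGj
  obtain ⟨y', hy'⟩ := C.exists_mul_eq_ep (j := j) (x := 1 ⊗ₜ t) (by simpa using ht)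
  refine ⟨y * y' * (1 ⊗ₜ t'), ?_⟩
  linear_combination (-(x - a)) * hy + y * C.ep j * hG - y * (x ^ q - x) * hy' + y * y' * C.ep j * h1

theorem exists_sub_mul_ep (j : S →+* k) (x : k ⊗[ℤ] S) : ∃ y,
    (x - algebraMap k (k ⊗[ℤ] S) (charExt j x)) * C.ep j = (1 ⊗ₜ C.ϖ j) * y * C.ep j := by
  induction x with
  | zero => exact ⟨0, by simp⟩
  | tmul c s =>
    obtain ⟨y, hy⟩ := C.exists_tmul_sub_mul_ep j s
    refine ⟨algebraMap k _ c * y, ?_⟩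
    have h1 : (c ⊗ₜ s : k ⊗[ℤ] S) = algebraMap k _ c * (1 ⊗ₜ s) := by
      rw [Algebra.TensorProduct.algebraMap_apply]; simp
    rw [charExt_tmul, h1, map_mul]; linear_combination (algebraMap k (k ⊗[ℤ] S) c) * hy
  | add x y hx hy =>
    obtain ⟨z, hz⟩ := hx
    obtain ⟨z', hz'⟩ := hy
    refine ⟨z + z', ?_⟩
    rw [map_add, map_add]; linear_combination hz + hz'

open Polynomial in
theorem exists_aeval_mul_ep (j : S →+* k) (r : k ⊗[ℤ] S) :
    ∃ f : k[X], r * C.ep j = aeval (1 ⊗ₜ C.ϖ j : k ⊗[ℤ] S) f * C.ep j := by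
  have key : ∀ n : ℕ, ∃ f : k[X], ∃ y, r * C.ep j = aeval (1 ⊗ₜ C.ϖ j : k ⊗[ℤ] S) f * C.ep j +
      (1 ⊗ₜ C.ϖ j) ^ n * y * C.ep j := by
    intro n
    induction n with
    | zero => exact ⟨0, r, by simp⟩
    | succ n ih =>
      obtain ⟨f, y, h⟩ := ih
      obtain ⟨y', hy'⟩ := C.exists_sub_mul_ep j y
      refine ⟨f + Polynomial.C (charExt j y) * X ^ n, y', ?_⟩
      rw [map_add, map_mul, aeval_C, aeval_X_pow, h]
      linear_combination ((1 ⊗ₜ C.ϖ j : k ⊗[ℤ] S) ^ n) * hy'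
  obtain ⟨f, y, h⟩ := key (C.e j)
  refine ⟨f, ?_⟩
  rw [h]; linear_combination y * C.ϖ_pow_mul_ep j

theorem exists_eq_add (a : Oₖ) : ∃ r0 r1, a = C.th k r0 + C.th k r1 * C.ww k := by
  induction a with
  | zero => exact ⟨0, 0, by simp⟩
  | add x y hx hy =>
    obtain ⟨r0, r1, rfl⟩ := hx
    obtain ⟨r0', r1', rfl⟩ := hy
    exact ⟨r0 + r0', r1 + r1', by simp only [map_add, add_mul]; abel⟩
  | tmul c x =>
    obtain ⟨d, y0, y1, h⟩ := C.span x
    refine ⟨c ⊗ₜ y0, c ⊗ₜ y1, ?_⟩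
    have h1 : (1 : k) ⊗ₜ[ℤ] (C.θ (1 + p * d) * x) = 1 ⊗ₜ x := by
      have h0 : (p : Oₖ) = 0 := by rw [← map_natCast (algebraMap k Oₖ), cast_eq_zero, map_zero]
      rw [map_add, map_one, map_mul, map_natCast, add_mul, one_mul, tmul_add]
      have : (1 : k) ⊗ₜ[ℤ] ((p : O) * C.θ d * x) = (p : Oₖ) * (1 ⊗ₜ (C.θ d * x)) := by
        have := map_mul (includeRight : O →ₐ[ℤ] Oₖ) (p : O) (C.θ d * x)
        rw [map_natCast] at this; rw [mul_assoc]; exact this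
      rw [this, h0, zero_mul, add_zero]
    have h2 : (c ⊗ₜ x : Oₖ) = c • (1 ⊗ₜ[ℤ] x) := by rw [smul_tmul', smul_eq_mul, mul_one]
    rw [h2, ← h1, h, th_tmul, th_tmul, ww, tmul_mul_tmul, mul_one,
      smul_tmul', smul_eq_mul, mul_one, tmul_add]

end CyclicFrame

variable {D : Type*} [AddCommGroup D] [Module k D] [Module Oₖ D] [IsScalarTower k Oₖ D]
   {M : Type*} [AddCommGroup M] [Module O𝕎 M] {q : M →+ D}

/-! ### Components of a module over `k ⊗ O` -/

theorem finrank_eq_sum_of_projections {k V ι : Type*} [Field k] [AddCommGroup V] [Module k V]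
    [FiniteDimensional k V] [Fintype ι] [DecidableEq ι] (U : ι → Submodule k V)
    (π : ι → V →ₗ[k] V) (hU : ∀ j x, π j x ∈ U j) (hπ : ∀ j, ∀ x ∈ U j, π j x = x)
    (h0 : ∀ i j, i ≠ j → ∀ x ∈ U j, π i x = 0) (hsum : ∀ x, ∑ j, π j x = x) :
    finrank k V = ∑ j, finrank k (U j) := by
  rw [← Module.finrank_pi_fintype (R := k) (M := fun j => U j)]
  refine LinearEquiv.finrank_eq
    { toFun := fun x j => ⟨π j x, hU j x⟩
      map_add' := fun x y => funext fun j => Subtype.ext (map_add _ _ _)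
      map_smul' := fun c x => funext fun j => Subtype.ext (map_smul _ _ _)
      invFun := fun y => ∑ j, (y j : V)
      left_inv := fun x => hsum x
      right_inv := fun y => funext fun i => Subtype.ext ?_ }
  simp only [map_sum]; rw [sum_eq_single i]
  · exact hπ i _ (y i).2
  · exact fun j _ hj => h0 i j hj.symm _ (y j).2
  · simp

/-- `q : M → D` is the reduction modulo `p` of a `p`-torsion free module over `W ⊗ O`. -/
structure IsReduction (p : ℕ) [Fact p.Prime] (k O : Type*) [Field k] [CharP k p] [Ring O]
    {M D : Type*} [AddCommGroup M] [AddCommGroup D] [Module O𝕎 M]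
    [Module Oₖ D] (q : M →+ D) : Prop where
  surjective : Surjective q
  eq_zero : ∀ x, q x = 0 → ∃ y, x = p • y
  map_nsmul : ∀ x, q (p • x) = 0
  torsionFree : ∀ x : M, p • x = 0 → x = 0
  map_smul : ∀ a x, q (a • x) = red p k O a • q x

theorem IsReduction.exact (hq : IsReduction p k O q) {a b c : O𝕎}
    (hab : a * b = p) (hca : c * a = p) {x : D} (hx : red p k O a • x = 0) :
    ∃ y, x = red p k O b • y := by
  obtain ⟨x, rfl⟩ := hq.surjective x
  rw [← hq.map_smul] at hx
  obtain ⟨y, hy⟩ := hq.eq_zero _ hx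
  refine ⟨q y, ?_⟩
  rw [← hq.map_smul]
  congr 1; rw [← sub_eq_zero]
  apply hq.torsionFree
  have h1 : a • (x - b • y) = 0 := by
    rw [smul_sub, smul_smul, hab, hy, cast_smul_eq_nsmul, sub_self]
  have h2 := congrArg (c • ·) h1
  simpa only [smul_smul, hca, smul_zero, cast_smul_eq_nsmul] using h2

namespace CyclicFrame

section PC

variable (D) in
/-- The component of `D` at the character `j`. -/
def pc (j : S →+* k) : Submodule k D where
  carrier := {x | C.th k (C.ep j) • x = x}
  zero_mem' := smul_zero _
  add_mem' {x y} hx hy := by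
    simp only [Set.mem_ofPred_eq] at hx hy ⊢; rw [smul_add, hx, hy]
  smul_mem' c x hx := by
    simp only [Set.mem_ofPred_eq] at hx ⊢
    rw [← algebraMap_smul Oₖ c x, smul_smul, ← commutes, ← smul_smul, hx]

theorem mem_pc {j : S →+* k} {x : D} : x ∈ C.pc D j ↔ C.th k (C.ep j) • x = x := Iff.rfl

theorem ep_smul_mem (j : S →+* k) (x : D) : C.th k (C.ep j) • x ∈ C.pc D j := by
  rw [mem_pc, smul_smul, ← map_mul, ep_mul_self]

theorem th_smul_mem {j : S →+* k} (r : k ⊗[ℤ] S) {x : D} (hx : x ∈ C.pc D j) :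
    C.th k r • x ∈ C.pc D j := by
  rw [mem_pc] at hx ⊢; rw [smul_smul, ← map_mul, mul_comm, map_mul, ← smul_smul, hx]

theorem ww_smul_mem {j : S →+* k} {x : D} (hx : x ∈ C.pc D j) :
    C.ww k • x ∈ C.pc D (j.comp C.bar) := by
  rw [mem_pc] at hx ⊢; rw [smul_smul, th_mul_ww, br_ep, comp_bar_bar, ← smul_smul, hx]

theorem ww_smul_mem' {j : S →+* k} {x : D} (hx : x ∈ C.pc D (j.comp C.bar)) :
    C.ww k • x ∈ C.pc D j := by
  have := C.ww_smul_mem hx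
  rwa [comp_bar_bar] at this

theorem ep_smul_eq_zero {i j : S →+* k} (h : i ≠ j) {x : D} (hx : x ∈ C.pc D j) :
    C.th k (C.ep i) • x = 0 := by
  rw [← C.mem_pc.mp hx, smul_smul, ← map_mul, ep_mul_of_ne _ h, map_zero]; exact zero_smul Oₖ x

theorem sum_ep_smul (x : D) : ∑ j, C.th k (C.ep j) • x = x := by
  rw [← Finset.sum_smul, ← map_sum, sum_ep, map_one, one_smul]

theorem ww_smul_ww_smul (x : D) : C.ww k • C.ww k • x = C.th k (1 ⊗ₜ C.β) • x := by
  rw [smul_smul, ww_mul_ww]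

theorem ww_smul_th_smul (r : k ⊗[ℤ] S) (x : D) :
    C.ww k • C.th k r • x = C.th k (C.br k r) • C.ww k • x := by
  rw [smul_smul, ww_mul, ← smul_smul]

theorem th_smul_ww_smul (r : k ⊗[ℤ] S) (x : D) :
    C.th k r • C.ww k • x = C.ww k • C.th k (C.br k r) • x := by
  rw [smul_smul, th_mul_ww, ← smul_smul]

theorem finrank_eq_sum_pc [FiniteDimensional k D] :
    finrank k D = ∑ j, finrank k (C.pc D j) :=
  finrank_eq_sum_of_projections (C.pc D) (fun j => lsmul k k D (C.th k (C.ep j)))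
    (fun j x => C.ep_smul_mem j x) (fun _ _ hx => hx) (fun _ _ h _ hx => C.ep_smul_eq_zero h hx)
    fun x => C.sum_ep_smul x

variable (D) in
/-- Multiplication by the uniformizer on the component at `j`. -/
def T (j : S →+* k) : End k (C.pc D j) :=
  (lsmul k k D (C.th k (1 ⊗ₜ C.ϖ j))).restrict fun _ hx => C.th_smul_mem _ hx

theorem coe_T (j : S →+* k) (x : C.pc D j) : (C.T D j x : D) = C.th k (1 ⊗ₜ C.ϖ j) • (x : D) := rfl

open Polynomial in
theorem coe_aeval_T (j : S →+* k) (f : k[X]) (x : C.pc D j) :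
    (aeval (C.T D j) f x : D) = C.th k (aeval (1 ⊗ₜ C.ϖ j : k ⊗[ℤ] S) f) • (x : D) := by
  induction f using Polynomial.induction_on with
  | C c =>
    rw [aeval_C, aeval_C, AlgHom.commutes, algebraMap_smul]; rfl
  | add f g hf hg => simp only [map_add, LinearMap.add_apply, Submodule.coe_add, hf, hg, add_smul]
  | monomial n c h =>
    rw [pow_succ, ← mul_assoc, mul_comm _ X, map_mul (aeval (C.T D j)), aeval_X,
      End.mul_apply, coe_T, h, smul_smul, ← map_mul, map_mul (aeval _) X, aeval_X]

theorem coe_T_pow (j : S →+* k) (n : ℕ) (x : C.pc D j) :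
    ((C.T D j ^ n) x : D) = C.th k ((1 ⊗ₜ C.ϖ j) ^ n) • (x : D) := by
  have := C.coe_aeval_T j (Polynomial.X ^ n) x
  simpa using this

theorem T_pow_eq_zero (j : S →+* k) : C.T D j ^ C.e j = 0 := by
  refine LinearMap.ext fun x => Subtype.ext ?_
  rw [coe_T_pow, ← C.mem_pc.mp x.2, smul_smul, ← map_mul, ϖ_pow_mul_ep, map_zero]
  exact zero_smul Oₖ (x : D)

open Polynomial in
theorem exists_aeval_T (j : S →+* k) (r : k ⊗[ℤ] S) :
    ∃ f : k[X], ∀ x : C.pc D j, C.th k r • (x : D) = (aeval (C.T D j) f x : D) := by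
  obtain ⟨f, hf⟩ := C.exists_aeval_mul_ep j r
  refine ⟨f, fun x => ?_⟩
  rw [coe_aeval_T]
  conv_lhs => rw [← C.mem_pc.mp x.2, smul_smul, ← map_mul, hf, map_mul, ← smul_smul,
    C.mem_pc.mp x.2]

/-- The projection to the component at `j`. -/
def proj (j : S →+* k) (x : D) : C.pc D j := ⟨C.th k (C.ep j) • x, C.ep_smul_mem j x⟩

theorem coe_proj (j : S →+* k) (x : D) : (C.proj j x : D) = C.th k (C.ep j) • x := rfl

/-- Multiplication by `w` between the components. -/
def wproj (j : S →+* k) (x : D) : C.pc D j :=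
  ⟨C.ww k • C.th k (C.ep (j.comp C.bar)) • x, C.ww_smul_mem' (C.ep_smul_mem _ x)⟩

theorem coe_wproj (j : S →+* k) (x : D) :
    (C.wproj j x : D) = C.ww k • C.th k (C.ep (j.comp C.bar)) • x := rfl

theorem coe_wproj' (j : S →+* k) (x : D) :
    (C.wproj j x : D) = C.th k (C.ep j) • C.ww k • x := by
  rw [coe_wproj, ww_smul_th_smul, br_ep, comp_bar_bar]

theorem generate_of_cyclic {m : D} (hm : ∀ x : D, ∃ a : Oₖ, x = a • m) (j : S →+* k) :
    Generate (C.T D j) (C.proj j m) (C.wproj j m) := by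
  intro v
  obtain ⟨a, ha⟩ := hm (v : D)
  obtain ⟨r0, r1, rfl⟩ := C.exists_eq_add a
  obtain ⟨f, hf⟩ := C.exists_aeval_T (D := D) j r0
  obtain ⟨g, hg⟩ := C.exists_aeval_T (D := D) j r1
  refine ⟨f, g, Subtype.ext ?_⟩
  rw [Submodule.coe_add, ← hf, ← hg, coe_proj, coe_wproj', ← C.mem_pc.mp v.2, ha]
  simp only [add_smul, smul_add, smul_smul, ← map_mul, ← mul_assoc, mul_comm]

theorem cyclic_of_generate {m : D}
    (h : ∀ j, Generate (C.T D j) (C.proj j m) (C.wproj j m)) (x : D) :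
    ∃ a : Oₖ, x = a • m := by
  choose f g hfg using fun j => h j (C.proj j x)
  refine ⟨∑ j, (C.th k (aeval (1 ⊗ₜ C.ϖ j : k ⊗[ℤ] S) (f j)) * C.th k (C.ep j) +
    C.th k (aeval (1 ⊗ₜ C.ϖ j : k ⊗[ℤ] S) (g j)) * C.th k (C.ep j) * C.ww k), ?_⟩
  rw [Finset.sum_smul]
  conv_lhs => rw [← C.sum_ep_smul x]
  refine sum_congr rfl fun j _ => ?_
  have := congrArg (fun y : C.pc D j => (y : D)) (hfg j)
  rw [coe_proj, Submodule.coe_add, coe_aeval_T, coe_aeval_T, coe_proj, coe_wproj'] at this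
  rw [this, add_smul, mul_smul, mul_smul, mul_smul]

end PC

section Exactness

theorem T_exact (hq : IsReduction p k O q) (j : S →+* k) (n : ℕ) (hn : n ≤ C.e j) (x : C.pc D j)
    (hx : (C.T D j ^ n) x = 0) : ∃ y, x = (C.T D j ^ (C.e j - n)) y := by
  obtain ⟨u, hu⟩ := C.exists_pow_mul_eq j
  set π : 𝕎 ⊗[ℤ] S := 1 ⊗ₜ C.ϖ j
  set ε := C.eps j
  have hε : ε * ε = ε := C.eps_mul_self j
  have hπ : π ^ n * π ^ (C.e j - n) = π ^ C.e j := by rw [← pow_add, Nat.add_sub_cancel' hn]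
  have hab : (π ^ n * ε + (1 - ε)) * (π ^ (C.e j - n) * u * ε + p * (1 - ε)) = p := by
    linear_combination (u * ε) * hπ + hu + (π ^ n * π ^ (C.e j - n) * u - π ^ n * p
      - π ^ (C.e j - n) * u + p) * hε
  obtain ⟨y, hy⟩ := hq.exact (a := C.th _ (π ^ n * ε + (1 - ε)))
    (b := C.th _ (π ^ (C.e j - n) * u * ε + p * (1 - ε)))
    (c := C.th _ (π ^ (C.e j - n) * u * ε + p * (1 - ε)))
    (by rw [← map_mul, hab, map_natCast]) (by rw [← map_mul, mul_comm, hab, map_natCast])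
    (x := (x : D)) (by
      rw [red_th, map_add, map_mul, map_pow, map_sub, map_one, red_tmul, map_one, map_add, add_smul,
        map_mul, map_sub, map_one, sub_smul, one_smul]
      change (C.th k ((1 ⊗ₜ C.ϖ j) ^ n) * C.th k (C.ep j)) • (x : D) + (x - C.th k (C.ep j) • (x : D)) = 0
      rw [mul_smul, C.mem_pc.mp x.2, sub_self, add_zero, ← coe_T_pow, hx]; rfl)
  have hred : red p k S (π ^ (C.e j - n) * u * ε + p * (1 - ε)) =
      (1 ⊗ₜ C.ϖ j) ^ (C.e j - n) * (red p k S u * C.ep j) := by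
    have h0 : (p : k ⊗[ℤ] S) = 0 := by
      rw [← map_natCast (algebraMap k (k ⊗[ℤ] S)), cast_eq_zero, map_zero]
    rw [map_add, map_mul, map_mul, map_mul, map_pow, map_natCast, h0, zero_mul, add_zero, red_tmul,
      map_one, mul_assoc]
    rfl
  refine ⟨C.proj j (C.th k (red p k S u) • y), Subtype.ext ?_⟩
  rw [coe_T_pow, coe_proj, hy, red_th, hred, smul_smul, smul_smul, ← map_mul, ← map_mul]
  congr 2; ring

theorem isReduction_of_cyclic [Free ℤ O] {m : D}
    (hm : Bijective fun a : Oₖ => a • m) :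
    IsReduction p k O (M := O𝕎) (D := D)
      ((AddMonoidHom.flip (smulAddHom Oₖ D) m).comp (red p k O).toAddMonoidHom) where
  surjective x := by
    obtain ⟨a, ha⟩ := hm.2 x
    obtain ⟨a, rfl⟩ := red_surjective p O a
    exact ⟨a, ha⟩
  eq_zero x hx := by
    have h1 : red p k O x = 0 := hm.1 (hx.trans (zero_smul Oₖ m).symm)
    obtain ⟨y, hy⟩ := (red_eq_zero_iff p x).mp h1
    exact ⟨y, by rw [hy, cast_smul_eq_nsmul]⟩
  map_nsmul x := by
    have : red p k O (p • x) = 0 := (red_eq_zero_iff p _).mpr ⟨x, by rw [cast_smul_eq_nsmul]⟩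
    change red p k O (p • x) • m = 0; rw [this]; exact zero_smul Oₖ m
  torsionFree x hx := isTorsionFree_witt_tensor p O (by rwa [cast_smul_eq_nsmul])
  map_smul a x := by
    change red p k O (a • x) • m = red p k O a • red p k O x • m
    rw [smul_eq_mul, map_mul, mul_smul]

end Exactness

section Dimension

open Polynomial

theorem ϖ_pow_mul_ep_ne_zero (j : S →+* k) {n : ℕ} (hn : n < C.e j) :
    (1 ⊗ₜ C.ϖ j : k ⊗[ℤ] S) ^ n * C.ep j ≠ 0 := by
  intro h
  obtain ⟨u, hu⟩ := C.exists_pow_mul_eq j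
  set π : 𝕎 ⊗[ℤ] S := 1 ⊗ₜ C.ϖ j with hπ
  have h1 : red p k S (π ^ n * C.eps j) = 0 := by
    rw [map_mul, map_pow, hπ, red_tmul, map_one]; exact h
  obtain ⟨y, hy⟩ := (red_eq_zero_iff p _).mp h1
  rw [cast_smul_eq_nsmul, nsmul_eq_mul] at hy
  have hpow : π ^ C.e j = π ^ n * π ^ (C.e j - n - 1) * π := by
    rw [mul_assoc, ← pow_succ, ← pow_add]; congr 1; omega
  -- `π ^ n` kills a unit multiple of the idempotent
  have h2 : π ^ n * (1 - π * (π ^ (C.e j - n - 1) * u * y)) * C.eps j = 0 := by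
    linear_combination C.eps j * hy + y * (-hu) +
      (u * y * C.eps j) * hpow - π ^ n * C.eps_mul_self j
  obtain ⟨v, hv⟩ := C.exists_mul_eq_eps (j := j)
    (x := 1 - π * (π ^ (C.e j - n - 1) * u * y)) (by
      rw [map_sub, map_one, map_mul, hπ, wchar_tmul, C.apply_ϖ, mul_zero, zero_mul, sub_zero]
      exact one_ne_zero)
  have h3 : π ^ n * C.eps j = 0 := by linear_combination v * h2 - π ^ n * hv
  have h4 : (p : 𝕎 ⊗[ℤ] S) * C.eps j = 0 := by
    linear_combination (π ^ (C.e j - n - 1) * π * u) * h3 - hu - (-u * C.eps j) * hpow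
  have h5 : C.eps j = 0 := isTorsionFree_witt_tensor p S (by
    rw [cast_smul_eq_nsmul, nsmul_eq_mul, h4])
  have := C.wchar_eps j j
  rw [h5, map_zero, if_pos rfl] at this; exact zero_ne_one this

theorem sum_e : ∑ j, C.e j = finrank ℤ S := by
  have hfin : FiniteDimensional k (k ⊗[ℤ] S) := inferInstance
  have h1 : finrank k (k ⊗[ℤ] S) = finrank ℤ S := finrank_baseChange
  let U : (S →+* k) → Submodule k (k ⊗[ℤ] S) := fun j => range (LinearMap.mulRight k (C.ep j))
  rw [← h1, finrank_eq_sum_of_projections U (fun j => LinearMap.mulRight k (C.ep j))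
    (fun j x => LinearMap.mem_range_self _ x) (by
      rintro j _ ⟨x, rfl⟩
      simp only [LinearMap.mulRight_apply, mul_assoc, ep_mul_self]) (by
      rintro i j h _ ⟨x, rfl⟩
      simp only [LinearMap.mulRight_apply, mul_assoc, C.ep_mul_of_ne h.symm, mul_zero]) (fun x => by
      simp only [LinearMap.mulRight_apply]; rw [← Finset.mul_sum, sum_ep, mul_one])]
  refine sum_congr rfl fun j _ => ?_
  let T0 : End k (k ⊗[ℤ] S) := Algebra.lmul k _ (1 ⊗ₜ C.ϖ j)
  have hT0 : ∀ f : k[X], ∀ x, aeval T0 f x = aeval (1 ⊗ₜ C.ϖ j : k ⊗[ℤ] S) f * x := fun f x => by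
    rw [aeval_algHom_apply (Algebra.lmul k (k ⊗[ℤ] S))]; rfl
  have hg : (T0 ^ C.e j) (C.ep j) = 0 := by
    have := hT0 (X ^ C.e j) (C.ep j)
    rw [aeval_X_pow, aeval_X_pow] at this; rw [this, ϖ_pow_mul_ep]
  let Ψ := evalQuot T0 hg
  have hΨ : range Ψ = U j := by
    ext x
    constructor
    · rintro ⟨c, rfl⟩
      obtain ⟨f, rfl⟩ := mk_surjective c
      exact ⟨aeval (1 ⊗ₜ C.ϖ j : k ⊗[ℤ] S) f, by simp only [Ψ]; rw [evalQuot_mk, hT0]; rfl⟩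
    · rintro ⟨r, rfl⟩
      obtain ⟨f, hf⟩ := C.exists_aeval_mul_ep j r
      exact ⟨Ideal.Quotient.mk _ f, by simp only [Ψ]; rw [evalQuot_mk, hT0, ← hf]; rfl⟩
  have hinj : Injective Ψ := by
    rw [injective_iff_map_eq_zero]
    intro c hc
    obtain ⟨f, rfl⟩ := mk_surjective c
    simp only [Ψ] at hc; rw [evalQuot_mk, hT0] at hc
    by_contra hne
    have hf0 : f ≠ 0 := by rintro rfl; exact hne (map_zero _)
    obtain ⟨n, g, rfl, hg0⟩ := exists_eq_X_pow_mul hf0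
    have hn : n < C.e j := by
      by_contra hcon
      exact hne (eq_zero_iff_mem.mpr (Ideal.mem_span_singleton.mpr
        (dvd_mul_of_dvd_left (pow_dvd_pow _ (not_lt.mp hcon)) g)))
    obtain ⟨v, hv⟩ := C.exists_mul_eq_ep (j := j) (x := aeval (1 ⊗ₜ C.ϖ j : k ⊗[ℤ] S) g) (by
      rw [← aeval_algHom_apply, charExt_tmul, C.apply_ϖ, mul_zero, ← coeff_zero_eq_aeval_zero]
      exact hg0)
    apply C.ϖ_pow_mul_ep_ne_zero j hn; rw [map_mul, aeval_X_pow] at hc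
    linear_combination v * hc - (1 ⊗ₜ C.ϖ j : k ⊗[ℤ] S) ^ n * hv
  rw [← hΨ, LinearMap.finrank_range_of_inj hinj, finrank_quotient_span_eq_natDegree, natDegree_X_pow]

theorem finrank_pc_le [FiniteDimensional k D] {j : S →+* k} {x y : C.pc D j}
    (h : Generate (C.T D j) x y) : finrank k (C.pc D j) ≤ 2 * C.e j := by
  have hx : (C.T D j ^ C.e j) x = 0 := by rw [T_pow_eq_zero]; rfl
  have hy : (C.T D j ^ C.e j) y = 0 := by rw [T_pow_eq_zero]; rfl
  have hs : Surjective ((evalQuot (C.T D j) hx).coprod (evalQuot (C.T D j) hy)) := by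
    intro v
    obtain ⟨f, g, rfl⟩ := h v
    exact ⟨(Ideal.Quotient.mk _ f, Ideal.Quotient.mk _ g), by
      rw [LinearMap.coprod_apply, evalQuot_mk, evalQuot_mk]⟩
  refine (LinearMap.finrank_le_finrank_of_surjective hs).trans ?_
  rw [Module.finrank_prod, finrank_quotient_span_eq_natDegree, natDegree_X_pow, two_mul]

theorem finrank_pc [FiniteDimensional k D] (hD : finrank k D = 2 * finrank ℤ S)
    (h : ∀ j, ∃ x y, Generate (C.T D j) x y) (j : S →+* k) :
    finrank k (C.pc D j) = 2 * C.e j := by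
  have h1 : ∀ j, finrank k (C.pc D j) ≤ 2 * C.e j := fun j => by
    obtain ⟨x, y, hxy⟩ := h j
    exact C.finrank_pc_le hxy
  have h2 : ∑ j, finrank k (C.pc D j) = ∑ j, 2 * C.e j := by
    rw [← finrank_eq_sum_pc, hD, ← C.sum_e, Finset.mul_sum]
  exact (Finset.sum_eq_sum_iff_of_le fun j _ => h1 j).mp h2 j (Finset.mem_univ j)

theorem bijective_of_cyclic [FiniteDimensional k D] [Module.Finite ℤ O] [Free ℤ O]
    (hD : finrank k D = finrank ℤ O) {m : D}
    (hm : ∀ x : D, ∃ a : Oₖ, x = a • m) :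
    Bijective fun a : Oₖ => a • m := by
  let f : Oₖ →ₗ[k] D := (toSpanSingleton Oₖ D m).restrictScalars k
  have hs : Surjective f := fun x => by
    obtain ⟨a, ha⟩ := hm x
    exact ⟨a, ha.symm⟩
  have h1 : finrank k Oₖ = finrank k D := by rw [hD, finrank_baseChange]
  exact ⟨(injective_iff_surjective_of_finrank_eq_finrank h1).mpr hs, hs⟩

end Dimension

end CyclicFrame

/-! ### The standard elements -/

namespace CyclicFrame

section Types

variable {p : ℕ} {k S O : Type*} [Field k] [CommRing S] [Ring O]
  {conj : O → O} (C : CyclicFrame p k S O conj)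

/-- A choice of one character in every pair of conjugate characters. -/
def Plus (j : S →+* k) : Prop := WellOrderingRel j (j.comp C.bar)

theorem plus_bar (j : S →+* k) : C.Plus (j.comp C.bar) ↔ ¬ C.Plus j := by
  rw [Plus, Plus, comp_bar_bar]
  constructor
  · exact fun h h' => (asymm h h')
  · intro h
    rcases trichotomous_of WellOrderingRel j (j.comp C.bar) with h1 | h1 | h1
    · exact absurd h1 h
    · exact absurd h1.symm (C.bar_ne j)
    · exact h1

/-- The admissible systems of pairs of exponents. -/
structure IsAdm (ε : (S →+* k) → ℕ × ℕ) : Prop where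
  bar_eq : ∀ j : S →+* k, ε (j.comp C.bar) = ε j
  le : ∀ j, (ε j).1 ≤ (ε j).2
  add : ∀ j, (ε j).1 + (ε j).2 = C.e j
  ramified : ∀ j : S →+* k, j C.β = 0 → (ε j).1 = C.e j / 2

open Classical in
/-- The exponent of the uniformizer in the standard element of type `ε`. -/
def mexp (ε : (S →+* k) → ℕ × ℕ) (j : S →+* k) : ℕ :=
  if j C.β = 0 then (ε j).1 else if C.Plus j then (ε j).1 else (ε j).2

open Classical in
/-- The exponent of `w` in the standard element of type `ε`. -/
def dexp (ε : (S →+* k) → ℕ × ℕ) (j : S →+* k) : ℕ := if j C.β = 0 then (ε j).2 - (ε j).1 else 1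

variable {C} {ε : (S →+* k) → ℕ × ℕ} {j : S →+* k}

theorem comp_bar_β : (j.comp C.bar) C.β = j C.β := by simp [C.bar_β]

theorem mexp_plus (hj : j C.β ≠ 0) (h : C.Plus j) : C.mexp ε j = (ε j).1 := by
  rw [mexp, if_neg hj, if_pos h]

theorem mexp_minus (hj : j C.β ≠ 0) (h : ¬ C.Plus j) : C.mexp ε j = (ε j).2 := by
  rw [mexp, if_neg hj, if_neg h]

theorem mexp_ramified (hj : j C.β = 0) : C.mexp ε j = (ε j).1 := by rw [mexp, if_pos hj]

theorem dexp_split (hj : j C.β ≠ 0) : C.dexp ε j = 1 := by rw [dexp, if_neg hj]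

theorem dexp_ramified (hj : j C.β = 0) : C.dexp ε j = (ε j).2 - (ε j).1 := by rw [dexp, if_pos hj]

theorem IsAdm.dexp_bar (h : C.IsAdm ε) : C.dexp ε (j.comp C.bar) = C.dexp ε j := by
  rw [dexp, dexp, comp_bar_β, h.bar_eq]

theorem IsAdm.mexp_add (h : C.IsAdm ε) (hj : j C.β ≠ 0) :
    C.mexp ε (j.comp C.bar) + C.mexp ε j = C.e j := by
  have hj' : (j.comp C.bar) C.β ≠ 0 := by rwa [comp_bar_β]
  by_cases hp : C.Plus j
  · rw [mexp_plus hj hp, mexp_minus hj' (by rw [plus_bar]; exact not_not.mpr hp), h.bar_eq, add_comm,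
      h.add]
  · rw [mexp_minus hj hp, mexp_plus hj' (by rwa [plus_bar]), h.bar_eq, h.add]

theorem IsAdm.mexp_dexp (h : C.IsAdm ε) (hj : j C.β = 0) :
    2 * C.mexp ε j + C.dexp ε j = C.e j := by
  have h1 := h.add j
  have h2 := h.le j
  rw [mexp_ramified hj, dexp_ramified hj]; omega

theorem IsAdm.dexp_le (h : C.IsAdm ε) (j : S →+* k) : C.dexp ε j ≤ 1 := by
  by_cases hj : j C.β = 0
  · have h1 := h.add j
    have h2 := h.ramified j hj
    rw [dexp_ramified hj]; omega
  · rw [dexp_split hj]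

theorem IsAdm.mexp_bar (h : C.IsAdm ε) (hj : j C.β = 0) : C.mexp ε (j.comp C.bar) = C.mexp ε j := by
  rw [mexp_ramified hj, mexp_ramified (by rwa [comp_bar_β]), h.bar_eq]

end Types

section Standard

/-- The standard element of type `ε` in `W ⊗ O`. -/
def zW (ε : (S →+* k) → ℕ × ℕ) : O𝕎 :=
  ∑ j, C.th _ ((1 ⊗ₜ C.ϖ j) ^ C.mexp ε j) * C.ww _ ^ C.dexp ε j * C.th _ (C.eps j)

/-- The standard element of type `ε` in `k ⊗ O`. -/
def z (ε : (S →+* k) → ℕ × ℕ) : Oₖ := red p k O (C.zW ε)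

theorem zW_mul_eps (ε : (S →+* k) → ℕ × ℕ) (j : S →+* k) : C.zW ε * C.th _ (C.eps j) =
    C.th _ ((1 ⊗ₜ C.ϖ j) ^ C.mexp ε j) * C.ww _ ^ C.dexp ε j * C.th _ (C.eps j) := by
  rw [zW, Finset.sum_mul, sum_eq_single j]
  · rw [mul_assoc, ← map_mul, eps_mul_self]
  · intro i _ hi
    rw [mul_assoc, ← map_mul, C.eps_complete.ortho hi, map_zero, mul_zero]
  · simp

theorem z_mul_ep (ε : (S →+* k) → ℕ × ℕ) (j : S →+* k) : C.z ε * C.th k (C.ep j) =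
    C.th k ((1 ⊗ₜ C.ϖ j) ^ C.mexp ε j) * C.ww k ^ C.dexp ε j * C.th k (C.ep j) := by
  have := congrArg (red p k O) (C.zW_mul_eps ε j)
  rw [map_mul, map_mul, map_mul, red_th, red_th, map_pow (red p k O),
    map_pow (red p k S), red_ww, red_tmul, map_one] at this
  exact this

variable {C} {ε : (S →+* k) → ℕ × ℕ}

open Classical in
theorem IsAdm.zW_sq_mul_eps (h : C.IsAdm ε) (j : S →+* k) :
    C.zW ε * C.zW ε * C.th _ (C.eps j) =
      C.th _ ((1 ⊗ₜ C.ϖ j) ^ C.e j * (if j C.β = 0 then 1 else 1 ⊗ₜ C.β) * C.eps j) := by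
  rw [mul_assoc, zW_mul_eps]
  have hd := h.dexp_le j
  rcases Nat.le_one_iff_eq_zero_or_eq_one.mp hd with hd | hd
  · rw [hd, pow_zero, mul_one, ← map_mul, mul_comm, map_mul, ← mul_assoc, zW_mul_eps, hd, pow_zero,
      mul_one, ← map_mul, ← map_mul]
    have hj : j C.β = 0 := by
      by_contra hj
      rw [dexp_split hj] at hd; exact one_ne_zero hd
    rw [if_pos hj, ← h.mexp_dexp hj, hd]
    congr 1; ring
  · have e1 : C.th _ ((1 ⊗ₜ C.ϖ j) ^ C.mexp ε j) * C.ww 𝕎 ^ C.dexp ε j *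
        C.th _ (C.eps j) = C.th _ (C.eps (j.comp C.bar)) *
          (C.th _ ((1 ⊗ₜ C.ϖ j) ^ C.mexp ε j) * C.ww _) := by
      rw [hd, pow_one, mul_assoc, ww_mul, br_eps, ← mul_assoc, ← mul_assoc, ← map_mul, ← map_mul,
        mul_comm]
    rw [e1, ← mul_assoc, zW_mul_eps, h.dexp_bar, hd, pow_one, C.ϖ_bar]
    have e2 : C.th _ ((1 ⊗ₜ C.ϖ j) ^ C.mexp ε (j.comp C.bar)) * C.ww 𝕎 *
        C.th _ (C.eps (j.comp C.bar)) * (C.th _ ((1 ⊗ₜ C.ϖ j) ^ C.mexp ε j) * C.ww _) =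
        C.th _ ((1 ⊗ₜ C.ϖ j) ^ (C.mexp ε (j.comp C.bar) + C.mexp ε j) * (1 ⊗ₜ C.β) * C.eps j) := by
      have e3 : C.ww 𝕎 * C.th _ (C.eps (j.comp C.bar)) *
          (C.th _ ((1 ⊗ₜ C.ϖ j) ^ C.mexp ε j) * C.ww _) =
          C.th _ (C.eps j * (1 ⊗ₜ C.ϖ j) ^ C.mexp ε j * (1 ⊗ₜ C.β)) := by
        rw [mul_assoc, ← mul_assoc (C.th _ (C.eps _)), ← map_mul, ← mul_assoc, ww_mul, map_mul,
          br_eps, comp_bar_bar, map_pow, br_ϖ, mul_assoc, ww_mul_ww, ← map_mul]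
      rw [mul_assoc (C.th _ _) (C.ww _), mul_assoc (C.th _ _), e3, ← map_mul]
      congr 1; ring
    rw [e2]
    by_cases hj : j C.β = 0
    · rw [if_pos hj, h.mexp_bar hj, ← two_mul, ← h.mexp_dexp hj, hd]
      congr 1
      have : (1 ⊗ₜ C.β : 𝕎 ⊗[ℤ] S) = 1 ⊗ₜ C.ϖ j := by rw [C.ϖ_eq j hj]
      rw [this]; ring
    · rw [if_neg hj, h.mexp_add hj]

theorem IsAdm.exists_zW_sq (h : C.IsAdm ε) : ∃ ζ η : 𝕎 ⊗[ℤ] S,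
    C.zW ε * C.zW ε = C.th _ ζ ∧ ζ * η = p ∧ red p k S ζ = 0 := by
  classical
  have hu : ∀ j : S →+* k, ∃ u, (1 ⊗ₜ C.ϖ j) ^ C.e j * (if j C.β = 0 then 1 else 1 ⊗ₜ C.β) * u * C.eps j
      = (p : 𝕎 ⊗[ℤ] S) * C.eps j := by
    intro j
    obtain ⟨u, hu⟩ := C.exists_pow_mul_eq j
    obtain ⟨y, hy⟩ := C.exists_mul_eq_eps (j := j)
      (x := if j C.β = 0 then (1 : 𝕎 ⊗[ℤ] S) else 1 ⊗ₜ C.β) (by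
        split_ifs with hj
        · simp
        · simpa using hj)
    exact ⟨y * u, by linear_combination ((1 ⊗ₜ C.ϖ j) ^ C.e j * u) * hy + hu⟩
  choose u hu using hu
  refine ⟨∑ j, (1 ⊗ₜ C.ϖ j) ^ C.e j * (if j C.β = 0 then 1 else 1 ⊗ₜ C.β) * C.eps j,
    ∑ j, u j * C.eps j, ?_, ?_, ?_⟩
  · have h1 : C.zW ε * C.zW ε = ∑ j, C.zW ε * C.zW ε * C.th _ (C.eps j) := by
      rw [← Finset.mul_sum, ← map_sum, C.eps_complete.complete, map_one, mul_one]
    rw [h1, map_sum]; exact sum_congr rfl fun j _ => h.zW_sq_mul_eps j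
  · rw [Finset.sum_mul_sum]
    have : ∀ i, ∑ j, (1 ⊗ₜ C.ϖ i) ^ C.e i * (if i C.β = 0 then 1 else 1 ⊗ₜ C.β) * C.eps i *
        (u j * C.eps j) = p * C.eps i := by
      intro i
      rw [sum_eq_single i]
      · rw [← hu]
        linear_combination ((1 ⊗ₜ C.ϖ i) ^ C.e i * (if i C.β = 0 then 1 else 1 ⊗ₜ C.β) * u i) *
          C.eps_mul_self i
      · intro j _ hj
        have h0 : C.eps i * C.eps j = 0 := C.eps_complete.ortho hj.symm
        linear_combination ((1 ⊗ₜ C.ϖ i) ^ C.e i * (if i C.β = 0 then 1 else 1 ⊗ₜ C.β) * u j) * h0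
      · simp
    rw [sum_congr rfl fun i _ => this i, ← Finset.mul_sum, C.eps_complete.complete, mul_one]
  · rw [map_sum]
    refine Finset.sum_eq_zero fun j _ => ?_
    have h0 := C.ϖ_pow_mul_ep j
    rw [map_mul, map_mul, map_pow, red_tmul, map_one]
    change _ * _ * C.ep j = 0; rw [mul_right_comm, h0, zero_mul]

theorem IsAdm.z_mul_z (h : C.IsAdm ε) : C.z ε * C.z ε = 0 := by
  obtain ⟨ζ, η, h1, -, h3⟩ := h.exists_zW_sq
  rw [z, ← map_mul, h1, red_th, h3, map_zero]

theorem IsAdm.exists_eq_mul_z [Free ℤ O] (h : C.IsAdm ε) {a : Oₖ}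
    (ha : a * C.z ε = 0) : ∃ b, a = b * C.z ε := by
  obtain ⟨ζ, η, h1, h2, -⟩ := h.exists_zW_sq
  obtain ⟨a, rfl⟩ := red_surjective p O a
  rw [z, ← map_mul] at ha
  obtain ⟨y, hy⟩ := (red_eq_zero_iff p _).mp ha
  rw [cast_smul_eq_nsmul, nsmul_eq_mul] at hy
  refine ⟨red p k O (y * C.th _ η), ?_⟩
  rw [z, ← map_mul, ← sub_eq_zero, ← map_sub]
  have h4 : C.th _ η * (C.zW ε * C.zW ε) = p := by rw [h1, ← map_mul, mul_comm, h2, map_natCast]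
  have h3 : (a - y * C.th _ η * C.zW ε) * C.zW ε = 0 := by
    rw [sub_mul, hy, mul_assoc, mul_assoc, h4, Nat.cast_comm, sub_self]
  have h5 : C.zW ε * (C.zW ε * C.th _ η) = p := by rw [← mul_assoc, h1, ← map_mul, h2, map_natCast]
  have h6 := congrArg (· * (C.zW ε * C.th _ η)) h3
  simp only [zero_mul] at h6
  rw [mul_assoc, h5, ← Nat.cast_comm, ← nsmul_eq_mul, ← cast_smul_eq_nsmul 𝕎] at h6
  rw [isTorsionFree_witt_tensor p O h6, map_zero]

theorem z_smul_of_mem {j : S →+* k} {x : D} (hx : x ∈ C.pc D j) : C.z ε • x =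
    C.th k ((1 ⊗ₜ C.ϖ j) ^ C.mexp ε j) • C.ww k ^ C.dexp ε j • x := by
  rw [← C.mem_pc.mp hx, smul_smul, z_mul_ep, mul_smul, mul_smul]

theorem z_smul_split {j : S →+* k} (hj : j C.β ≠ 0) {x : D} (hx : x ∈ C.pc D j) : C.z ε • x =
    C.th k ((1 ⊗ₜ C.ϖ j) ^ C.mexp ε j) • C.ww k • x := by
  rw [z_smul_of_mem hx, dexp_split hj, pow_one]

theorem ww_pow_two_mul (K : Type*) [CommRing K] {j : S →+* k} (hj : j C.β = 0) (n : ℕ) :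
    C.ww K ^ (2 * n) = C.th K ((1 ⊗ₜ C.ϖ j) ^ n) := by
  rw [pow_mul, pow_two, ww_mul_ww, ← map_pow, C.ϖ_eq j hj]

end Standard

end CyclicFrame

variable {C}

/-! ### Skew-Hermitian forms and stable subspaces -/

namespace CyclicFrame

variable (C) in
/-- Perfect alternating skew-Hermitian forms. -/
structure IsSkewForm (ψ : BilinForm k D) : Prop where
  alt : ψ.IsAlt
  nondeg : ∀ x, (∀ y, ψ x y = 0) → x = 0
  adj : ∀ (a : Oₖ) x y, ψ (a • x) y = ψ x (C.cj k a • y)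

section Form

variable {ψ : BilinForm k D} (hψ : C.IsSkewForm ψ)

include hψ

theorem IsSkewForm.skew (x y : D) : ψ x y = -ψ y x := (LinearMap.IsAlt.neg hψ.alt y x).symm

theorem IsSkewForm.adj_th (r : k ⊗[ℤ] S) (x y : D) :
    ψ (C.th k r • x) y = ψ x (C.th k (C.br k r) • y) := by
  rw [hψ.adj, cj_th]

theorem IsSkewForm.adj_ww (x y : D) : ψ (C.ww k • x) y = -ψ x (C.ww k • y) := by
  rw [hψ.adj, cj_ww, neg_smul, map_neg]

theorem IsSkewForm.pc_orth {j j' : S →+* k} (h : j' ≠ j.comp C.bar) {x y : D} (hx : x ∈ C.pc D j)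
    (hy : y ∈ C.pc D j') : ψ x y = 0 := by
  rw [← C.mem_pc.mp hx, hψ.adj_th, br_ep, C.ep_smul_eq_zero h.symm hy, map_zero]

theorem IsSkewForm.eq_zero_of_pc {j : S →+* k} {x : D} (hx : x ∈ C.pc D j)
    (h : ∀ y ∈ C.pc D (j.comp C.bar), ψ x y = 0) : x = 0 := by
  refine hψ.nondeg x fun y => ?_
  rw [← C.mem_pc.mp hx, hψ.adj_th, br_ep]; exact h _ (C.ep_smul_mem _ y)

theorem IsSkewForm.adj_ww_pow (n : ℕ) (x y : D) :
    ψ (C.ww k ^ n • x) y = (-1) ^ n * ψ x (C.ww k ^ n • y) := by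
  induction n generalizing x with
  | zero => simp
  | succ n ih => rw [pow_succ, mul_smul, ih, hψ.adj_ww, smul_smul, ← pow_succ', pow_succ, pow_succ]; ring

/-- The symmetric form on the component at `j`. -/
def phi (ψ : BilinForm k D) (j : S →+* k) : BilinForm k (C.pc D j) :=
  LinearMap.mk₂ k (fun x y => ψ (x : D) (C.ww k • (y : D))) (by simp) (by simp)
    (by simp [smul_add]) (fun c x y => by rw [Submodule.coe_smul, smul_comm, map_smul])

omit hψ in
theorem phi_apply (j : S →+* k) (x y : C.pc D j) : phi ψ j x y = ψ (x : D) (C.ww k • (y : D)) := rfl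

theorem IsSkewForm.phi_symm (j : S →+* k) (x y : C.pc D j) : phi ψ j x y = phi ψ j y x := by
  rw [phi_apply, phi_apply, hψ.skew, hψ.adj_ww, neg_neg]

theorem IsSkewForm.phi_adj (j : S →+* k) (x y : C.pc D j) :
    phi ψ j (C.T D j x) y = phi ψ j x (C.T D j y) := by
  rw [phi_apply, phi_apply, coe_T, coe_T, hψ.adj_th, br_ϖ, ww_smul_th_smul, br_ϖ]

end Form

section Split

variable {j : S →+* k}

theorem exists_β_inv (hj : j C.β ≠ 0) : ∃ b : k ⊗[ℤ] S, b * (1 ⊗ₜ C.β) * C.ep j = C.ep j :=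
  C.exists_mul_eq_ep (by simpa using hj)

theorem exists_β_smul (hj : j C.β ≠ 0) :
    ∃ b : k ⊗[ℤ] S, ∀ x ∈ C.pc D j, C.th k b • C.th k (1 ⊗ₜ C.β) • x = x := by
  obtain ⟨b, hb⟩ := exists_β_inv hj
  refine ⟨b, fun x hx => ?_⟩
  conv_lhs => rw [← C.mem_pc.mp hx, smul_smul, smul_smul, ← map_mul, ← map_mul, hb,
    C.mem_pc.mp hx]

theorem exists_ww_smul_eq (hj : j C.β ≠ 0) {y : D} (hy : y ∈ C.pc D j) :
    ∃ x ∈ C.pc D (j.comp C.bar), C.ww k • x = y := by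
  obtain ⟨b, hb⟩ := exists_β_smul (D := D) hj
  refine ⟨C.ww k • C.th k b • y, C.ww_smul_mem (C.th_smul_mem _ hy), ?_⟩
  rw [ww_smul_ww_smul, smul_smul, ← map_mul, mul_comm, map_mul, ← smul_smul, hb y hy]

theorem IsSkewForm.phi_nondeg {ψ : BilinForm k D} (hψ : C.IsSkewForm ψ)
    (hj : j C.β ≠ 0) (x : C.pc D j) (h : ∀ y, phi ψ j x y = 0) : x = 0 := by
  refine Subtype.ext (hψ.eq_zero_of_pc x.2 fun y hy => ?_)
  obtain ⟨y', hy', rfl⟩ := exists_ww_smul_eq (j := j.comp C.bar) (by rwa [comp_bar_β]) hy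
  rw [comp_bar_bar] at hy'; exact h ⟨y', hy'⟩

end Split

section Stable

theorem generate_iff {j : S →+* k} {x y : C.pc D j} : Generate (C.T D j) x y ↔
    ∀ v ∈ C.pc D j, ∃ r s : k ⊗[ℤ] S, v = C.th k r • (x : D) + C.th k s • (y : D) := by
  constructor
  · intro h v hv
    obtain ⟨f, g, hfg⟩ := h ⟨v, hv⟩
    have := congrArg (fun y : C.pc D j => (y : D)) hfg
    rw [Submodule.coe_add, coe_aeval_T, coe_aeval_T] at this; exact ⟨_, _, this⟩
  · intro h v
    obtain ⟨r, s, hv⟩ := h v v.2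
    obtain ⟨f, hf⟩ := C.exists_aeval_T (D := D) j r
    obtain ⟨g, hg⟩ := C.exists_aeval_T (D := D) j s
    exact ⟨f, g, Subtype.ext (by rw [hv, Submodule.coe_add, hf, hg])⟩

theorem exists_generator_of_components (x y : ∀ j : S →+* k, C.pc D j)
    (hxy : ∀ j : S →+* k, j C.β ≠ 0 → C.Plus j → Generate (C.T D j) (x j) (y j))
    (hr : ∀ j : S →+* k, j C.β = 0 →
      Generate (C.T D j) (x j) ⟨C.ww k • (x (j.comp C.bar) : D), C.ww_smul_mem' (x _).2⟩) :
    ∃ m : D, (∀ x : D, ∃ a : Oₖ, x = a • m) ∧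
      ∀ j : S →+* k, j C.β ≠ 0 → C.Plus j → C.proj j m = x j ∧ C.wproj j m = y j := by
  classical
  have hμ : ∀ j : S →+* k, ∃ μ ∈ C.pc D j, (j C.β = 0 → μ = x j) ∧
      (j C.β ≠ 0 → C.Plus j → μ = x j) ∧
      (j C.β ≠ 0 → ¬ C.Plus j → C.ww k • μ = y (j.comp C.bar)) := by
    intro j
    by_cases hj : j C.β = 0
    · exact ⟨_, (x j).2, fun _ => rfl, fun h => absurd hj h, fun h => absurd hj h⟩
    by_cases hp : C.Plus j
    · exact ⟨_, (x j).2, fun h => absurd h hj, fun _ _ => rfl, fun _ h => absurd hp h⟩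
    · obtain ⟨u, hu, hu'⟩ := exists_ww_smul_eq (j := j.comp C.bar) (by rwa [comp_bar_β])
        (y (j.comp C.bar)).2
      rw [comp_bar_bar] at hu
      exact ⟨u, hu, fun h => absurd h hj, fun _ h => absurd h hp, fun _ _ => hu'⟩
  choose μ hμ1 hμ2 hμ3 hμ4 using hμ
  have hproj : ∀ j, C.th k (C.ep j) • ∑ i, μ i = μ j := by
    intro j
    rw [Finset.smul_sum, sum_eq_single j]
    · exact hμ1 j
    · exact fun i _ hi => C.ep_smul_eq_zero hi.symm (hμ1 i)
    · simp
  have hplus : ∀ j : S →+* k, j C.β ≠ 0 → C.Plus j →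
      C.proj j (∑ i, μ i) = x j ∧ C.wproj j (∑ i, μ i) = y j := by
    intro j hj hp
    refine ⟨Subtype.ext ?_, Subtype.ext ?_⟩
    · rw [coe_proj, hproj, hμ3 j hj hp]
    · rw [coe_wproj, hproj, hμ4 _ (by rwa [comp_bar_β]) (by rw [plus_bar]; exact not_not.mpr hp),
        comp_bar_bar]
  refine ⟨∑ i, μ i, C.cyclic_of_generate fun j => ?_, hplus⟩
  by_cases hj : j C.β = 0
  · have h1 : C.proj j (∑ i, μ i) = x j := Subtype.ext (by
      rw [coe_proj, hproj, hμ2 j hj])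
    have h2 : C.wproj j (∑ i, μ i) = ⟨C.ww k • (x (j.comp C.bar) : D), C.ww_smul_mem' (x _).2⟩ :=
      Subtype.ext (by rw [coe_wproj, hproj, hμ2 _ (by rwa [comp_bar_β])])
    rw [h1, h2]; exact hr j hj
  by_cases hp : C.Plus j
  · rw [(hplus j hj hp).1, (hplus j hj hp).2]; exact hxy j hj hp
  · rw [generate_iff]
    intro v hv
    have hj' : (j.comp C.bar) C.β ≠ 0 := by rwa [comp_bar_β]
    have hp' : C.Plus (j.comp C.bar) := by rwa [plus_bar]
    obtain ⟨b, hb⟩ := exists_β_smul (D := D) hj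
    obtain ⟨r, s, h⟩ := generate_iff.mp (hxy _ hj' hp') _ (C.ww_smul_mem hv)
    refine ⟨b * (C.br k s * (1 ⊗ₜ C.β)), b * C.br k r, ?_⟩
    rw [coe_proj, coe_wproj, hproj, hproj, hμ3 _ hj' hp', ← hb v hv, ← ww_smul_ww_smul, h, smul_add,
      ww_smul_th_smul, ww_smul_th_smul, ← hμ4 j hj hp, ww_smul_ww_smul]
    simp only [smul_add, smul_smul, map_mul, mul_assoc]; rw [add_comm]

theorem exists_generator {m₀ : D} (hm₀ : ∀ x : D, ∃ a : Oₖ, x = a • m₀)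
    (x y : ∀ j : S →+* k, C.pc D j)
    (hxy : ∀ j : S →+* k, j C.β ≠ 0 → C.Plus j → Generate (C.T D j) (x j) (y j)) :
    ∃ m : D, (∀ x : D, ∃ a : Oₖ, x = a • m) ∧
      ∀ j : S →+* k, j C.β ≠ 0 → C.Plus j → C.proj j m = x j ∧ C.wproj j m = y j := by
  classical
  let x' : ∀ j : S →+* k, C.pc D j := fun j => if j C.β = 0 then C.proj j m₀ else x j
  have h1 : ∀ j : S →+* k, j C.β ≠ 0 → x' j = x j := fun j hj => if_neg hj
  have h2 : ∀ j : S →+* k, j C.β = 0 → x' j = C.proj j m₀ := fun j hj => if_pos hj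
  obtain ⟨m, hm, hm'⟩ := exists_generator_of_components x' y
    (fun j hj hp => by rw [h1 j hj]; exact hxy j hj hp) fun j hj => by
      rw [h2 j hj]
      convert C.generate_of_cyclic hm₀ j using 1
      exact Subtype.ext (congrArg (fun z : C.pc D (j.comp C.bar) => C.ww k • (z : D))
        (h2 _ (by rwa [comp_bar_β])))
  exact ⟨m, hm, fun j hj hp => by rw [← h1 j hj]; exact hm' j hj hp⟩

theorem le_of_components {N N' : Submodule k D} (hN : ∀ (a : Oₖ), ∀ x ∈ N, a • x ∈ N)
    (hN' : ∀ (a : Oₖ), ∀ x ∈ N', a • x ∈ N')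
    (hs : ∀ j : S →+* k, j C.β ≠ 0 → C.Plus j → ∀ x ∈ C.pc D j, x ∈ N → x ∈ N')
    (hr : ∀ j : S →+* k, j C.β = 0 → ∀ x ∈ C.pc D j, x ∈ N → x ∈ N') : N ≤ N' := by
  intro x hx
  rw [← C.sum_ep_smul x]
  refine Submodule.sum_mem _ fun j _ => ?_
  have h1 := hN (C.th k (C.ep j)) x hx
  have h2 := C.ep_smul_mem j x
  by_cases hj : j C.β = 0
  · exact hr j hj _ h2 h1
  by_cases hp : C.Plus j
  · exact hs j hj hp _ h2 h1
  · have h3 := hs (j.comp C.bar) (by rwa [comp_bar_β]) (by rwa [plus_bar]) _ (C.ww_smul_mem h2)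
      (hN _ _ h1)
    obtain ⟨b, hb⟩ := exists_β_smul (D := D) hj
    rw [← hb _ h2, ← ww_smul_ww_smul]; exact hN' _ _ (hN' _ _ h3)

theorem exists_mul_ww_pow (a : Oₖ) (n : ℕ) : ∃ a', a * C.ww k ^ n = C.ww k ^ n * a' := by
  induction n with
  | zero => exact ⟨a, by simp⟩
  | succ n ih =>
    obtain ⟨a', ha'⟩ := ih
    obtain ⟨r0, r1, rfl⟩ := C.exists_eq_add a'
    refine ⟨C.th k (C.br k r0) + C.th k (C.br k r1) * C.ww k, ?_⟩
    rw [pow_succ, ← mul_assoc, ha', mul_assoc, mul_assoc, add_mul, mul_add, th_mul_ww, th_mul_ww,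
      mul_assoc]
    simp only [mul_add]

theorem exists_ww_pow_mul (a : Oₖ) (n : ℕ) : ∃ a', C.ww k ^ n * a = a' * C.ww k ^ n := by
  induction n with
  | zero => exact ⟨a, by simp⟩
  | succ n ih =>
    obtain ⟨a', ha'⟩ := ih
    obtain ⟨r0, r1, rfl⟩ := C.exists_eq_add a'
    refine ⟨C.th k (C.br k r0) + C.th k (C.br k r1) * C.ww k, ?_⟩
    rw [pow_succ', mul_assoc, ha', ← mul_assoc, ← mul_assoc, mul_add, add_mul (C.th k _), ww_mul,
      ← mul_assoc, ww_mul]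

theorem IsSkewForm.isotropic_of_components {ψ : BilinForm k D} (hψ : C.IsSkewForm ψ)
    {N : Submodule k D} (hN : ∀ (a : Oₖ), ∀ x ∈ N, a • x ∈ N)
    (hs : ∀ j : S →+* k, j C.β ≠ 0 → C.Plus j → ∀ x ∈ C.pc D j, ∀ y ∈ C.pc D j, x ∈ N → y ∈ N →
      ψ x (C.ww k • y) = 0)
    (hr : ∀ j : S →+* k, j C.β = 0 → ∀ x ∈ C.pc D j, x ∈ N → ∃ y, x = C.ww k ^ C.e j • y) :
    ∀ x ∈ N, ∀ y ∈ N, ψ x y = 0 := by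
  have key : ∀ j : S →+* k, (j C.β ≠ 0 → C.Plus j) → ∀ x ∈ C.pc D j, x ∈ N →
      ∀ y ∈ C.pc D (j.comp C.bar), y ∈ N → ψ x y = 0 := by
    intro j hj x hx hxN y hy hyN
    by_cases h : j C.β = 0
    · obtain ⟨x', hx'⟩ := hr j h x hx hxN
      obtain ⟨y', hy'⟩ := hr _ (by rwa [comp_bar_β]) y hy hyN
      have e1 : y = C.ww k ^ C.e j • C.th k (C.ep j + C.ep (j.comp C.bar)) • y' := by
        have h1 : C.th k (C.ep j + C.ep (j.comp C.bar)) • y = y := by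
          rw [map_add, add_smul, C.ep_smul_eq_zero (C.bar_ne j).symm hy, zero_add]; exact hy
        have h2 : ∀ n : ℕ, C.th k (C.ep j + C.ep (j.comp C.bar)) * C.ww k ^ n =
            C.ww k ^ n * C.th k (C.ep j + C.ep (j.comp C.bar)) := by
          intro n
          induction n with
          | zero => simp
          | succ n ih => rw [pow_succ, ← mul_assoc, ih, mul_assoc, th_mul_ww, map_add, br_ep, br_ep,
              comp_bar_bar, add_comm, mul_assoc]
        rw [← h1, hy', C.e_bar, smul_smul, h2, mul_smul]
      rw [hx', hψ.adj_ww_pow, e1, smul_smul, ← pow_add, ← two_mul, ww_pow_two_mul k h, smul_smul,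
        ← map_mul, mul_add]
      have h3 := C.ϖ_pow_mul_ep j
      have h4 := C.ϖ_pow_mul_ep (j.comp C.bar)
      rw [C.ϖ_bar, C.e_bar] at h4; rw [h3, h4, add_zero, map_zero]
      simp [show (0 : Oₖ) • y' = 0 from zero_smul Oₖ y']
    · have hj' : (j.comp C.bar) C.β ≠ 0 := by rwa [comp_bar_β]
      obtain ⟨b, hb⟩ := exists_β_smul (D := D) hj'
      rw [← hb y hy, ← ww_smul_ww_smul, th_smul_ww_smul]
      refine hs j h (hj h) x hx _ ?_ hxN (hN _ _ (hN _ _ hyN))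
      exact C.th_smul_mem _ (C.ww_smul_mem' hy)
  intro x hx y hy
  rw [← C.sum_ep_smul x, map_sum, LinearMap.sum_apply]
  refine Finset.sum_eq_zero fun j _ => ?_
  rw [← C.mem_pc.mp (C.ep_smul_mem j x), hψ.adj_th, br_ep]
  by_cases hj : j C.β ≠ 0 → C.Plus j
  · exact key j hj _ (C.ep_smul_mem j x) (hN _ _ hx) _ (C.ep_smul_mem _ y) (hN _ _ hy)
  · rw [hψ.skew, neg_eq_zero]
    push Not at hj
    refine key (j.comp C.bar) (fun _ => by rw [plus_bar]; exact hj.2) _ (C.ep_smul_mem _ y) (hN _ _ hy)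
      _ ?_ (hN _ _ hx)
    rw [comp_bar_bar]; exact C.ep_smul_mem j x

end Stable

end CyclicFrame

/-! ### Lagrangian subspaces -/

theorem corner_mul {A : Type*} [Ring A] {G x y : A} {P : ℕ} (hG : G * G = G) (hy : G * y = y * G)
    (hxy : x * y * G = P * G) : (x * G + (1 - G)) * (y * G + P * (1 - G)) = P := by
  have h1 : x * G * (y * G) = P * G := by
    rw [mul_assoc, ← mul_assoc G, hy, mul_assoc y, hG, ← mul_assoc, hxy]
  have h2 : x * G * (P * (1 - G)) = 0 := by
    rw [← mul_assoc, mul_assoc x, ← Nat.cast_comm, ← mul_assoc, mul_assoc, mul_sub, mul_one, hG,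
      sub_self, mul_zero]
  have h3 : (1 - G) * (y * G) = 0 := by
    rw [sub_mul, one_mul, ← mul_assoc, hy, mul_assoc, hG, sub_self]
  have h4 : (1 - G) * (P * (1 - G)) = P * (1 - G) := by
    rw [← mul_assoc, ← Nat.cast_comm, mul_assoc, mul_sub (1 - G), mul_one, sub_mul, one_mul, hG,
      sub_self, sub_zero]
  rw [add_mul, mul_add, mul_add, h1, h2, h3, h4, mul_sub, mul_one]; abel

theorem corner_mul' {A : Type*} [Ring A] {G x y : A} {P : ℕ} (hG : G * G = G) (hy : G * y = y * G)
    (hxy : x * y * G = P * G) : (x * G + P * (1 - G)) * (y * G + (1 - G)) = P := by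
  have h1 : x * G * (y * G) = P * G := by
    rw [mul_assoc, ← mul_assoc G, hy, mul_assoc y, hG, ← mul_assoc, hxy]
  have h2 : x * G * (1 - G) = 0 := by rw [mul_assoc, mul_sub, mul_one, hG, sub_self, mul_zero]
  have h3 : P * (1 - G) * (y * G) = 0 := by
    rw [mul_assoc, sub_mul, one_mul, ← mul_assoc, hy, mul_assoc, hG, sub_self, mul_zero]
  have h4 : P * (1 - G) * (1 - G) = P * (1 - G) := by
    rw [mul_assoc, mul_sub (1 - G), mul_one, sub_mul, one_mul, hG, sub_self, sub_zero]
  rw [add_mul, mul_add, mul_add, h1, h2, h3, h4, mul_sub, mul_one]; abel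

namespace CyclicFrame

section Ramified

theorem ww_exact (hq : IsReduction p k O q) {j : S →+* k} (hj : j C.β = 0) (n : ℕ)
    (hn : n ≤ 2 * C.e j) {x : D} (hx : x ∈ C.pc D j) (h : C.ww k ^ n • x = 0) :
    ∃ y, x = C.ww k ^ (2 * C.e j - n) • y := by
  obtain ⟨u, hu⟩ := C.exists_pow_mul_eq j
  obtain ⟨u', hu'⟩ := C.exists_pow_mul_eq (j.comp C.bar)
  rw [C.ϖ_bar, C.e_bar] at hu'
  set π : 𝕎 ⊗[ℤ] S := 1 ⊗ₜ C.ϖ j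
  have h1 := C.eps_mul_self j
  have h2 := C.eps_mul_self (j.comp C.bar)
  have h3 : C.eps j * C.eps (j.comp C.bar) = 0 := C.eps_complete.ortho (C.bar_ne j).symm
  set g : 𝕎 ⊗[ℤ] S := C.eps j + C.eps (j.comp C.bar) with hg
  set v : 𝕎 ⊗[ℤ] S := u * C.eps j + u' * C.eps (j.comp C.bar) with hv
  have hgg : g * g = g := by rw [hg]; linear_combination h1 + h2 + 2 * h3
  have hvg : π ^ C.e j * v * g = p * g := by
    rw [hv, hg]
    linear_combination (π ^ C.e j * u) * h1 + (π ^ C.e j * u') * h2 +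
      (π ^ C.e j * u + π ^ C.e j * u') * h3 + hu + hu'
  have hbg : C.br _ g = g := by rw [hg, map_add, br_eps, br_eps, comp_bar_bar, add_comm]
  set G := C.th 𝕎 g with hG
  have hGG : G * G = G := by rw [hG, ← map_mul, hgg]
  have hGw : ∀ n : ℕ, G * C.ww _ ^ n = C.ww _ ^ n * G := by
    intro n
    induction n with
    | zero => simp
    | succ n ih => rw [pow_succ, ← mul_assoc, ih, mul_assoc, hG, th_mul_ww, hbg, mul_assoc]
  have hpw : C.ww 𝕎 ^ (2 * C.e j) = C.th _ (π ^ C.e j) := ww_pow_two_mul _ hj _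
  have hab : (C.ww _ ^ n * G + (1 - G)) * (C.ww _ ^ (2 * C.e j - n) * C.th _ v * G +
        ((p : ℕ) : O𝕎) * (1 - G)) = ((p : ℕ) : O𝕎) := by
    refine corner_mul hGG ?_ ?_
    · rw [← mul_assoc, hGw, mul_assoc, hG, ← map_mul, mul_comm g v, map_mul, mul_assoc]
    · rw [← mul_assoc, ← pow_add, Nat.add_sub_cancel' hn, hpw, ← map_mul, hG, ← map_mul, hvg, map_mul,
        map_natCast]
  have hca : (C.th _ v * C.ww _ ^ (2 * C.e j - n) * G +
        ((p : ℕ) : O𝕎) * (1 - G)) * (C.ww _ ^ n * G + (1 - G)) =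
          ((p : ℕ) : O𝕎) := by
    refine corner_mul' hGG (hGw n) ?_
    rw [mul_assoc (C.th _ v), ← pow_add, Nat.sub_add_cancel hn, hpw, ← map_mul, hG, ← map_mul,
      mul_comm v, hvg, map_mul, map_natCast]
  have hredG : red p k O G = C.th k (C.ep j + C.ep (j.comp C.bar)) := by
    rw [hG, red_th, hg, map_add]; rfl
  have hGx : red p k O G • x = x := by
    rw [hredG, map_add, add_smul, C.ep_smul_eq_zero (C.bar_ne j) hx, add_zero]; exact hx
  obtain ⟨y, hy⟩ := hq.exact hab hca (x := x) (by
    rw [map_add, map_mul, map_sub, map_one, map_pow, red_ww, add_smul, mul_smul, hGx, h, sub_smul,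
      one_smul, hGx, sub_self, add_zero])
  refine ⟨red p k O (C.th _ v * G) • y, ?_⟩
  have h0 : (p : Oₖ) = 0 := by rw [← map_natCast (algebraMap k Oₖ), cast_eq_zero, map_zero]
  rw [hy, smul_smul, map_add, map_mul (red p k O) (p : _ ⊗[ℤ] O), map_natCast, h0, zero_mul, add_zero,
    mul_assoc, map_mul, map_pow, red_ww]

theorem IsSkewForm.mem_iff_ramified (hq : IsReduction p k O q) {ψ : BilinForm k D}
    (hψ : C.IsSkewForm ψ) {m₀ : D} (hm₀ : ∀ x : D, ∃ a : Oₖ, x = a • m₀)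
    {N : Submodule k D} (hN : ∀ (a : Oₖ), ∀ x ∈ N, a • x ∈ N)
    (hNN : ∀ x, x ∈ N ↔ ∀ y ∈ N, ψ x y = 0) {j : S →+* k} (hj : j C.β = 0) {x : D}
    (hx : x ∈ C.pc D j) : x ∈ N ↔ ∃ y, x = C.ww k ^ C.e j • y := by
  classical
  have hcomm : ∀ (n : ℕ) (j : S →+* k), ∃ j' : S →+* k, (j' = j ∨ j' = j.comp C.bar) ∧
      C.th k (C.ep j) * C.ww k ^ n = C.ww k ^ n * C.th k (C.ep j') := by
    intro n
    induction n with
    | zero => exact fun j => ⟨j, Or.inl rfl, by simp⟩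
    | succ n ih =>
      intro j
      obtain ⟨j', hj', h⟩ := ih (j.comp C.bar)
      refine ⟨j', ?_, ?_⟩
      · rw [comp_bar_bar] at hj'; exact hj'.symm
      · rw [pow_succ', ← mul_assoc, th_mul_ww, br_ep, mul_assoc, h, mul_assoc]
  have hw0 : ∀ x ∈ C.pc D j, C.ww k ^ (2 * C.e j) • x = 0 := fun x hx => by
    rw [ww_pow_two_mul k hj, ← C.mem_pc.mp hx, smul_smul, ← map_mul, ϖ_pow_mul_ep, map_zero]
    exact zero_smul Oₖ x
  have hw0' : ∀ x ∈ C.pc D (j.comp C.bar), C.ww k ^ (2 * C.e j) • x = 0 := fun x hx => by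
    have := C.ϖ_pow_mul_ep (j.comp C.bar)
    rw [C.ϖ_bar, C.e_bar] at this
    rw [ww_pow_two_mul k hj, ← C.mem_pc.mp hx, smul_smul, ← map_mul, this, map_zero]
    exact zero_smul Oₖ x
  have hβ : ∀ j' : S →+* k, (j' = j ∨ j' = j.comp C.bar) → j' C.β = 0 := by
    rintro j' (rfl | rfl)
    · exact hj
    · rwa [comp_bar_β]
  have he : ∀ j' : S →+* k, (j' = j ∨ j' = j.comp C.bar) → C.e j' = C.e j := by
    rintro j' (rfl | rfl)
    · rfl
    · rw [C.e_bar]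
  have hw1 : ∀ j' : S →+* k, (j' = j ∨ j' = j.comp C.bar) → ∀ x ∈ C.pc D j',
      C.ww k ^ (2 * C.e j) • x = 0 := by
    rintro j' (rfl | rfl)
    · exact hw0
    · exact hw0'
  have hfwd : ∀ j' : S →+* k, (j' = j ∨ j' = j.comp C.bar) → ∀ y ∈ C.pc D j', y ∈ N →
      ∃ y', y = C.ww k ^ C.e j • y' := by
    intro j₁ hj₁ y hy hyN
    let P : ℕ → Prop := fun n => ∃ y', y = C.ww k ^ n • y'
    have hP0 : P 0 := ⟨y, by simp⟩
    obtain ⟨y', hy'⟩ : P (Nat.findGreatest P (2 * C.e j)) := Nat.findGreatest_spec (Nat.zero_le _) hP0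
    set n := Nat.findGreatest P (2 * C.e j) with hn
    by_cases hne : C.e j ≤ n
    · exact ⟨C.ww k ^ (n - C.e j) • y', by rw [smul_smul, ← pow_add, Nat.add_sub_cancel' hne, hy']⟩
    exfalso
    have hgr : ¬ P (n + 1) := Nat.findGreatest_is_greatest (Nat.lt_succ_self _) (by omega)
    obtain ⟨j', hj', hcm⟩ := hcomm n j₁
    have hj'' : j' = j ∨ j' = j.comp C.bar := by
      rcases hj₁ with rfl | rfl
      · exact hj'
      · rw [comp_bar_bar] at hj'; exact hj'.symm
    set x' := C.th k (C.ep j') • y' with hx'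
    have hx'pc : x' ∈ C.pc D j' := C.ep_smul_mem j' y'
    have hyx : y = C.ww k ^ n • x' := by rw [hx', smul_smul, ← hcm, mul_smul, ← hy']; exact hy.symm
    have hx'w : ∀ u, x' ≠ C.ww k • u := by
      intro u hu
      exact hgr ⟨u, by rw [hyx, hu, smul_smul, ← pow_succ]⟩
    have hcoef : ∀ v ∈ C.pc D j', ∃ (c : k) (u : D),
        v = c • (C.proj j' m₀ : D) + C.ww k • u := by
      intro v hv
      obtain ⟨c, d, u, h⟩ := (C.generate_of_cyclic hm₀ j').exists_coeff ⟨v, hv⟩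
      have := congrArg (fun y : C.pc D j' => (y : D)) h
      simp only [Submodule.coe_add, Submodule.coe_smul, coe_T] at this
      refine ⟨c, d • C.th k (C.ep (j'.comp C.bar)) • m₀ + C.ww k • (u : D), ?_⟩
      rw [this, C.ϖ_eq _ (hβ _ hj''), ← ww_smul_ww_smul, coe_wproj, smul_add, smul_comm d, add_assoc]
    obtain ⟨c, u, hcu⟩ := hcoef x' hx'pc
    have hc : c ≠ 0 := by
      rintro rfl
      exact hx'w u (by rw [hcu, zero_smul, zero_add])
    have h2e : 2 * C.e j - 1 = n + (2 * C.e j - 1 - 2 * n) + n := by omega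
    have hself : ψ x' (C.ww k ^ (2 * C.e j - 1) • x') = 0 := by
      have h1 : ψ y (C.ww k ^ (2 * C.e j - 1 - 2 * n) • y) = 0 := (hNN y).mp hyN _ (hN _ _ hyN)
      rw [hyx, hψ.adj_ww_pow, smul_smul, smul_smul, ← pow_add, ← pow_add, ← h2e] at h1
      exact (mul_eq_zero.mp h1).resolve_left (pow_ne_zero _ (neg_ne_zero.mpr one_ne_zero))
    have h2e1 : 1 + (2 * C.e j - 1) = 2 * C.e j := by have := C.e_pos j; omega
    have hall : ∀ v ∈ C.pc D j', ψ (C.ww k ^ (2 * C.e j - 1) • x') v = 0 := by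
      intro v hv
      obtain ⟨c', u', hv'⟩ := hcoef v hv
      have hv2 : v = (c' * c⁻¹) • x' + C.ww k • (u' - (c' * c⁻¹) • u) := by
        rw [hv', hcu, smul_add, smul_smul, mul_assoc, inv_mul_cancel₀ hc, mul_one, smul_sub,
          smul_comm (C.ww k) (c' * c⁻¹) u]
        abel
      rw [hψ.skew, hv2, map_add ψ, map_smul ψ (c' * c⁻¹), LinearMap.add_apply, LinearMap.smul_apply, hself, smul_zero,
        zero_add, hψ.adj_ww, smul_smul, ← pow_succ', add_comm, h2e1, hw1 _ hj'' _ hx'pc, map_zero,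
        neg_zero, neg_zero]
    have hzero : C.ww k ^ (2 * C.e j - 1) • x' = 0 := by
      refine hψ.nondeg _ fun v => ?_
      rw [hψ.adj_ww_pow, ← C.mem_pc.mp hx'pc, hψ.adj_th, br_ep]
      obtain ⟨i, -, hi'⟩ := hcomm (2 * C.e j - 1) (j'.comp C.bar)
      rw [smul_smul, hi', mul_smul, ← hψ.adj_ww_pow]
      by_cases hij : i = j'
      · rw [hij]; exact hall _ (C.ep_smul_mem _ v)
      · have : C.ww k ^ (2 * C.e j - 1) • x' ∈ C.pc D (j'.comp C.bar) := by
          have hodd : ∀ n : ℕ, ∀ i : S →+* k, ∀ x ∈ C.pc D i, C.ww k ^ (2 * n + 1) • x ∈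
              C.pc D (i.comp C.bar) := by
            intro n i x hx
            rw [pow_succ', pow_mul, pow_two, ww_mul_ww, ← map_pow, mul_smul]
            exact C.ww_smul_mem (C.th_smul_mem _ hx)
          have h3 : 2 * C.e j - 1 = 2 * (C.e j - 1) + 1 := by have := C.e_pos j; omega
          rw [h3]; exact hodd _ _ _ hx'pc
        refine hψ.pc_orth ?_ this (C.ep_smul_mem i v)
        rw [comp_bar_bar]; exact hij
    obtain ⟨y'', hy''⟩ := ww_exact hq (hβ _ hj'') (2 * C.e j - 1) (by rw [he _ hj'']; omega) hx'pc hzero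
    refine hx'w y'' ?_
    rw [hy'', he _ hj'', show 2 * C.e j - (2 * C.e j - 1) = 1 by have := C.e_pos j; omega, pow_one]
  constructor
  · exact fun h => hfwd j (Or.inl rfl) x hx h
  · rintro ⟨y, rfl⟩
    rw [hNN]
    intro n hn
    obtain ⟨i, hi, hci⟩ := hcomm (C.e j) j
    have h1 : C.ww k ^ C.e j • y = C.ww k ^ C.e j • C.th k (C.ep i) • y := by
      rw [smul_smul, ← hci, mul_smul]; exact hx.symm
    obtain ⟨i', hi', hci'⟩ := hcomm (C.e j) (i.comp C.bar)
    have hi'' : i' = j ∨ i' = j.comp C.bar := by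
      rcases hi with rfl | rfl
      · exact hi'.symm.imp_left fun h => by rw [h, comp_bar_bar]
      · rw [comp_bar_bar] at hi'; exact hi'
    obtain ⟨n', hn'⟩ := hfwd i' hi'' (C.th k (C.ep i') • n) (C.ep_smul_mem _ n) (hN _ _ hn)
    rw [h1, hψ.adj_ww_pow, ← C.mem_pc.mp (C.ep_smul_mem i y), hψ.adj_th, br_ep, smul_smul, hci',
      mul_smul, hn', smul_smul, ← pow_add, ← two_mul]
    have h2 := hψ.adj_ww_pow (2 * C.e j) (C.th k (C.ep i) • y) n'
    rw [hw1 i hi _ (C.ep_smul_mem i y), map_zero, LinearMap.zero_apply] at h2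
    rw [(mul_eq_zero.mp h2.symm).resolve_left (pow_ne_zero _ (neg_ne_zero.mpr one_ne_zero)), mul_zero]

end Ramified

end CyclicFrame

/-! ### The standard Lagrangian subspaces -/

namespace CyclicFrame

variable (C)

/-- The submodule generated by `z • m`, where `z` is the standard element of type `ε`. -/
def zspan (ε : (S →+* k) → ℕ × ℕ) (m : D) : Submodule k D :=
  range ((toSpanSingleton Oₖ D (C.z ε • m)).restrictScalars k)

variable {C} {ε : (S →+* k) → ℕ × ℕ}

theorem mem_zspan {m v : D} : v ∈ C.zspan ε m ↔ ∃ a : Oₖ, a • C.z ε • m = v := by simp [zspan]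

theorem smul_mem_zspan {m : D} (a : Oₖ) : ∀ x ∈ C.zspan ε m, a • x ∈ C.zspan ε m := by
  intro x hx
  obtain ⟨b, rfl⟩ := mem_zspan.mp hx
  exact mem_zspan.mpr ⟨a * b, by rw [mul_smul]⟩

theorem z_smul_mem_zspan (m : D) : C.z ε • m ∈ C.zspan ε m := mem_zspan.mpr ⟨1, one_smul _ _⟩

theorem th_mul_th_comm (r s : k ⊗[ℤ] S) : C.th k r * C.th k s = C.th k s * C.th k r := by
  rw [← map_mul, mul_comm, map_mul]

theorem commute_th_of_br {g : k ⊗[ℤ] S} (hg : C.br k g = g) (a : Oₖ) :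
    C.th k g * a = a * C.th k g := by
  obtain ⟨r0, r1, rfl⟩ := C.exists_eq_add a
  rw [mul_add, add_mul, th_mul_th_comm g r0, ← mul_assoc, th_mul_th_comm g r1, mul_assoc, mul_assoc,
    th_mul_ww, hg]

theorem br_ep_add (j : S →+* k) :
    C.br k (C.ep j + C.ep (j.comp C.bar)) = C.ep j + C.ep (j.comp C.bar) := by
  rw [map_add, br_ep, br_ep, comp_bar_bar, add_comm]

theorem ep_add_smul {j : S →+* k} {x : D} (hx : x ∈ C.pc D j) :
    C.th k (C.ep j + C.ep (j.comp C.bar)) • x = x := by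
  rw [map_add, add_smul, C.ep_smul_eq_zero (C.bar_ne j) hx, add_zero]; exact hx

theorem IsAdm.z_mul_ep_add (h : C.IsAdm ε) {j : S →+* k} (hj : j C.β = 0) :
    C.z ε * C.th k (C.ep j + C.ep (j.comp C.bar)) =
      C.ww k ^ C.e j * C.th k (C.ep j + C.ep (j.comp C.bar)) := by
  have hj' : (j.comp C.bar) C.β = 0 := by rwa [comp_bar_β]
  rw [map_add, mul_add, mul_add, z_mul_ep, z_mul_ep, h.dexp_bar, h.mexp_bar hj, C.ϖ_bar,
    ← ww_pow_two_mul k hj, ← pow_add, h.mexp_dexp hj]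

theorem IsAdm.mem_zspan_ramified (h : C.IsAdm ε) {m : D} (hm : ∀ x : D, ∃ a : Oₖ, x = a • m)
    {j : S →+* k} (hj : j C.β = 0) {v : D} (hv : v ∈ C.pc D j) :
    v ∈ C.zspan ε m ↔ ∃ u, v = C.ww k ^ C.e j • u := by
  have hc := commute_th_of_br (C.br_ep_add j)
  have hF := ep_add_smul hv
  set F := C.th k (C.ep j + C.ep (j.comp C.bar))
  have hz : C.z ε * F = C.ww k ^ C.e j * F := h.z_mul_ep_add hj
  rw [mem_zspan]
  constructor
  · rintro ⟨a, ha⟩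
    obtain ⟨a', ha'⟩ := exists_mul_ww_pow (C := C) a (C.e j)
    refine ⟨a' • F • m, ?_⟩
    rw [← hF, ← ha, smul_smul, smul_smul, hc, mul_assoc, hc, hz, ← mul_assoc, ha']
    simp only [mul_smul]
  · rintro ⟨u, rfl⟩
    obtain ⟨b, rfl⟩ := hm u
    obtain ⟨b', hb'⟩ := exists_ww_pow_mul (C := C) b (C.e j)
    refine ⟨b' * F, ?_⟩
    have h1 : b' * F * C.z ε = F * C.ww k ^ C.e j * b := by
      rw [mul_assoc, hc, hz, mul_assoc F, hb', ← mul_assoc F, hc b', mul_assoc, hc]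
    rw [← hF, smul_smul, smul_smul, smul_smul, h1]

theorem IsAdm.ep_smul_z_smul (h : C.IsAdm ε) {j : S →+* k} (hj : j C.β ≠ 0) (m : D) :
    C.th k (C.ep j) • C.z ε • m =
      C.th k ((1 ⊗ₜ C.ϖ j) ^ C.mexp ε (j.comp C.bar)) • (C.wproj j m : D) := by
  conv_lhs => rw [← C.sum_ep_smul m, Finset.smul_sum, Finset.smul_sum]
  rw [sum_eq_single (j.comp C.bar)]
  · have hj' : (j.comp C.bar) C.β ≠ 0 := by rwa [comp_bar_β]
    rw [z_smul_split hj' (C.ep_smul_mem _ m), coe_wproj, C.ϖ_bar]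
    exact C.mem_pc.mp (C.th_smul_mem _ (C.ww_smul_mem' (C.ep_smul_mem _ _)))
  · intro i _ hi
    have hx := C.ep_smul_mem i m
    set x := C.th k (C.ep i) • m
    have hji : j ≠ i.comp C.bar := fun h => hi (by rw [h, comp_bar_bar])
    rcases Nat.le_one_iff_eq_zero_or_eq_one.mp (h.dexp_le i) with hd | hd
    · rw [z_smul_of_mem hx, hd, pow_zero, one_smul]
      refine C.ep_smul_eq_zero ?_ (C.th_smul_mem _ hx)
      rintro rfl
      rw [dexp_split hj] at hd; exact one_ne_zero hd
    · rw [z_smul_of_mem hx, hd, pow_one]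
      exact C.ep_smul_eq_zero hji (C.th_smul_mem _ (C.ww_smul_mem hx))
  · simp

theorem ep_smul_smul (j : S →+* k) (r0 r1 : k ⊗[ℤ] S) (u : D) :
    C.th k (C.ep j) • (C.th k r0 + C.th k r1 * C.ww k) • u =
      C.th k r0 • C.th k (C.ep j) • u + C.th k r1 • (C.wproj j u : D) := by
  rw [coe_wproj', add_smul, smul_add, smul_smul, th_mul_th_comm, mul_smul, mul_smul, smul_smul (C.th k (C.ep j)) (C.th k r1),
    th_mul_th_comm _ r1, mul_smul (C.th k r1)]

theorem IsAdm.wproj_z_smul (h : C.IsAdm ε) {j : S →+* k} (hj : j C.β ≠ 0) (m : D) :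
    (C.wproj j (C.z ε • m) : D) =
      C.th k (1 ⊗ₜ C.β) • C.th k ((1 ⊗ₜ C.ϖ j) ^ C.mexp ε j) • (C.proj j m : D) := by
  rw [coe_wproj, h.ep_smul_z_smul (by rwa [comp_bar_β]), comp_bar_bar, C.ϖ_bar, coe_wproj,
    comp_bar_bar, ww_smul_th_smul, ww_smul_ww_smul, map_pow, br_ϖ, coe_proj, smul_smul,
    th_mul_th_comm, mul_smul]

theorem IsAdm.mem_zspan_split (h : C.IsAdm ε) {m : D} {j : S →+* k} (hj : j C.β ≠ 0) {v : D}
    (hv : v ∈ C.pc D j) : v ∈ C.zspan ε m ↔ ∃ r s : k ⊗[ℤ] S, v =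
      C.th k r • C.th k ((1 ⊗ₜ C.ϖ j) ^ C.mexp ε j) • (C.proj j m : D) +
      C.th k s • C.th k ((1 ⊗ₜ C.ϖ j) ^ C.mexp ε (j.comp C.bar)) • (C.wproj j m : D) := by
  constructor
  · intro h'
    obtain ⟨a, ha⟩ := mem_zspan.mp h'
    obtain ⟨r0, r1, rfl⟩ := C.exists_eq_add a
    refine ⟨r1 * 1 ⊗ₜ C.β, r0, ?_⟩
    rw [← C.mem_pc.mp hv, ← ha, ep_smul_smul, h.ep_smul_z_smul hj, h.wproj_z_smul hj, map_mul,
      mul_smul, add_comm]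
  · rintro ⟨r, s, rfl⟩
    refine Submodule.add_mem _ (smul_mem_zspan _ _ ?_) (smul_mem_zspan _ _ ?_)
    · obtain ⟨b, hb⟩ := exists_β_smul (C := C) (D := D) hj
      rw [← hb _ (C.th_smul_mem _ (C.proj j m).2), ← h.wproj_z_smul hj, coe_wproj]
      exact smul_mem_zspan _ _ (smul_mem_zspan _ _ (smul_mem_zspan _ _ (z_smul_mem_zspan m)))
    · rw [← h.ep_smul_z_smul hj]; exact smul_mem_zspan _ _ (z_smul_mem_zspan m)

section Form

/-- Every Lagrangian submodule is a standard one for a suitable generator. -/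
theorem IsSkewForm.exists_eq_zspan (hq : IsReduction p k O q) {ψ : BilinForm k D}
    (hψ : C.IsSkewForm ψ) {m₀ : D} (hm₀ : ∀ x : D, ∃ a : Oₖ, x = a • m₀)
    (hpc : ∀ j, Nontrivial (C.pc D j))
    {N : Submodule k D} (hN : ∀ (a : Oₖ), ∀ x ∈ N, a • x ∈ N)
    (hNN : ∀ x, x ∈ N ↔ ∀ y ∈ N, ψ x y = 0) :
    ∃ (ε : (S →+* k) → ℕ × ℕ) (m : D), C.IsAdm ε ∧ (∀ x : D, ∃ a : Oₖ, x = a • m) ∧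
      N = C.zspan ε m := by
  classical
  have key : ∀ j : S →+* k, ∃ (a : ℕ) (x y : C.pc D j), j C.β ≠ 0 → 2 * a ≤ C.e j ∧
      Generate (C.T D j) x y ∧ ((C.T D j ^ a) x : D) ∈ N ∧
      (∀ w, ((C.T D j ^ (C.e j - a)) w : D) ∈ N) ∧
      ∀ v : C.pc D j, (v : D) ∈ N → ∃ (f : k[X]) (w : C.pc D j),
        v = aeval (C.T D j) f ((C.T D j ^ a) x) + (C.T D j ^ (C.e j - a)) w := by
    intro j
    by_cases hj : j C.β = 0
    · exact ⟨0, 0, 0, fun h => absurd hj h⟩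
    have hS : ∀ x : C.pc D j, x ∈ N.comap (C.pc D j).subtype ↔
        ∀ y ∈ N.comap (C.pc D j).subtype, phi ψ j x y = 0 := by
      intro x
      rw [Submodule.mem_comap, Submodule.subtype_apply, hNN]
      constructor
      · exact fun h y hy => h _ (hN _ _ hy)
      · intro h y hy
        rw [← C.mem_pc.mp x.2, hψ.adj_th, br_ep]
        obtain ⟨b, hb⟩ := exists_β_smul (C := C) (D := D) (j := j.comp C.bar) (by rwa [comp_bar_β])
        have h1 := h (C.wproj j (C.th k b • y))
          (hN _ _ (hN _ _ (hN _ _ hy)))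
        rw [phi_apply, coe_wproj, ww_smul_ww_smul, smul_smul (C.th k (C.ep _)), th_mul_th_comm,
          mul_smul, smul_smul, th_mul_th_comm, mul_smul, hb _ (C.ep_smul_mem _ _)] at h1
        exact h1
    obtain ⟨a, x, y, h⟩ := exists_of_lagrangian (e := C.e j) (C.T_pow_eq_zero (D := D) j)
      (fun n hn x hx => C.T_exact hq j n hn x hx)
      (C.generate_of_cyclic hm₀ j) (hψ.phi_adj j) (fun x hx => hψ.phi_nondeg hj x hx)
      (N.comap (C.pc D j).subtype) (fun u hu => hN _ _ hu) hS
    exact ⟨a, x, y, fun _ => h⟩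
  choose a x y hk using key
  obtain ⟨m, hm, hmxy⟩ := exists_generator (C := C) hm₀ x y fun j hj _ => (hk j hj).2.1
  let ε : (S →+* k) → ℕ × ℕ := fun j =>
    if j C.β = 0 then (C.e j / 2, C.e j - C.e j / 2)
    else if C.Plus j then (a j, C.e j - a j)
    else (a (j.comp C.bar), C.e j - a (j.comp C.bar))
  have hε : C.IsAdm ε := by
    refine ⟨fun j => ?_, fun j => ?_, fun j => ?_, fun j hj => by simp [ε, hj]⟩
    · simp only [ε, comp_bar_β, C.e_bar, plus_bar, comp_bar_bar]
      split_ifs <;> rfl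
    all_goals
      have h1 := fun hj => (hk j hj).1
      have h2 := fun hj => (hk (j.comp C.bar) hj).1
      rw [comp_bar_β, C.e_bar] at h2; simp only [ε]
      split_ifs with hj hp
      · dsimp only; omega
      · have := h1 hj; dsimp only; omega
      · have := h2 hj; dsimp only; omega
  have h1 : ∀ j : S →+* k, j C.β ≠ 0 → C.Plus j →
      C.mexp ε j = a j ∧ C.mexp ε (j.comp C.bar) = C.e j - a j := by
    intro j hj hp
    rw [mexp_plus hj hp, mexp_minus (by rwa [comp_bar_β]) (by rw [plus_bar]; exact not_not.mpr hp),
      hε.bar_eq]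
    simp [ε, hj, hp]
  refine ⟨ε, m, hε, hm, le_antisymm ?_ ?_⟩
  · refine le_of_components (C := C) hN smul_mem_zspan ?_ ?_
    · intro j hj hp v hv hvN
      obtain ⟨-, hg, -, -, h5⟩ := hk j hj
      obtain ⟨f, w, hfw⟩ := h5 ⟨v, hv⟩ hvN
      obtain ⟨f₁, f₂, rfl⟩ := hg w
      have h6 := congrArg (fun y : C.pc D j => (y : D)) hfw
      simp only [map_add, Submodule.coe_add, coe_aeval_T, coe_T_pow] at h6
      rw [hε.mem_zspan_split hj hv, (h1 j hj hp).1, (h1 j hj hp).2, (hmxy j hj hp).1,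
        (hmxy j hj hp).2]
      have h7 : C.e j - a j = a j + (C.e j - 2 * a j) := by have := (hk j hj).1; omega
      refine ⟨aeval (1 ⊗ₜ C.ϖ j : k ⊗[ℤ] S) f +
        (1 ⊗ₜ C.ϖ j) ^ (C.e j - 2 * a j) * aeval (1 ⊗ₜ C.ϖ j : k ⊗[ℤ] S) f₁,
        aeval (1 ⊗ₜ C.ϖ j : k ⊗[ℤ] S) f₂, ?_⟩
      rw [h6]; simp only [smul_smul, ← map_mul]; rw [add_mul, map_add, add_smul, add_assoc]
      congr 2
      · rw [h7, pow_add]; congr 2; ring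
      · rw [mul_comm]
    · intro j hj v hv hvN
      rw [hε.mem_zspan_ramified hm hj hv]; exact (hψ.mem_iff_ramified hq hm₀ hN hNN hj hv).mp hvN
  · refine le_of_components (C := C) smul_mem_zspan hN ?_ ?_
    · intro j hj hp v hv hvN
      obtain ⟨-, hg, h3, h4, -⟩ := hk j hj
      rw [hε.mem_zspan_split hj hv, (h1 j hj hp).1, (h1 j hj hp).2, (hmxy j hj hp).1,
        (hmxy j hj hp).2] at hvN
      obtain ⟨r, s, rfl⟩ := hvN
      refine N.add_mem (hN _ _ ?_) (hN _ _ ?_)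
      · rw [coe_T_pow] at h3; exact h3
      · have := h4 (y j); rw [coe_T_pow] at this; exact this
    · intro j hj v hv hvN
      rw [hε.mem_zspan_ramified hm hj hv] at hvN
      exact (hψ.mem_iff_ramified hq hm₀ hN hNN hj hv).mpr hvN

/-- For every admissible system there is a generator such that the standard submodule is
isotropic. -/
theorem IsSkewForm.exists_isotropic_zspan (h2 : (2 : k) ≠ 0) [FiniteDimensional k D]
    (hq : IsReduction p k O q) {ψ : BilinForm k D}
    (hψ : C.IsSkewForm ψ) {m₀ : D} (hm₀ : ∀ x : D, ∃ a : Oₖ, x = a • m₀)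
    (hdim : ∀ j, finrank k (C.pc D j) = 2 * C.e j) (hε : C.IsAdm ε) :
    ∃ m : D, (∀ x : D, ∃ a : Oₖ, x = a • m) ∧
      ∀ x ∈ C.zspan ε m, ∀ y ∈ C.zspan ε m, ψ x y = 0 := by
  classical
  have key : ∀ j : S →+* k, ∃ (x y : C.pc D j), j C.β ≠ 0 →
      Generate (C.T D j) x y ∧ ∀ f : k[X], phi ψ j x (aeval (C.T D j) f x) = 0 := by
    intro j
    by_cases hj : j C.β = 0
    · exact ⟨0, 0, fun h => absurd hj h⟩
    obtain ⟨x, y, h⟩ := exists_isotropic (φ := phi ψ j) h2 (C.e_pos j) (C.T_pow_eq_zero (D := D) j)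
      (fun n hn x hx => C.T_exact hq j n hn x hx) (C.generate_of_cyclic hm₀ j) (hdim j)
      (hψ.phi_adj j) (hψ.phi_symm j) (fun x hx => hψ.phi_nondeg hj x hx)
    exact ⟨x, y, fun _ => h⟩
  choose x y hk using key
  obtain ⟨m, hm, hmxy⟩ := exists_generator (C := C) hm₀ x y fun j hj _ => (hk j hj).1
  refine ⟨m, hm, hψ.isotropic_of_components smul_mem_zspan ?_ ?_⟩
  · intro j hj hp v hv v' hv' hvN hvN'
    obtain ⟨hg, hi⟩ := hk j hj
    rw [hε.mem_zspan_split hj hv] at hvN; rw [hε.mem_zspan_split hj hv'] at hvN'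
    obtain ⟨r, s, rfl⟩ := hvN
    obtain ⟨r', s', rfl⟩ := hvN'
    rw [(hmxy j hj hp).1, (hmxy j hj hp).2]
    set μ := C.mexp ε j
    set ν := C.mexp ε (j.comp C.bar)
    have hμν : ν + μ = C.e j := hε.mexp_add hj
    have hle : μ ≤ ν := by
      have h1 := hε.le j
      have h3 : μ = (ε j).1 := mexp_plus hj hp
      have h4 := hε.add j
      omega
    set π : k ⊗[ℤ] S := 1 ⊗ₜ C.ϖ j with hπ
    have hcomm : ∀ (r s : k ⊗[ℤ] S) (u v : D),
        ψ (C.th k r • u) (C.ww k • C.th k s • v) = ψ u (C.ww k • C.th k (r * s) • v) := by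
      intro r s u v
      rw [hψ.adj_th, smul_smul, th_mul_ww, br_br, mul_smul, smul_smul (C.th k r), ← map_mul (C.th k)]
    have hzero : ∀ (r : k ⊗[ℤ] S) (u v : D), v ∈ C.pc D j →
        ψ u (C.ww k • C.th k (r * π ^ C.e j) • v) = 0 := by
      intro r u v hv
      have h0 : C.th k (r * π ^ C.e j) • v = 0 := by
        rw [← C.mem_pc.mp hv, smul_smul, ← map_mul, mul_assoc, C.ϖ_pow_mul_ep, mul_zero, map_zero]
        exact zero_smul Oₖ v
      rw [h0, smul_zero, map_zero]
    have hcomb : ∀ (r r' a b : k ⊗[ℤ] S) (u v : D),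
        ψ (C.th k r • C.th k a • u) (C.ww k • C.th k r' • C.th k b • v) =
          ψ u (C.ww k • C.th k (r * r' * (a * b)) • v) := by
      intro r r' a b u v
      rw [smul_smul (C.th k r), smul_smul (C.th k r'), ← map_mul, ← map_mul, hcomm,
        show r * a * (r' * b) = r * r' * (a * b) by ring]
    obtain ⟨f, hf⟩ := C.exists_aeval_T (D := D) j (r * r' * (π ^ μ * π ^ μ))
    have hνν : π ^ ν * π ^ ν = π ^ (ν - μ) * π ^ C.e j := by
      rw [← pow_add, ← pow_add]; congr 1; omega
    rw [smul_add, map_add (ψ _), map_add ψ, LinearMap.add_apply, LinearMap.add_apply, hcomb, hcomb,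
      hcomb, hcomb, ← pow_add π μ ν, ← pow_add π ν μ, add_comm μ ν, hμν, hνν, ← mul_assoc (s * s'),
      hzero _ _ _ (x j).2, hzero _ _ _ (y j).2, hzero _ _ _ (y j).2, hf]
    have := hi f
    rw [phi_apply] at this; rw [this, add_zero, add_zero]
  · intro j hj v hv hvN
    exact (hε.mem_zspan_ramified hm hj hv).mp hvN

end Form

end CyclicFrame

/-! ### Quotients by stable subspaces -/

theorem finrank_eq_two_mul_finrank_ker {k V : Type*} [Field k] [AddCommGroup V] [Module k V]
    [FiniteDimensional k V] (f : V →ₗ[k] V) (h : range f = LinearMap.ker f) :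
    finrank k V = 2 * finrank k (LinearMap.ker f) := by
  rw [← f.finrank_range_add_finrank_ker, h, two_mul]

theorem charpoly_eq_mul {k V : Type*} [Field k] [Infinite k] [AddCommGroup V] [Module k V]
    [FiniteDimensional k V] (f : End k V) (N : Submodule k V) (hN : N ≤ N.comap f) :
    f.charpoly = (f.restrict hN).charpoly * (N.mapQ N f hN).charpoly := by
  refine Polynomial.funext fun t => ?_
  have hN' : N ≤ N.comap (algebraMap k (End k V) t - f) := fun x hx =>
    N.sub_mem (N.smul_mem t hx) (hN hx)
  rw [Polynomial.eval_mul, eval_charpoly, eval_charpoly, eval_charpoly,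
    LinearMap.det_eq_det_mul_det N _ hN']
  congr 2
  refine LinearMap.ext fun x => ?_
  obtain ⟨x, rfl⟩ := N.mkQ_surjective x
  simp

theorem mem_iff_of_isotropic {k V : Type*} [Field k] [AddCommGroup V] [Module k V]
    [FiniteDimensional k V] {ψ : BilinForm k V} (halt : ψ.IsAlt)
    (hnd : ∀ x, (∀ y, ψ x y = 0) → x = 0) {N : Submodule k V}
    (hdim : finrank k V = 2 * finrank k N) (hN : ∀ x ∈ N, ∀ y ∈ N, ψ x y = 0) (x : V) :
    x ∈ N ↔ ∀ y ∈ N, ψ x y = 0 := by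
  have hrefl : ψ.IsRefl := halt.isRefl
  have hN' : N ≤ ψ.orthogonal N := fun x hx y hy => hN y hy x hx
  have hker : LinearMap.ker ψ = ⊥ := by
    rw [LinearMap.ker_eq_bot']; exact fun x hx => hnd x fun y => by rw [hx]; rfl
  have h1 := LinearMap.BilinForm.finrank_add_finrank_orthogonal' (B := ψ) N
  rw [hker, inf_bot_eq, finrank_bot, add_zero] at h1
  have h2 : N = ψ.orthogonal N := Submodule.eq_of_le_of_finrank_eq hN' (by omega)
  refine ⟨fun hx y hy => hN x hx y hy, fun h => ?_⟩
  rw [h2]; exact fun y hy => hrefl _ _ (h y hy)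

section

variable [FiniteDimensional k D] {ε : (S →+* k) → ℕ × ℕ}

namespace CyclicFrame

section Quot

variable {k A D : Type*} [Field k] [Ring A] [Algebra k A] [AddCommGroup D] [Module k D]
  [Module A D] [IsScalarTower k A D]

/-- The module structure on the quotient by a stable subspace. -/
@[reducible]
def quotModule (N : Submodule k D) (hN : ∀ a : A, ∀ x ∈ N, a • x ∈ N) : Module A (D ⧸ N) where
  smul a := N.mapQ N (lsmul k k D a) (hN a)
  one_smul := by rintro ⟨x⟩; exact congrArg N.mkQ (one_smul A x)
  mul_smul a b := by rintro ⟨x⟩; exact congrArg N.mkQ (mul_smul a b x)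
  smul_zero a := map_zero (N.mapQ N (lsmul k k D a) (hN a))
  smul_add a := map_add (N.mapQ N (lsmul k k D a) (hN a))
  add_smul a b := by rintro ⟨x⟩; exact congrArg N.mkQ (add_smul a b x)
  zero_smul := by rintro ⟨x⟩; exact congrArg N.mkQ (zero_smul A x)

theorem quotModule_tower (N : Submodule k D) (hN : ∀ a : A, ∀ x ∈ N, a • x ∈ N) :
    letI := quotModule N hN
    IsScalarTower k A (D ⧸ N) := by
  let _ := quotModule N hN
  refine ⟨fun c a => ?_⟩
  rintro ⟨x⟩
  exact congrArg N.mkQ (smul_assoc c a x)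

end Quot

theorem finrank_pc_eq_add {Q : Type*} [AddCommGroup Q] [Module k Q] [Module Oₖ Q]
    [IsScalarTower k Oₖ Q] (f : D →ₗ[k] Q) (hf : Surjective f)
    (hfA : ∀ (a : Oₖ) x, f (a • x) = a • f x) (j : S →+* k) :
    finrank k (C.pc D j) = finrank k (C.pc Q j) +
      finrank k ((LinearMap.ker f).comap (C.pc D j).subtype) := by
  let g : C.pc D j →ₗ[k] C.pc Q j := f.restrict fun x hx => by
    rw [mem_pc] at hx ⊢; rw [← hfA, hx]
  have hg : range g = ⊤ := by
    rw [LinearMap.range_eq_top]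
    rintro ⟨y, hy⟩
    obtain ⟨x, rfl⟩ := hf y
    exact ⟨C.proj j x, Subtype.ext ((hfA _ x).trans hy)⟩
  have hk : LinearMap.ker g = (LinearMap.ker f).comap (C.pc D j).subtype := by
    ext x; simp [g, LinearMap.restrict_apply, Subtype.ext_iff]
  rw [← g.finrank_range_add_finrank_ker, hg, finrank_top, hk]

section Standard

variable [Free ℤ O] (hε : C.IsAdm ε) {m : D}
  (hm : Bijective fun a : Oₖ => a • m)

variable (C ε) in
/-- Right multiplication by the standard element, with respect to a generator. -/
def zmul : D →ₗ[Oₖ] D :=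
  (toSpanSingleton Oₖ D (C.z ε • m)) ∘ₗ
    ((ofBijective (toSpanSingleton Oₖ D m) hm).symm : D →ₗ[_] _)

theorem zmul_smul (a : Oₖ) : zmul C ε hm (a • m) = a • C.z ε • m := by
  have : (ofBijective (toSpanSingleton Oₖ D m) hm).symm (a • m) = a := by
    rw [LinearEquiv.symm_apply_eq]; rfl
  rw [zmul, LinearMap.comp_apply, LinearEquiv.coe_coe, this]; rfl

theorem range_zmul : range ((zmul C ε hm).restrictScalars k) = C.zspan ε m := by
  ext v; rw [mem_zspan]
  constructor
  · rintro ⟨x, rfl⟩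
    obtain ⟨a, rfl⟩ := hm.2 x
    exact ⟨a, (zmul_smul hm a).symm⟩
  · rintro ⟨a, rfl⟩
    exact ⟨a • m, zmul_smul hm a⟩

include hε in
theorem IsAdm.ker_zmul : LinearMap.ker ((zmul C ε hm).restrictScalars k) = C.zspan ε m := by
  ext v
  obtain ⟨a, rfl⟩ := hm.2 v
  rw [mem_zspan, LinearMap.mem_ker, LinearMap.restrictScalars_apply]
  dsimp only
  rw [zmul_smul]
  constructor
  · intro h
    obtain ⟨b, rfl⟩ := hε.exists_eq_mul_z (a := a) (hm.1 (by
      dsimp only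
      rw [mul_smul, h]; exact (zero_smul Oₖ m).symm))
    exact ⟨b, (mul_smul _ _ _).symm⟩
  · rintro ⟨b, hb⟩
    rw [← mul_smul] at hb; rw [← hm.1 hb, smul_smul, mul_assoc, hε.z_mul_z, mul_zero]
    exact zero_smul Oₖ m

include hε hm in
theorem IsAdm.finrank_zspan : finrank k D = 2 * finrank k (C.zspan ε m) := by
  rw [finrank_eq_two_mul_finrank_ker ((zmul C ε hm).restrictScalars k)
    (by rw [range_zmul, hε.ker_zmul]), hε.ker_zmul]

include hε hm in
theorem IsAdm.finrank_zspan_comap (j : S →+* k) : finrank k (C.pc D j) =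
    2 * finrank k ((C.zspan ε m).comap (C.pc D j).subtype) := by
  let f := (zmul C ε hm).restrictScalars k
  have hf : ∀ x ∈ C.pc D j, f x ∈ C.pc D j := fun x hx => by
    rw [mem_pc] at hx ⊢; rw [LinearMap.restrictScalars_apply, ← map_smul, hx]
  have h1 : LinearMap.ker (f.restrict hf) = (C.zspan ε m).comap (C.pc D j).subtype := by
    rw [← hε.ker_zmul hm]
    ext x; simp [f, LinearMap.restrict_apply, Subtype.ext_iff]
  have h2 : range (f.restrict hf) = (C.zspan ε m).comap (C.pc D j).subtype := by
    rw [← range_zmul hm]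
    ext x
    constructor
    · rintro ⟨y, rfl⟩
      exact ⟨y, rfl⟩
    · rintro ⟨y, hy⟩
      refine ⟨C.proj j y, Subtype.ext ?_⟩
      change zmul C ε hm (C.th k (C.ep j) • y) = x; rw [map_smul]; exact (congrArg _ hy).trans x.2
  rw [finrank_eq_two_mul_finrank_ker (f.restrict hf) (by rw [h1, h2]), h1]

include hε hm in
theorem IsAdm.charpoly_sq (ρ : End k D) (a : Oₖ) (hρ : ∀ x, ρ x = a • x)
    (hN : C.zspan ε m ≤ (C.zspan ε m).comap ρ) :
    ((C.zspan ε m).mapQ (C.zspan ε m) ρ hN).charpoly ^ 2 = ρ.charpoly := by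
  have : Infinite k := IsAlgClosed.instInfinite
  rw [charpoly_eq_mul ρ _ hN, pow_two]
  congr 1
  let f := (zmul C ε hm).restrictScalars k
  let e1 := Submodule.quotEquivOfEq _ _ (hε.ker_zmul hm)
  let e2 := LinearEquiv.ofEq _ _ (range_zmul (C := C) (ε := ε) hm)
  let E : (D ⧸ C.zspan ε m) ≃ₗ[k] C.zspan ε m := (e1.symm.trans f.quotKerEquivRange).trans e2
  have hE : ∀ x, (E ((C.zspan ε m).mkQ x) : D) = zmul C ε hm x := fun x => rfl
  rw [← LinearEquiv.charpoly_conj E]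
  congr 1
  refine LinearMap.ext fun y => Subtype.ext ?_
  obtain ⟨y, rfl⟩ := E.surjective y
  obtain ⟨x, rfl⟩ := (C.zspan ε m).mkQ_surjective y
  rw [LinearEquiv.conj_apply_apply, symm_apply_apply, Submodule.mkQ_apply,
    Submodule.mapQ_apply, hρ, ← Submodule.mkQ_apply, hE, map_smul]
  exact ((hρ _).trans (congrArg (a • ·) (hE x))).symm

end Standard

end CyclicFrame

end

/-! ### Components and reduced Lie types -/

namespace CyclicFrame

section Base

variable {p : ℕ} {k S O : Type*} [Field k] [CommRing S] [Ring O] {conj : O → O}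

/-- `R` is the ring fixed by the involution of `S`, in a weak sense. -/
structure IsBase (C : CyclicFrame p k S O conj) {R : Type*} [CommRing R] (ι : R →+* S) : Prop where
  bar_ι : ∀ r, C.bar (ι r) = ι r
  exists_extension : ∀ i : R →+* k, ∃ j : S →+* k, j.comp ι = i
  eq_or_eq : ∀ j j' : S →+* k, j'.comp ι = j.comp ι → j' = j ∨ j' = j.comp C.bar
  exists_unif : ∀ (j : S →+* k) (π : R), π ∈ ker (j.comp ι) →
    π ∉ ker (j.comp ι) ^ 2 →
    ∃ t d : R, j (ι t) ≠ 0 ∧ j (ι d) ≠ 0 ∧ ι t * C.ϖ j = ι π * ι d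

variable {C : CyclicFrame p k S O conj} {R : Type*} [CommRing R] {ι : R →+* S}

theorem IsBase.comp_bar (hB : C.IsBase ι) (j : S →+* k) : (j.comp C.bar).comp ι = j.comp ι :=
  RingHom.ext fun r => congrArg j (hB.bar_ι r)

end Base

variable {F : Type*} [Field F] [NumberField F] {ι : 𝓞 F →+* S} (hB : C.IsBase ι)
  {Q : Type*} [AddCommGroup Q] [Module k Q] [Module Oₖ Q] [IsScalarTower k Oₖ Q]
  {act : 𝓞 F → End k Q} (hact : ∀ c x, act c x = C.th k (1 ⊗ₜ ι c) • x)

theorem mem_maxGenEigenspace_of_mem_pc {f : End k Q} {s : S}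
    (hf : ∀ x, f x = C.th k (1 ⊗ₜ s) • x) {j : S →+* k} {x : Q} (hx : x ∈ C.pc Q j) :
    x ∈ f.maxGenEigenspace (j s) := by
  rw [Module.End.mem_maxGenEigenspace]
  obtain ⟨y, hy⟩ := C.exists_sub_mul_ep j (1 ⊗ₜ s)
  rw [charExt_tmul, one_mul] at hy
  have key : ∀ n : ℕ, ∃ r, ((f - j (s) • (1 : End k Q)) ^ n) x =
      C.th k ((1 ⊗ₜ C.ϖ j) ^ n * r * C.ep j) • x := by
    intro n
    induction n with
    | zero => exact ⟨1, by rw [pow_zero, pow_zero, one_mul, one_mul]; exact hx.symm⟩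
    | succ n ih =>
      obtain ⟨r, hr⟩ := ih
      refine ⟨y * r, ?_⟩
      have h1 : (f - j (s) • (1 : End k Q)) (C.th k ((1 ⊗ₜ C.ϖ j) ^ n * r * C.ep j) • x) =
          C.th k ((1 ⊗ₜ s - algebraMap k (k ⊗[ℤ] S) (j (s))) *
            ((1 ⊗ₜ C.ϖ j) ^ n * r * C.ep j)) • x := by
        rw [LinearMap.sub_apply, hf, LinearMap.smul_apply, Module.End.one_apply,
          map_mul (C.th k) (_ - _), mul_smul (C.th k (_ - _)), map_sub (C.th k), sub_smul,
          AlgHom.commutes, algebraMap_smul]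
      rw [pow_succ', End.mul_apply, hr, h1, mul_comm _ (C.ep j), ← mul_assoc, hy]
      congr 2; ring
  obtain ⟨r, hr⟩ := key (C.e j)
  refine ⟨C.e j, ?_⟩
  rw [hr, mul_right_comm, C.ϖ_pow_mul_ep, zero_mul, map_zero]; exact zero_smul Oₖ x

theorem maxGenEigenspace_eq_pc {f : End k Q} {s : S} (hf : ∀ x, f x = C.th k (1 ⊗ₜ s) • x)
    {j : S →+* k} (hj : ∀ l : S →+* k, l s = j s → l = j) :
    f.maxGenEigenspace (j s) = C.pc Q j := by
  refine le_antisymm (fun v hv => ?_) fun x hx => mem_maxGenEigenspace_of_mem_pc hf hx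
  rw [mem_pc]
  conv_rhs => rw [← C.sum_ep_smul v]
  rw [sum_eq_single j (fun l _ hl => ?_) (by simp)]
  refine Submodule.disjoint_def.mp (Module.End.disjoint_genEigenspace f (fun h => hl (hj l h)) ⊤ ⊤) _
    (mem_maxGenEigenspace_of_mem_pc hf (C.ep_smul_mem l v)) ?_
  refine Module.End.mapsTo_maxGenEigenspace_of_comm (f := f)
    (g := lsmul k k Q (C.th k (C.ep l))) ?_ (j s) hv
  refine LinearMap.ext fun x => ?_
  change f (C.th k (C.ep l) • x) = C.th k (C.ep l) • f x
  rw [hf, hf, smul_smul, smul_smul, th_mul_th_comm]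

include hact hB in
theorem component_eq {i : 𝓞 F →+* k} {j : S →+* k} (hj : j.comp ι = i) :
    component act i = C.pc Q j ⊔ C.pc Q (j.comp C.bar) := by
  have hc : ∀ c, j (ι c) = i c := fun c => by rw [← hj]; rfl
  have hc' : ∀ c, (j.comp C.bar) (ι c) = i c := fun c => by rw [← hj, ← hB.comp_bar j]; rfl
  apply le_antisymm
  · intro v hv
    rw [component, Submodule.mem_iInf] at hv
    have hz : ∀ l : S →+* k, l ≠ j → l ≠ j.comp C.bar → C.th k (C.ep l) • v = 0 := by
      intro l h1 h2
      obtain ⟨c, hne⟩ : ∃ c, l (ι c) ≠ i c := by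
        by_contra! h
        rcases hB.eq_or_eq j l (by rw [hj]; exact RingHom.ext h) with h | h
        exacts [h1 h, h2 h]
      have h3 := mem_maxGenEigenspace_of_mem_pc (hact c) (C.ep_smul_mem l v)
      have h4 : C.th k (C.ep l) • v ∈ (act c).maxGenEigenspace (i c) := by
        refine Module.End.mapsTo_maxGenEigenspace_of_comm (f := act c)
          (g := lsmul k k Q (C.th k (C.ep l))) ?_ (i c) (hv c)
        refine LinearMap.ext fun x => ?_
        change act c (C.th k (C.ep l) • x) = C.th k (C.ep l) • act c x
        rw [hact, hact, smul_smul, smul_smul, th_mul_th_comm]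
      exact (Submodule.disjoint_def.mp (Module.End.disjoint_genEigenspace (act c) hne ⊤ ⊤)) _ h3 h4
    have h5 := C.sum_ep_smul v
    rw [← Finset.sum_subset (Finset.subset_univ {j, j.comp C.bar}) (fun l _ hl => by
      simp only [Finset.mem_insert, Finset.mem_singleton, not_or] at hl
      exact hz l hl.1 hl.2), Finset.sum_pair (C.bar_ne j).symm] at h5
    rw [← h5]; exact Submodule.add_mem_sup (C.ep_smul_mem _ _) (C.ep_smul_mem _ _)
  · refine sup_le ?_ ?_
    · intro x hx
      rw [component, Submodule.mem_iInf]
      intro c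
      rw [← hc]; exact mem_maxGenEigenspace_of_mem_pc (hact c) hx
    · intro x hx
      rw [component, Submodule.mem_iInf]
      intro c
      rw [← hc']; exact mem_maxGenEigenspace_of_mem_pc (hact c) hx

theorem finrank_pc_sup [FiniteDimensional k Q] (j : S →+* k) :
    finrank k (C.pc Q j ⊔ C.pc Q (j.comp C.bar) : Submodule k Q) =
      finrank k (C.pc Q j) + finrank k (C.pc Q (j.comp C.bar)) := by
  rw [← Submodule.finrank_sup_add_finrank_inf_eq]
  have : C.pc Q j ⊓ C.pc Q (j.comp C.bar) = ⊥ := by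
    rw [eq_bot_iff]
    rintro x ⟨h1, h2⟩
    rw [Submodule.mem_bot, ← C.mem_pc.mp h1]; exact C.ep_smul_eq_zero (C.bar_ne j).symm h2
  rw [this, finrank_bot, add_zero]

/-- The action of a local parameter on the components of `π`. -/
structure IsUnif (C : CyclicFrame p k S O conj) (j : S →+* k) (T : End k Q) : Prop where
  mem_of_mem : ∀ x ∈ C.pc Q j, T x ∈ C.pc Q j
  pow_eq_zero : ∀ n : ℕ, ∀ x ∈ C.pc Q j, C.th k ((1 ⊗ₜ C.ϖ j) ^ n) • x = 0 → (T ^ n) x = 0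
  exists_eq : ∀ x ∈ C.pc Q j, ∃ y ∈ C.pc Q j, C.th k (1 ⊗ₜ C.ϖ j) • x = T y

include hact hB in
theorem isUnif_of_uniformizer {j : S →+* k} {π : 𝓞 F} (h1 : π ∈ ker (j.comp ι))
    (h2 : π ∉ ker (j.comp ι) ^ 2) : IsUnif (Q := Q) C j (act π) := by
  obtain ⟨t, d, ht, hd, htd⟩ := hB.exists_unif j π h1 h2
  obtain ⟨t', ht'⟩ := C.exists_mul_eq_ep (j := j) (x := 1 ⊗ₜ ι t) (by simpa using ht)
  obtain ⟨d', hd'⟩ := C.exists_mul_eq_ep (j := j) (x := 1 ⊗ₜ ι d) (by simpa using hd)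
  have htd' : (1 ⊗ₜ ι t : k ⊗[ℤ] S) * 1 ⊗ₜ C.ϖ j = 1 ⊗ₜ ι π * 1 ⊗ₜ ι d := by
    rw [tmul_mul_tmul, tmul_mul_tmul, htd]
  set π' : k ⊗[ℤ] S := 1 ⊗ₜ ι π
  set τ : k ⊗[ℤ] S := 1 ⊗ₜ ι t
  set δ : k ⊗[ℤ] S := 1 ⊗ₜ ι d
  set ϖ : k ⊗[ℤ] S := 1 ⊗ₜ C.ϖ j
  have hep := C.ep_mul_self j
  refine ⟨fun x hx => by rw [hact]; exact C.th_smul_mem _ hx, fun n x hx h0 => ?_, fun x hx =>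
    ⟨C.th k (t' * δ) • x, C.th_smul_mem _ hx, ?_⟩⟩
  · have hpow : ∀ n : ℕ, (act π ^ n) x = C.th k (π' ^ n) • x := by
      intro n
      induction n with
      | zero => simp
      | succ n ih => rw [pow_succ', End.mul_apply, ih, hact, smul_smul, ← map_mul, ← pow_succ']
    have h3 : π' ^ n * C.ep j = (d' * τ) ^ n * ϖ ^ n * C.ep j := by
      have h4 : π' * C.ep j = d' * τ * ϖ * C.ep j := by
        linear_combination -π' * hd' - d' * C.ep j * htd'
      have h5 : ∀ n : ℕ, (0 : ℕ) < n → π' ^ n * C.ep j = (π' * C.ep j) ^ n := by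
        intro n hn
        obtain ⟨n, rfl⟩ := Nat.exists_eq_succ_of_ne_zero hn.ne'
        have h6 : C.ep j ^ (n + 1) = C.ep j := IsIdempotentElem.pow_succ_eq n hep
        rw [mul_pow, h6]
      rcases Nat.eq_zero_or_pos n with rfl | hn
      · simp
      · have h6 : C.ep j ^ n = C.ep j := by
          obtain ⟨n, rfl⟩ := Nat.exists_eq_succ_of_ne_zero hn.ne'
          exact IsIdempotentElem.pow_succ_eq n hep
        rw [h5 n hn, h4, mul_pow, mul_pow, h6]
    rw [hpow, ← C.mem_pc.mp hx, smul_smul, ← map_mul, h3, map_mul, map_mul, mul_smul, mul_smul,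
      C.mem_pc.mp hx, h0, smul_zero]
  · rw [hact, smul_smul, ← map_mul]
    conv_lhs => rw [← C.mem_pc.mp hx, smul_smul, ← map_mul]
    conv_rhs => rw [← C.mem_pc.mp hx, smul_smul, ← map_mul]
    congr 2; linear_combination -ϖ * ht' + t' * C.ep j * htd'

open Polynomial in
include hact hB in
theorem isLieModel_of_orders [FiniteDimensional k Q] {i : 𝓞 F →+* k} {j : S →+* k}
    (hj : j.comp ι = i)
    {e : ℕ × ℕ} {T : End k Q} (hT : IsUnif C j T) (hT' : IsUnif C (j.comp C.bar) T)
    (hd : finrank k (C.pc Q j) + finrank k (C.pc Q (j.comp C.bar)) = 2 * (e.1 + e.2))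
    {x₁ x₂ : C.pc Q j} {y₁ y₂ : C.pc Q (j.comp C.bar)}
    (hx : Generate (C.T Q j) x₁ x₂) (hy : Generate (C.T Q (j.comp C.bar)) y₁ y₂)
    (hx₁ : C.th k ((1 ⊗ₜ C.ϖ j) ^ e.1) • (x₁ : Q) = 0)
    (hx₂ : C.th k ((1 ⊗ₜ C.ϖ j) ^ e.2) • (x₂ : Q) = 0)
    (hy₁ : C.th k ((1 ⊗ₜ C.ϖ j) ^ e.1) • (y₁ : Q) = 0)
    (hy₂ : C.th k ((1 ⊗ₜ C.ϖ j) ^ e.2) • (y₂ : Q) = 0) :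
    ∃ φ : component act i ≃ₗ[k] LieModel k e,
      ∀ y, ((φ.symm ((X : k[X]) • φ y) : component act i) : Q) = T y := by
  have hcomp := component_eq hB hact hj
  have hj₁ : C.pc Q j ≤ component act i := hcomp ▸ le_sup_left
  have hj₂ : C.pc Q (j.comp C.bar) ≤ component act i := hcomp ▸ le_sup_right
  have hst : ∀ x ∈ component act i, T x ∈ component act i := by
    intro x hx
    rw [hcomp] at hx ⊢
    obtain ⟨a, ha, b, hb, rfl⟩ := mem_sup.mp hx
    rw [map_add]; exact Submodule.add_mem_sup (hT.mem_of_mem a ha) (hT'.mem_of_mem b hb)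
  let T' : End k (component act i) := T.restrict hst
  have hTpow : ∀ (n : ℕ) x, ((T' ^ n) x : Q) = (T ^ n) x := by
    intro n
    induction n with
    | zero => simp
    | succ n ih => intro x; rw [pow_succ, End.mul_apply, ih, pow_succ]; rfl
  have hnil : T' ^ C.e j = 0 := by
    refine LinearMap.ext fun ⟨x, hx⟩ => Subtype.ext ?_
    rw [hTpow]
    have hx' := hx
    rw [hcomp] at hx'
    obtain ⟨a, ha, b, hb, hab⟩ := mem_sup.mp hx'
    change (T ^ C.e j) x = 0
    rw [← hab, map_add, hT.pow_eq_zero _ a ha, hT'.pow_eq_zero _ b hb, add_zero]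
    · rw [← C.mem_pc.mp hb, smul_smul, ← map_mul, ← C.e_bar j, C.ϖ_pow_mul_ep, map_zero]
      exact zero_smul Oₖ b
    · rw [← C.mem_pc.mp ha, smul_smul, ← map_mul, C.ϖ_pow_mul_ep, map_zero]; exact zero_smul Oₖ a
  let X₁ : component act i := ⟨x₁, hj₁ x₁.2⟩
  let X₂ : component act i := ⟨x₂, hj₁ x₂.2⟩
  let Y₁ : component act i := ⟨y₁, hj₂ y₁.2⟩
  let Y₂ : component act i := ⟨y₂, hj₂ y₂.2⟩
  have htop := eq_top_of_nilpotent hnil (genSub T' X₁ X₂ ⊔ genSub T' Y₁ Y₂) (fun u hu => by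
      obtain ⟨a, ha, b, hb, rfl⟩ := mem_sup.mp hu
      rw [map_add]
      exact Submodule.add_mem_sup (genSub_stable _ _ a ha) (genSub_stable _ _ b hb)) (by
    rintro ⟨v, hv⟩
    have hv' := hv
    rw [hcomp] at hv'
    obtain ⟨a, ha, b, hb, rfl⟩ := mem_sup.mp hv'
    obtain ⟨c₁, c₂, w, hw⟩ := hx.exists_coeff ⟨a, ha⟩
    obtain ⟨d₁, d₂, z, hz⟩ := hy.exists_coeff ⟨b, hb⟩
    have hw' := congrArg (fun y : C.pc Q j => (y : Q)) hw
    have hz' := congrArg (fun y : C.pc Q (j.comp C.bar) => (y : Q)) hz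
    simp only [Submodule.coe_add, Submodule.coe_smul, coe_T] at hw' hz'
    obtain ⟨w', hw'm, hw''⟩ := hT.exists_eq w w.2
    obtain ⟨z', hz'm, hz''⟩ := hT'.exists_eq z z.2
    refine ⟨(c₁ • X₁ + c₂ • X₂) + (d₁ • Y₁ + d₂ • Y₂), Submodule.add_mem_sup
      (add_mem (Submodule.smul_mem _ _ (left_mem_genSub _ _))
        (Submodule.smul_mem _ _ (right_mem_genSub _ _)))
      (add_mem (Submodule.smul_mem _ _ (left_mem_genSub _ _))
        (Submodule.smul_mem _ _ (right_mem_genSub _ _))), ⟨w' + z', add_mem (hj₁ hw'm) (hj₂ hz'm)⟩,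
      Subtype.ext ?_⟩
    change a + b = (c₁ • (x₁ : Q) + c₂ • (x₂ : Q)) + (d₁ • (y₁ : Q) + d₂ • (y₂ : Q)) + T (w' + z')
    rw [map_add, ← hw'', ← hz'', hw', hz']; abel)
  have hmodel : IsLieModel T' e := by
    refine isLieModel_of_generators (g := ![X₁, Y₁]) (h := ![X₂, Y₂]) ?_ ?_ ?_ ?_
    · intro l
      fin_cases l
      · exact Subtype.ext ((hTpow _ _).trans (hT.pow_eq_zero _ _ x₁.2 hx₁))
      · exact Subtype.ext ((hTpow _ _).trans (hT'.pow_eq_zero _ _ y₁.2 (by rw [C.ϖ_bar]; exact hy₁)))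
    · intro l
      fin_cases l
      · exact Subtype.ext ((hTpow _ _).trans (hT.pow_eq_zero _ _ x₂.2 hx₂))
      · exact Subtype.ext ((hTpow _ _).trans (hT'.pow_eq_zero _ _ y₂.2 (by rw [C.ϖ_bar]; exact hy₂)))
    · intro v
      obtain ⟨a, ha, b, hb, rfl⟩ := mem_sup.mp (htop ▸ mem_top : v ∈ _)
      obtain ⟨f₁, f₂, rfl⟩ := mem_genSub.mp ha
      obtain ⟨g₁, g₂, rfl⟩ := mem_genSub.mp hb
      refine ⟨![f₁, g₁], ![f₂, g₂], ?_⟩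
      simp only [Fin.sum_univ_two, Matrix.cons_val_zero, Matrix.cons_val_one]; abel
    · rw [(LinearEquiv.ofEq _ _ hcomp).finrank_eq, finrank_pc_sup, hd]
  obtain ⟨φ, hφ⟩ := hmodel
  exact ⟨φ, fun y => congrArg Subtype.val (hφ y)⟩

include hact hB in
theorem IsAdm.isLieModel [FiniteDimensional k Q] {ε : (S →+* k) → ℕ × ℕ} (hε : C.IsAdm ε) {m : Q}
    (hm : ∀ x : Q, ∃ a : Oₖ, x = a • m) (hz : C.z ε • m = 0)
    (hdim : ∀ j, finrank k (C.pc Q j) = C.e j) {i : 𝓞 F →+* k} {j : S →+* k}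
    (hj : j.comp ι = i) {π : 𝓞 F} (h1 : π ∈ ker i) (h2 : π ∉ ker i ^ 2) :
    ∃ φ : component act i ≃ₗ[k] LieModel k (ε j),
      ∀ y, ((φ.symm ((Polynomial.X : k[X]) • φ y) : component act i) : Q) = act π y := by
  have hd : ∀ j, finrank k (C.pc Q j) + finrank k (C.pc Q (j.comp C.bar)) =
      2 * ((ε j).1 + (ε j).2) := fun j => by rw [hdim, hdim, C.e_bar, hε.add, two_mul]
  have hT : ∀ j : S →+* k, j.comp ι = i → IsUnif (Q := Q) C j (act π) := fun j hj =>
    isUnif_of_uniformizer hB hact (hj ▸ h1) (hj ▸ h2)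
  have hj' : (j.comp C.bar).comp ι = i := (hB.comp_bar j).trans hj
  by_cases hβ : j C.β = 0
  · have hw : ∀ l : S →+* k, l = j ∨ l = j.comp C.bar → ∀ n, C.e j ≤ n →
        C.ww k ^ n • C.th k (C.ep l) • m = 0 := by
      intro l hl n hn
      have hF : C.ww k ^ C.e j • C.th k (C.ep j + C.ep (j.comp C.bar)) • m = 0 := by
        rw [smul_smul, ← hε.z_mul_ep_add hβ, ← commute_th_of_br (C.br_ep_add j), mul_smul, hz,
          smul_zero]
      have hl' : C.ep l = (C.ep j + C.ep (j.comp C.bar)) * C.ep l := by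
        rcases hl with rfl | rfl
        · rw [add_mul, ep_mul_self, C.ep_mul_of_ne (C.bar_ne l), add_zero]
        · rw [add_mul, ep_mul_self, C.ep_mul_of_ne (C.bar_ne j).symm, zero_add]
      obtain ⟨a, ha⟩ := exists_ww_pow_mul (C := C) (C.th k (C.ep l)) (C.e j)
      rw [← Nat.sub_add_cancel hn, pow_add, mul_smul, hl', mul_comm, map_mul, mul_smul,
        smul_smul (C.ww k ^ C.e j), ha, mul_smul, hF, smul_zero, smul_zero]
    have hadd := hε.add j
    have hr := hε.ramified j hβ
    have hl : C.e j ≤ 2 * (ε j).1 + 1 := by omega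
    have hl' : C.e j ≤ 2 * (ε j).2 := by omega
    refine isLieModel_of_orders hB hact hj (hT j hj) (hT _ hj') (hd j)
      (C.generate_of_cyclic hm j).symm (C.generate_of_cyclic hm (j.comp C.bar)).symm ?_ ?_ ?_ ?_
    · rw [coe_wproj, ← ww_pow_two_mul k hβ, smul_smul, ← pow_succ]; exact hw _ (Or.inr rfl) _ hl
    · rw [coe_proj, ← ww_pow_two_mul k hβ]; exact hw _ (Or.inl rfl) _ hl'
    · rw [coe_wproj, ← ww_pow_two_mul k hβ, smul_smul, ← pow_succ, comp_bar_bar]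
      exact hw _ (Or.inl rfl) _ hl
    · rw [coe_proj, ← ww_pow_two_mul k hβ]; exact hw _ (Or.inr rfl) _ hl'
  · have hord : ∀ l : S →+* k, l C.β ≠ 0 →
        C.th k ((1 ⊗ₜ C.ϖ l) ^ C.mexp ε l) • (C.proj l m : Q) = 0 ∧
        C.th k ((1 ⊗ₜ C.ϖ l) ^ C.mexp ε (l.comp C.bar)) • (C.wproj l m : Q) = 0 := by
      intro l hl
      refine ⟨?_, by rw [← hε.ep_smul_z_smul hl, hz, smul_zero]⟩
      obtain ⟨b, hb⟩ := exists_β_smul (C := C) (D := Q) hl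
      rw [← hb _ (C.th_smul_mem _ (C.proj l m).2), ← hε.wproj_z_smul hl, hz, coe_wproj, smul_zero,
        smul_zero, smul_zero]
    have hplus : ∀ l : S →+* k, l C.β ≠ 0 → C.Plus l → l.comp ι = i →
        ∃ φ : component act i ≃ₗ[k] LieModel k (ε l),
          ∀ y, ((φ.symm ((Polynomial.X : k[X]) • φ y) : component act i) : Q) = act π y := by
      intro l hl hp hli
      have hl' : (l.comp C.bar) C.β ≠ 0 := by rwa [comp_bar_β]
      obtain ⟨o1, o2⟩ := hord l hl
      obtain ⟨o3, o4⟩ := hord (l.comp C.bar) hl'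
      have hm1 : C.mexp ε l = (ε l).1 := mexp_plus hl hp
      have hm2 : C.mexp ε (l.comp C.bar) = (ε l).2 := by
        rw [mexp_minus hl' (by rw [plus_bar]; exact not_not.mpr hp), hε.bar_eq]
      rw [comp_bar_bar, hm1, C.ϖ_bar] at o4; rw [hm2, C.ϖ_bar] at o3; rw [hm1] at o1; rw [hm2] at o2
      have hli' : (l.comp C.bar).comp ι = i := (hB.comp_bar l).trans hli
      exact isLieModel_of_orders hB hact hli (hT l hli) (hT _ hli') (hd l)
        (C.generate_of_cyclic hm l) (C.generate_of_cyclic hm (l.comp C.bar)).symm o1 o2 o4 o3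
    by_cases hp : C.Plus j
    · exact hplus j hβ hp hj
    · have := hplus (j.comp C.bar) (by rwa [comp_bar_β]) (by rwa [plus_bar]) hj'
      rwa [hε.bar_eq] at this

end CyclicFrame

/-! ### Isometries of free modules of rank one -/

theorem HasSquareRoots.exists_isometry_of_bijective {R D : Type*} [CommRing R] [AddCommGroup D]
    [Module R D] (H : HasSquareRoots R D) {ψ ψ' : BilinForm R D} (hψ : ψ.IsAlt)
    (hψ' : ψ'.IsAlt) (hb : Bijective ψ) (hb' : Bijective ψ') :
    ∃ u g : D ≃ₗ[R] D, (∀ x y, ψ' x y = ψ (u x) y) ∧ (∀ x y, ψ' x y = ψ (g x) (g y)) ∧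
      (∀ f f' : D → D, (∀ x y, f (x + y) = f x + f y) → (∀ (c : R) x, f (c • x) = c • f x) →
        (∀ x y, ψ (f x) y = ψ x (f' y)) → (∀ x y, ψ' (f x) y = ψ' x (f' y)) →
        ∀ x, f (g x) = g (f x)) ∧
      ∀ N : Submodule R D, (∀ x ∈ N, u x ∈ N) → (∀ x ∈ N, u.symm x ∈ N) → ∀ x ∈ N, g x ∈ N := by
  let E := ofBijective ψ hb
  let E' := ofBijective ψ' hb'
  let u : D ≃ₗ[R] D := E'.trans E.symm
  have hu : ∀ x y, ψ' x y = ψ (u x) y := fun x y =>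
    (LinearMap.congr_fun (E.apply_symm_apply (E' x)) y).symm
  obtain ⟨g, h1, h2, h3⟩ := H.exists_isometry ψ ψ' u hu hψ hψ'
  refine ⟨u, g, hu, h1, fun f f' hadd hf hff hff' => ?_, h3⟩
  refine h2 (AddMonoidHom.mk' f hadd) hf fun x => hb.1 (LinearMap.ext fun y => ?_)
  change ψ (f (u x)) y = ψ (u (f x)) y; rw [← hu, hff', hff, hu]

theorem bijective_of_nondeg {k V : Type*} [Field k] [AddCommGroup V] [Module k V]
    [FiniteDimensional k V] {ψ : BilinForm k V} (hnd : ∀ x, (∀ y, ψ x y = 0) → x = 0) :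
    Bijective ψ := by
  have hinj : Injective ψ := by
    rw [injective_iff_map_eq_zero]; exact fun x hx => hnd x fun y => by rw [hx]; rfl
  exact ⟨hinj, (injective_iff_surjective_of_finrank_eq_finrank
    (Subspace.dual_finrank_eq (K := k) (V := V)).symm).mp hinj⟩

namespace CyclicFrame

variable {D' : Type*} [AddCommGroup D'] [Module k D'] [Module Oₖ D']
  [IsScalarTower k Oₖ D']

/-- Free modules of rank one with skew forms are isometric, compatibly with standard Lagrangian
submodules. -/
theorem IsSkewForm.exists_isometry (hp : p ≠ 2) [FiniteDimensional k D] [Free ℤ O]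
    {ψ : BilinForm k D}
    (hψ : C.IsSkewForm ψ) {ψ' : BilinForm k D'} (hψ' : C.IsSkewForm ψ') {m : D} {m' : D'}
    (hm : Bijective fun a : Oₖ => a • m)
    (hm' : Bijective fun a : Oₖ => a • m') :
    ∃ γ : D ≃ₗ[k] D', (∀ (a : Oₖ) x, γ (a • x) = a • γ x) ∧
      (∀ x y, ψ' (γ x) (γ y) = ψ x y) ∧ ∀ ε, C.IsAdm ε →
        (∀ x ∈ C.zspan ε m, ∀ y ∈ C.zspan ε m, ψ x y = 0) →
        (∀ x ∈ C.zspan ε m', ∀ y ∈ C.zspan ε m', ψ' x y = 0) →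
        (C.zspan ε m).map (γ : D →ₗ[k] D') = C.zspan ε m' := by
  let g₀ : D ≃ₗ[Oₖ] D' :=
    (ofBijective (toSpanSingleton Oₖ D m) hm).symm.trans
      (ofBijective (toSpanSingleton Oₖ D' m') hm')
  have hg₀ : ∀ a : Oₖ, g₀ (a • m) = a • m' := by
    intro a
    have : (ofBijective (toSpanSingleton Oₖ D m) hm).symm (a • m) =
        a := by
      rw [LinearEquiv.symm_apply_eq]; rfl
    rw [trans_apply]; exact congrArg _ this
  let h₀ : D ≃ₗ[k] D' := g₀.restrictScalars k
  have hh₀ : ∀ x, h₀ x = g₀ x := fun _ => rfl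
  let ψ₁ : BilinForm k D := ψ'.compl₁₂ (h₀ : D →ₗ[k] D') (h₀ : D →ₗ[k] D')
  have hψ₁ : ∀ x y, ψ₁ x y = ψ' (h₀ x) (h₀ y) := fun _ _ => rfl
  have hnd : ∀ x, (∀ y, ψ₁ x y = 0) → x = 0 := by
    intro x hx
    refine h₀.injective ((hψ'.nondeg _ fun y => ?_).trans (map_zero h₀).symm)
    obtain ⟨y, rfl⟩ := h₀.surjective y
    exact hx y
  obtain ⟨u, g, hu, hg, hcomm, hstab⟩ := (hasSquareRoots_field (D := D)
    (two_ne_zero_of_charP p hp k)).exists_isometry_of_bijective hψ.alt (ψ' := ψ₁)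
    (fun x => hψ'.alt _) (bijective_of_nondeg hψ.nondeg) (bijective_of_nondeg hnd)
  have hgA : ∀ (a : Oₖ) x, a • g x = g (a • x) := fun a =>
    hcomm (a • ·) (C.cj k a • ·) (smul_add a) (fun c x => smul_comm a c x) (hψ.adj a) fun x y => by
      rw [hψ₁, hψ₁, hh₀, hh₀, map_smul, hψ'.adj, ← map_smul]; rfl
  have hgA' : ∀ (a : Oₖ) x, a • g.symm x = g.symm (a • x) := fun a x => by
    rw [LinearEquiv.eq_symm_apply, ← hgA, apply_symm_apply]
  refine ⟨g.symm.trans h₀, fun a x => ?_, fun x y => ?_, fun ε hε hN hN' => ?_⟩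
  · rw [trans_apply, ← hgA', hh₀, map_smul]; rfl
  · rw [trans_apply, trans_apply, ← hψ₁, hg, apply_symm_apply,
      apply_symm_apply]
  · have hNN := mem_iff_of_isotropic hψ.alt hψ.nondeg (hε.finrank_zspan hm) hN
    have hmap : ∀ x, x ∈ C.zspan ε m ↔ h₀ x ∈ C.zspan ε m' := by
      intro x
      obtain ⟨b, rfl⟩ := hm.2 x
      dsimp only
      rw [hh₀, hg₀, mem_zspan, mem_zspan]
      refine exists_congr fun a => ?_
      rw [smul_smul, smul_smul]
      exact ⟨fun h => congrArg (· • m') (hm.1 h), fun h => congrArg (· • m) (hm'.1 h)⟩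
    have huN : ∀ x ∈ C.zspan ε m, u x ∈ C.zspan ε m := by
      intro x hx
      rw [hNN]
      intro y hy
      rw [← hu, hψ₁]; exact hN' _ ((hmap x).mp hx) _ ((hmap y).mp hy)
    have hfix : ∀ f : D ≃ₗ[k] D, (∀ x ∈ C.zspan ε m, f x ∈ C.zspan ε m) →
        ∀ x ∈ C.zspan ε m, f.symm x ∈ C.zspan ε m := by
      intro f hf x hx
      have h1 : (C.zspan ε m).map (f : D →ₗ[k] D) = C.zspan ε m :=
        Submodule.eq_of_le_of_finrank_eq (Submodule.map_le_iff_le_comap.mpr hf)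
          (LinearEquiv.finrank_map_eq f _)
      rw [← h1] at hx
      obtain ⟨y, hy, rfl⟩ := hx
      rw [LinearEquiv.coe_coe, symm_apply_apply]; exact hy
    have hgN := hstab _ huN (hfix u huN)
    have hgN' := hfix g hgN
    ext y
    constructor
    · rintro ⟨x, hx, rfl⟩
      exact (hmap _).mp (hgN' x hx)
    · intro hy
      refine ⟨g (h₀.symm y), hgN _ ((hmap _).mpr (by rwa [apply_symm_apply])), ?_⟩
      rw [LinearEquiv.coe_coe, trans_apply, symm_apply_apply,
        apply_symm_apply]

end CyclicFrame

/-! ### The reduction of a Dieudonné module is free -/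

section Free

variable {k P : Type*} [Field k] [AddCommGroup P] [Module k P] [FiniteDimensional k P]
  {T : End k P} {e : ℕ}

theorem finrank_eq_mul_finrank_ker (hT : T ^ e = 0)
    (hex : ∀ n ≤ e, ∀ x, (T ^ n) x = 0 → ∃ y, x = (T ^ (e - n)) y) :
    finrank k P = e * finrank k (LinearMap.ker T) := by
  have key : ∀ n ≤ e, finrank k P = finrank k (range (T ^ n)) +
      n * finrank k (LinearMap.ker T) := by
    intro n
    induction n with
    | zero =>
      intro _
      have : range (T ^ 0) = ⊤ := by rw [pow_zero]; exact LinearMap.range_id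
      rw [this, finrank_top, zero_mul, add_zero]
    | succ n ih =>
      intro hn
      have hmem : ∀ x ∈ range (T ^ n), T x ∈ range (T ^ n) := by
        rintro _ ⟨y, rfl⟩
        exact ⟨T y, by rw [← End.mul_apply, ← pow_succ, pow_succ']; rfl⟩
      have h1 := (T.restrict hmem).finrank_range_add_finrank_ker
      have h2 : finrank k (range (T.restrict hmem)) =
          finrank k (range (T ^ (n + 1))) := by
        rw [← Submodule.finrank_map_subtype_eq]
        suffices h : (range (T.restrict hmem)).map (range (T ^ n)).subtype =
          range (T ^ (n + 1)) by rw [h]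
        ext x
        constructor
        · rintro ⟨_, ⟨⟨_, ⟨z, rfl⟩⟩, rfl⟩, rfl⟩
          exact ⟨z, by rw [pow_succ']; rfl⟩
        · rintro ⟨z, rfl⟩
          exact ⟨_, ⟨⟨(T ^ n) z, ⟨z, rfl⟩⟩, rfl⟩, by rw [pow_succ']; rfl⟩
      have h3 : finrank k (LinearMap.ker (T.restrict hmem)) =
          finrank k (LinearMap.ker T) := by
        rw [← Submodule.finrank_map_subtype_eq]
        suffices h : (LinearMap.ker (T.restrict hmem)).map (range (T ^ n)).subtype =
          LinearMap.ker T by rw [h]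
        ext x
        constructor
        · rintro ⟨y, hy, rfl⟩
          exact congrArg Subtype.val hy
        · intro hx
          obtain ⟨y, hy⟩ := hex 1 (by omega) x (by rw [pow_one]; exact hx)
          refine ⟨⟨x, (T ^ (e - 1 - n)) y, ?_⟩, Subtype.ext hx, rfl⟩
          rw [← End.mul_apply, ← pow_add, hy]
          congr 2; omega
      rw [ih (by omega), ← h1, h2, h3]; ring
  have h := key e le_rfl
  rwa [hT, LinearMap.range_zero, finrank_bot, zero_add] at h

theorem exists_generate (he : 0 < e) (hT : T ^ e = 0)
    (hex : ∀ n ≤ e, ∀ x, (T ^ n) x = 0 → ∃ y, x = (T ^ (e - n)) y)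
    (hdim : finrank k P = 2 * e) : ∃ x y, Generate T x y := by
  have h1 := finrank_eq_mul_finrank_ker hT hex
  have h2 : finrank k (LinearMap.ker T) = 2 := by
    rw [hdim, mul_comm] at h1; exact (Nat.eq_of_mul_eq_mul_left he h1).symm
  have h3 : finrank k (P ⧸ range T) = 2 := by
    have h4 := (range T).finrank_quotient_add_finrank
    have h5 := T.finrank_range_add_finrank_ker
    omega
  let b := Module.finBasisOfFinrankEq k _ h3
  obtain ⟨x, hx⟩ := (range T).mkQ_surjective (b 0)
  obtain ⟨y, hy⟩ := (range T).mkQ_surjective (b 1)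
  refine ⟨x, y, generate_of_mod hT fun v => ?_⟩
  have h6 := b.sum_repr ((range T).mkQ v)
  rw [Fin.sum_univ_two, ← hx, ← hy, ← map_smul, ← map_smul, ← map_add] at h6
  obtain ⟨w, hw⟩ := (Submodule.Quotient.eq _).mp h6.symm
  exact ⟨_, Submodule.add_mem _ (Submodule.smul_mem _ _ (left_mem_genSub x y))
    (Submodule.smul_mem _ _ (right_mem_genSub x y)), w, by rw [hw]; abel⟩

end Free

section

variable [FiniteDimensional k D]

namespace CyclicFrame

theorem IsSkewForm.finrank_pc_of_quotient {Q : Type*} [AddCommGroup Q] [Module k Q]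
    [Module Oₖ Q] [IsScalarTower k Oₖ Q] {ψ : BilinForm k D}
    (hψ : C.IsSkewForm ψ) (f : D →ₗ[k] Q) (hf : Surjective f)
    (hfA : ∀ (a : Oₖ) x, f (a • x) = a • f x)
    (hN : ∀ x, x ∈ LinearMap.ker f ↔ ∀ y ∈ LinearMap.ker f, ψ x y = 0)
    (hQ : ∀ j, finrank k (C.pc Q j) = C.e j)
    (hD : finrank k D = 2 * finrank ℤ S) (j : S →+* k) :
    finrank k (C.pc D j) = 2 * C.e j := by
  let N : (S →+* k) → ℕ := fun j => finrank k ((LinearMap.ker f).comap (C.pc D j).subtype)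
  have h1 : ∀ j, finrank k (C.pc D j) = C.e j + N j := fun j => by
    rw [finrank_pc_eq_add (C := C) f hf hfA j, hQ]
  have h2 : ∀ j : S →+* k, C.e j ≤ N (j.comp C.bar) := by
    intro j
    let g : C.pc D j →ₗ[k] Module.Dual k ((LinearMap.ker f).comap (C.pc D (j.comp C.bar)).subtype) :=
      (ψ.compl₁₂ (C.pc D j).subtype ((C.pc D (j.comp C.bar)).subtype ∘ₗ Submodule.subtype _))
    have hg : LinearMap.ker g = (LinearMap.ker f).comap (C.pc D j).subtype := by
      ext x; rw [LinearMap.mem_ker, Submodule.mem_comap, hN]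
      constructor
      · intro h y hy
        rw [Submodule.subtype_apply, ← C.mem_pc.mp x.2, hψ.adj_th, br_ep]
        have h3 : C.th k (C.ep (j.comp C.bar)) • y ∈ LinearMap.ker f := by
          rw [LinearMap.mem_ker, hfA, LinearMap.mem_ker.mp hy, smul_zero]
        exact LinearMap.congr_fun h ⟨⟨_, C.ep_smul_mem (j.comp C.bar) y⟩, h3⟩
      · intro h
        refine LinearMap.ext fun y => h _ y.2
    have h3 := g.finrank_range_add_finrank_ker
    have h4 : finrank k (range g) ≤ N (j.comp C.bar) :=
      (Submodule.finrank_le _).trans (Subspace.dual_finrank_eq).le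
    rw [hg, h1] at h3
    change _ + N j = _ at h3; omega
  have h3 : ∑ j, N j = ∑ j, C.e j := by
    have h4 := C.finrank_eq_sum_pc (D := D)
    rw [hD, ← C.sum_e, sum_congr rfl fun j _ => h1 j, Finset.sum_add_distrib] at h4
    omega
  have h5 : ∀ j : S →+* k, C.e j ≤ N j := fun j => by
    have := h2 (j.comp C.bar)
    rwa [comp_bar_bar, C.e_bar] at this
  have h6 := (Finset.sum_eq_sum_iff_of_le fun j _ => h5 j).mp h3.symm j (Finset.mem_univ j)
  rw [h1, ← h6, two_mul]

section Cyclic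

/-- The condition that the `j`-component is divisible by `w`. -/
def Divisible (C : CyclicFrame p k S O conj) (D : Type*) [AddCommGroup D] [Module k D]
    [Module Oₖ D] [IsScalarTower k Oₖ D] (j : S →+* k) : Prop :=
  ∀ x ∈ C.pc D j, ∃ y, x = C.ww k • y

theorem pc_eq_bot_of_divisible {j : S →+* k} (hj : j C.β = 0) (h1 : Divisible C D j)
    (h2 : Divisible C D (j.comp C.bar)) {x : D} (hx : x ∈ C.pc D j) : x = 0 := by
  have key : ∀ n : ℕ, ∃ y ∈ C.pc D j, x = C.th k ((1 ⊗ₜ C.ϖ j) ^ n) • y := by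
    intro n
    induction n with
    | zero => exact ⟨x, hx, by simp⟩
    | succ n ih =>
      obtain ⟨y, hy, hxy⟩ := ih
      obtain ⟨z, hz⟩ := h1 y hy
      obtain ⟨u, hu⟩ := h2 _ (C.ep_smul_mem (j.comp C.bar) z)
      refine ⟨C.th k (C.ep j) • u, C.ep_smul_mem j u, ?_⟩
      have h3 : C.ww k • C.th k (C.ep (j.comp C.bar)) • z = y := by
        have := C.th_smul_ww_smul (C.ep j) z
        rw [br_ep, ← hz, C.mem_pc.mp hy] at this; exact this.symm
      have h4 : y = C.th k (1 ⊗ₜ C.ϖ j) • C.th k (C.ep j) • u := by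
        rw [smul_smul, th_mul_th_comm, mul_smul, C.ϖ_eq j hj, ← ww_smul_ww_smul, ← hu, h3]
        exact hy.symm
      rw [hxy, pow_succ, map_mul, mul_smul, ← h4]
  obtain ⟨y, hy, rfl⟩ := key (C.e j)
  rw [← C.mem_pc.mp hy, smul_smul, ← map_mul, C.ϖ_pow_mul_ep, map_zero]; exact zero_smul Oₖ y

theorem generate_of_not_divisible (hq : IsReduction p k O q) {j : S →+* k} (hj : j C.β = 0)
    {x₀ y₀ : C.pc D j} (hgen : Generate (C.T D j) x₀ y₀) (x : C.pc D j) (y : C.pc D (j.comp C.bar))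
    (hx : ∀ u, (x : D) ≠ C.ww k • u) (hy : ∀ u, (y : D) ≠ C.ww k • u) :
    Generate (C.T D j) x ⟨C.ww k • (y : D), C.ww_smul_mem' y.2⟩ := by
  have hT : ∀ u : C.pc D j, (C.T D j u : D) = C.ww k • C.ww k • (u : D) := fun u => by
    rw [coe_T, ww_smul_ww_smul, C.ϖ_eq j hj]
  obtain ⟨y₁, h1⟩ := hgen.exists_of_notMem (C.T_pow_eq_zero j) (x := x) fun w hw => by
    exact hx (C.ww k • (w : D)) (by rw [hw, hT])
  obtain ⟨c, d, u, h2⟩ := h1.exists_coeff ⟨C.ww k • (y : D), C.ww_smul_mem' y.2⟩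
  by_cases hd : d = 0
  · exfalso
    have h3 := congrArg (fun y : C.pc D j => (y : D)) h2
    simp only [hd, zero_smul, add_zero, Submodule.coe_add, Submodule.coe_smul, hT] at h3
    by_cases hc : c = 0
    · rw [hc, zero_smul, zero_add] at h3
      have hj' : (j.comp C.bar) C.β = 0 := by rwa [comp_bar_β]
      have he := C.e_pos j
      obtain ⟨v, hv⟩ := ww_exact hq hj' 1 (by rw [C.e_bar]; omega)
        (x := (y : D) - C.ww k • (u : D)) (Submodule.sub_mem _ y.2 (C.ww_smul_mem u.2))
        (by rw [pow_one, smul_sub, h3, sub_self])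
      refine hy (u + C.ww k ^ (2 * C.e j - 2) • v) ?_
      rw [smul_add, smul_smul, ← pow_succ', ← sub_eq_iff_eq_add', hv, C.e_bar]
      congr 2; omega
    · refine hx (c⁻¹ • ((y : D) - C.ww k • (u : D))) ?_
      rw [smul_comm, smul_sub, h3, add_sub_cancel_right, smul_smul, inv_mul_cancel₀ hc, one_smul]
  · exact h1.replace (C.T_pow_eq_zero j) h2 hd

/-- Existence of a generator. -/
theorem exists_cyclic (hq : IsReduction p k O q)
    (hdim : ∀ j, finrank k (C.pc D j) = 2 * C.e j)
    (hnd : ∀ j : S →+* k, j C.β = 0 → ¬ Divisible C D j) :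
    ∃ m : D, ∀ x : D, ∃ a : Oₖ, x = a • m := by
  classical
  have hgen : ∀ j : S →+* k, ∃ x y, Generate (C.T D j) x y := fun j =>
    exists_generate (C.e_pos j) (C.T_pow_eq_zero j) (fun n hn x hx => C.T_exact hq j n hn x hx)
      (hdim j)
  choose x y hxy using hgen
  have hr : ∀ j : S →+* k, ∃ x : C.pc D j, j C.β = 0 → ∀ u, (x : D) ≠ C.ww k • u := by
    intro j
    by_cases hj : j C.β = 0
    · have := hnd j hj
      unfold Divisible at this
      push Not at this
      obtain ⟨x, hx, h⟩ := this
      exact ⟨⟨x, hx⟩, fun _ => h⟩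
    · exact ⟨0, fun h => absurd h hj⟩
  choose x' hx' using hr
  let X : ∀ j : S →+* k, C.pc D j := fun j => if j C.β = 0 then x' j else x j
  have hX : ∀ j : S →+* k, j C.β = 0 → X j = x' j := fun j hj => if_pos hj
  have hX' : ∀ j : S →+* k, j C.β ≠ 0 → X j = x j := fun j hj => if_neg hj
  obtain ⟨m, hm, -⟩ := exists_generator_of_components X y
    (fun j hj _ => by rw [hX' j hj]; exact hxy j) fun j hj => by
      have hj' : (j.comp C.bar) C.β = 0 := by rwa [comp_bar_β]
      refine generate_of_not_divisible hq hj (hxy j) _ _ ?_ ?_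
      · rw [hX j hj]; exact hx' j hj
      · rw [hX _ hj']; exact hx' _ hj'
  exact ⟨m, hm⟩

end Cyclic

end CyclicFrame

end

/-! ### Frobenius twists of the components -/

/-- `q : M → D` with the kernel of `D → M/VM`. -/
structure IsVerschiebung (p : ℕ) [Fact p.Prime] {k O M D : Type*} [Field k] [CharP k p] [Ring O]
    [AddCommGroup M] [Module O𝕎 M] [AddCommGroup D] [Module k D]
    (q : M →+ D) (V : M →+ M) (N : Submodule k D) : Prop where
  injective : Injective V
  tmul_smul : ∀ (c : 𝕎) (s : O) x,
    V ((WittVector.frobenius c ⊗ₜ[ℤ] s : O𝕎) • x) = (c ⊗ₜ[ℤ] s) • V x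
  mem : ∀ x, q (V x) ∈ N
  exists_of_mem : ∀ y, q y ∈ N → ∃ y', y = V y'

section

namespace CyclicFrame

variable (p k S) in
/-- The Frobenius twist of `W ⊗ S`. -/
def twist : 𝕎 ⊗[ℤ] S →+* 𝕎 ⊗[ℤ] S :=
  (Algebra.TensorProduct.map (WittVector.frobenius (p := p) (R := k)).toIntAlgHom
    (AlgHom.id ℤ S)).toRingHom

theorem twist_tmul (c : 𝕎) (s : S) :
    twist p k S (c ⊗ₜ s) = WittVector.frobenius c ⊗ₜ s := rfl

theorem wchar_twist (j : S →+* k) (r : 𝕎 ⊗[ℤ] S) :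
    wchar p ((frobenius k p).comp j) (twist p k S r) = wchar p j r ^ p := by
  induction r with
  | zero => simp [(Fact.out : p.Prime).ne_zero]
  | add x y hx hy => rw [map_add, map_add, hx, hy, map_add, add_pow_char]
  | tmul c s =>
    rw [twist_tmul, wchar_tmul, wchar_tmul, mul_pow, RingHom.comp_apply, frobenius_def]
    congr 1; exact WittVector.coeff_frobenius_charP p c 0

theorem twist_eps (j : S →+* k) :
    twist p k S (C.eps j) = C.eps ((frobenius k p).comp j) := by
  refine idempotent_ext p (by rw [← map_mul, eps_mul_self]) (C.eps_mul_self _) fun l => ?_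
  obtain ⟨l', rfl⟩ : ∃ l' : S →+* k, (frobenius k p).comp l' = l := by
    refine ⟨((frobeniusEquiv k p).symm : k →+* k).comp l, RingHom.ext fun x => ?_⟩
    exact frobenius_apply_frobeniusEquiv_symm k p (l x)
  have hinj : (frobenius k p).comp l' = (frobenius k p).comp j ↔ l' = j := by
    refine ⟨fun h => RingHom.ext fun x => ?_, fun h => by rw [h]⟩
    exact frobenius_inj k p (congrArg (fun g : S →+* k => g x) h)
  rw [wchar_twist, wchar_eps, wchar_eps]; simp only [hinj]
  split_ifs
  · exact one_pow p
  · exact zero_pow (Fact.out : p.Prime).ne_zero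

variable [FiniteDimensional k D] {V : M →+ M} {N : Submodule k D}

theorem _root_.MinimalTypeD.IsVerschiebung.map_th_twist (hV : IsVerschiebung p (O := O) q V N)
    (r : 𝕎 ⊗[ℤ] S) (x : M) :
    V (C.th _ (twist p k S r) • x) = C.th _ r • V x := by
  induction r with
  | zero =>
    rw [map_zero, map_zero]
    have h1 : (0 : O𝕎) • x = 0 := zero_smul O𝕎 x
    have h2 : (0 : O𝕎) • V x = 0 := zero_smul O𝕎 (V x)
    rw [h1, h2, map_zero]
  | add r s hr hs => rw [map_add, map_add, map_add, add_smul, add_smul, map_add, hr, hs]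
  | tmul c s => exact hV.tmul_smul c (C.θ s) x

theorem _root_.MinimalTypeD.IsVerschiebung.map_eps (hV : IsVerschiebung p (O := O) q V N)
    (j : S →+* k) (x : M) :
    V (C.th _ (C.eps ((frobenius k p).comp j)) • x) = C.th _ (C.eps j) • V x := by
  rw [← twist_eps, hV.map_th_twist]

theorem _root_.MinimalTypeD.IsVerschiebung.map_ww (hV : IsVerschiebung p (O := O) q V N) (x : M) :
    V (C.ww 𝕎 • x) = C.ww 𝕎 • V x := by
  have := hV.tmul_smul 1 C.w x
  rwa [map_one] at this

section Divisible

variable {Q : Type*} [AddCommGroup Q] [Module k Q] [Module Oₖ Q]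
  [IsScalarTower k Oₖ Q] {f : D →ₗ[k] Q}

theorem Divisible.frobenius (hq : IsReduction p k O q)
    (hV : IsVerschiebung p (O := O) q V (LinearMap.ker f)) (hf : Surjective f)
    (hfA : ∀ (a : Oₖ) x, f (a • x) = a • f x)
    (hQ : ∀ j, finrank k (C.pc Q j) = C.e j) {j : S →+* k} (hj : j C.β = 0)
    (hd : Divisible C D j) : Divisible C D ((frobenius k p).comp j) := by
  have hfin : FiniteDimensional k Q := Module.Finite.of_surjective f hf
  have hred : ∀ (j : S →+* k) (x : M),
      q (C.th _ (C.eps j) • x) = C.th k (C.ep j) • q x := fun j x => by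
    rw [hq.map_smul, red_th]; rfl
  have hredw : ∀ x : M, q (C.ww 𝕎 • x) = C.ww k • q x := fun x => by rw [hq.map_smul, red_ww]
  intro x hx
  obtain ⟨x', rfl⟩ := hq.surjective x
  set z := C.th _ (C.eps ((_root_.frobenius k p).comp j)) • x' with hz
  have hqz : q z = q x' := by rw [hz, hred]; exact hx
  have hVz : V z = C.th _ (C.eps j) • V x' := hV.map_eps j x'
  have hVz' : C.th _ (C.eps j) • V z = V z := by rw [hVz, smul_smul, ← map_mul, eps_mul_self]
  obtain ⟨y₀, hy₀⟩ := hd (q (V z)) (by rw [hVz, hred]; exact C.ep_smul_mem _ _)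
  obtain ⟨y', rfl⟩ := hq.surjective y₀
  rw [← hredw, ← sub_eq_zero, ← map_sub] at hy₀
  obtain ⟨t, ht⟩ := hq.eq_zero _ hy₀
  obtain ⟨u, hu⟩ := C.exists_pow_mul_eq j
  obtain ⟨n, hn⟩ : ∃ n, 2 * C.e j = n + 1 := ⟨2 * C.e j - 1, by have := C.e_pos j; omega⟩
  have hpe : C.th 𝕎 (C.eps j) • p • t =
      C.ww 𝕎 • (C.ww 𝕎 ^ n * C.th 𝕎 u *
        C.th 𝕎 (C.eps j)) • t := by
    have h1 : C.ww 𝕎 * (C.ww 𝕎 ^ n * C.th _ u * C.th _ (C.eps j)) =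
        C.th _ ((p : 𝕎 ⊗[ℤ] S) * C.eps j) := by
      rw [← hu, ← mul_assoc, ← mul_assoc, ← pow_succ', ← hn, ww_pow_two_mul _ hj, ← map_mul,
        ← map_mul]
    rw [smul_smul, h1, ← cast_smul_eq_nsmul O𝕎, smul_smul, map_mul,
      map_natCast, Nat.cast_comm]
  obtain ⟨y, hy⟩ : ∃ y, V z = C.ww 𝕎 • C.th _ (C.eps (j.comp C.bar)) • y := by
    refine ⟨y' + (C.ww _ ^ n * C.th _ u * C.th _ (C.eps j)) • t, ?_⟩
    have h2 : C.th 𝕎 (C.eps j) • C.th 𝕎 (C.eps j) • p • t =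
        C.th 𝕎 (C.eps j) • p • t := by
      rw [smul_smul, ← map_mul, eps_mul_self]
    rw [smul_smul, ← br_eps, ← th_mul_ww, mul_smul, smul_add, ← hpe, smul_add, h2, ← smul_add,
      ← sub_eq_iff_eq_add'.mp ht, hVz']
  set y₁ := C.th 𝕎 (C.eps (j.comp C.bar)) • y with hy₁
  have hy₁pc : f (q y₁) ∈ C.pc Q (j.comp C.bar) := by rw [hy₁, hred, hfA]; exact C.ep_smul_mem _ _
  let g : C.pc Q (j.comp C.bar) →ₗ[k] C.pc Q j :=
    (lsmul k k Q (C.ww k)).restrict fun x hx => C.ww_smul_mem' hx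
  have hg : ∀ x, (g x : Q) = C.ww k • (x : Q) := fun _ => rfl
  have hgs : Surjective g := by
    rintro ⟨v, hv⟩
    obtain ⟨d, rfl⟩ := hf v
    obtain ⟨y₁, h1⟩ := hd _ (C.ep_smul_mem j d)
    refine ⟨C.proj _ (f y₁), Subtype.ext ?_⟩
    rw [hg, coe_proj, ww_smul_th_smul, br_ep, comp_bar_bar, ← hfA (C.ww k), ← h1, ← hfA, smul_smul,
      ← map_mul, ep_mul_self, hfA]
    exact hv
  have hgi : Injective g :=
    (injective_iff_surjective_of_finrank_eq_finrank (by rw [hQ, hQ, C.e_bar])).mpr hgs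
  have h0 : f (q y₁) = 0 := by
    have h1 : g ⟨f (q y₁), hy₁pc⟩ = g 0 := by
      rw [map_zero]
      refine Subtype.ext ?_
      rw [hg, Submodule.coe_zero, ← hfA, ← hredw, ← hy]; exact hV.mem z
    exact congrArg Subtype.val (hgi h1)
  obtain ⟨y₂, hy₂⟩ := hV.exists_of_mem y₁ h0
  rw [hy₂, ← hV.map_ww] at hy
  refine ⟨q y₂, ?_⟩
  rw [← hqz, hV.injective hy, hredw]

theorem not_divisible (hq : IsReduction p k O q)
    (hV : IsVerschiebung p (O := O) q V (LinearMap.ker f)) (hf : Surjective f)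
    (hfA : ∀ (a : Oₖ) x, f (a • x) = a • f x)
    (hQ : ∀ j, finrank k (C.pc Q j) = C.e j)
    (hdim : ∀ j, finrank k (C.pc D j) = 2 * C.e j) {j : S →+* k} (hj : j C.β = 0) :
    ¬ Divisible C D j := by
  intro h
  have key : ∀ n : ℕ, Divisible C D ((iterateFrobenius k p n).comp j) := by
    intro n
    induction n with
    | zero =>
      have : (iterateFrobenius k p 0).comp j = j := RingHom.ext fun x => by simp
      rwa [this]
    | succ n ih =>
      have h1 : (iterateFrobenius k p (n + 1)).comp j =
          (frobenius k p).comp ((iterateFrobenius k p n).comp j) := RingHom.ext fun x => by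
        simp [iterateFrobenius_def, frobenius_def, pow_succ, pow_mul]
      rw [h1]; exact ih.frobenius hq hV hf hfA hQ (by simp [hj])
  obtain ⟨n, hn⟩ := C.frob j hj
  have h1 : (iterateFrobenius k p n).comp j = j.comp C.bar := RingHom.ext fun x => by
    rw [RingHom.comp_apply, iterateFrobenius_def, hn]; rfl
  have h2 := key n
  rw [h1] at h2
  have h3 : C.pc D j = ⊥ := by
    rw [eq_bot_iff]; exact fun x hx => pc_eq_bot_of_divisible hj h h2 hx
  have h4 := hdim j
  rw [h3, finrank_bot] at h4
  have := C.e_pos j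
  omega

end Divisible

end CyclicFrame

end

/-! ### The determinant condition -/

section

namespace CyclicFrame

variable {F : Type*} [Field F] [NumberField F] [IsTotallyReal F] {a b : F}
  {O : Subalgebra (𝓞 F) ℍ[F, a, b]} (hO : IsOrderIn (𝓞 F) F O)
  {conj : O → O} {C : CyclicFrame p k S O conj}
  {D : Type*} [AddCommGroup D] [Module k D] [Module Oₖ D] [IsScalarTower k Oₖ D]
  [FiniteDimensional k D]

include hO in
theorem charpoly_of_bijective {m : D} (hm : Bijective fun a : Oₖ => a • m)
    (x : O) {f : End k D} (hf : ∀ v, f v = ((1 : k) ⊗ₜ[ℤ] x) • v) {P : ℤ[X]}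
    (hP : IsReducedCharpoly (x : ℍ[F, a, b]) P) :
    f.charpoly = (P.map (Int.castRingHom k)) ^ 2 := by
  have := finite_int hO.1
  let E : Oₖ ≃ₗ[k] D := (ofBijective
    (toSpanSingleton Oₖ D m) hm).restrictScalars k
  have hE : ∀ a, E a = a • m := fun _ => rfl
  have h1 : f = E.conj ((mulLeft ℤ x).baseChange k) := by
    refine LinearMap.ext fun v => ?_
    obtain ⟨a, rfl⟩ := E.surjective v
    have h2 : (mulLeft ℤ x).baseChange k a = (1 ⊗ₜ x) * a := by
      induction a with
      | zero => simp
      | add a b ha hb => rw [map_add, mul_add, ha, hb]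
      | tmul c y => simp
    rw [LinearEquiv.conj_apply_apply, symm_apply_apply, h2, hf, hE, hE, smul_smul]
  rw [h1, LinearEquiv.charpoly_conj, LinearMap.charpoly_baseChange, hP.sq_eq hO, Polynomial.map_pow]
  rfl

theorem monic_of_isReducedCharpoly {x : ℍ[F, a, b]} {P : ℤ[X]} (hP : IsReducedCharpoly x P) :
    P.Monic := by
  unfold IsReducedCharpoly at hP
  refine Polynomial.monic_of_injective (f := Int.castRingHom ℝ) Int.cast_injective
    (hP ▸ Polynomial.monic_prod_of_monic _ _ fun φ _ => ?_)
  monicity!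

include hO in
theorem natDegree_of_isReducedCharpoly {x : O} {P : ℤ[X]}
    (hP : IsReducedCharpoly (x : ℍ[F, a, b]) P) : P.natDegree = 2 * finrank ℚ F := by
  have := finite_int hO.1
  have h := congrArg Polynomial.natDegree (hP.sq_eq hO)
  rw [LinearMap.charpoly_natDegree, finrank_order hO, Polynomial.natDegree_pow] at h; omega

include hO in
/-- The determinant condition holds for standard Lagrangian submodules. -/
theorem IsAdm.charpoly_quotient (h2 : (2 : k) ≠ 0) {ε : (S →+* k) → ℕ × ℕ} (hε : C.IsAdm ε) {m : D}
    (hm : Bijective fun a : Oₖ => a • m) (x : O) {f : End k D}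
    (hf : ∀ v, f v = ((1 : k) ⊗ₜ[ℤ] x) • v) {P : ℤ[X]} (hP : IsReducedCharpoly (x : ℍ[F, a, b]) P)
    (hN : C.zspan ε m ≤ (C.zspan ε m).comap f) :
    ((C.zspan ε m).mapQ (C.zspan ε m) f hN).charpoly = P.map (Int.castRingHom k) := by
  have := finite_int hO.1
  have h := hε.charpoly_sq hm f _ hf hN
  rw [charpoly_of_bijective hO hm x hf hP, sq_eq_sq_iff_eq_or_eq_neg] at h
  refine h.resolve_right fun h => h2 ?_
  have h3 := (LinearMap.charpoly_monic ((C.zspan ε m).mapQ (C.zspan ε m) f hN)).leadingCoeff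
  rw [h, Polynomial.leadingCoeff_neg, ((monic_of_isReducedCharpoly hP).map _).leadingCoeff] at h3
  linear_combination -h3

include hO in
/-- The determinant condition determines the dimensions of the components. -/
theorem finrank_pc_of_charpoly (hS : finrank ℤ S = 2 * finrank ℚ F) {Q : Type*}
    [AddCommGroup Q] [Module k Q] [Module Oₖ Q] [IsScalarTower k Oₖ Q]
    [FiniteDimensional k Q] {ρ : O → End k Q} (hρ : ∀ x v, ρ x v = ((1 : k) ⊗ₜ[ℤ] x) • v)
    (hdet : ∀ x : O, ∃ P : ℤ[X], IsReducedCharpoly (x : ℍ[F, a, b]) P ∧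
      (ρ x).charpoly = P.map (Int.castRingHom k)) (j : S →+* k) :
    finrank k (C.pc Q j) = C.e j := by
  have := finite_int hO.1
  obtain ⟨s, hs⟩ := exists_separating p j
  obtain ⟨P, hP, hPQ⟩ := hdet (C.θ s)
  have hbij : Bijective fun a : Oₖ => a • (1 : Oₖ) :=
    ⟨fun a b h => by simpa using h, fun a => ⟨a, by simp⟩⟩
  have h1 := charpoly_of_bijective hO hbij (C.θ s)
    (f := lsmul k k Oₖ ((1 : k) ⊗ₜ[ℤ] (C.θ s))) (fun _ => rfl) hP
  have h2 := LinearMap.finrank_maxGenEigenspace_eq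
    (lsmul k k Oₖ ((1 : k) ⊗ₜ[ℤ] (C.θ s))) (j s)
  have hcyc : ∀ x : Oₖ, ∃ a : Oₖ, x = a • (1 : Oₖ) := fun x => ⟨x, by simp⟩
  rw [maxGenEigenspace_eq_pc (C := C) (fun _ => rfl) fun l hl => hs l hl, h1,
    C.finrank_pc (by rw [finrank_baseChange, finrank_order hO, hS]; ring)
      fun j => ⟨_, _, C.generate_of_cyclic hcyc j⟩] at h2
  have h3 := LinearMap.finrank_maxGenEigenspace_eq (ρ (C.θ s)) (j s)
  rw [maxGenEigenspace_eq_pc (C := C) (f := ρ (C.θ s)) (s := s) (fun x => hρ _ x)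
    fun l hl => hs l hl, hPQ] at h3
  have h4 := ((monic_of_isReducedCharpoly hP).map (Int.castRingHom k)).ne_zero
  rw [pow_two, Polynomial.rootMultiplicity_mul (mul_ne_zero h4 h4)] at h2; omega

end CyclicFrame

end

/-! ### The places where the quaternion algebra is ramified -/

theorem exists_sq_eq_of_norm_sub_lt {L : Type*} [NormedField L] [CompleteSpace L]
    [IsUltrametricDist L] (h2 : ‖(2 : L)‖ = 1) {u c : L} (hc : ‖c‖ = 1) (h : ‖u - c ^ 2‖ < 1) :
    ∃ x, x ^ 2 = u := by
  have hc0 : c ≠ 0 := fun h => by simp [h] at hc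
  have h20 : (2 : L) ≠ 0 := fun h => by simp [h] at h2
  set e : L := u / c ^ 2 - 1 with he
  have hec : e * c ^ 2 = u - c ^ 2 := by rw [he]; field_simp
  have hen : ‖e‖ < 1 := by
    have := congrArg norm hec
    rw [norm_mul, norm_pow, hc, one_pow, mul_one] at this; rwa [this]
  let s : Set L := Metric.closedBall 0 ‖e‖
  let f : L → L := fun t => (e - t ^ 2) / 2
  have hs : Set.MapsTo f s s := fun t ht => by
    rw [mem_closedBall_zero_iff] at ht ⊢; rw [norm_div, h2, div_one]
    refine (sub_eq_add_neg e _ ▸ norm_add_le_max _ _).trans (max_le le_rfl ?_)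
    rw [norm_neg, norm_pow, pow_two]
    nlinarith [norm_nonneg t]
  have hcon : ContractingWith ‖e‖₊ (hs.restrict f s s) := by
    refine ⟨by exact_mod_cast hen, LipschitzWith.of_dist_le_mul fun x y => ?_⟩
    have hx := mem_closedBall_zero_iff.mp x.2
    have hy := mem_closedBall_zero_iff.mp y.2
    change dist (f x) (f y) ≤ ‖e‖ * dist (x : L) y
    rw [dist_eq_norm, dist_eq_norm, show f x - f y = -((x + y) * (x - y)) / 2 by
      simp only [f]; ring, norm_div, h2, div_one, norm_neg, norm_mul]
    exact mul_le_mul_of_nonneg_right ((norm_add_le_max _ _).trans (max_le hx hy))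
      (norm_nonneg _)
  obtain ⟨t, -, ht, -⟩ := hcon.exists_fixedPoint' Metric.isClosed_closedBall.isComplete hs
    (x := 0) (by simp [s]) (edist_ne_top _ _)
  refine ⟨c * (1 + t), ?_⟩
  have ht' : (e - t ^ 2) / 2 = t := ht
  field_simp at ht'
  linear_combination (-c ^ 2) * ht' + hec

theorem mul_star_eq_algebraMap {R : Type*} [CommRing R] {c d : R} (y : ℍ[R, c, d]) :
    y * star y = algebraMap _ _ (y.re ^ 2 - c * y.imI ^ 2 - d * (y.imJ ^ 2 - c * y.imK ^ 2)) := by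
  change y * star y = QuaternionAlgebra.coe _
  ext <;> simp only [QuaternionAlgebra.re_coe, QuaternionAlgebra.imI_coe,
    QuaternionAlgebra.imJ_coe, QuaternionAlgebra.imK_coe] <;> simp <;> ring

namespace QuatFrame

open IsDedekindDomain WithZero

variable {F : Type*} [Field F] [NumberField F] {a b : F}
  {O : Subalgebra (𝓞 F) ℍ[F, a, b]} {conj : O → O} (f : QuatFrame (R := 𝓞 F) p O conj)
  (v : HeightOneSpectrum (𝓞 F))

/-- The inclusion of the integers of `F` in the completion. -/
def toCompl : 𝓞 F →+* v.adicCompletion F := (algebraMap F (v.adicCompletion F)).comp (algebraMap (𝓞 F) F)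

theorem norm_toCompl_lt_one_iff (c : 𝓞 F) : ‖toCompl v c‖ < 1 ↔ c ∈ v.asIdeal :=
  NumberField.FinitePlace.norm_lt_one_iff_mem F v c

theorem norm_toCompl_eq_one_iff (c : 𝓞 F) : ‖toCompl v c‖ = 1 ↔ c ∉ v.asIdeal :=
  NumberField.FinitePlace.norm_eq_one_iff_notMem F v c

instance : IsUltrametricDist (v.adicCompletion F) :=
  inferInstanceAs (@IsUltrametricDist _ (Valued.toNormedField (v.adicCompletion F) ℤᵐ⁰).toDist)

theorem exists_norm_sub_lt {t : v.adicCompletion F} (ht : ‖t‖ ≤ 1) :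
    ∃ c : 𝓞 F, ‖t - toCompl v c‖ < 1 := by
  obtain ⟨y, hy⟩ := (HeightOneSpectrum.denseRange_algebraMap (K := F) v).exists_dist_lt t one_pos
  rw [dist_eq_norm] at hy
  have hy1 : ‖algebraMap F (v.adicCompletion F) y‖ ≤ 1 := by
    rw [← sub_sub_cancel t (algebraMap F (v.adicCompletion F) y), sub_eq_add_neg]
    exact (norm_add_le_max _ _).trans (max_le ht (by rw [norm_neg]; exact hy.le))
  have hy2 : v.valuation F y ≤ 1 := by
    rw [← HeightOneSpectrum.valuedAdicCompletion_eq_valuation']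
    exact Valued.toNormedField.norm_le_one_iff.mp hy1
  obtain ⟨c, hc⟩ := v.exists_valuation_sub_lt_of_integer hy2 1
  refine ⟨c, ?_⟩
  have hc' : ‖algebraMap F (v.adicCompletion F) y - toCompl v c‖ < 1 := by
    rw [norm_sub_rev, toCompl, RingHom.comp_apply, ← map_sub]
    rw [← HeightOneSpectrum.valuedAdicCompletion_eq_valuation'] at hc
    exact Valued.toNormedField.norm_lt_one_iff.mpr hc
  rw [← sub_add_sub_cancel t (algebraMap F (v.adicCompletion F) y)]
  exact (norm_add_le_max _ _).trans_lt (max_lt hy hc')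

theorem tmul_algebraMap_coe {v : HeightOneSpectrum (𝓞 F)} (c : 𝓞 F) :
    (1 : v.adicCompletion F) ⊗ₜ[F] ((algebraMap (𝓞 F) O c : O) : ℍ[F, a, b]) =
      toCompl v c • (1 : v.adicCompletion F ⊗[F] ℍ[F, a, b]) := by
  have h : ((algebraMap (𝓞 F) O c : O) : ℍ[F, a, b]) = (c : F) • (1 : ℍ[F, a, b]) := by
    rw [← algebraMap_eq_smul_one]; rfl
  rw [h, tmul_smul, ← algebraMap_smul (v.adicCompletion F) (c : F)]; rfl

theorem norm_sub_sq {α : 𝓞 F} (hα : α ∉ v.asIdeal) (hns : ∀ c, c ^ 2 - α ∉ v.asIdeal)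
    (r s : v.adicCompletion F) : ∃ x : v.adicCompletion F, ‖r ^ 2 - toCompl v α * s ^ 2‖ = ‖x‖ ^ 2 ∧
      (x = 0 → r = 0 ∧ s = 0) := by
  have hα' := (norm_toCompl_eq_one_iff v α).mpr hα
  have hs' : ‖toCompl v α * s ^ 2‖ = ‖s‖ ^ 2 := by rw [norm_mul, hα', one_mul, norm_pow]
  rcases lt_trichotomy ‖r‖ ‖s‖ with h | h | h
  · refine ⟨s, ?_, fun h0 => absurd h (by rw [h0, norm_zero]; exact (norm_nonneg r).not_gt)⟩
    rw [← hs', ← norm_neg (toCompl v α * s ^ 2)]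
    have h2 : ‖r ^ 2‖ < ‖-(toCompl v α * s ^ 2)‖ := by
      rw [norm_neg, hs', norm_pow]; exact pow_lt_pow_left₀ h (norm_nonneg r) two_ne_zero
    rw [sub_eq_add_neg, IsUltrametricDist.norm_add_eq_max_of_norm_ne_norm h2.ne, max_eq_right h2.le]
  · by_cases hs0 : s = 0
    · exact ⟨0, by rw [hs0, norm_zero, norm_eq_zero] at h; simp [h, hs0], fun _ =>
        ⟨by rwa [hs0, norm_zero, norm_eq_zero] at h, hs0⟩⟩
    refine ⟨s, ?_, fun h0 => absurd h0 hs0⟩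
    set t := r / s
    have ht : ‖t‖ = 1 := by rw [norm_div, h, div_self (norm_ne_zero_iff.mpr hs0)]
    have hrt : r ^ 2 - toCompl v α * s ^ 2 = (t ^ 2 - toCompl v α) * s ^ 2 := by
      simp only [t]; field_simp
    suffices h1 : ‖t ^ 2 - toCompl v α‖ = 1 by rw [hrt, norm_mul, h1, one_mul, norm_pow]
    obtain ⟨c, hc⟩ := exists_norm_sub_lt v ht.le
    have hc1 := (norm_toCompl_eq_one_iff v _).mpr (hns c)
    have hc2 : ‖(t - toCompl v c) * (t + toCompl v c)‖ < 1 := by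
      rw [norm_mul]
      refine mul_lt_one_of_nonneg_of_lt_one_left (norm_nonneg _) hc
        ((norm_add_le_max _ _).trans (max_le ht.le ?_))
      exact NumberField.FinitePlace.norm_le_one F v c
    have hsum : t ^ 2 - toCompl v α =
        (t - toCompl v c) * (t + toCompl v c) + toCompl v (c ^ 2 - α) := by
      rw [map_sub, map_pow]; ring
    rw [hsum, IsUltrametricDist.norm_add_eq_max_of_norm_ne_norm (by rw [hc1]; exact hc2.ne), hc1,
      max_eq_right hc2.le]
  · refine ⟨r, ?_, fun h0 => absurd h (by rw [h0, norm_zero]; exact (norm_nonneg s).not_gt)⟩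
    have h2 : ‖-(toCompl v α * s ^ 2)‖ < ‖r ^ 2‖ := by
      rw [norm_neg, hs', norm_pow]; exact pow_lt_pow_left₀ h (norm_nonneg s) two_ne_zero
    rw [sub_eq_add_neg, IsUltrametricDist.norm_add_eq_max_of_norm_ne_norm h2.ne', max_eq_left h2.le,
      norm_pow]

theorem eq_zero_of_sub_sq_eq {α β : 𝓞 F} (hα : α ∉ v.asIdeal) (hns : ∀ c, c ^ 2 - α ∉ v.asIdeal)
    (hβ : β ∈ v.asIdeal) (hβ2 : β ∉ v.asIdeal ^ 2) {x y z t : v.adicCompletion F}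
    (h : x ^ 2 - toCompl v α * y ^ 2 = toCompl v β * (z ^ 2 - toCompl v α * t ^ 2)) :
    x = 0 ∧ y = 0 ∧ z = 0 ∧ t = 0 := by
  obtain ⟨X, hX, hX0⟩ := norm_sub_sq v hα hns x y
  obtain ⟨Z, hZ, hZ0⟩ := norm_sub_sq v hα hns z t
  have hXZ := congrArg norm h
  rw [norm_mul, hX, hZ] at hXZ
  by_cases hz : Z = 0
  · rw [hz, norm_zero, zero_pow two_ne_zero, mul_zero] at hXZ
    have hx : X = 0 := by simpa using hXZ
    exact ⟨(hX0 hx).1, (hX0 hx).2, (hZ0 hz).1, (hZ0 hz).2⟩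
  exfalso
  have hq : ‖(X / Z) ^ 2‖ = ‖toCompl v β‖ := by
    rw [norm_pow, norm_div, div_pow, hXZ, mul_div_assoc, div_self (by positivity), mul_one]
  have hv : Valued.v ((X / Z) ^ 2) = v.intValuation β := by
    rw [← v.valuation_of_algebraMap (K := F), ← HeightOneSpectrum.valuedAdicCompletion_eq_valuation']
    exact le_antisymm (norm_le_iff.mp hq.le)
      (norm_le_iff.mp hq.ge)
  rw [map_pow] at hv
  have h1 := (v.intValuation_le_pow_iff_mem β 1).mpr (by rwa [pow_one])
  have h2 := mt (v.intValuation_le_pow_iff_mem β 2).mp hβ2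
  rw [← hv] at h1 h2
  have h0 : Valued.v (X / Z) ≠ 0 := fun h0 => h2 (by rw [h0]; simp)
  obtain ⟨n, hn⟩ : ∃ n : ℤ, Valued.v (X / Z) = exp n := ⟨_, (exp_log h0).symm⟩
  rw [hn, ← exp_nsmul, exp_le_exp] at h1 h2; simp at h1 h2; omega

theorem exists_sub_sq_eq (h2 : (2 : 𝓞 F) ∉ v.asIdeal) {α β : 𝓞 F} (hα : α ∉ v.asIdeal)
    (hβ : β ∉ v.asIdeal) : ∃ x y, x ^ 2 - toCompl v α * y ^ 2 = toCompl v β := by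
  have hv : v.asIdeal.IsMaximal := v.isMaximal
  have := Ideal.finiteQuotientOfFreeOfNeBot v.asIdeal v.ne_bot
  let κ := 𝓞 F ⧸ v.asIdeal
  let _ : Field κ := Ideal.Quotient.field _
  let _ : Fintype κ := Fintype.ofFinite κ
  let q : 𝓞 F →+* κ := Ideal.Quotient.mk v.asIdeal
  have hq : ∀ {c}, q c = 0 ↔ c ∈ v.asIdeal := Ideal.Quotient.eq_zero_iff_mem
  obtain ⟨c, d, hcd⟩ : ∃ c d, c ^ 2 - α * d ^ 2 - β ∈ v.asIdeal := by
    obtain ⟨c, d, h⟩ := FiniteField.exists_root_sum_quadratic (R := κ)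
      (f := Polynomial.X ^ 2 - Polynomial.C (q β)) (g := Polynomial.C (-q α) * Polynomial.X ^ 2)
      (Polynomial.degree_X_pow_sub_C two_pos _)
      (Polynomial.degree_C_mul_X_pow 2 (neg_ne_zero.mpr fun h => hα (hq.mp h))) (by
        refine FiniteField.odd_card_of_char_ne_two fun hc => h2 (hq.mp ?_)
        rw [map_ofNat, ← Nat.cast_ofNat, ← hc, ringChar.Nat.cast_ringChar])
    obtain ⟨c, rfl⟩ := mk_surjective c
    obtain ⟨d, rfl⟩ := mk_surjective d
    refine ⟨c, d, hq.mp ?_⟩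
    simp only [Polynomial.eval_sub, Polynomial.eval_mul, Polynomial.eval_pow, Polynomial.eval_X,
      Polynomial.eval_C] at h
    rw [map_sub, map_sub, map_mul, map_pow, map_pow]; linear_combination h
  have h2' : ‖(2 : v.adicCompletion F)‖ = 1 := by
    rw [← map_ofNat (toCompl v) 2]; exact (norm_toCompl_eq_one_iff v _).mpr h2
  have hα' := (norm_toCompl_eq_one_iff v α).mpr hα
  have hα0 : toCompl v α ≠ 0 := fun h => by simp [h] at hα'
  have hcd' := (norm_toCompl_lt_one_iff v _).mpr hcd
  simp only [map_sub, map_mul, map_pow] at hcd'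
  by_cases hc : c ∈ v.asIdeal
  · have hd : d ∉ v.asIdeal := fun hd => hβ <| by
      have := sub_mem (sub_mem (Ideal.pow_mem_of_mem _ hc 2 two_pos)
        (Ideal.mul_mem_left _ α (Ideal.pow_mem_of_mem _ hd 2 two_pos))) hcd
      rwa [sub_sub_cancel] at this
    obtain ⟨y, hy⟩ := exists_sq_eq_of_norm_sub_lt h2' (u := (toCompl v c ^ 2 - toCompl v β) / toCompl v α)
      ((norm_toCompl_eq_one_iff v d).mpr hd) (by
        rw [show (toCompl v c ^ 2 - toCompl v β) / toCompl v α - toCompl v d ^ 2 =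
          (toCompl v c ^ 2 - toCompl v α * toCompl v d ^ 2 - toCompl v β) / toCompl v α by
            field_simp; ring, norm_div, hα', div_one]
        exact hcd')
    exact ⟨toCompl v c, y, by rw [hy]; field_simp; ring⟩
  · obtain ⟨x, hx⟩ := exists_sq_eq_of_norm_sub_lt h2' (u := toCompl v β + toCompl v α * toCompl v d ^ 2)
      ((norm_toCompl_eq_one_iff v c).mpr hc) (by
        rw [norm_sub_rev]; rwa [show toCompl v c ^ 2 - (toCompl v β + toCompl v α * toCompl v d ^ 2) = _ by rw [add_comm, ← sub_sub]])
    exact ⟨x, toCompl v d, by rw [hx]; ring⟩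

variable {v}

/-- The quaternion basis of `B ⊗ F_v` defined by a frame. -/
def basisCompl : QuaternionAlgebra.Basis (v.adicCompletion F ⊗[F] ℍ[F, a, b])
    (toCompl v f.α) 0 (toCompl v f.β) where
  i := 1 ⊗ₜ (f.s : ℍ[F, a, b])
  j := 1 ⊗ₜ (f.w : ℍ[F, a, b])
  k := 1 ⊗ₜ ((f.s * f.w : O) : ℍ[F, a, b])
  i_mul_i := by
    rw [tmul_mul_tmul, one_mul, zero_smul, add_zero, ← Subalgebra.coe_mul,
      f.s_sq]
    exact tmul_algebraMap_coe f.α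
  j_mul_j := by
    rw [tmul_mul_tmul, one_mul, ← Subalgebra.coe_mul, f.w_sq]; exact tmul_algebraMap_coe f.β
  i_mul_j := by rw [tmul_mul_tmul, one_mul, ← Subalgebra.coe_mul]
  j_mul_i := by
    rw [tmul_mul_tmul, one_mul, ← Subalgebra.coe_mul, zero_smul, zero_sub,
      f.anti, Subalgebra.coe_neg, TensorProduct.tmul_neg, neg_neg]

theorem basisCompl_surjective (hO : IsOrderIn (𝓞 F) F O) (hpv : (p : 𝓞 F) ∈ v.asIdeal) :
    Surjective (f.basisCompl (v := v)).liftHom := by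
  set Ψ := (f.basisCompl (v := v)).liftHom
  have hΨ : ∀ x, Ψ x = (f.basisCompl (v := v)).lift x := fun _ => rfl
  have h1 : ∀ x : O, (1 : v.adicCompletion F) ⊗ₜ[F] (x : ℍ[F, a, b]) ∈ range Ψ.toLinearMap := by
    intro x
    obtain ⟨c, y0, y1, y2, y3, h⟩ := f.exists_mem_span x
    have hc : toCompl v (1 + p * c) ≠ 0 := fun h0 => by
      have := (norm_toCompl_lt_one_iff v (1 + p * c)).mp (by rw [h0, norm_zero]; exact one_pos)
      exact v.isPrime.ne_top ((Ideal.eq_top_iff_one _).mpr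
        (by simpa using sub_mem this (Ideal.mul_mem_right c _ hpv)))
    have h2 : ∀ (c : 𝓞 F) (y : O), (1 : v.adicCompletion F) ⊗ₜ[F] ((c • y : O) : ℍ[F, a, b]) =
        toCompl v c • ((1 : v.adicCompletion F) ⊗ₜ[F] (y : ℍ[F, a, b])) := by
      intro c y
      rw [smul_def, Subalgebra.coe_mul, ← one_mul (1 : v.adicCompletion F),
        ← tmul_mul_tmul, one_mul]
      change 1 ⊗ₜ[F] ((algebraMap (𝓞 F) O c : O) : ℍ[F, a, b]) * _ = _
      rw [tmul_algebraMap_coe, smul_mul_assoc, one_mul]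
    have h3 : toCompl v (1 + p * c) • ((1 : v.adicCompletion F) ⊗ₜ[F] (x : ℍ[F, a, b])) =
        Ψ ⟨toCompl v y0, toCompl v y1, toCompl v y2, toCompl v y3⟩ := by
      rw [← h2, h, hΨ, QuaternionAlgebra.Basis.lift]; simp only [Subalgebra.coe_add, tmul_add, h2]
      rw [tmul_algebraMap_coe, algebraMap_eq_smul_one]; rfl
    refine (Submodule.smul_mem_iff _ hc).mp ?_
    rw [h3]; exact ⟨_, rfl⟩
  intro z
  change z ∈ range Ψ.toLinearMap
  induction z with
  | zero => exact zero_mem _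
  | add x y hx hy => exact add_mem hx hy
  | tmul c y =>
    rw [show c ⊗ₜ[F] y = c • ((1 : v.adicCompletion F) ⊗ₜ[F] y) by
      rw [smul_tmul', smul_eq_mul, mul_one]]
    refine Submodule.smul_mem _ _ ?_
    have hy : y ∈ Submodule.span F (O : Set ℍ[F, a, b]) := hO.2 ▸ mem_top
    induction hy using Submodule.span_induction with
    | mem x hx => exact h1 ⟨x, hx⟩
    | zero => rw [tmul_zero]; exact zero_mem _
    | add x y _ _ hx hy => rw [tmul_add]; exact add_mem hx hy
    | smul c x _ hx =>
      rw [tmul_smul, ← algebraMap_smul (v.adicCompletion F) c]; exact Submodule.smul_mem _ _ hx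

theorem isRamifiedAt_iff (hO : IsOrderIn (𝓞 F) F O) (hp : p ≠ 2) (hpv : (p : 𝓞 F) ∈ v.asIdeal) :
    IsRamifiedAt a b v ↔ f.β ∈ v.asIdeal := by
  set Ψ := (f.basisCompl (v := v)).liftHom
  have hsurj : Surjective Ψ := f.basisCompl_surjective hO hpv
  have hinj : Injective Ψ := by
    have hfin : finrank (v.adicCompletion F) ℍ[v.adicCompletion F, toCompl v f.α, toCompl v f.β] =
        finrank (v.adicCompletion F) (v.adicCompletion F ⊗[F] ℍ[F, a, b]) := by
      rw [finrank_baseChange, finrank_eq_four,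
        finrank_eq_four]
    exact (injective_iff_surjective_of_finrank_eq_finrank
      (f := Ψ.toLinearMap) hfin).mpr hsurj
  have hα := f.α_notMem _ v.isPrime hpv
  have hnorm : ∀ y : ℍ[v.adicCompletion F, toCompl v f.α, toCompl v f.β],
      y * star y = algebraMap _ _ (y.re ^ 2 - toCompl v f.α * y.imI ^ 2 -
        toCompl v f.β * (y.imJ ^ 2 - toCompl v f.α * y.imK ^ 2)) := by
    exact mul_star_eq_algebraMap
  constructor
  · intro hr
    by_contra hβ
    have h2 : (2 : 𝓞 F) ∉ v.asIdeal := fun h2 => by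
      obtain ⟨m, hm⟩ := (Fact.out : p.Prime).odd_of_ne_two hp
      apply v.isPrime.ne_top; rw [Ideal.eq_top_iff_one]
      have h := sub_mem hpv (Ideal.mul_mem_right (m : 𝓞 F) _ h2)
      rwa [hm, Nat.cast_add, Nat.cast_mul, Nat.cast_ofNat, Nat.cast_one, add_sub_cancel_left] at h
    obtain ⟨x, y, hxy⟩ := exists_sub_sq_eq v h2 hα hβ
    let z : ℍ[v.adicCompletion F, toCompl v f.α, toCompl v f.β] := ⟨x, y, 1, 0⟩
    have hz : z * star z = 0 := by
      rw [hnorm]; simp [z, hxy]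
    have hz0 : z ≠ 0 := fun h => one_ne_zero (congrArg QuaternionAlgebra.imJ h)
    have hu := hr (Ψ z) fun h => hz0 (hinj (h.trans (map_zero Ψ).symm))
    have h0 : Ψ z * Ψ (star z) = 0 := by rw [← map_mul, hz, map_zero]
    have h1 : star z = 0 := hinj (((hu.mul_right_eq_zero).mp h0).trans (map_zero Ψ).symm)
    exact hz0 (star_eq_zero.mp h1)
  · intro hβ x hx
    obtain ⟨y, rfl⟩ := hsurj x
    have hn : y.re ^ 2 - toCompl v f.α * y.imI ^ 2 -
        toCompl v f.β * (y.imJ ^ 2 - toCompl v f.α * y.imK ^ 2) ≠ 0 := by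
      intro h0
      obtain ⟨h1, h2, h3, h4⟩ := eq_zero_of_sub_sq_eq v hα (f.nonsquare _ v.isPrime hpv hβ) hβ
        (f.β_notMem _ v.isPrime hpv) (sub_eq_zero.mp h0)
      exact hx (by rw [show y = 0 from QuaternionAlgebra.ext h1 h2 h3 h4, map_zero])
    refine IsUnit.map Ψ ?_
    set c := y.re ^ 2 - toCompl v f.α * y.imI ^ 2 -
        toCompl v f.β * (y.imJ ^ 2 - toCompl v f.α * y.imK ^ 2)
    have h1 : y * (c⁻¹ • star y) = 1 := by
      rw [mul_smul_comm, hnorm, algebraMap_eq_smul_one, smul_smul, inv_mul_cancel₀ hn, one_smul]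
    have h2 : (c⁻¹ • star y) * y = 1 := by
      have := hnorm (star y)
      rw [star_star] at this; rw [smul_mul_assoc, this, algebraMap_eq_smul_one, smul_smul]
      simp only [QuaternionAlgebra.re_star, QuaternionAlgebra.imI_star, QuaternionAlgebra.imJ_star,
        QuaternionAlgebra.imK_star, zero_mul, add_zero, neg_sq]
      rw [inv_mul_cancel₀ hn, one_smul]
    exact ⟨⟨y, _, h1, h2⟩, rfl⟩

end QuatFrame

/-! ### The crossed product structure of the order -/

section FrameOf

universe v

variable {p : ℕ} [Fact p.Prime] {F : Type v} [Field F] [NumberField F] {a b : F}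
  {O : Subalgebra (𝓞 F) ℍ[F, a, b]} {conj : O → O} {k : Type*} [Field k] [CharP k p]

/-- A crossed product structure on `O` which is compatible with the integers of `F`. -/
structure CyclicFrame.IsFrameOf {S : Type*} [CommRing S] (C : CyclicFrame p k S O conj)
    (ι : 𝓞 F →+* S) : Prop extends C.IsBase ι where
  finite : Module.Finite ℤ S
  free : Free ℤ S
  finrank_eq : finrank ℤ S = 2 * finrank ℚ F
  θ_ι : ∀ c, C.θ (ι c) = algebraMap (𝓞 F) O c
  e_eq : ∀ j : S →+* k, C.e j =
    Ideal.ramificationIdx' (Ideal.span {(p : ℤ)}) (placeOf p (j.comp ι)).asIdeal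
  ramified_iff : ∀ j : S →+* k, IsRamifiedAt a b (placeOf p (j.comp ι)) ↔ j C.β = 0

namespace CyclicFrame.IsFrameOf

variable {S : Type*} [CommRing S] {C : CyclicFrame p k S O conj} {ι : 𝓞 F →+* S}
  (h : C.IsFrameOf ι)

include h

theorem isAdm {ε : (𝓞 F →+* k) → ℕ × ℕ} (hε : IsAdmissible p a b ε) :
    C.IsAdm fun j => ε (j.comp ι) where
  bar_eq j := congrArg ε (h.comp_bar j)
  le j := (hε _).1
  add j := (hε _).2.1.trans (h.e_eq j).symm
  ramified j hj := by rw [h.e_eq]; exact (hε _).2.2 ((h.ramified_iff j).mpr hj)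

theorem exists_isAdmissible {ε : (S →+* k) → ℕ × ℕ} (hε : C.IsAdm ε) :
    ∃ ε' : (𝓞 F →+* k) → ℕ × ℕ, IsAdmissible p a b ε' ∧ ∀ j, ε j = ε' (j.comp ι) := by
  choose ext hext using h.exists_extension
  have key : ∀ j, ε j = ε (ext (j.comp ι)) := fun j => by
    rcases h.eq_or_eq j (ext (j.comp ι)) (hext _) with h1 | h1
    · rw [h1]
    · rw [h1, hε.bar_eq]
  refine ⟨fun i => ε (ext i), fun i => ?_, key⟩
  have he := h.e_eq (ext i)
  have hr := h.ramified_iff (ext i)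
  rw [hext] at he hr
  exact ⟨hε.le _, (hε.add _).trans he, fun hi => (hε.ramified _ (hr.mp hi)).trans (by rw [he])⟩

end CyclicFrame.IsFrameOf

theorem QuatFrame.isBase [IsAlgClosed k] (f : QuatFrame (R := 𝓞 F) p O conj) (hp : p ≠ 2)
    (conj_add : ∀ x y, conj (x + y) = conj x + conj y)
    (conj_mul : ∀ x y, conj (x * y) = conj y * conj x)
    (conj_algebraMap : ∀ c, conj (algebraMap (𝓞 F) O c) = algebraMap (𝓞 F) O c) :
    (f.toCyclicFrame (k := k) hp conj_add conj_mul conj_algebraMap).IsBase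
      (algebraMap (𝓞 F) f.Quad) where
  bar_ι r := f.bar_algebraMap r
  exists_extension i := by
    obtain ⟨t, ht⟩ := IsAlgClosed.exists_pow_nat_eq (i f.α) two_pos
    refine ⟨{ toFun := fun x => i x.re + i x.im * t
              map_zero' := by simp
              map_one' := ?_
              map_add' := fun x y => ?_
              map_mul' := fun x y => ?_ }, RingHom.ext fun c => ?_⟩
    · rw [show (1 : f.Quad).re = 1 from rfl, show (1 : f.Quad).im = 0 from rfl]; simp
    · simp only [QuadraticAlgebra.re_mul, QuadraticAlgebra.im_mul, map_add, map_mul]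
      rw [← ht]; simp only [map_zero]; ring
    · simp only [QuadraticAlgebra.re_add, QuadraticAlgebra.im_add, map_add]; ring
    · simp
  eq_or_eq j j' h := by
    have hω : ∀ j : f.Quad →+* k, j ⟨0, 1⟩ * j ⟨0, 1⟩ = j (algebraMap (𝓞 F) f.Quad f.α) := fun j => by
      rw [← map_mul, f.omega_mul_self]
    have hc : ∀ c, j' (algebraMap (𝓞 F) f.Quad c) = j (algebraMap (𝓞 F) f.Quad c) := fun c =>
      RingHom.congr_fun h c
    have h1 : j' ⟨0, 1⟩ * j' ⟨0, 1⟩ = j ⟨0, 1⟩ * j ⟨0, 1⟩ := by rw [hω, hω, hc]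
    rcases mul_self_eq_mul_self_iff.mp h1 with h2 | h2
    · refine Or.inl (RingHom.ext fun x => ?_)
      rw [f.eq_add x, map_add, map_mul, map_add, map_mul, hc, hc, h2]
    · refine Or.inr (RingHom.ext fun x => ?_)
      change j' x = j (f.bar x)
      rw [f.eq_add x, map_add, map_mul, map_add, map_mul, map_add, map_mul, f.bar_algebraMap,
        f.bar_algebraMap, hc, hc, h2, show f.bar ⟨0, 1⟩ = -⟨0, 1⟩ by
          ext <;> simp [QuatFrame.bar_re, QuatFrame.bar_im], map_neg]
  exists_unif j π h1 h2 := by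
    set i := j.comp (algebraMap (𝓞 F) f.Quad) with hi
    have := RingHom.ker_isPrime i
    obtain ⟨t, ht, h⟩ := exists_mul_eq_uniformizer_mul (ker i) h1 h2
    have hu := (f.exists_unif i).choose_spec
    obtain ⟨d, hd⟩ := h _ hu.1
    refine ⟨t, d, ht, fun h0 => hu.2.1 ?_, ?_⟩
    · rw [← pow_one (ker i)] at ht
      refine (mul_mem_pow (ker i) (a := t) ?_).resolve_left (by simpa using ht)
      rw [hd, pow_two]; exact Ideal.mul_mem_mul h1 h0
    · rw [toCyclicFrame_ϖ, ← map_mul, ← map_mul]; exact congrArg _ hd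

theorem exists_isFrameOf [IsTotallyReal F] [IsAlgClosed k]
    (hB : IsTotallyDefinite a b) (hp : p ≠ 2) (hO : IsStarOrderMaximalAt p O) :
    ∃ (S : Type v) (_ : CommRing S) (C : CyclicFrame p k S O (MinimalTypeD.conj hO.star_mem))
      (ι : 𝓞 F →+* S), C.IsFrameOf ι := by
  obtain ⟨f⟩ := exists_quatFrame hB p hp hO
  have h1 : Module.Finite ℤ f.Quad := Module.Finite.trans (𝓞 F) f.Quad
  have h2 : Free ℤ f.Quad := Free.trans (S := 𝓞 F)
  refine ⟨f.Quad, inferInstance, f.toCyclicFrame hp (fun x y => Subtype.ext (star_add _ _))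
    (fun x y => Subtype.ext (star_mul _ _)) (fun c => Subtype.ext ?_), algebraMap (𝓞 F) f.Quad,
    ⟨f.isBase hp _ _ _, h1, h2, ?_, f.incl_algebraMap, fun j => rfl, fun j => ?_⟩⟩
  · exact QuaternionAlgebra.star_coe _
  · rw [← Module.finrank_mul_finrank ℤ (𝓞 F) f.Quad, QuadraticAlgebra.finrank_eq_two,
      NumberField.RingOfIntegers.rank, mul_comm]
  · rw [f.isRamifiedAt_iff hO.isOrder hp]
    · exact Iff.rfl
    · change (j.comp (algebraMap (𝓞 F) f.Quad)) p = 0; rw [map_natCast, cast_eq_zero]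

end FrameOf

section

variable {X : Type*} [AddCommGroup X] [Module 𝕎 X]
  [Module O𝕎 X] [IsScalarTower 𝕎 O𝕎 X]
  [Module.Finite 𝕎 X] [Free 𝕎 X]

namespace CyclicFrame

/-! ### Construction of Dieudonné modules -/

theorem IsAdm.exists_mul_zW [Free ℤ O] {ε : (S →+* k) → ℕ × ℕ} (hε : C.IsAdm ε) :
    ∃ z', C.zW ε * z' = p ∧ z' * C.zW ε = p := by
  obtain ⟨ζ, η, h1, h2, -⟩ := hε.exists_zW_sq
  have h3 : C.zW ε * (C.zW ε * C.th _ η) = p := by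
    rw [← mul_assoc, h1, ← map_mul (C.th 𝕎), h2, map_natCast]
  have h4 : (C.th _ η * C.zW ε) * C.zW ε = p := by
    rw [mul_assoc, h1, ← map_mul (C.th 𝕎), mul_comm, h2, map_natCast]
  refine ⟨_, h3, sub_eq_zero.mp (isTorsionFree_witt_tensor p O ?_)⟩
  have h5 : C.zW ε * (C.zW ε * C.th _ η * C.zW ε - p) = 0 := by
    rw [mul_sub, ← mul_assoc (C.zW ε), h3, Nat.cast_comm, sub_self]
  rw [cast_smul_eq_nsmul, nsmul_eq_mul, ← h4, h4, ← h4, mul_assoc (C.th _ η * C.zW ε), h4, h5,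
    mul_zero]

theorem eq_zero_of_p_smul {x : X} (h : (p : 𝕎) • x = 0) : x = 0 :=
  (smul_eq_zero.mp h).resolve_left (WittVector.p_nonzero p k)

theorem IsAdm.exists_similitude (hp : p ≠ 2) [Free ℤ O] {ε : (S →+* k) → ℕ × ℕ}
    (hε : C.IsAdm ε) {ψ : BilinForm 𝕎 X} (halt : ψ.IsAlt)
    (hbij : Bijective ψ)
    (hadj : ∀ (a : O𝕎) x y, ψ (a • x) y = ψ x (C.cj _ a • y)) {m : X}
    (hm : Bijective fun a : O𝕎 => a • m)
    (hiso : ∀ a b : O𝕎,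
      (p : 𝕎) ∣ ψ (a • C.zW ε • m) (b • C.zW ε • m))
    (hmax : ∀ y, (∀ a : O𝕎, (p : 𝕎) ∣ ψ y (a • C.zW ε • m)) →
      ∃ a : O𝕎, y = a • C.zW ε • m) :
    ∃ Φ Ψ : X →ₗ[O𝕎] X, (∀ x, Φ (Ψ x) = (p : 𝕎) • x) ∧
      (∀ x, Ψ (Φ x) = (p : 𝕎) • x) ∧ (∀ x y, ψ (Ψ x) y = ψ x (Φ y)) ∧
      ∀ y, (∃ x, y = Φ x) ↔ ∃ a : O𝕎, y = a • C.zW ε • m := by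
  have hp0 : (p : 𝕎) ≠ 0 := WittVector.p_nonzero p k
  obtain ⟨z', hz1, hz2⟩ := hε.exists_mul_zW
  let E := ofBijective (toSpanSingleton O𝕎 X m) hm
  have hE : ∀ a, E.symm (a • m) = a := fun a => by rw [LinearEquiv.symm_apply_eq]; rfl
  let h := (toSpanSingleton O𝕎 X (C.zW ε • m)) ∘ₗ E.symm.toLinearMap
  let h' := (toSpanSingleton O𝕎 X (z' • m)) ∘ₗ E.symm.toLinearMap
  have hh : ∀ a, h (a • m) = a • C.zW ε • m := fun a => congrArg (· • C.zW ε • m) (hE a)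
  have hh' : ∀ a, h' (a • m) = a • z' • m := fun a => congrArg (· • z' • m) (hE a)
  have hps : ∀ x : X, (p : O𝕎) • x = (p : 𝕎) • x := fun x => by
    rw [cast_smul_eq_nsmul, cast_smul_eq_nsmul]
  have h1 : ∀ x, h (h' x) = (p : 𝕎) • x := fun x => by
    obtain ⟨a, rfl⟩ := hm.2 x
    dsimp only
    rw [hh', map_smul, hh, smul_smul z', hz2, hps, smul_comm]
  have h2 : ∀ x, h' (h x) = (p : 𝕎) • x := fun x => by
    obtain ⟨a, rfl⟩ := hm.2 x
    dsimp only
    rw [hh, map_smul, hh', smul_smul (C.zW ε), hz1, hps, smul_comm]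
  have hW : ∀ (f : X →ₗ[O𝕎] X) (c : 𝕎) x, f (c • x) = c • f x :=
    fun f c x => by rw [← algebraMap_smul O𝕎 c x, map_smul, algebraMap_smul]
  have hdvd : ∀ x y, (p : 𝕎) ∣ ψ (h x) (h y) := fun x y => by
    obtain ⟨a, rfl⟩ := hm.2 x
    obtain ⟨b, rfl⟩ := hm.2 y
    dsimp only
    rw [hh, hh]; exact hiso a b
  choose ψ₀ hψ₀ using hdvd
  have hc := fun {a b : 𝕎} => mul_left_cancel₀ (b := a) (c := b) hp0
  let ψ' : BilinForm 𝕎 X := LinearMap.mk₂ _ ψ₀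
    (fun x y z => hc (by rw [mul_add, ← hψ₀, ← hψ₀, ← hψ₀, map_add, map_add]; rfl))
    (fun c x y => hc (by
      rw [← hψ₀, hW, map_smul, LinearMap.smul_apply, hψ₀, smul_eq_mul, smul_eq_mul]; ring))
    (fun x y z => hc (by rw [mul_add, ← hψ₀, ← hψ₀, ← hψ₀, map_add, map_add]))
    (fun c x y => hc (by rw [← hψ₀, hW, map_smul, hψ₀, smul_eq_mul, smul_eq_mul]; ring))
  have hψ' : ∀ x y, ψ (h x) (h y) = p * ψ' x y := hψ₀
  have halt' : ψ'.IsAlt := fun x => hc (by rw [← hψ', halt, mul_zero])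
  have hbij' : Bijective ψ' := by
    constructor
    · rw [injective_iff_map_eq_zero]
      intro x hx
      have h3 : ψ (h x) = 0 := LinearMap.ext fun y => hc (by
        rw [← smul_eq_mul, ← map_smul, ← h1, hψ', hx]; simp)
      have h4 : h x = 0 := hbij.1 (h3.trans (map_zero ψ).symm)
      exact eq_zero_of_p_smul (by rw [← h2, h4, map_zero])
    · intro φ
      let h'' : X →ₗ[𝕎] X := { toFun := h', map_add' := map_add h', map_smul' := hW h' }
      obtain ⟨y, hy⟩ := hbij.2 (φ ∘ₗ h'')
      have hy' : ∀ w, ψ y (h w) = p * φ w := fun w => by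
        rw [hy, LinearMap.comp_apply, show h'' (h w) = h' (h w) from rfl, h2, map_smul, smul_eq_mul]
      obtain ⟨a, ha⟩ := hmax y fun a => ⟨φ (a • m), by rw [← hh, hy']⟩
      refine ⟨a • m, LinearMap.ext fun w => hc ?_⟩
      rw [← hψ', hh, ← ha, hy']
  obtain ⟨-, g, -, hg, hcomm, -⟩ :=
    (hasSquareRoots_witt p hp (k := k) (D := X)).exists_isometry_of_bijective halt halt' hbij hbij'
  have hgA : ∀ (a : O𝕎) x, a • g x = g (a • x) := fun a =>
    hcomm (a • ·) (C.cj _ a • ·) (smul_add a) (fun c x => smul_comm a c x) (hadj a) fun x y =>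
      hc (by rw [← hψ', ← hψ', map_smul h, map_smul h, hadj])
  let G : X ≃ₗ[O𝕎] X := { g with map_smul' := fun a x => (hgA a x).symm }
  have hG : ∀ x y, ψ' x y = ψ (G x) (G y) := hg
  have hΦ : ∀ x y, ψ (h (G.symm x)) (h (G.symm y)) = p * ψ x y := fun x y => by
    rw [hψ', hG, apply_symm_apply, apply_symm_apply]
  have h3 : ∀ x, h (G.symm (G (h' x))) = (p : 𝕎) • x := fun x => by rw [symm_apply_apply, h1]
  refine ⟨h ∘ₗ G.symm.toLinearMap, G.toLinearMap ∘ₗ h', h3, fun x => ?_, fun x y => hc ?_,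
    fun y => ⟨?_, ?_⟩⟩
  · change G (h' (h (G.symm x))) = _; rw [h2]
    exact (hW G.toLinearMap _ _).trans (congrArg _ (G.apply_symm_apply x))
  · change p * ψ (G (h' x)) y = p * ψ x (h (G.symm y))
    rw [← hΦ, h3, map_smul, LinearMap.smul_apply, smul_eq_mul]
  · rintro ⟨x, rfl⟩
    obtain ⟨a, ha⟩ := hm.2 (G.symm x)
    exact ⟨a, (congrArg h ha).symm.trans (hh a)⟩
  · rintro ⟨a, rfl⟩
    exact ⟨G (a • m), by rw [← hh]; exact congrArg h (G.symm_apply_apply _).symm⟩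

end CyclicFrame

/-! ### Reduction modulo `p` -/

theorem isAlt_baseChange {R K M : Type*} [CommRing R] [CommRing K] [Algebra R K] [AddCommGroup M]
    [Module R M] {ψ : BilinForm R M} (h : ψ.IsAlt) : (ψ.baseChange K).IsAlt := by
  have hs : ∀ x y, ψ.baseChange K x y + ψ.baseChange K y x = 0 := by
    intro x y
    induction x with
    | zero => simp
    | add x x' hx hx' =>
      rw [map_add, LinearMap.add_apply, map_add, add_add_add_comm, hx, hx', add_zero]
    | tmul c x =>
      induction y with
      | zero => simp
      | add y y' hy hy' =>
        rw [map_add, map_add, LinearMap.add_apply, add_add_add_comm, hy, hy', add_zero]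
      | tmul d y =>
        rw [baseChange_tmul, baseChange_tmul,
          mul_comm d c, ← add_smul, ← LinearMap.IsAlt.neg h, neg_add_cancel, zero_smul]
  intro x
  induction x with
  | zero => simp
  | add x y hx hy =>
    rw [map_add (ψ.baseChange K), LinearMap.add_apply, map_add, map_add, hx, hy, zero_add, add_zero,
      hs]
  | tmul c x => rw [baseChange_tmul, h, zero_smul]

theorem eq_zero_of_dual {K Y ι : Type*} [CommRing K] [AddCommGroup Y] [Module K Y] [Fintype ι]
    [DecidableEq ι] (β : Basis ι K Y) {B : BilinForm K Y} (l : ι → Y)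
    (hl : ∀ i j, B (β j) (l i) = if i = j then -1 else 0) {x : Y} (hx : ∀ y, B x y = 0) : x = 0 := by
  apply β.repr.injective; rw [map_zero]
  ext i
  have h := hx (l i)
  rw [← β.sum_repr x, map_sum, LinearMap.sum_apply] at h
  simp only [map_smul, LinearMap.smul_apply, hl, smul_eq_mul, mul_ite, mul_neg, mul_one, mul_zero,
    Finset.sum_ite_eq, Finset.mem_univ, if_true, neg_eq_zero] at h
  exact h

theorem exists_dual {R M ι : Type*} [CommRing R] [AddCommGroup M] [Module R M] [Fintype ι]
    [DecidableEq ι] (β : Basis ι R M) {ψ : BilinForm R M} (h : ψ.IsAlt)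
    (hs : Surjective ψ) : ∃ l : ι → M, ∀ i j, ψ (β j) (l i) = if i = j then -1 else 0 := by
  choose l hl using fun i => hs (β.coord i)
  refine ⟨l, fun i j => ?_⟩
  rw [← LinearMap.IsAlt.neg h, hl, Module.Basis.coord_apply, Module.Basis.repr_self,
    Finsupp.single_apply]
  simp only [eq_comm (a := i)]
  split_ifs <;> simp

theorem nondeg_baseChange {R M : Type*} (K : Type*) [CommRing R] [CommRing K] [Algebra R K]
    [AddCommGroup M] [Module R M] [Free R M] [Module.Finite R M]
    {ψ : BilinForm R M} (h : ψ.IsAlt) (hs : Surjective ψ) (x : K ⊗[R] M)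
    (hx : ∀ y, ψ.baseChange K x y = 0) : x = 0 := by
  classical
  let β := Module.Free.chooseBasis R M
  obtain ⟨l, hl⟩ := exists_dual β h hs
  refine eq_zero_of_dual (β.baseChange K) (fun i => 1 ⊗ₜ l i) (fun i j => ?_) hx
  rw [Module.Basis.baseChange_apply, baseChange_tmul, hl]
  split_ifs <;> simp

namespace CyclicFrame

variable (p k O) in
/-- `q : X → D` is the reduction modulo `p` of the lattice `X`. -/
structure IsModP (q : X →+ D) : Prop where
  surjective : Surjective q
  eq_zero_iff : ∀ x, q x = 0 ↔ ∃ z, x = (p : 𝕎) • z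
  map_smul : ∀ (c : 𝕎) x, q (c • x) = algebraMap 𝕎 k c • q x
  map_act : ∀ (s : O) x, q (((1 : 𝕎) ⊗ₜ[ℤ] s) • x) = ((1 : k) ⊗ₜ[ℤ] s) • q x

variable {q : X →+ D} (hq : IsModP p k O q)

theorem _root_.MinimalTypeD.tmul_eq_smul {R : Type*} [CommRing R] (c : R) (s : O) :
    (c ⊗ₜ[ℤ] s : R ⊗[ℤ] O) = c • (1 ⊗ₜ[ℤ] s) := by
  rw [smul_tmul', smul_eq_mul, mul_one]

include hq

theorem IsModP.isReduction : IsReduction p k O q where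
  surjective := hq.surjective
  eq_zero x hx := by
    obtain ⟨z, rfl⟩ := (hq.eq_zero_iff x).mp hx
    exact ⟨z, cast_smul_eq_nsmul _ _ _⟩
  map_nsmul x := (hq.eq_zero_iff _).mpr ⟨x, (cast_smul_eq_nsmul _ _ _).symm⟩
  torsionFree x hx := eq_zero_of_p_smul (k := k) (p := p) (by rwa [cast_smul_eq_nsmul])
  map_smul a x := by
    induction a with
    | zero =>
      have h1 : (0 : O𝕎) • x = 0 := zero_smul O𝕎 x
      rw [h1, map_zero, map_zero]; exact (zero_smul Oₖ (q x)).symm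
    | add a b ha hb => rw [add_smul, map_add, ha, hb, map_add, add_smul]
    | tmul c s =>
      rw [red_tmul, tmul_eq_smul c, tmul_eq_smul (algebraMap _ k c), smul_assoc, hq.map_smul, smul_assoc, hq.map_act]

theorem IsModP.bijective [Free ℤ O] [Module.Finite ℤ O] {m₀ m : X}
    (hm₀ : Bijective fun a : O𝕎 => a • m₀)
    (hm : Surjective fun a : Oₖ => a • q m) :
    Bijective fun a : O𝕎 => a • m := by
  let T (m : X) : O𝕎 →ₗ[𝕎] X := (toSpanSingleton O𝕎 X m).restrictScalars 𝕎
  let E := ofBijective (T m₀) hm₀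
  have hE : ∀ a, E.symm (a • m₀) = a := fun a => E.symm_apply_apply a
  let f : X →ₗ[𝕎] X := T m ∘ₗ E.symm.toLinearMap
  have hf : ∀ a, f (a • m₀) = a • m := fun a => congrArg (T m) (hE a)
  have hsurj : Surjective f := by
    rw [← LinearMap.range_eq_top, ← top_le_iff]
    refine Submodule.le_of_le_smul_of_le_jacobson_bot
      (I := Ideal.span {(p : 𝕎)}) Module.Finite.fg_top ?_ fun x _ => ?_
    · rw [IsLocalRing.jacobson_eq_maximalIdeal ⊥ bot_ne_top, Ideal.span_singleton_le_iff_mem,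
        IsLocalRing.mem_maximalIdeal, mem_nonunits_iff]
      intro hu
      have := hu.map (algebraMap 𝕎 k)
      rw [map_natCast, cast_eq_zero] at this; exact not_isUnit_zero this
    · obtain ⟨a, ha⟩ := hm (q x)
      obtain ⟨a, rfl⟩ := red_surjective p O a
      have h1 : q (x - a • m) = 0 := by
        rw [map_sub, hq.isReduction.map_smul, sub_eq_zero]; exact ha.symm
      obtain ⟨z, hz⟩ := (hq.eq_zero_iff _).mp h1
      rw [← sub_add_cancel x (a • m), hz]
      exact add_mem (Submodule.mem_sup_right (Submodule.smul_mem_smul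
        (Ideal.mem_span_singleton_self _) trivial))
        (Submodule.mem_sup_left ⟨a • m₀, hf a⟩)
  have : (fun a : O𝕎 => a • m) = f ∘ E := funext fun a => (hf a).symm
  rw [this]
  exact ⟨(OrzechProperty.injective_of_surjective_endomorphism f hsurj).comp E.injective,
    hsurj.comp E.surjective⟩

variable [FiniteDimensional k D]

/-- Symplectic similitudes with multiplier `p` whose image reduces to a Lagrangian submodule of
given type. -/
theorem IsModP.exists_similitude (hp : p ≠ 2) [Free ℤ O]
    [Module.Finite ℤ O] {ε : (S →+* k) → ℕ × ℕ} (hε : C.IsAdm ε)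
    {ψ : BilinForm 𝕎 X} (halt : ψ.IsAlt) (hbij : Bijective ψ)
    (hadj : ∀ (s : O) x y,
      ψ (((1 : 𝕎) ⊗ₜ[ℤ] s) • x) y = ψ x (((1 : 𝕎) ⊗ₜ[ℤ] conj s) • y))
    {B : BilinForm k D} (hskew : C.IsSkewForm B)
    (hB : ∀ x y, B (q x) (q y) = algebraMap 𝕎 k (ψ x y))
    {m₀ : X}
    (hm₀ : Bijective fun a : O𝕎 => a • m₀)
    (hfr : finrank k D = finrank ℤ O)
    (hOS : finrank ℤ O = 2 * finrank ℤ S) :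
    ∃ (Φ Ψ : X →ₗ[O𝕎] X) (m : D),
      (∀ x ∈ C.zspan ε m, ∀ y ∈ C.zspan ε m, B x y = 0) ∧
      (Bijective fun a : Oₖ => a • m) ∧ (∀ x, Φ (Ψ x) = (p : 𝕎) • x) ∧
      (∀ x, Ψ (Φ x) = (p : 𝕎) • x) ∧ (∀ x y, ψ (Ψ x) y = ψ x (Φ y)) ∧
      ∀ d, d ∈ C.zspan ε m ↔ ∃ x, d = q (Φ x) := by
  have hqr := hq.isReduction
  have hgen : ∀ d : D, ∃ a : Oₖ, d = a • q m₀ := fun d => by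
    obtain ⟨x, rfl⟩ := hq.surjective d
    obtain ⟨a, rfl⟩ := hm₀.2 x
    exact ⟨red p k O a, hqr.map_smul a m₀⟩
  have hdim := C.finrank_pc (hfr.trans hOS) fun j => ⟨_, _, C.generate_of_cyclic hgen j⟩
  obtain ⟨m', hm', hiso⟩ := hskew.exists_isotropic_zspan (two_ne_zero_of_charP p hp k) hqr hgen hdim hε
  obtain ⟨m, rfl⟩ := hq.surjective m'
  have hm : Bijective fun a : O𝕎 => a • m :=
    hq.bijective hm₀ fun d => by obtain ⟨a, ha⟩ := hm' d; exact ⟨a, ha.symm⟩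
  have hadj' : ∀ (a : O𝕎) x y, ψ (a • x) y = ψ x (C.cj _ a • y) := by
    intro a x y
    induction a with
    | zero =>
      have h1 : ∀ x : X, (0 : O𝕎) • x = 0 := fun x => zero_smul O𝕎 x
      rw [map_zero, h1, h1, map_zero, map_zero, LinearMap.zero_apply]
    | add a b ha hb =>
      rw [add_smul, map_add ψ, LinearMap.add_apply, ha, hb, map_add, add_smul, map_add]
    | tmul c s =>
      rw [cj_tmul, tmul_eq_smul c s, tmul_eq_smul c (conj s), smul_assoc, smul_assoc,
        _root_.map_smul ψ c, _root_.map_smul (ψ _) c, LinearMap.smul_apply, hadj]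
  have hqz : ∀ a : O𝕎, q (a • C.zW ε • m) = red p k O a • C.z ε • q m :=
    fun a => by rw [hqr.map_smul, hqr.map_smul]; rfl
  have hmem : ∀ a : O𝕎, q (a • C.zW ε • m) ∈ C.zspan ε (q m) := fun a => by
    rw [hqz]; exact C.mem_zspan.mpr ⟨_, rfl⟩
  have hex : ∀ d ∈ C.zspan ε (q m), ∃ a : O𝕎, d = q (a • C.zW ε • m) := by
    intro d hd
    obtain ⟨a, rfl⟩ := C.mem_zspan.mp hd
    obtain ⟨a, rfl⟩ := red_surjective p O a
    exact ⟨a, (hqz a).symm⟩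
  have hdvd : ∀ x y, (p : 𝕎) ∣ ψ x y ↔ B (q x) (q y) = 0 := fun x y => by
    rw [hB, algebraMap_witt_eq_zero_iff]; rfl
  obtain ⟨z', hz1, hz2⟩ := hε.exists_mul_zW
  obtain ⟨Φ, Ψ, h1, h2, h3, h4⟩ := hε.exists_similitude hp halt hbij hadj' hm
    (fun a b => (hdvd _ _).mpr (hiso _ (hmem a) _ (hmem b))) (fun y hy => by
      have hy' : q y ∈ C.zspan ε (q m) := by
        rw [mem_iff_of_isotropic hskew.alt hskew.nondeg (hε.finrank_zspan (bijective_of_cyclic hfr hm')) hiso]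
        intro d hd
        obtain ⟨a, rfl⟩ := hex d hd
        exact (hdvd _ _).mp (hy a)
      obtain ⟨a, ha⟩ := hex _ hy'
      rw [← sub_eq_zero, ← map_sub, hq.eq_zero_iff] at ha
      obtain ⟨w, hw⟩ := ha
      obtain ⟨b, rfl⟩ := hm.2 w
      refine ⟨a + b * z', ?_⟩
      dsimp only at hw
      rw [add_smul, mul_smul, ← mul_smul z', hz2, ← sub_eq_iff_eq_add', hw]
      rw [cast_smul_eq_nsmul, ← cast_smul_eq_nsmul O𝕎, ← mul_smul,
        ← mul_smul, Nat.cast_comm])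
  refine ⟨Φ, Ψ, q m, hiso, bijective_of_cyclic hfr hm', h1, h2, h3, fun d => ⟨fun hd => ?_, ?_⟩⟩
  · obtain ⟨a, rfl⟩ := hex d hd
    obtain ⟨x, hx⟩ := (h4 _).mpr ⟨a, rfl⟩
    exact ⟨x, by rw [hx]⟩
  · rintro ⟨x, rfl⟩
    obtain ⟨a, ha⟩ := (h4 _).mp ⟨x, rfl⟩
    rw [ha]; exact hmem a

end CyclicFrame

end

/-! ### Lagrangian submodules of given reduced Lie type -/

section

variable {p : ℕ} [Fact p.Prime] {F : Type*} [Field F] [NumberField F] {a b : F}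
  {O : Subalgebra (𝓞 F) ℍ[F, a, b]} {k : Type*} [Field k] [CharP k p]
  {D : Type*} [AddCommGroup D] [Module k D] {ρ : O → End k D}

theorem exists_uniformizer (p : ℕ) [Fact p.Prime] [CharP k p] (i : 𝓞 F →+* k) :
    ∃ π : 𝓞 F, π ∈ ker i ∧ π ∉ ker i ^ 2 := by
  obtain ⟨π, h1, h2⟩ := Ideal.exists_mem_pow_notMem_pow_succ (placeOf p i).asIdeal
    (placeOf p i).ne_bot (placeOf p i).isPrime.ne_top 1
  exact ⟨π, by rwa [pow_one] at h1, h2⟩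

theorem HasReducedLieType.unique (p : ℕ) [Fact p.Prime] [CharP k p] {N : Submodule k D}
    {hN : ∀ x, N ≤ N.comap (ρ x)} {ε ε' : (𝓞 F →+* k) → ℕ × ℕ} (h : HasReducedLieType ρ N hN ε)
    (h' : HasReducedLieType ρ N hN ε') : ε = ε' := by
  funext i
  obtain ⟨π, h1, h2⟩ := exists_uniformizer p i
  obtain ⟨φ, hφ⟩ := (h i).2 π h1 h2
  obtain ⟨φ', hφ'⟩ := (h' i).2 π h1 h2
  exact IsLieModel.unique (T := φ.symm.conj (lsmul k k _ Polynomial.X)) ⟨φ, fun y => rfl⟩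
    ⟨φ', fun y => Subtype.ext ((hφ' y).trans (hφ y).symm)⟩ (h i).1 (h' i).1

end

section

variable {k O D : Type*} [Field k] [Ring O] [AddCommGroup D] [Module k D] [Module Oₖ D]
  [IsScalarTower k Oₖ D] {ρ : O → End k D}

theorem smul_mem_of_act (hρ : ∀ x v, ρ x v = ((1 : k) ⊗ₜ[ℤ] x) • v) {N : Submodule k D}
    (hN : ∀ x, N ≤ N.comap (ρ x)) (a : Oₖ) : ∀ v ∈ N, a • v ∈ N := by
  intro v hv
  induction a with
  | zero =>
    have h : (0 : Oₖ) • v = 0 := zero_smul Oₖ v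
    rw [h]; exact N.zero_mem
  | add a b ha hb => rw [add_smul]; exact N.add_mem ha hb
  | tmul c s =>
    rw [tmul_eq_smul c s, smul_assoc, ← hρ]; exact N.smul_mem c (hN s hv)

end

section

namespace CyclicFrame

section

variable [Free ℤ O] {F : Type*} [Field F] [NumberField F] {ι : 𝓞 F →+* S}
  [FiniteDimensional k D]

theorem IsAdm.isLieModel_quotient (hB : C.IsBase ι) {ε : (S →+* k) → ℕ × ℕ} (hε : C.IsAdm ε) {m : D}
    (hm : Bijective fun a : Oₖ => a • m)
    (hdim : ∀ j, finrank k (C.pc D j) = 2 * C.e j)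
    {act : 𝓞 F → End k (D ⧸ C.zspan ε m)}
    (hact : ∀ c (x : D), act c ((C.zspan ε m).mkQ x) =
      (C.zspan ε m).mkQ (((1 : k) ⊗ₜ[ℤ] C.θ (ι c)) • x)) {j : S →+* k} {i : 𝓞 F →+* k}
    (hj : j.comp ι = i) {π : 𝓞 F} (h1 : π ∈ ker i) (h2 : π ∉ ker i ^ 2) :
    ∃ φ : component act i ≃ₗ[k] LieModel k (ε j),
      ∀ y, ((φ.symm ((Polynomial.X : k[X]) • φ y) : component act i) : D ⧸ C.zspan ε m) =
        act π y := by
  let _ := quotModule (A := Oₖ) (C.zspan ε m) smul_mem_zspan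
  have := quotModule_tower (A := Oₖ) (C.zspan ε m) smul_mem_zspan
  have hquot : ∀ (a : Oₖ) (x : D),
    (C.zspan ε m).mkQ (a • x) = a • (C.zspan ε m).mkQ x := fun _ _ => rfl
  have hact' : ∀ c (x : D ⧸ C.zspan ε m), act c x = C.th k (1 ⊗ₜ ι c) • x := fun c x => by
    obtain ⟨x, rfl⟩ := (C.zspan ε m).mkQ_surjective x
    rw [hact, hquot, th_tmul]
  refine hε.isLieModel hB hact' (m := (C.zspan ε m).mkQ m) (fun x => ?_) ?_ (fun j => ?_) hj h1 h2
  · obtain ⟨x, rfl⟩ := (C.zspan ε m).mkQ_surjective x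
    obtain ⟨a, rfl⟩ := hm.2 x
    exact ⟨a, rfl⟩
  · rw [← hquot]; exact (Submodule.Quotient.mk_eq_zero _).mpr (C.z_smul_mem_zspan m)
  · have h3 := finrank_pc_eq_add (C := C) (C.zspan ε m).mkQ (Submodule.mkQ_surjective _) hquot j
    have h4 := hε.finrank_zspan_comap hm j
    have h5 := hdim j
    rw [Submodule.ker_mkQ] at h3; omega

theorem finrank_of_bijective [Module.Finite ℤ O]
    {m₀ : D} (hm₀ : Bijective fun a : Oₖ => a • m₀) :
    finrank k D = finrank ℤ O := by
  rw [← (ofBijective ((toSpanSingleton Oₖ D m₀).restrictScalars k)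
      hm₀).finrank_eq, finrank_baseChange]

theorem exists_eq_smul {R D : Type*} [SMul R D] {m : D} (hm : Bijective fun a : R => a • m)
    (x : D) : ∃ a : R, x = a • m :=
  (hm.2 x).imp fun _ => Eq.symm

theorem finrank_pc_of_bijective [Module.Finite ℤ O] (h : finrank ℤ O = 2 * finrank ℤ S)
    {m₀ : D} (hm₀ : Bijective fun a : Oₖ => a • m₀)
    (j : S →+* k) : finrank k (C.pc D j) = 2 * C.e j :=
  C.finrank_pc ((finrank_of_bijective hm₀).trans h)
    (fun j => ⟨_, _, C.generate_of_cyclic (exists_eq_smul hm₀) j⟩) j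

theorem IsSkewForm.exists_eq_zspan_of_finrank [Module.Finite ℤ O]
    (h : finrank ℤ O = 2 * finrank ℤ S) {B : BilinForm k D}
    (hB : C.IsSkewForm B) {m₀ : D}
    (hm₀ : Bijective fun a : Oₖ => a • m₀) {N : Submodule k D}
    (hN : ∀ (a : Oₖ), ∀ v ∈ N, a • v ∈ N) (hiso : ∀ x ∈ N, ∀ y ∈ N, B x y = 0)
    (hd : finrank k N = finrank ℤ S) :
    ∃ ε, C.IsAdm ε ∧ ∃ m : D, (Bijective fun a : Oₖ => a • m) ∧ N = C.zspan ε m := by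
  obtain ⟨ε, m, hε, hm, h⟩ := hB.exists_eq_zspan (isReduction_of_cyclic hm₀) (exists_eq_smul hm₀)
    (fun j => Module.nontrivial_of_finrank_pos (R := k) (by
      rw [finrank_pc_of_bijective h hm₀]
      have := C.e_pos j
      omega)) hN
    (mem_iff_of_isotropic hB.alt hB.nondeg (by rw [finrank_of_bijective hm₀, h, hd]) hiso)
  exact ⟨ε, hε, m, bijective_of_cyclic (finrank_of_bijective hm₀) hm, h⟩

end

variable {F : Type*} [Field F] [NumberField F] {a b : F}
  {O : Subalgebra (𝓞 F) ℍ[F, a, b]} (hO : IsOrderIn (𝓞 F) F O)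
  {conj : O → O} {C : CyclicFrame p k S O conj}
  {ι : 𝓞 F →+* S} (hC : C.IsFrameOf ι)
  {D : Type*} [AddCommGroup D] [Module k D] [Module Oₖ D] [IsScalarTower k Oₖ D]
  [FiniteDimensional k D] {ρ : O → End k D} (hρ : ∀ x v, ρ x v = ((1 : k) ⊗ₜ[ℤ] x) • v)

include hO hC hρ in
theorem IsFrameOf.hasReducedLieType {ε : (𝓞 F →+* k) → ℕ × ℕ} (hε : IsAdmissible p a b ε) {m : D}
    (hm : Bijective fun a : Oₖ => a • m) {N : Submodule k D}
    (hNm : N = C.zspan (fun j => ε (j.comp ι)) m)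
    (hN : ∀ x, N ≤ N.comap (ρ x)) : HasReducedLieType ρ N hN ε := by
  have := finite_int hO.1
  subst hNm
  refine fun i => ⟨(hε i).1, fun π h1 h2 => ?_⟩
  obtain ⟨j, rfl⟩ := hC.exists_extension i
  exact (hC.isAdm hε).isLieModel_quotient hC.toIsBase hm
    (finrank_pc_of_bijective (by rw [finrank_order hO, hC.finrank_eq]; ring) hm)
    (fun c x => by
      rw [hC.θ_ι, ← hρ]; rfl) rfl h1 h2

include hO hC hρ in
theorem IsFrameOf.detCondition [IsTotallyReal F] (hs : ∀ x ∈ O, star x ∈ O)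
    (hp : p ≠ 2) {ε : (𝓞 F →+* k) → ℕ × ℕ}
    (hε : IsAdmissible p a b ε) {m : D}
    (hm : Bijective fun a : Oₖ => a • m) {N : Submodule k D}
    (hNm : N = C.zspan (fun j => ε (j.comp ι)) m)
    (hN : ∀ x, N ≤ N.comap (ρ x)) : DetCondition ρ N hN := by
  subst hNm
  intro x
  obtain ⟨P, hP⟩ := exists_isReducedCharpoly hO hs x
  exact ⟨P, hP, (hC.isAdm hε).charpoly_quotient hO (two_ne_zero_of_charP p hp k) hm x (hρ x) hP
    (hN x)⟩

include hO hC in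
theorem IsFrameOf.finrank_zspan {ε : (𝓞 F →+* k) → ℕ × ℕ} (hε : IsAdmissible p a b ε) {m : D}
    (hm : Bijective fun a : Oₖ => a • m) :
    finrank k (C.zspan (fun j => ε (j.comp ι)) m) = 2 * finrank ℚ F := by
  have := finite_int hO.1
  have h := (hC.isAdm hε).finrank_zspan hm
  rw [finrank_of_bijective hm, finrank_order hO] at h; omega

end CyclicFrame

end

/-! ### The reduction of a Dieudonné module is free of rank one -/

section

namespace CyclicFrame

section

variable [Free ℤ O] [Module.Finite ℤ O] [FiniteDimensional k D]
  {X : Type*} [AddCommGroup X] [Module O𝕎 X]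

theorem IsSkewForm.exists_bijective_of_verschiebung {ρ : O → End k D}
    (hρ : ∀ x v, ρ x v = ((1 : k) ⊗ₜ[ℤ] x) • v) (h : finrank ℤ O = 2 * finrank ℤ S)
    {B : BilinForm k D} (hB : C.IsSkewForm B) {q : X →+ D} (hq : IsReduction p k O q)
    {V : X →+ X} {N : Submodule k D} (hV : IsVerschiebung p (O := O) q V N)
    (hN : ∀ x, N ≤ N.comap (ρ x)) (hiso : ∀ x ∈ N, ∀ y ∈ N, B x y = 0)
    (hfr : finrank k D = finrank ℤ O)
    (hd : finrank k N = finrank ℤ S)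
    (hQ : ∀ [Module Oₖ (D ⧸ N)] [IsScalarTower k Oₖ (D ⧸ N)],
      (∀ x v, N.mapQ N (ρ x) (hN x) v = ((1 : k) ⊗ₜ[ℤ] x) • v) →
      ∀ j, finrank k (C.pc (D ⧸ N) j) = C.e j) :
    ∃ m : D, Bijective fun a : Oₖ => a • m := by
  have hst := smul_mem_of_act hρ hN
  let _ : Module Oₖ (D ⧸ N) := quotModule N hst
  have : IsScalarTower k Oₖ (D ⧸ N) := quotModule_tower N hst
  have hQ := hQ (by rintro x ⟨v⟩; exact congrArg N.mkQ (hρ x v))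
  have hf := N.mkQ_surjective
  have hfA : ∀ (a : Oₖ) (x : D), N.mkQ (a • x) = a • N.mkQ x := fun _ _ => rfl
  rw [← Submodule.ker_mkQ N] at hV hiso hd
  have hdim := hB.finrank_pc_of_quotient N.mkQ hf hfA
    (mem_iff_of_isotropic hB.alt hB.nondeg (by rw [hfr, h, hd]) hiso) hQ (hfr.trans h)
  obtain ⟨m, hm⟩ := exists_cyclic hq hdim fun j hj => not_divisible hq hV hf hfA hQ hdim hj
  exact ⟨m, bijective_of_cyclic hfr hm⟩

end

variable {F : Type*} [Field F] [NumberField F] [IsTotallyReal F] {a b : F}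
  {O : Subalgebra (𝓞 F) ℍ[F, a, b]} (hO : IsOrderIn (𝓞 F) F O)
  {conj : O → O} {C : CyclicFrame p k S O conj}
  {ι : 𝓞 F →+* S} (hC : C.IsFrameOf ι)
  {D : Type*} [AddCommGroup D] [Module k D] [Module Oₖ D] [IsScalarTower k Oₖ D]
  [FiniteDimensional k D] {ρ : O → End k D} (hρ : ∀ x v, ρ x v = ((1 : k) ⊗ₜ[ℤ] x) • v)
  {X : Type*} [AddCommGroup X] [Module O𝕎 X]

include hO in
theorem finrank_of_detCondition {D : Type*} [AddCommGroup D] [Module k D] [FiniteDimensional k D]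
    {ρ : O → End k D} {N : Submodule k D} {hN : ∀ x, N ≤ N.comap (ρ x)}
    (hfr : finrank k D = 4 * finrank ℚ F) (hdet : DetCondition ρ N hN) :
    finrank k N = 2 * finrank ℚ F := by
  obtain ⟨P, hP, h⟩ := hdet 1
  have h1 := congrArg Polynomial.natDegree h
  rw [LinearMap.charpoly_natDegree, (monic_of_isReducedCharpoly hP).natDegree_map,
    natDegree_of_isReducedCharpoly hO hP] at h1
  have := N.finrank_quotient_add_finrank
  omega

include hO hC hρ in
theorem IsFrameOf.exists_bijective_of_verschiebung
    {B : BilinForm k D} (hB : C.IsSkewForm B) {q : X →+ D} (hq : IsReduction p k O q)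
    {V : X →+ X} {N : Submodule k D} (hV : IsVerschiebung p (O := O) q V N)
    {hN : ∀ x, N ≤ N.comap (ρ x)} (hiso : ∀ x ∈ N, ∀ y ∈ N, B x y = 0)
    (hfr : finrank k D = 4 * finrank ℚ F) (hdet : DetCondition ρ N hN) :
    ∃ m : D, Bijective fun a : Oₖ => a • m := by
  have := finite_int hO.1
  exact hB.exists_bijective_of_verschiebung hρ (by rw [finrank_order hO, hC.finrank_eq]; ring) hq hV
    hN hiso (hfr.trans (finrank_order hO).symm)
    (by rw [finrank_of_detCondition hO hfr hdet, hC.finrank_eq]) fun h =>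
      finrank_pc_of_charpoly hO hC.finrank_eq (ρ := quotAct ρ N hN) h hdet

end CyclicFrame

end

/-! ### Extension of scalars -/

section ExtModule

variable {R O Y : Type*} [CommRing R] [Ring O] [AddCommGroup Y] [Module R Y]

/-- The action of `R ⊗ O` on an `R`-module with an action of `O`. -/
def extAct (ρ : O →+* End R Y) : R ⊗[ℤ] O →+* End R Y :=
  (Algebra.TensorProduct.lift (Algebra.ofId R (End R Y)) ρ.toIntAlgHom
    fun c s => commutes c (ρ s)).toRingHom

/-- The `R ⊗ O`-module defined by an `R`-module with an action of `O`. -/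
@[reducible]
def extModule (ρ : O →+* End R Y) : Module (R ⊗[ℤ] O) Y := Module.compHom Y (extAct ρ)

theorem extModule_tmul (ρ : O →+* End R Y) (c : R) (s : O) (y : Y) :
    letI := extModule ρ
    (c ⊗ₜ[ℤ] s : R ⊗[ℤ] O) • y = c • ρ s y :=
  congrArg (fun f : End R Y => f y)
    (Algebra.TensorProduct.lift_tmul (Algebra.ofId R (End R Y)) ρ.toIntAlgHom
      (fun c s => commutes c (ρ s)) c s)

theorem extModule_one_tmul (ρ : O →+* End R Y) (s : O) (y : Y) :
    letI := extModule ρ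
    ((1 : R) ⊗ₜ[ℤ] s : R ⊗[ℤ] O) • y = ρ s y :=
  (extModule_tmul ρ 1 s y).trans (one_smul _ _)

theorem extModule_tower (ρ : O →+* End R Y) :
    letI := extModule ρ
    IsScalarTower R (R ⊗[ℤ] O) Y := by
  let _ := extModule ρ
  refine ⟨fun c a y => ?_⟩
  change extAct ρ (c • a) y = c • extAct ρ a y
  exact congrArg (fun f : End R Y => f y) (map_smul (Algebra.TensorProduct.lift
    (Algebra.ofId R (End R Y)) ρ.toIntAlgHom fun c s => commutes c (ρ s)) c a)

variable (k : Type*) [CommRing k] [Algebra R k]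

/-- Base change of an action. -/
def baseAct (ρ : O →+* End R Y) : O →+* End k (k ⊗[R] Y) :=
  (Module.End.baseChangeHom R k Y).toRingHom.comp ρ

theorem baseAct_tmul (ρ : O →+* End R Y) (s : O) (c : k) (y : Y) :
    baseAct k ρ s (c ⊗ₜ y) = c ⊗ₜ ρ s y := rfl

theorem baseAct_adjoint (ρ : O →+* End R Y) {ψ : BilinForm R Y} {s s' : O}
    (hadj : ∀ x y, ψ (ρ s x) y = ψ x (ρ s' y)) (x y : k ⊗[R] Y) :
    ψ.baseChange k (baseAct k ρ s x) y = ψ.baseChange k x (baseAct k ρ s' y) := by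
  induction x with
  | zero => simp
  | add x x' hx hx' => rw [map_add, map_add, LinearMap.add_apply, hx, hx', map_add,
      LinearMap.add_apply]
  | tmul c x =>
    induction y with
    | zero => simp
    | add y y' hy hy' => rw [map_add, hy, hy', map_add, map_add]
    | tmul d y =>
      rw [baseAct_tmul, baseAct_tmul, baseChange_tmul,
        baseChange_tmul, hadj]

end ExtModule

namespace CyclicFrame

theorem isSkewForm_baseChange {R Y : Type*} [CommRing R] [AddCommGroup Y] [Module R Y]
    [Algebra R k] [Free R Y] [Module.Finite R Y] (ρ : O →+* End R Y)
    {ψ : BilinForm R Y} (halt : ψ.IsAlt) (hsurj : Surjective ψ)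
    (hadj : ∀ s x y, ψ (ρ s x) y = ψ x (ρ (conj s) y)) :
    letI := extModule (baseAct k ρ)
    haveI := extModule_tower (baseAct k ρ)
    C.IsSkewForm (ψ.baseChange k) := by
  let _ := extModule (baseAct k ρ)
  have := extModule_tower (baseAct k ρ)
  refine ⟨isAlt_baseChange halt, nondeg_baseChange k halt hsurj, fun a x y => ?_⟩
  have key := fun s => baseAct_adjoint k ρ (hadj s)
  induction a with
  | zero =>
    have h : ∀ x : k ⊗[R] Y, (0 : Oₖ) • x = 0 := fun x => zero_smul Oₖ x
    rw [map_zero, h, h, map_zero, map_zero, LinearMap.zero_apply]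
  | add a b ha hb =>
    rw [add_smul, map_add (ψ.baseChange k), LinearMap.add_apply, ha, hb, map_add, add_smul, map_add]
  | tmul c s =>
    rw [cj_tmul, extModule_tmul, extModule_tmul, map_smul (ψ.baseChange k), LinearMap.smul_apply, key,
      map_smul]

variable {X : Type*} [AddCommGroup X] [Module 𝕎 X]
  [Module.Finite 𝕎 X] [Free 𝕎 X]

theorem isModP_mk (ρ : O →+* End 𝕎 X) :
    letI := extModule ρ
    letI := extModule (baseAct k ρ)
    IsModP p k O (TensorProduct.mk 𝕎 k X 1).toAddMonoidHom := by
  let _ := extModule ρ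
  let _ := extModule (baseAct k ρ)
  refine ⟨one_tmul_surjective p X, one_tmul_eq_zero_iff p, fun c x => ?_, fun s x => ?_⟩
  · change (1 : k) ⊗ₜ (c • x) = algebraMap 𝕎 k c • ((1 : k) ⊗ₜ x); rw [tmul_smul, algebraMap_smul]
  · rw [extModule_one_tmul, extModule_one_tmul]; rfl

end CyclicFrame

end

section

section ExtModule

variable {R O Y : Type*} [CommRing R] [Ring O] [AddCommGroup Y] [Module R Y]
  (k : Type*) [CommRing k] [Algebra R k]

theorem extAct_tmul (ρ : O →+* End R Y) (c : R) (s : O) (y : Y) :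
    extAct ρ (c ⊗ₜ s) y = c • ρ s y := extModule_tmul ρ c s y

theorem exists_eq_smul_baseChange (ρ : O →+* End R Y) {x₀ : Y}
    (hx : ∀ y, ∃ a, y = extAct ρ a x₀) :
    letI := extModule (baseAct k ρ)
    ∀ d : k ⊗[R] Y, ∃ a : Oₖ, d = a • ((1 : k) ⊗ₜ[R] x₀) := by
  intro d
  change ∃ a, d = extAct (baseAct k ρ) a (1 ⊗ₜ[R] x₀)
  induction d with
  | zero => exact ⟨0, by rw [map_zero, LinearMap.zero_apply]⟩
  | add d d' h h' =>
    obtain ⟨a, rfl⟩ := h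
    obtain ⟨a', rfl⟩ := h'
    exact ⟨a + a', by rw [map_add, LinearMap.add_apply]⟩
  | tmul c y =>
    obtain ⟨a, rfl⟩ := hx y
    induction a with
    | zero => exact ⟨0, by rw [map_zero, map_zero, LinearMap.zero_apply, LinearMap.zero_apply,
        tmul_zero]⟩
    | add a a' h h' =>
      obtain ⟨b, hb⟩ := h
      obtain ⟨b', hb'⟩ := h'
      exact ⟨b + b', by rw [map_add, map_add, LinearMap.add_apply, LinearMap.add_apply, ← hb, ← hb',
        tmul_add]⟩
    | tmul r s =>
      refine ⟨(r • c) ⊗ₜ s, ?_⟩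
      rw [extAct_tmul, extAct_tmul, baseAct_tmul, smul_tmul', smul_eq_mul, mul_one,
        smul_tmul]

end ExtModule

universe u

variable {p : ℕ} [Fact p.Prime] {F : Type*} [Field F] [NumberField F] {a b : F}
  {O : Subalgebra (𝓞 F) ℍ[F, a, b]} {k : Type u} [Field k] [CharP k p] [IsAlgClosed k]

section Lattice

variable {Λ : Type*} [AddCommGroup Λ] [Module ℤ_[p] Λ] [Module.Finite ℤ_[p] Λ]

/-- The action of the order on the lattice. -/
def SkewHermitianLattice.orderAct (L : SkewHermitianLattice p O Λ) : O →+* End ℤ_[p] Λ :=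
  L.ι.toRingHom.comp (includeRight : O →ₐ[ℤ] AtP p O).toRingHom

namespace SkewHermitianLattice

variable (L : SkewHermitianLattice p O Λ)

theorem extAct_orderAct (r : AtP p O) : extAct L.orderAct r = L.ι r := by
  induction r using TensorProduct.induction_on with
  | zero => rw [map_zero, map_zero]
  | add r r' h h' => rw [map_add, map_add, h, h']
  | tmul c s =>
    refine LinearMap.ext fun y => ?_
    rw [extAct_tmul, tmul_eq_smul c s, map_smul]; rfl

include L in
theorem free [Free ℤ O] : Free ℤ_[p] Λ := by
  obtain ⟨x₀, h⟩ := L.free_rank_one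
  exact Module.Free.of_equiv (ofBijective
    ((LinearMap.applyₗ x₀).comp L.ι.toLinearMap : AtP p O →ₗ[ℤ_[p]] Λ) h)

include L in
theorem finrank_eq (hO : IsOrderIn (𝓞 F) F O) :
    finrank ℤ_[p] Λ = 4 * finrank ℚ F := by
  have := finite_int hO.1
  obtain ⟨x₀, h⟩ := L.free_rank_one
  rw [← (ofBijective
    ((LinearMap.applyₗ x₀).comp L.ι.toLinearMap : AtP p O →ₗ[ℤ_[p]] Λ) h).finrank_eq,
    finrank_baseChange, finrank_order hO]

theorem exists_generator (k : Type*) [Field k] [CharP k p] :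
    letI := extModule (baseAct k L.orderAct)
    ∃ m : k ⊗[ℤ_[p]] Λ, ∀ d, ∃ a : Oₖ, d = a • m := by
  obtain ⟨x₀, h⟩ := L.free_rank_one
  refine ⟨1 ⊗ₜ x₀, exists_eq_smul_baseChange k L.orderAct fun y => ?_⟩
  obtain ⟨r, rfl⟩ := h.2 y
  exact ⟨r, by rw [extAct_orderAct]⟩

end SkewHermitianLattice

end Lattice

namespace DieuObject

variable (M : DieuObject p k O)

/-- The action of the order on a Dieudonné module. -/
def orderAct : O →+* End 𝕎 M.carrier := M.ι.comp (includeRight : O →ₐ[ℤ] AtP p O).toRingHom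

theorem exists_of_mem_hodge {d : M.ModP} (hd : d ∈ M.hodge) :
    ∃ x, d = (1 : k) ⊗ₜ[𝕎] M.Ve x := by
  induction hd using Submodule.span_induction with
  | mem d h => exact h.imp fun _ => Eq.symm
  | zero => exact ⟨0, by rw [map_zero, tmul_zero]⟩
  | add d d' _ _ h h' =>
    obtain ⟨x, rfl⟩ := h
    obtain ⟨y, rfl⟩ := h'
    exact ⟨x + y, by rw [map_add, tmul_add]⟩
  | smul c d _ h =>
    obtain ⟨x, rfl⟩ := h
    obtain ⟨c, rfl⟩ := algebraMap_witt_surjective (k := k) p c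
    refine ⟨WittVector.frobeniusEquiv p k c • x, ?_⟩
    rw [LinearMap.map_smulₛₗ, RingHom.coe_coe, RingEquiv.symm_apply_apply,
      tmul_smul, algebraMap_smul]

theorem isotropic : ∀ x ∈ M.hodge, ∀ y ∈ M.hodge,
    M.form.baseChange k x y = 0 := by
  intro x hx y hy
  obtain ⟨x, rfl⟩ := M.exists_of_mem_hodge hx
  obtain ⟨y, rfl⟩ := M.exists_of_mem_hodge hy
  have h := M.form_Fr (M.Ve x) y
  rw [M.Fr_Ve, map_smul, LinearMap.smul_apply, smul_eq_mul] at h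
  have h1 := congrArg (algebraMap 𝕎 k) h
  rw [map_mul, map_natCast, cast_eq_zero, zero_mul] at h1
  have h2 : algebraMap 𝕎 k (WittVector.frobenius (M.form (M.Ve x) (M.Ve y))) =
    algebraMap 𝕎 k (M.form (M.Ve x) (M.Ve y)) ^ p :=
    WittVector.coeff_frobenius_charP p (M.form (M.Ve x) (M.Ve y)) 0
  rw [baseChange_tmul, mul_one, ← algebraMap_smul k, smul_eq_mul, mul_one]; rw [h2] at h1
  exact pow_eq_zero_iff (Fact.out : p.Prime).ne_zero |>.mp h1.symm

theorem isVerschiebung :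
    letI := extModule M.orderAct
    IsVerschiebung p (O := O) (TensorProduct.mk 𝕎 k M.carrier 1).toAddMonoidHom
      M.Ve.toAddMonoidHom M.hodge := by
  let _ := extModule M.orderAct
  refine ⟨?_, fun c s x => ?_, fun x => Submodule.subset_span ⟨x, rfl⟩, fun y hy => ?_⟩
  · refine (injective_iff_map_eq_zero _).mpr fun x hx => ?_
    have h := M.Fr_Ve x
    rw [show M.Ve x = 0 from hx, map_zero] at h; exact CyclicFrame.eq_zero_of_p_smul h.symm
  · rw [extModule_tmul, extModule_tmul]
    refine (LinearMap.map_smulₛₗ M.Ve _ _).trans ?_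
    congr 1
    · exact RingEquiv.symm_apply_apply (WittVector.frobeniusEquiv p k) c
    · exact (M.ι_Ve _ _).symm
  · obtain ⟨x, hx⟩ := M.exists_of_mem_hodge hy
    have h : (1 : k) ⊗ₜ[𝕎] (y - M.Ve x) = 0 := by
      rw [TensorProduct.tmul_sub, sub_eq_zero]; exact hx
    obtain ⟨z, hz⟩ := (one_tmul_eq_zero_iff p _).mp h
    refine ⟨x + M.Fr z, ?_⟩
    change y = M.Ve (x + M.Fr z); rw [map_add, M.Ve_Fr, ← hz, add_sub_cancel]

end DieuObject

/-! ### Construction of Dieudonné modules -/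

section Witt

variable (p : ℕ) [Fact p.Prime] (k : Type*) [Field k] [CharP k p]

/-- `W(k)` is a `ℤ_p`-algebra. -/
instance algebraPadicWitt : Algebra ℤ_[p] 𝕎 := (padicToWitt p k).toAlgebra

theorem frobenius_algebraMap (c : ℤ_[p]) :
    WittVector.frobenius (algebraMap ℤ_[p] 𝕎 c) = algebraMap ℤ_[p] _ c := by
  ext n; rw [WittVector.coeff_frobenius_charP]
  change ZMod.castHom (dvd_refl p) k (((WittVector.equiv p).symm c).coeff n) ^ p = _
  rw [← map_pow, ZMod.pow_card]; rfl

theorem algebraMap_padic_witt_injective :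
    Injective (algebraMap ℤ_[p] 𝕎) :=
  (WittVector.map_injective _ (RingHom.injective _)).comp (WittVector.equiv p).symm.injective

variable [PerfectRing k p] (Y : Type*) [AddCommGroup Y] [Module ℤ_[p] Y]

/-- The Frobenius of `W(k) ⊗ Y`. -/
def frobTensor : (𝕎 ⊗[ℤ_[p]] Y) ≃ₗ[ℤ_[p]] 𝕎 ⊗[ℤ_[p]] Y :=
  TensorProduct.congr
    { (WittVector.frobeniusEquiv p k).toAddEquiv with
      map_smul' := fun c x => by
        change WittVector.frobenius (c • x) = c • WittVector.frobenius x
        rw [smul_def, smul_def, map_mul, frobenius_algebraMap] }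
    (LinearEquiv.refl _ _)

theorem frobTensor_tmul (c : 𝕎) (y : Y) :
    frobTensor p k Y (c ⊗ₜ y) = WittVector.frobenius c ⊗ₜ y := rfl

theorem frobTensor_smul (c : 𝕎) (x : 𝕎 ⊗[ℤ_[p]] Y) :
    frobTensor p k Y (c • x) = WittVector.frobenius c • frobTensor p k Y x := by
  induction x with
  | zero => simp
  | add x x' h h' => rw [smul_add, map_add, h, h', map_add, smul_add]
  | tmul d y =>
    rw [smul_tmul', frobTensor_tmul, frobTensor_tmul, smul_tmul',
      smul_eq_mul, map_mul, smul_eq_mul]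

theorem frobTensor_baseChange (f : End ℤ_[p] Y) (x : 𝕎 ⊗[ℤ_[p]] Y) :
    f.baseChange 𝕎 (frobTensor p k Y x) =
      frobTensor p k Y (f.baseChange 𝕎 x) := by
  induction x with
  | zero => simp
  | add x x' h h' => rw [map_add, map_add, h, h', map_add, map_add]
  | tmul d y => rfl

theorem baseChange_frobTensor (ψ : BilinForm ℤ_[p] Y) (x y : 𝕎 ⊗[ℤ_[p]] Y) :
    ψ.baseChange 𝕎 (frobTensor p k Y x) (frobTensor p k Y y) =
      WittVector.frobenius (ψ.baseChange 𝕎 x y) := by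
  induction x with
  | zero => simp
  | add x x' h h' => rw [map_add, map_add, map_add, LinearMap.add_apply, LinearMap.add_apply, h, h',
      map_add]
  | tmul c x =>
    induction y with
    | zero => simp
    | add y y' h h' => rw [map_add, map_add, map_add, h, h', map_add]
    | tmul d y =>
      rw [frobTensor_tmul, frobTensor_tmul, baseChange_tmul,
        baseChange_tmul, smul_def, smul_def, map_mul, map_mul,
        frobenius_algebraMap]

variable {Y} in
theorem baseChange_injective [Free ℤ_[p] Y] {f : End ℤ_[p] Y}
    (h : f.baseChange 𝕎 = 0) : f = 0 := by
  have hinj : Injective fun y : Y => (1 : 𝕎) ⊗ₜ[ℤ_[p]] y := by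
    have h1 := (Module.Flat.rTensor_preserves_injective_linearMap (M := Y)
      (Algebra.linearMap ℤ_[p] 𝕎) (algebraMap_padic_witt_injective p k)).comp
      (TensorProduct.lid ℤ_[p] Y).symm.injective
    refine fun x y hxy => h1 ?_
    simpa using hxy
  refine LinearMap.ext fun y => hinj ?_
  have := LinearMap.congr_fun h (1 ⊗ₜ y)
  rw [LinearMap.baseChange_tmul] at this; exact this.trans (tmul_zero _ _).symm

end Witt

theorem bijective_baseChange {R M : Type*} (K : Type*) [CommRing R] [CommRing K] [Algebra R K]
    [AddCommGroup M] [Module R M] [Free R M] [Module.Finite R M]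
    {ψ : BilinForm R M} (h : ψ.IsAlt) (hs : Surjective ψ) :
    Bijective (ψ.baseChange K) := by
  classical
  refine ⟨(injective_iff_map_eq_zero _).mpr fun x hx => nondeg_baseChange K h hs x fun y => by
    rw [hx, LinearMap.zero_apply], fun φ => ?_⟩
  let β := Module.Free.chooseBasis R M
  obtain ⟨l, hl⟩ := exists_dual β h hs
  refine ⟨∑ i, φ (β.baseChange K i) • (1 ⊗ₜ l i), (β.baseChange K).ext fun j => ?_⟩
  rw [map_sum, LinearMap.sum_apply, sum_eq_single j]
  · rw [map_smul, LinearMap.smul_apply, Module.Basis.baseChange_apply,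
      baseChange_tmul, ← LinearMap.IsAlt.neg h, hl]
    simp
  · intro i _ hij
    rw [map_smul, LinearMap.smul_apply, Module.Basis.baseChange_apply, Module.Basis.baseChange_apply,
      baseChange_tmul, ← LinearMap.IsAlt.neg h, hl, if_neg hij]
    simp
  · simp

section Transport

/-- Transport of structure. -/
def SkewHermitianLattice.transport {Λ Λ' : Type*} [AddCommGroup Λ] [Module ℤ_[p] Λ]
    [AddCommGroup Λ'] [Module ℤ_[p] Λ'] (L : SkewHermitianLattice p O Λ) (e : Λ ≃ₗ[ℤ_[p]] Λ') :
    SkewHermitianLattice p O Λ' where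
  ι := (e.conjAlgEquiv ℤ_[p]).toAlgHom.comp L.ι
  free_rank_one := by
    obtain ⟨x₀, h⟩ := L.free_rank_one
    refine ⟨e x₀, ?_⟩
    convert e.bijective.comp h using 2 with r
    exact congrArg (fun x => e (L.ι r x)) (e.symm_apply_apply x₀)
  ψ := L.ψ.compl₁₂ e.symm e.symm
  alternating x := L.alternating _
  perfect := have := L.perfect; inferInstance
  adjoint c c' h x y := by
    change L.ψ (e.symm (e (L.ι (1 ⊗ₜ c) (e.symm x)))) (e.symm y) =
      L.ψ (e.symm x) (e.symm (e (L.ι (1 ⊗ₜ c') (e.symm y))))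
    rw [e.symm_apply_apply, e.symm_apply_apply, L.adjoint c c' h]

end Transport

variable {Y : Type} [AddCommGroup Y] [Module ℤ_[p] Y] [Module.Finite ℤ_[p] Y] [Free ℤ_[p] Y]

theorem SkewHermitianLattice.commute_baseChange (L : SkewHermitianLattice p O Y)
    {T : End 𝕎 (𝕎 ⊗[ℤ_[p]] Y)}
    (hT : ∀ s x, baseAct 𝕎 L.orderAct s (T x) =
      T (baseAct 𝕎 L.orderAct s x)) (r : AtP p O) (x) :
    (L.ι r).baseChange 𝕎 (T x) = T ((L.ι r).baseChange 𝕎 x) := by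
  induction r using TensorProduct.induction_on with
  | zero => simp
  | add r r' h h' =>
    rw [map_add, LinearMap.baseChange_add, LinearMap.add_apply, LinearMap.add_apply, h, h', map_add]
  | tmul c s =>
    rw [tmul_eq_smul c s, map_smul, LinearMap.baseChange_smul, LinearMap.smul_apply,
      LinearMap.smul_apply, ← algebraMap_smul 𝕎 c, ← algebraMap_smul 𝕎 c,
      map_smul]
    exact congrArg _ (hT s x)

/-- The Dieudonné module on `W(k) ⊗ Y` with `V = Φ σ⁻¹` and `F = σ Ψ`. -/
def SkewHermitianLattice.toDieudonne (L : SkewHermitianLattice p O Y)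
    (Φ Ψ : End 𝕎 (𝕎 ⊗[ℤ_[p]] Y))
    (hΦ : ∀ x, Φ (Ψ x) = (p : 𝕎) • x) (hΨ : ∀ x, Ψ (Φ x) = (p : 𝕎) • x)
    (hψ : ∀ x y, L.ψ.baseChange 𝕎 (Ψ x) y = L.ψ.baseChange 𝕎 x (Φ y))
    (hΦι : ∀ r x, (L.ι r).baseChange 𝕎 (Φ x) =
      Φ ((L.ι r).baseChange 𝕎 x))
    (hΨι : ∀ r x, (L.ι r).baseChange 𝕎 (Ψ x) =
      Ψ ((L.ι r).baseChange 𝕎 x)) : SepQPDieudonneOModule p k O where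
  carrier := 𝕎 ⊗[ℤ_[p]] Y
  Fr := 
    { toFun x := frobTensor p k Y (Ψ x)
      map_add' x y := by rw [map_add, map_add]
      map_smul' c x := by rw [map_smul, frobTensor_smul]; rfl }
  Ve :=
    { toFun x := Φ ((frobTensor p k Y).symm x)
      map_add' x y := by rw [map_add, map_add]
      map_smul' c x := by
        rw [← map_smul]
        congr 1; rw [LinearEquiv.symm_apply_eq, frobTensor_smul, apply_symm_apply]
        congr 1; exact ((WittVector.frobeniusEquiv p k).apply_symm_apply c).symm }
  Fr_Ve x := by
    change frobTensor p k Y (Ψ (Φ ((frobTensor p k Y).symm x))) = _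
    rw [hΨ, frobTensor_smul, apply_symm_apply, map_natCast]
  Ve_Fr x := by
    change Φ ((frobTensor p k Y).symm (frobTensor p k Y (Ψ x))) = _; rw [symm_apply_apply, hΦ]
  ι := (Module.End.baseChangeHom ℤ_[p] 𝕎 Y).toRingHom.comp L.ι.toRingHom
  ι_padic c := by
    have h : L.ι (c ⊗ₜ 1) = algebraMap ℤ_[p] _ c := L.ι.commutes c
    change (L.ι (c ⊗ₜ 1)).baseChange 𝕎 = _
    rw [h, Module.algebraMap_end_eq_smul_id, LinearMap.baseChange_smul, LinearMap.baseChange_id]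
    exact (algebraMap_smul 𝕎 c _).symm
  ι_injective := (injective_iff_map_eq_zero _).mpr fun r hr => by
    obtain ⟨x₀, h⟩ := L.free_rank_one
    have h1 : L.ι r = 0 := baseChange_injective p k hr
    refine h.1 ?_
    dsimp only
    rw [h1, map_zero]
  ι_Fr r x := by
    change (L.ι r).baseChange 𝕎 (frobTensor p k Y (Ψ x)) =
      frobTensor p k Y (Ψ ((L.ι r).baseChange 𝕎 x))
    rw [frobTensor_baseChange, hΨι]
  ι_Ve r x := by
    change (L.ι r).baseChange 𝕎 (Φ ((frobTensor p k Y).symm x)) =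
      Φ ((frobTensor p k Y).symm ((L.ι r).baseChange 𝕎 x))
    rw [hΦι]
    congr 1; rw [LinearEquiv.eq_symm_apply, ← frobTensor_baseChange, apply_symm_apply]
  form := L.ψ.baseChange 𝕎
  alternating := isAlt_baseChange L.alternating
  perfect := .of_bijective _ (bijective_baseChange _ L.alternating L.perfect.bijective_left.2)
  form_Fr x y := by
    change L.ψ.baseChange 𝕎 (frobTensor p k Y (Ψ x)) y =
      WittVector.frobenius (L.ψ.baseChange 𝕎 x (Φ ((frobTensor p k Y).symm y)))
    rw [← hψ, ← baseChange_frobTensor, apply_symm_apply]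
  adjoint c c' h := baseAct_adjoint 𝕎 L.orderAct (s := c) (s' := c')
    (L.adjoint c c' h)

theorem bijective_of_generator {R A X : Type*} [CommRing R] [Nontrivial R] [Ring A] [Algebra R A]
    [Free R A] [Module.Finite R A] [AddCommGroup X] [Module R X] [Module A X]
    [IsScalarTower R A X] [Free R X] [Module.Finite R X]
    (h : finrank R X = finrank R A) {m : X} (hm : ∀ x : X, ∃ a : A, x = a • m) :
    Bijective fun a : A => a • m := by
  have hs : Surjective fun a : A => a • m := fun x => (hm x).imp fun _ => Eq.symm
  let T : A →ₗ[R] X := (toSpanSingleton A X m).restrictScalars R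
  let e : X ≃ₗ[R] A := LinearEquiv.ofFinrankEq _ _ h
  have := OrzechProperty.injective_of_surjective_endomorphism (e.toLinearMap ∘ₗ T)
    (e.surjective.comp hs)
  exact ⟨fun x y hxy => this (congrArg e hxy), hs⟩

namespace CyclicFrame

section

variable {S O : Type*} [CommRing S] [Ring O] [Free ℤ O] [Module.Finite ℤ O] {conj : O → O}
  {C : CyclicFrame p k S O conj} [Module.Finite ℤ S]
  [Free ℤ S] [Fintype (S →+* k)] [DecidableEq (S →+* k)]

theorem IsAdm.exists_similitude_lattice (hp : p ≠ 2)
    (hOS : finrank ℤ O = 2 * finrank ℤ S) {ε : (S →+* k) → ℕ × ℕ} (hε : C.IsAdm ε)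
    {Y : Type*} [AddCommGroup Y] [Module ℤ_[p] Y] [Module.Finite ℤ_[p] Y] [Free ℤ_[p] Y]
    (ρ : O →+* End ℤ_[p] Y) {ψ : BilinForm ℤ_[p] Y} (halt : ψ.IsAlt)
    (hsurj : Surjective ψ) (hadj : ∀ s x y, ψ (ρ s x) y = ψ x (ρ (conj s) y)) {x₀ : Y}
    (hx₀ : ∀ y, ∃ a, y = extAct ρ a x₀) (hY : finrank ℤ_[p] Y = finrank ℤ O) :
    ∃ Φ Ψ : End 𝕎 (𝕎 ⊗[ℤ_[p]] Y),
      (∀ x, Φ (Ψ x) = (p : 𝕎) • x) ∧ (∀ x, Ψ (Φ x) = (p : 𝕎) • x) ∧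
      (∀ x y, ψ.baseChange 𝕎 (Ψ x) y = ψ.baseChange 𝕎 x (Φ y)) ∧
      (∀ s x, baseAct 𝕎 ρ s (Φ x) = Φ (baseAct 𝕎 ρ s x)) ∧
      (∀ s x, baseAct 𝕎 ρ s (Ψ x) = Ψ (baseAct 𝕎 ρ s x)) ∧
      letI := extModule (baseAct k (baseAct 𝕎 ρ))
      haveI := extModule_tower (baseAct k (baseAct 𝕎 ρ))
      ∃ m, (Bijective fun a : Oₖ => a • m) ∧
        ∀ d, d ∈ C.zspan ε m ↔ ∃ x, d = (1 : k) ⊗ₜ[𝕎] Φ x := by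
  let X := 𝕎 ⊗[ℤ_[p]] Y
  let ρ' : O →+* End 𝕎 X := baseAct 𝕎 ρ
  let _ := extModule ρ'
  have := extModule_tower ρ'
  let _ := extModule (baseAct k ρ')
  have := extModule_tower (baseAct k ρ')
  let ψ' : BilinForm 𝕎 X := ψ.baseChange 𝕎
  have hX : finrank 𝕎 X = finrank ℤ O := by rw [finrank_baseChange, hY]
  have halt' : ψ'.IsAlt := isAlt_baseChange halt
  have hbij : Bijective ψ' := bijective_baseChange _ halt hsurj
  have hadj' : ∀ s x y, ψ' (ρ' s x) y = ψ' x (ρ' (conj s) y) := fun s =>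
    baseAct_adjoint 𝕎 ρ (hadj s)
  have hskew : C.IsSkewForm (ψ'.baseChange k) := isSkewForm_baseChange ρ' halt' hbij.2 hadj'
  have hm₀ : Bijective fun a : O𝕎 => a • ((1 ⊗ₜ x₀ : X)) :=
    bijective_of_generator (by rw [hX, finrank_baseChange])
      (exists_eq_smul_baseChange 𝕎 ρ hx₀)
  have hq : IsModP p k O (TensorProduct.mk 𝕎 k X 1).toAddMonoidHom := isModP_mk ρ'
  obtain ⟨Φ, Ψ, m, hiso, hm, h1, h2, h3, h4⟩ := hq.exists_similitude hp hε halt' hbij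
    (fun s x y => by rw [extModule_one_tmul, extModule_one_tmul, hadj']) hskew
    (fun x y => by
      refine (baseChange_tmul ψ' (1 : k) x 1 y).trans ?_
      rw [mul_one, algebraMap_eq_smul_one]) hm₀
    (by rw [finrank_baseChange, hX]) hOS
  have hcomm : ∀ (T : X →ₗ[O𝕎] X) s x, ρ' s (T x) = T (ρ' s x) := by
    intro T s x
    rw [← extModule_one_tmul ρ', ← extModule_one_tmul ρ']; exact (map_smul T _ x).symm
  exact ⟨Φ.restrictScalars 𝕎, Ψ.restrictScalars 𝕎, h1, h2, h3, hcomm Φ,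
    hcomm Ψ, m, hm, h4⟩

end

end CyclicFrame

variable {S : Type*} [CommRing S] {hs : ∀ x ∈ O, star x ∈ O}
  {C : CyclicFrame p k S O (MinimalTypeD.conj hs)} [Module.Finite ℤ S]
  [Free ℤ S] [Fintype (S →+* k)] [DecidableEq (S →+* k)]
  {ι : 𝓞 F →+* S}

namespace CyclicFrame

section

variable {p : ℕ} [Fact p.Prime] {k S O : Type*} [Field k] [CharP k p] [CommRing S] [Ring O]
  {conj : O → O} {C : CyclicFrame p k S O conj} [IsAlgClosed k] [Module.Finite ℤ S]
  [Free ℤ S] [Free ℤ O] [Module.Finite ℤ O] [Fintype (S →+* k)]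
  [DecidableEq (S →+* k)]
  {D : Type*} [AddCommGroup D] [Module k D] [FiniteDimensional k D]
  {D' : Type*} [AddCommGroup D'] [Module k D'] [FiniteDimensional k D']

/-- `D` is free of rank one over `k ⊗ O`, and `B` is a skew form on it. -/
def IsSkewFree (C : CyclicFrame p k S O conj) (ρ : O →+* End k D)
    (B : BilinForm k D) : Prop :=
  letI := extModule ρ
  haveI := extModule_tower ρ
  C.IsSkewForm B ∧ ∃ m : D, Bijective fun a : Oₖ => a • m

/-- `N` is a submodule of type `ε` of a free `k ⊗ O`-module `D` of rank one. -/
def IsOfType (C : CyclicFrame p k S O conj) (ρ : O →+* End k D) (ε : (S →+* k) → ℕ × ℕ)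
    (N : Submodule k D) : Prop :=
  letI := extModule ρ
  haveI := extModule_tower ρ
  ∃ m : D, (Bijective fun a : Oₖ => a • m) ∧ N = C.zspan ε m

variable {ρ : O →+* End k D} {ρ' : O →+* End k D'} {B : BilinForm k D}
  {B' : BilinForm k D'} {ε : (S →+* k) → ℕ × ℕ} {N : Submodule k D} {N' : Submodule k D'}

theorem map_extAct {γ : D →ₗ[k] D'} (h : ∀ s x, γ (ρ s x) = ρ' s (γ x)) (a : Oₖ) (x : D) :
    γ (extAct ρ a x) = extAct ρ' a (γ x) := by
  induction a with
  | zero => rw [map_zero, map_zero, LinearMap.zero_apply, LinearMap.zero_apply, map_zero]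
  | add a b ha hb =>
    rw [map_add, map_add, LinearMap.add_apply, LinearMap.add_apply, map_add, ha, hb]
  | tmul c s => rw [extAct_tmul, extAct_tmul, map_smul, h]

theorem IsOfType.map (h : C.IsOfType ρ ε N) (γ : D ≃ₗ[k] D')
    (hγ : ∀ s x, γ (ρ s x) = ρ' s (γ x)) : C.IsOfType ρ' ε (N.map (γ : D →ₗ[k] D')) := by
  obtain ⟨m, hm, rfl⟩ := h
  have key := map_extAct (γ := (γ : D →ₗ[k] D')) hγ
  let _ := extModule ρ
  let _ := extModule ρ'
  have := extModule_tower ρ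
  have := extModule_tower ρ'
  refine ⟨γ m, ?_, ?_⟩
  · convert γ.bijective.comp hm using 2 with a
    exact (key a m).symm
  · ext v; rw [Submodule.mem_map, mem_zspan]
    constructor
    · rintro ⟨x, hx, rfl⟩
      obtain ⟨a, rfl⟩ := mem_zspan.mp hx
      exact ⟨a, ((key a _).trans (congrArg (extAct ρ' a) (key _ m))).symm⟩
    · rintro ⟨a, rfl⟩
      exact ⟨_, mem_zspan.mpr ⟨a, rfl⟩, (key a _).trans (congrArg (extAct ρ' a) (key _ m))⟩

theorem IsSkewFree.exists_isOfType (hD : C.IsSkewFree ρ B) (hp : p ≠ 2)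
    (hOS : finrank ℤ O = 2 * finrank ℤ S) (hε : C.IsAdm ε) :
    ∃ N : Submodule k D, C.IsOfType ρ ε N ∧ (∀ s, N ≤ N.comap (ρ s)) ∧
      ∀ x ∈ N, ∀ y ∈ N, B x y = 0 := by
  let _ := extModule ρ
  have := extModule_tower ρ
  obtain ⟨hB, m₀, hm₀⟩ := hD
  obtain ⟨m, hm, hiso⟩ := hB.exists_isotropic_zspan (two_ne_zero_of_charP p hp k)
    (isReduction_of_cyclic hm₀) (exists_eq_smul hm₀) (finrank_pc_of_bijective hOS hm₀) hε
  refine ⟨_, ⟨m, bijective_of_cyclic (finrank_of_bijective hm₀) hm, rfl⟩, fun s x hx => ?_, hiso⟩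
  rw [Submodule.mem_comap, ← extModule_one_tmul ρ]; exact smul_mem_zspan _ _ hx

theorem IsSkewFree.exists_isOfType_of_finrank (hD : C.IsSkewFree ρ B)
    (hOS : finrank ℤ O = 2 * finrank ℤ S) (hN : ∀ s, N ≤ N.comap (ρ s))
    (hiso : ∀ x ∈ N, ∀ y ∈ N, B x y = 0) (hd : finrank k N = finrank ℤ S) :
    ∃ ε, C.IsAdm ε ∧ C.IsOfType ρ ε N := by
  let _ := extModule ρ
  have := extModule_tower ρ
  obtain ⟨hB, m₀, hm₀⟩ := hD
  exact hB.exists_eq_zspan_of_finrank hOS hm₀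
    (smul_mem_of_act (fun s v => (extModule_one_tmul ρ s v).symm) hN) hiso hd

theorem IsSkewFree.exists_isometry (hp : p ≠ 2) (hD : C.IsSkewFree ρ B)
    (hD' : C.IsSkewFree ρ' B') :
    ∃ γ : D ≃ₗ[k] D', (∀ s x, γ (ρ s x) = ρ' s (γ x)) ∧ ∀ x y, B' (γ x) (γ y) = B x y := by
  let _ := extModule ρ
  let _ := extModule ρ'
  have := extModule_tower ρ
  have := extModule_tower ρ'
  obtain ⟨hB, m, hm⟩ := hD
  obtain ⟨hB', m', hm'⟩ := hD'
  obtain ⟨γ, h1, h2, -⟩ := hB.exists_isometry hp hB' hm hm'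
  refine ⟨γ, fun s x => ?_, h2⟩
  rw [← extModule_one_tmul ρ, h1, extModule_one_tmul]

theorem IsOfType.exists_isometry (hp : p ≠ 2) (hD : C.IsSkewFree ρ B)
    (hD' : C.IsSkewFree ρ' B') (hε : C.IsAdm ε) (hN : C.IsOfType ρ ε N) (hN' : C.IsOfType ρ' ε N')
    (hiso : ∀ x ∈ N, ∀ y ∈ N, B x y = 0) (hiso' : ∀ x ∈ N', ∀ y ∈ N', B' x y = 0) :
    ∃ γ : D ≃ₗ[k] D', (∀ s x, γ (ρ s x) = ρ' s (γ x)) ∧ (∀ x y, B' (γ x) (γ y) = B x y) ∧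
      N.map (γ : D →ₗ[k] D') = N' := by
  let _ := extModule ρ
  let _ := extModule ρ'
  have := extModule_tower ρ
  have := extModule_tower ρ'
  obtain ⟨m, hm, rfl⟩ := hN
  obtain ⟨m', hm', rfl⟩ := hN'
  obtain ⟨γ, h1, h2, h3⟩ := hD.1.exists_isometry hp hD'.1 hm hm'
  refine ⟨γ, fun s x => ?_, h2, h3 ε hε hiso hiso'⟩
  rw [← extModule_one_tmul ρ, h1, extModule_one_tmul]

end

variable [IsTotallyReal F] (hC : C.IsFrameOf ι) (hO : IsOrderIn (𝓞 F) F O)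
  {D : Type*} [AddCommGroup D] [Module k D] [FiniteDimensional k D] {ρ : O →+* End k D}
  {N : Submodule k D} {ε : (𝓞 F →+* k) → ℕ × ℕ}

include hC hO

theorem IsOfType.hasReducedLieType (hN : C.IsOfType ρ (fun j => ε (j.comp ι)) N)
    (hε : IsAdmissible p a b ε) (hst : ∀ x, N ≤ N.comap (ρ x)) : HasReducedLieType ρ N hst ε := by
  obtain ⟨m, hm, h⟩ := hN
  let _ := extModule ρ
  have := extModule_tower ρ
  exact hC.hasReducedLieType hO (fun x v => (extModule_one_tmul ρ x v).symm) hε hm h hst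

theorem IsOfType.detCondition (hN : C.IsOfType ρ (fun j => ε (j.comp ι)) N)
    (hp : p ≠ 2) (hε : IsAdmissible p a b ε) (hst : ∀ x, N ≤ N.comap (ρ x)) :
    DetCondition ρ N hst := by
  obtain ⟨m, hm, h⟩ := hN
  let _ := extModule ρ
  have := extModule_tower ρ
  exact hC.detCondition hO (fun x v => (extModule_one_tmul ρ x v).symm) hs hp hε hm h hst

theorem IsOfType.finrank_eq (hN : C.IsOfType ρ (fun j => ε (j.comp ι)) N)
    (hε : IsAdmissible p a b ε) : finrank k N = 2 * finrank ℚ F := by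
  obtain ⟨m, hm, rfl⟩ := hN
  let _ := extModule ρ
  have := extModule_tower ρ
  exact hC.finrank_zspan hO hε hm

theorem IsSkewFree.exists_isAdmissible {B : BilinForm k D} (hD : C.IsSkewFree ρ B)
    (hN : ∀ s, N ≤ N.comap (ρ s)) (hiso : ∀ x ∈ N, ∀ y ∈ N, B x y = 0)
    (hd : finrank k N = 2 * finrank ℚ F) :
    ∃ ε, IsAdmissible p a b ε ∧ C.IsOfType ρ (fun j => ε (j.comp ι)) N := by
  have := finite_int hO.1
  obtain ⟨ε, hε, h⟩ := hD.exists_isOfType_of_finrank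
    (by rw [finrank_order hO, hC.finrank_eq]; ring) hN hiso (hd.trans hC.finrank_eq.symm)
  obtain ⟨ε', hε', hεε⟩ := hC.exists_isAdmissible hε
  exact ⟨ε', hε', by rwa [← funext hεε]⟩

theorem isSkewFree_lattice {Λ : Type*} [AddCommGroup Λ] [Module ℤ_[p] Λ] [Module.Finite ℤ_[p] Λ]
    (L : SkewHermitianLattice p O Λ) : C.IsSkewFree (baseAct k L.orderAct) (L.form k) := by
  have := finite_int hO.1
  have := L.free
  refine ⟨isSkewForm_baseChange L.orderAct L.alternating L.perfect.bijective_left.2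
    fun s => L.adjoint s _ rfl, ?_⟩
  obtain ⟨m, hm⟩ := L.exists_generator k
  let _ := extModule (baseAct k L.orderAct)
  have := extModule_tower (baseAct k L.orderAct)
  exact ⟨m, bijective_of_cyclic
    (by rw [finrank_baseChange, L.finrank_eq hO, finrank_order hO]) hm⟩

theorem isSkewFree_dieuObject (M : DieuObject p k O) :
    C.IsSkewFree (baseAct k M.orderAct) (M.form.baseChange k) := by
  have hB := isSkewForm_baseChange (C := C) M.orderAct M.alternating M.perfect.bijective_left.2
    fun s => M.adjoint s _ rfl
  refine ⟨hB, ?_⟩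
  have hfr : finrank k M.ModP = 4 * finrank ℚ F :=
    finrank_baseChange.trans M.finrank_eq
  let _ := extModule M.orderAct
  let _ := extModule (baseAct k M.orderAct)
  have := extModule_tower M.orderAct
  have := extModule_tower (baseAct k M.orderAct)
  have hq := (isModP_mk (k := k) M.orderAct).isReduction
  exact hC.exists_bijective_of_verschiebung hO (ρ := baseAct k M.orderAct)
    (fun x v => (extModule_one_tmul (baseAct k M.orderAct) x v).symm) hB hq M.isVerschiebung
    M.isotropic hfr M.det

theorem exists_isOfType_dieuObject (M : DieuObject p k O) : ∃ ε, IsAdmissible p a b ε ∧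
    C.IsOfType (baseAct k M.orderAct) (fun j => ε (j.comp ι)) M.hodge :=
  (isSkewFree_dieuObject hC hO M).exists_isAdmissible hC hO M.hodge_stable M.isotropic
    (finrank_of_detCondition hO (finrank_baseChange.trans M.finrank_eq) M.det)

theorem exists_dieuObject (hp : p ≠ 2) {Y : Type} [AddCommGroup Y] [Module ℤ_[p] Y]
    [Module.Finite ℤ_[p] Y] (L : SkewHermitianLattice p O Y) (hε : IsAdmissible p a b ε) :
    ∃ M : DieuObject p k O, C.IsOfType (baseAct k M.orderAct) (fun j => ε (j.comp ι)) M.hodge := by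
  have := finite_int hO.1
  have := L.free
  have hY : finrank ℤ_[p] Y = 4 * finrank ℚ F := L.finrank_eq hO
  obtain ⟨x₀, hx₀⟩ := L.free_rank_one
  obtain ⟨Φ, Ψ, h1, h2, h3, h4, h5, m, hm, h6⟩ := (hC.isAdm hε).exists_similitude_lattice hp
    (by rw [finrank_order hO, hC.finrank_eq]; ring) L.orderAct L.alternating
    L.perfect.bijective_left.2 (fun s => L.adjoint s _ rfl) (fun y => by
        obtain ⟨r, rfl⟩ := hx₀.2 y
        exact ⟨r, by rw [L.extAct_orderAct]⟩) (hY.trans (finrank_order hO).symm)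
  let M₀ : SepQPDieudonneOModule p k O := L.toDieudonne Φ Ψ h1 h2 h3 (L.commute_baseChange h4)
    (L.commute_baseChange h5)
  let ρ := baseAct k (baseAct 𝕎 L.orderAct)
  let _ := extModule ρ
  have := extModule_tower ρ
  have hhodge : M₀.hodge = C.zspan (fun j => ε (j.comp ι)) m := by
    refine le_antisymm (Submodule.span_le.mpr ?_) fun d hd => ?_
    · rintro _ ⟨x, rfl⟩
      exact (h6 _).mpr ⟨(frobTensor p k Y).symm x, rfl⟩
    · obtain ⟨x, rfl⟩ := (h6 d).mp hd
      refine Submodule.subset_span ⟨frobTensor p k Y x, ?_⟩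
      change (1 : k) ⊗ₜ[𝕎] Φ ((frobTensor p k Y).symm (frobTensor p k Y x)) = _
      rw [symm_apply_apply]
  have h : C.IsOfType ρ (fun j => ε (j.comp ι)) M₀.hodge := ⟨m, hm, hhodge⟩
  exact ⟨⟨M₀, finrank_baseChange.trans hY, h.detCondition hC hO hp hε M₀.hodge_stable⟩, h⟩

end CyclicFrame

/-! ### The map from Dieudonné modules to orbits -/

theorem DieuObject.IsIso.baseChange {M M' : DieuObject p k O}
    {g : M.carrier ≃ₗ[𝕎] M'.carrier} (hg : IsIso g) :
    ∃ γ : M.ModP ≃ₗ[k] M'.ModP,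
      (∀ c x, γ (M.act c x) = M'.act c (γ x)) ∧
      (∀ x y, M'.form.baseChange k (γ x) (γ y) = M.form.baseChange k x y) ∧
      M.hodge.map (γ : _ →ₗ[k] M'.ModP) =
        M'.hodge := by
  obtain ⟨-, h2, h3, h4⟩ := hg
  let γ := g.baseChange 𝕎 k M.carrier M'.carrier
  have hγ : ∀ x : M.carrier, γ (1 ⊗ₜ x) = 1 ⊗ₜ g x := fun x => rfl
  refine ⟨γ, fun c x => ?_, fun x y => ?_, ?_⟩
  · obtain ⟨x, rfl⟩ := one_tmul_surjective p M.carrier x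
    exact congrArg (fun y => (1 : k) ⊗ₜ[𝕎] y) (h3 _ x)
  · obtain ⟨x, rfl⟩ := one_tmul_surjective p M.carrier x
    obtain ⟨y, rfl⟩ := one_tmul_surjective p M.carrier y
    dsimp only
    rw [hγ, hγ, baseChange_tmul, baseChange_tmul, h4]
  · rw [DieudonneOModule.hodge, Submodule.map_span, ← Set.range_comp]
    refine congrArg (Submodule.span k) (Set.ext fun d => ⟨?_, ?_⟩)
    · rintro ⟨x, rfl⟩
      exact ⟨g x, congrArg (fun y => (1 : k) ⊗ₜ[𝕎] y) (h2 x).symm⟩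
    · rintro ⟨x, rfl⟩
      refine ⟨g.symm x, congrArg (fun y => (1 : k) ⊗ₜ[𝕎] y) ?_⟩
      exact (h2 _).trans (congrArg M'.Ve (g.apply_symm_apply x))

variable {Λ : Type*} [AddCommGroup Λ] [Module ℤ_[p] Λ] [Module.Finite ℤ_[p] Λ]
  {L : SkewHermitianLattice p O Λ}

theorem DieuObject.IsIso.orbit_eq {M M' : DieuObject p k O}
    {g : M.carrier ≃ₗ[𝕎] M'.carrier} (hg : IsIso g) {γ γ'}
    (hγ : M.IsTrivialization L γ) (hγ' : M'.IsTrivialization L γ') {N N' : L.LocalModelPoint k}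
    (hN : N.toSubmodule = M.hodge.map (γ : _ →ₗ[k] (k ⊗[ℤ_[p]] Λ)))
    (hN' : N'.toSubmodule = M'.hodge.map (γ' : _ →ₗ[k] (k ⊗[ℤ_[p]] Λ))) :
    L.orbit k N = L.orbit k N' := by
  obtain ⟨δ, h1, h2, h3⟩ := hg.baseChange
  refine Quotient.sound ⟨γ.symm ≪≫ₗ δ ≪≫ₗ γ', ⟨fun c x => ?_, fun x y => ?_⟩, ?_⟩
  · obtain ⟨x, rfl⟩ := γ.surjective x
    rw [← hγ.1]; simp only [trans_apply, symm_apply_apply, h1, hγ'.1]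
  · obtain ⟨x, rfl⟩ := γ.surjective x
    obtain ⟨y, rfl⟩ := γ.surjective y
    simp only [trans_apply, symm_apply_apply, hγ'.2, h2, hγ.2]
  · rw [hN, hN', ← h3, ← Submodule.map_comp, ← Submodule.map_comp]
    exact congrArg (fun f => Submodule.map f _)
      (LinearMap.ext fun x => congrArg (fun y => γ' (δ y)) (γ.symm_apply_apply x))

open CyclicFrame

variable [IsTotallyReal F] (hC : C.IsFrameOf ι) (hO : IsOrderIn (𝓞 F) F O)

include hC hO

theorem DieuObject.IsTrivialization.exists_point (hp : p ≠ 2) {M : DieuObject p k O} {γ}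
    (hγ : M.IsTrivialization L γ) : ∃ N : L.LocalModelPoint k,
      N.toSubmodule = M.hodge.map (γ : _ →ₗ[k] (k ⊗[ℤ_[p]] Λ)) := by
  have := finite_int hO.1
  obtain ⟨ε, hε, h⟩ := exists_isOfType_dieuObject hC hO M
  have h' := h.map (ρ' := baseAct k L.orderAct) γ hγ.1
  have hst : ∀ c, M.hodge.map (γ : _ →ₗ[k] (k ⊗[ℤ_[p]] Λ)) ≤
      (M.hodge.map (γ : _ →ₗ[k] (k ⊗[ℤ_[p]] Λ))).comap (L.act k c) := by
    rintro c _ ⟨x, hx, rfl⟩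
    exact ⟨_, M.hodge_stable c hx, hγ.1 c x⟩
  refine ⟨⟨_, h'.finrank_eq hC hO hε, ?_, hst, h'.detCondition hC hO hp hε hst⟩, rfl⟩
  rintro _ ⟨x, hx, rfl⟩ _ ⟨y, hy, rfl⟩
  exact (hγ.2 x y).trans (M.isotropic x hx y hy)

theorem SkewHermitianLattice.LocalModelPoint.orbit_eq (hp : p ≠ 2) {N N' : L.LocalModelPoint k}
    {ε : (𝓞 F →+* k) → ℕ × ℕ} (hε : IsAdmissible p a b ε)
    (hN : C.IsOfType (baseAct k L.orderAct) (fun j => ε (j.comp ι)) N.toSubmodule)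
    (hN' : C.IsOfType (baseAct k L.orderAct) (fun j => ε (j.comp ι)) N'.toSubmodule) :
    L.orbit k N = L.orbit k N' := by
  have := finite_int hO.1
  have hL := isSkewFree_lattice hC hO (k := k) L
  obtain ⟨γ, h1, h2, h3⟩ := hN.exists_isometry hp hL hL (hC.isAdm hε) hN' N.isotropic N'.isotropic
  exact Quotient.sound ⟨γ, ⟨h1, h2⟩, h3⟩

theorem exists_point_isOfType (hp : p ≠ 2) (L : SkewHermitianLattice p O Λ)
    {ε : (𝓞 F →+* k) → ℕ × ℕ} (hε : IsAdmissible p a b ε) : ∃ N : L.LocalModelPoint k,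
      C.IsOfType (baseAct k L.orderAct) (fun j => ε (j.comp ι)) N.toSubmodule := by
  have := finite_int hO.1
  obtain ⟨N, h, hst, hiso⟩ := (isSkewFree_lattice hC hO (k := k) L).exists_isOfType hp
    (by rw [finrank_order hO, hC.finrank_eq]; ring) (hC.isAdm hε)
  exact ⟨⟨N, h.finrank_eq hC hO hε, hiso, hst, h.detCondition hC hO hp hε hst⟩, h⟩

theorem exists_dieuObject_isOfType (hp : p ≠ 2) (L : SkewHermitianLattice p O Λ)
    {ε : (𝓞 F →+* k) → ℕ × ℕ} (hε : IsAdmissible p a b ε) : ∃ M : DieuObject p k O,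
      C.IsOfType (baseAct k M.orderAct) (fun j => ε (j.comp ι)) M.hodge := by
  have := finite_int hO.1
  have := L.free
  exact exists_dieuObject hC hO hp (L.transport (Module.finBasis ℤ_[p] Λ).equivFun) hε

end

end MinimalTypeD

end

open MinimalTypeD in
theorem proposition12p1 (p : ℕ) [Fact p.Prime] (hp : p ≠ 2)
    {F : Type*} [Field F] [NumberField F] [NumberField.IsTotallyReal F]
    (a b : F) (hB : IsTotallyDefinite a b)
    (O : Subalgebra (𝓞 F) ℍ[F, a, b]) (hO : IsStarOrderMaximalAt p O)
    {k : Type*} [Field k] [IsAlgClosed k] [CharP k p]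
    {Λ : Type*} [AddCommGroup Λ] [Module ℤ_[p] Λ] [Module.Finite ℤ_[p] Λ]
    (L : SkewHermitianLattice p O Λ) :
    -- the map `α`, which sends the class of `M` to the orbit of `γ(VM/pM)`
    ∃ α : DieuClasses p k O → L.Orbits k,
      (∀ M : DieuObject p k O,
        (∃ γ, M.IsTrivialization L γ) ∧
        ∀ γ, M.IsTrivialization L γ → ∃ N : L.LocalModelPoint k,
          N.toSubmodule =
            M.toDieudonneOModule.hodge.map (γ : _ →ₗ[k] (k ⊗[ℤ_[p]] Λ)) ∧
          α M.cls = L.orbit k N) ∧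
      Function.Surjective α ∧
      -- the reduced Lie types classify the orbits
      (∃ t : L.Orbits k → {ε : (𝓞 F →+* k) → ℕ × ℕ // IsAdmissible p a b ε},
        Function.Bijective t ∧
        (∀ (N : L.LocalModelPoint k) ε, N.HasLieType ε ↔ ε = (t (L.orbit k N)).1) ∧
        ∀ (M : DieuObject p k O) ε, M.HasLieType ε ↔ ε = (t (α M.cls)).1) ∧
      -- every reduced Lie type is that of a Dieudonné module
      ∀ ε : (𝓞 F →+* k) → ℕ × ℕ, IsAdmissible p a b ε → ∃ M : DieuObject p k O, M.HasLieType ε := by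
  classical
  obtain ⟨S, _, C, ι, hC⟩ := exists_isFrameOf (k := k) hB hp hO
  have := hC.finite
  have := hC.free
  have := finite_characters (k := k) (R := S)
  have := Fintype.ofFinite (S →+* k)
  have hO' := hO.isOrder
  have := finite_int hO'.1
  have hL := CyclicFrame.isSkewFree_lattice hC hO' (k := k) L
  have htype : ∀ N : L.LocalModelPoint k, ∃ ε, IsAdmissible p a b ε ∧
      C.IsOfType (baseAct k L.orderAct) (fun j => ε (j.comp ι)) N.toSubmodule := fun N =>
    hL.exists_isAdmissible hC hO' N.stable N.isotropic N.finrank_eq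
  choose τ hτ hτN using htype
  have hlie : ∀ (N : L.LocalModelPoint k) ε, IsAdmissible p a b ε →
      C.IsOfType (baseAct k L.orderAct) (fun j => ε (j.comp ι)) N.toSubmodule → ε = τ N :=
    fun N ε hε h => HasReducedLieType.unique p (h.hasReducedLieType hC hO' hε N.stable)
      ((hτN N).hasReducedLieType hC hO' (hτ N) N.stable)
  have htriv : ∀ M : DieuObject p k O, ∃ γ, M.IsTrivialization L γ := fun M =>
    (CyclicFrame.isSkewFree_dieuObject hC hO' M).exists_isometry hp hL
  choose γ hγ using htriv
  choose P hP using fun M : DieuObject p k O => (hγ M).exists_point hC hO' hp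
  let α : DieuClasses p k O → L.Orbits k := Quotient.lift (fun M => L.orbit k (P M))
    fun M M' ⟨g, hg⟩ => hg.orbit_eq (hγ M) (hγ M') (hP M) (hP M')
  let t : L.Orbits k → {ε : (𝓞 F →+* k) → ℕ × ℕ // IsAdmissible p a b ε} :=
    Quotient.lift (fun N => ⟨τ N, hτ N⟩) fun N N' ⟨g, hg, h⟩ =>
      Subtype.ext (hlie N' _ (hτ N) (h ▸ (hτN N).map g hg.1))
  have ht : ∀ N, (t (L.orbit k N)).1 = τ N := fun N => rfl
  have hα : ∀ M : DieuObject p k O, α M.cls = L.orbit k (P M) := fun M => rfl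
  have hτM : ∀ (M : DieuObject p k O) ε, IsAdmissible p a b ε →
      C.IsOfType (baseAct k M.orderAct) (fun j => ε (j.comp ι)) M.toDieudonneOModule.hodge →
      ε = τ (P M) := fun M ε hε h => hlie _ _ hε (hP M ▸ h.map (γ M) (hγ M).1)
  refine ⟨α, fun M => ⟨⟨γ M, hγ M⟩, fun δ hδ => ?_⟩, fun c => ?_, ⟨t, ⟨?_, ?_⟩, ?_, ?_⟩, ?_⟩
  · obtain ⟨N, hN⟩ := hδ.exists_point hC hO' hp
    exact ⟨N, hN, DieuObject.IsIso.orbit_eq (g := LinearEquiv.refl _ _)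
      ⟨fun _ => rfl, fun _ => rfl, fun _ _ => rfl, fun _ _ => rfl⟩ (hγ M) hδ (hP M) hN⟩
  · obtain ⟨N, rfl⟩ := Quotient.exists_rep c
    obtain ⟨M, hM⟩ := exists_dieuObject_isOfType hC hO' hp L (hτ N)
    exact ⟨M.cls, SkewHermitianLattice.LocalModelPoint.orbit_eq hC hO' hp (hτ N)
      (hP M ▸ hM.map (γ M) (hγ M).1) (hτN N)⟩
  · intro c c' h
    obtain ⟨N, rfl⟩ := Quotient.exists_rep c
    obtain ⟨N', rfl⟩ := Quotient.exists_rep c'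
    have h' : τ N = τ N' := congrArg Subtype.val h
    exact SkewHermitianLattice.LocalModelPoint.orbit_eq hC hO' hp (hτ N) (hτN N) (h' ▸ hτN N')
  · rintro ⟨ε, hε⟩
    obtain ⟨N, hN⟩ := exists_point_isOfType hC hO' hp L hε
    exact ⟨L.orbit k N, Subtype.ext (hlie N ε hε hN).symm⟩
  · intro N ε
    have h := (hτN N).hasReducedLieType hC hO' (hτ N) N.stable
    exact ⟨fun h' => HasReducedLieType.unique p h' h, fun h' => h' ▸ h⟩
  · intro M ε
    obtain ⟨ε', hε', h'⟩ := CyclicFrame.exists_isOfType_dieuObject hC hO' M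
    have h := h'.hasReducedLieType hC hO' hε' M.hodge_stable
    rw [hα, ht, ← hτM M ε' hε' h']
    exact ⟨fun h' => HasReducedLieType.unique p h' h, fun h' => h' ▸ h⟩
  · intro ε hε
    obtain ⟨M, hM⟩ := exists_dieuObject_isOfType hC hO' hp L hε
    exact ⟨M, hM.hasReducedLieType hC hO' hε M.hodge_stable⟩
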